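/- **Setting.** Let $\mathcal C$ be a complete and cocomplete closed symmetric monoidal category $(\otimes, I, F)$ with a proper, stable model structure such that the following hold. * $\mathcal C$ is an *operadic model category*: the pushout-product axiom holds; $x\otimes-$ preserves weak equivalences for $x$ cofibrant; and $\mathcal C$ carries a compatible simplicial structure with cofibrant unit, that is, a strong symmetric monoidal left Quillen functor $K\mapsto K\otimes I$ from simplicial sets to $\mathcal C$. Mapping spaces are $\mathrm{Map}(x,y)_n=\mathcal C((\Delta^n\otimes I)\otimes x,\,y)$. * (Small) filtered colimits in $\mathcal C$ preserve fibrations, preserve weak equivalences (so they represent homotopy colimits), and commute with finite limits. Let $E$ be a $\mu$-ring in $ho(\mathcal C)$ (an object with a unit $e:I\to E$ and a multiplication $E\otimes^{\mathbf L}E\to E$ that is left unital in $ho(\mathcal C)$) which is dualizable, i.e. $\mathbf RF(E,I)\otimes^{\mathbf L}x\to\mathbf RF(E,x)$ is an isomorphism for all $x\in ho(\mathcal C)$; represent $E$ by a cofibrant-fibrant object. Let $\mathcal O$ be a cofibrant symmetric operad in simplicial sets (for the model structure with levelwise weak equivalences and fibrations), and let $y\in\mathcal C$ be a cofibrant-fibrant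 object with an $\mathcal O$-algebra structure $\theta:\mathcal O\to\mathrm{End}(y)$, where $\mathrm{End}(y)_n=\mathrm{Map}(y^{\otimes n},y)$. **Definitions.** $Nil(E)$ is the smallest class of objects of $ho(\mathcal C)$ that contains $E$ and is closed under isomorphisms, retracts, cofiber sequences (if two of the three objects are in the class, so is the third) and tensoring with arbitrary objects. An *$E$-nilpotent resolution* of $y$ is a tower $W=\{w_s\}_{s\ge0}$ under $y$ such that every $w_s$ is in $Nil(E)$ and $\mathrm{hocolim}_s\,\mathbf RF(w_s,z)\to\mathbf RF(y,z)$ is a weak equivalence for all $z\in Nil(E)$. If $J\to I\xrightarrow{e}E$ is a fiber sequence, the tower $\{(I/J^n)\otimes y\}_n$ of homotopy cofibers of $J^{\otimes n}\otimes y\to I\otimes y\cong y$, with transition maps induced by $J^{\otimes(n+1)}=J\otimes J^{\otimes n}\to I\otimes J^{\otimes n}\cong J^{\otimes n}$, is an *Adams tower* of $y$. Towers under $y$ are represented by maps of towers $\eta:y\to W$ in $\mathcal C$ for which every $y\to w_s$ is a cofibration, $w_0$ is fibrant and every $w_{s+1}\to w_s$ is a fibration. View $\eta$ as a morphism from the constant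 pro-object $y$ in $\mathrm{pro}\text{-}\mathcal C$, with the levelwise tensor product. Let $\mathrm{Lift}_\theta(\eta)$ be the simplicial set of $\mathcal O$-algebra structures on the pro-object $W$ for which $\eta$ is a map of $\mathcal O$-algebras from $(y,\theta)$; that is, the fiber over $\theta$ of $\mathrm{Map}_{operad}(\mathcal O,\mathrm{End}(\eta))\to\mathrm{Map}_{operad}(\mathcal O,\mathrm{End}(y))$, where $\mathrm{End}(\eta)$ is the endomorphism operad of $\eta$ in $\mathrm{pro}\text{-}\mathcal C$. **Theorem.** 1. There is an Adams tower $\eta:y\to W$ of $y$ (represented as above). 2. Every Adams tower $\eta:y\to W$ of $y$ is an $E$-nilpotent resolution of $y$, and $\mathrm{Lift}_\theta(\eta)$ is a contractible Kan complex. Thus the $E$-nilpotent completion $\hat y_E$, represented by the Adams tower, has an $\mathcal O$-algebra structure in $\mathrm{pro}\text{-}\mathcal C$ compatible with $y$, and it is unique up to homotopy. 3. If moreover $I$ is compact, i.e. $\mathbf R\mathrm{Map}(I,-)$ commutes with filtered homotopy colimits, then $\mathrm{Lift}_\theta(\eta)$ is a contractible Kan complex for every $E$-nilpotent resolution $\eta:y\to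 W$ of $y$. -/

import Mathlib

open CategoryTheory Limits MonoidalCategory HomotopicalAlgebra Opposite


universe v u

namespace ProCompletion

/-- A pro-object of `C`: a small cofiltered diagram in `C`. -/
structure ProObj (C : Type u) [Category.{v} C] where
  J : Type v
  [cat : SmallCategory J]
  [cofiltered : IsCofiltered J]
  diag : J ⥤ C

namespace ProObj

attribute [instance] ProObj.cat ProObj.cofiltered

section Category

variable {C : Type u} [Category.{v} C]

/-- `Germ X c` is `colim_α Hom(x_α, c)`, -/
def Germ (X : ProObj.{v} C) (c : C) : Type v :=
  Quot (fun p q : (Σ a : X.J, (X.diag.obj a ⟶ c)) =>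
    ∃ w : q.1 ⟶ p.1, q.2 = X.diag.map w ≫ p.2)

namespace Germ

variable {X : ProObj.{v} C}

/-- The class of a morphism `x_α ⟶ c` in the colimit. -/
def mk {c : C} (a : X.J) (f : X.diag.obj a ⟶ c) : Germ X c := Quot.mk _ ⟨a, f⟩

theorem mk_map {c : C} {a b : X.J} (w : b ⟶ a) (f : X.diag.obj a ⟶ c) :
    mk b (X.diag.map w ≫ f) = mk a f :=
  (Quot.sound ⟨w, rfl⟩).symm

theorem ind {c : C} {P : Germ X c → Prop} (h : ∀ a f, P (mk a f)) (p : Germ X c) : P p :=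
  Quot.ind (fun q => h q.1 q.2) p

/-- Functoriality of the colimit in `c`. -/
def push {c d : C} (g : c ⟶ d) : Germ X c → Germ X d :=
  Quot.lift (fun p => mk p.1 (p.2 ≫ g)) (by
    rintro ⟨a, f⟩ ⟨b, f'⟩ ⟨w, hw⟩
    dsimp only at w hw ⊢
    rw [hw, Category.assoc, mk_map])

@[simp] theorem push_mk {c d : C} (g : c ⟶ d) (a : X.J) (f : X.diag.obj a ⟶ c) :
    push g (mk a f) = mk a (f ≫ g) := rfl

@[simp] theorem push_id {c : C} (p : Germ X c) : push (𝟙 c) p = p := by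
  induction p using ind; simp

theorem push_push {c d e : C} (g : c ⟶ d) (h : d ⟶ e) (p : Germ X c) :
    push h (push g p) = push (g ≫ h) p := by
  induction p using ind; simp

end Germ

/-- `Hom(X, Y) = lim_β colim_α Hom(x_α, y_β)`. -/
@[ext]
structure Hom (X Y : ProObj.{v} C) where
  val : ∀ b : Y.J, Germ X (Y.diag.obj b)
  compat : ∀ {b b' : Y.J} (w : b ⟶ b'), (val b).push (Y.diag.map w) = val b'

/-- Precomposition of germs with a morphism of pro-objects. -/
def Hom.pull {X Y : ProObj.{v} C} (φ : Hom X Y) {c : C} : Germ Y c → Germ X c :=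
  Quot.lift (fun p => (φ.val p.1).push p.2) (by
    rintro ⟨a, f⟩ ⟨b, f'⟩ ⟨w, hw⟩
    dsimp only at w hw ⊢
    rw [hw, ← Germ.push_push, φ.compat])

@[simp] theorem Hom.pull_mk {X Y : ProObj.{v} C} (φ : Hom X Y) {c : C} (b : Y.J)
    (f : Y.diag.obj b ⟶ c) : φ.pull (Germ.mk b f) = (φ.val b).push f := rfl

theorem Hom.pull_push {X Y : ProObj.{v} C} (φ : Hom X Y) {c d : C} (g : c ⟶ d) (p : Germ Y c) :
    φ.pull (p.push g) = (φ.pull p).push g := by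
  induction p using Germ.ind; simp [Germ.push_push]

instance : Category.{v} (ProObj.{v} C) where
  Hom := Hom
  id X := ⟨fun a => Germ.mk a (𝟙 _), fun {b b'} w => by
    rw [Germ.push_mk, Category.id_comp, ← Germ.mk_map w, Category.comp_id]⟩
  comp φ ψ := ⟨fun c => φ.pull (ψ.val c), fun w => by rw [← Hom.pull_push, ψ.compat]⟩
  id_comp {X Y} φ := Hom.ext (funext fun c => by
    dsimp only
    induction φ.val c using Germ.ind; simp)
  comp_id φ := Hom.ext (funext fun c => by simp)
  assoc {W X Y Z} φ ψ χ := Hom.ext (funext fun c => by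
    dsimp only
    induction χ.val c using Germ.ind; simp [Hom.pull_push])

@[ext] theorem hom_ext {X Y : ProObj.{v} C} {φ ψ : X ⟶ Y} (h : ∀ b, Hom.val φ b = Hom.val ψ b) :
    φ = ψ := Hom.ext (funext h)

@[simp] theorem comp_val {X Y Z : ProObj.{v} C} (φ : X ⟶ Y) (ψ : Y ⟶ Z) (c : Z.J) :
    Hom.val (φ ≫ ψ) c = Hom.pull φ (Hom.val ψ c) := rfl

@[simp] theorem id_val (X : ProObj.{v} C) (c : X.J) :
    Hom.val (𝟙 X) c = Germ.mk c (𝟙 _) := rfl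

/-- The morphism of pro-objects given by a reindexing and compatible morphisms
`x_{r(β)} ⟶ y_β`.  With `r` the identity this is a level map. -/
def ofReindex {X Y : ProObj.{v} C} (r : Y.J → X.J)
    (rmap : ∀ {b b' : Y.J}, (b ⟶ b') → (r b ⟶ r b'))
    (t : ∀ b, X.diag.obj (r b) ⟶ Y.diag.obj b)
    (h : ∀ {b b' : Y.J} (w : b ⟶ b'), X.diag.map (rmap w) ≫ t b' = t b ≫ Y.diag.map w) : X ⟶ Y :=
  Hom.mk (fun b => Germ.mk (r b) (t b)) (fun {b b'} w => by
    rw [Germ.push_mk, ← h, Germ.mk_map])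

/-- The constant pro-object. -/
def const : C ⥤ ProObj.{v} C where
  obj c := { J := Discrete PUnit.{v + 1}, diag := (Functor.const _).obj c }
  map f := ofReindex (fun b => b) (fun w => w) (fun _ => f) (fun _ =>
    (Category.id_comp f).trans (Category.comp_id f).symm)
  map_id _ := rfl
  map_comp _ _ := rfl

end Category

section Monoidal

variable {C : Type u} [Category.{v} C] [MonoidalCategory C]

/-- The levelwise tensor product: `X ⊗ Y = {x_α ⊗ y_β}` indexed by the pairs `(α, β)`. -/
def tensor (X Y : ProObj.{v} C) : ProObj.{v} C where
  J := X.J × Y.J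
  diag :=
    { obj := fun p => X.diag.obj p.1 ⊗ Y.diag.obj p.2
      map := fun w => X.diag.map w.1 ⊗ₘ Y.diag.map w.2 }

/-- The tensor product of germs. -/
def Germ.tensor {X Y : ProObj.{v} C} {c d : C} (p : Germ X c) (q : Germ Y d) :
    Germ (ProObj.tensor X Y) (c ⊗ d) :=
  Quot.map₂ (fun p q => ⟨(p.1, q.1), p.2 ⊗ₘ q.2⟩)
    (by
      rintro ⟨a, f⟩ ⟨b, g⟩ ⟨b', g'⟩ ⟨w, hw⟩
      dsimp only at w hw ⊢
      refine ⟨(𝟙 a, w), ?_⟩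
      change f ⊗ₘ g' = (X.diag.map (𝟙 a) ⊗ₘ Y.diag.map w) ≫ (f ⊗ₘ g)
      rw [tensorHom_comp_tensorHom, hw, X.diag.map_id, Category.id_comp])
    (by
      rintro ⟨a, f⟩ ⟨a', f'⟩ ⟨b, g⟩ ⟨w, hw⟩
      dsimp only at w hw ⊢
      refine ⟨(w, 𝟙 b), ?_⟩
      change f' ⊗ₘ g = (X.diag.map w ⊗ₘ Y.diag.map (𝟙 b)) ≫ (f ⊗ₘ g)
      rw [tensorHom_comp_tensorHom, hw, Y.diag.map_id, Category.id_comp]) p q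

theorem Germ.push_tensor {X Y : ProObj.{v} C} {c d c' d' : C} (p : Germ X c) (q : Germ Y d)
    (f : c ⟶ c') (g : d ⟶ d') :
    (Germ.tensor p q).push (f ⊗ₘ g) = Germ.tensor (p.push f) (q.push g) := by
  induction p using Germ.ind
  induction q using Germ.ind
  exact congrArg (Germ.mk (X := ProObj.tensor X Y) _) (tensorHom_comp_tensorHom _ _ _ _)

/-- The levelwise tensor product of morphisms. -/
def tensorMap {X X' Y Y' : ProObj.{v} C} (φ : X ⟶ X') (ψ : Y ⟶ Y') :
    tensor X Y ⟶ tensor X' Y' :=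
  Hom.mk (fun p => Germ.tensor (Hom.val φ p.1) (Hom.val ψ p.2)) (fun {p p'} w => by
    have h := Germ.push_tensor (Hom.val φ p.1) (Hom.val ψ p.2) (X'.diag.map w.1) (Y'.diag.map w.2)
    rw [Hom.compat, Hom.compat] at h
    exact h)

theorem tensorMap_pull {X X' Y Y' : ProObj.{v} C} (φ : X ⟶ X') (ψ : Y ⟶ Y') {c d : C}
    (p : Germ X' c) (q : Germ Y' d) :
    Hom.pull (tensorMap φ ψ) (Germ.tensor p q) =
      Germ.tensor (Hom.pull φ p) (Hom.pull ψ q) := by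
  induction p using Germ.ind
  induction q using Germ.ind
  exact Germ.push_tensor _ _ _ _

instance : MonoidalCategoryStruct (ProObj.{v} C) where
  tensorObj := tensor
  tensorUnit := const.obj (𝟙_ C)
  whiskerLeft X _ _ f := tensorMap (𝟙 X) f
  whiskerRight f Y := tensorMap f (𝟙 Y)
  tensorHom := tensorMap
  associator X Y Z :=
    { hom := ofReindex (X := tensor (tensor X Y) Z) (Y := tensor X (tensor Y Z))
        (fun p => ((p.1, p.2.1), p.2.2)) (fun w => ((w.1, w.2.1), w.2.2))
        (fun p => (α_ (X.diag.obj p.1) (Y.diag.obj p.2.1) (Z.diag.obj p.2.2)).hom)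
        (fun _ => associator_naturality _ _ _)
      inv := ofReindex (X := tensor X (tensor Y Z)) (Y := tensor (tensor X Y) Z)
        (fun p => (p.1.1, (p.1.2, p.2))) (fun w => (w.1.1, (w.1.2, w.2)))
        (fun p => (α_ (X.diag.obj p.1.1) (Y.diag.obj p.1.2) (Z.diag.obj p.2)).inv)
        (fun _ => associator_inv_naturality _ _ _)
      hom_inv_id := hom_ext fun b =>
        congrArg (Germ.mk (X := tensor (tensor X Y) Z) b) (Iso.hom_inv_id _)
      inv_hom_id := hom_ext fun b =>
        congrArg (Germ.mk (X := tensor X (tensor Y Z)) b) (Iso.inv_hom_id _) }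
  leftUnitor X :=
    { hom := ofReindex (X := tensor (const.obj (𝟙_ C)) X) (Y := X)
        (fun p => (⟨⟨⟩⟩, p)) (fun w => (𝟙 _, w)) (fun p => (λ_ (X.diag.obj p)).hom)
        (fun _ => (congrArg (· ≫ _) (id_tensorHom _ _)).trans (leftUnitor_naturality _))
      inv := ofReindex (X := X) (Y := tensor (const.obj (𝟙_ C)) X)
        (fun p => p.2) (fun w => w.2) (fun p => (λ_ (X.diag.obj p.2)).inv)
        (fun _ => (leftUnitor_inv_naturality _).trans
          (congrArg (_ ≫ ·) (id_tensorHom _ _).symm))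
      hom_inv_id := hom_ext fun b =>
        congrArg (Germ.mk (X := tensor (const.obj (𝟙_ C)) X) b) (Iso.hom_inv_id _)
      inv_hom_id := hom_ext fun b => congrArg (Germ.mk b) (Iso.inv_hom_id _) }
  rightUnitor X :=
    { hom := ofReindex (X := tensor X (const.obj (𝟙_ C))) (Y := X)
        (fun p => (p, ⟨⟨⟩⟩)) (fun w => (w, 𝟙 _)) (fun p => (ρ_ (X.diag.obj p)).hom)
        (fun _ => (congrArg (· ≫ _) (tensorHom_id _ _)).trans (rightUnitor_naturality _))
      inv := ofReindex (X := X) (Y := tensor X (const.obj (𝟙_ C)))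
        (fun p => p.1) (fun w => w.1) (fun p => (ρ_ (X.diag.obj p.1)).inv)
        (fun _ => (rightUnitor_inv_naturality _).trans
          (congrArg (_ ≫ ·) (tensorHom_id _ _).symm))
      hom_inv_id := hom_ext fun b =>
        congrArg (Germ.mk (X := tensor X (const.obj (𝟙_ C))) b) (Iso.hom_inv_id _)
      inv_hom_id := hom_ext fun b => congrArg (Germ.mk b) (Iso.inv_hom_id _) }

theorem pentagon_tensorHom (W X Y Z : C) :
    ((α_ W X Y).hom ⊗ₘ 𝟙 Z) ≫ (α_ W (X ⊗ Y) Z).hom ≫ (𝟙 W ⊗ₘ (α_ X Y Z).hom) =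
      (α_ (W ⊗ X) Y Z).hom ≫ (α_ W X (Y ⊗ Z)).hom := by
  rw [tensorHom_id, id_tensorHom]
  exact MonoidalCategory.pentagon W X Y Z

theorem triangle_tensorHom (X Y : C) :
    (α_ X (𝟙_ C) Y).hom ≫ (𝟙 X ⊗ₘ (λ_ Y).hom) = (ρ_ X).hom ⊗ₘ 𝟙 Y := by
  rw [tensorHom_id, id_tensorHom]
  exact MonoidalCategory.triangle X Y

instance : MonoidalCategory (ProObj.{v} C) := MonoidalCategory.ofTensorHom
  (id_tensorHom_id := fun X Y => hom_ext fun b =>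
    congrArg (Germ.mk (X := tensor X Y) b) (id_tensorHom_id _ _))
  (tensorHom_comp_tensorHom := fun f₁ f₂ g₁ g₂ => hom_ext fun b => tensorMap_pull _ _ _ _)
  (associator_naturality := fun {X₁ X₂ X₃ Y₁ Y₂ Y₃} f₁ f₂ f₃ => hom_ext fun b => by
    change (Germ.tensor (Germ.tensor (Hom.val f₁ b.1) (Hom.val f₂ b.2.1)) (Hom.val f₃ b.2.2)).push
      (α_ _ _ _).hom = Hom.pull (α_ X₁ X₂ X₃).hom
        (Germ.tensor (Hom.val f₁ b.1) (Germ.tensor (Hom.val f₂ b.2.1) (Hom.val f₃ b.2.2)))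
    generalize Hom.val f₁ b.1 = p, Hom.val f₂ b.2.1 = q, Hom.val f₃ b.2.2 = r
    induction p using Germ.ind
    induction q using Germ.ind
    induction r using Germ.ind
    exact congrArg (Germ.mk (X := tensor (tensor X₁ X₂) X₃) _) (associator_naturality _ _ _))
  (leftUnitor_naturality := fun {X Y} f => hom_ext fun b => by
    change (Germ.tensor (Germ.mk (X := const.obj (𝟙_ C)) _ (𝟙 _)) (Hom.val f b)).push (λ_ _).hom =
      Hom.pull (λ_ X).hom (Hom.val f b)
    generalize Hom.val f b = p
    induction p using Germ.ind
    exact congrArg (Germ.mk (X := tensor (const.obj (𝟙_ C)) X) _)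
      ((congrArg (· ≫ _) (id_tensorHom _ _)).trans (leftUnitor_naturality _)))
  (rightUnitor_naturality := fun {X Y} f => hom_ext fun b => by
    change (Germ.tensor (Hom.val f b) (Germ.mk (X := const.obj (𝟙_ C)) _ (𝟙 _))).push (ρ_ _).hom =
      Hom.pull (ρ_ X).hom (Hom.val f b)
    generalize Hom.val f b = p
    induction p using Germ.ind
    exact congrArg (Germ.mk (X := tensor X (const.obj (𝟙_ C))) _)
      ((congrArg (· ≫ _) (tensorHom_id _ _)).trans (rightUnitor_naturality _)))
  (pentagon := fun W X Y Z => hom_ext fun b =>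
    congrArg (Germ.mk (X := tensor (tensor (tensor W X) Y) Z) _)
      (pentagon_tensorHom (W.diag.obj b.1) (X.diag.obj b.2.1) (Y.diag.obj b.2.2.1)
        (Z.diag.obj b.2.2.2)))
  (triangle := fun X Y => hom_ext fun b =>
    congrArg (Germ.mk (X := tensor (tensor X (const.obj (𝟙_ C))) Y) _)
      (triangle_tensorHom (X.diag.obj b.1) (Y.diag.obj b.2)))

/-- The functor of constant pro-objects is monoidal. -/
instance : (const : C ⥤ ProObj.{v} C).Monoidal :=
  Functor.CoreMonoidal.toMonoidal
    { εIso := Iso.refl _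
      μIso := fun c d =>
        { hom := ofReindex (X := tensor (const.obj c) (const.obj d)) (Y := const.obj (c ⊗ d))
            (fun b => (b, b)) (fun w => (w, w)) (fun _ => 𝟙 _) (fun _ => by
              exact (Category.comp_id _).trans ((id_tensorHom_id c d).trans
                (Category.comp_id _).symm))
          inv := ofReindex (X := const.obj (c ⊗ d)) (Y := tensor (const.obj c) (const.obj d))
            (fun b => b.1) (fun w => w.1) (fun _ => 𝟙 _) (fun _ =>
              congrArg (𝟙 (c ⊗ d) ≫ ·) (id_tensorHom_id c d).symm)
          hom_inv_id := hom_ext fun ⟨⟨⟨⟩⟩, ⟨⟨⟩⟩⟩ =>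
            congrArg (Germ.mk (X := tensor (const.obj c) (const.obj d)) _)
              (Category.comp_id (𝟙 (c ⊗ d)))
          inv_hom_id := hom_ext fun _ =>
            congrArg (Germ.mk (X := const.obj (c ⊗ d)) _) (Category.comp_id _) }
      μIso_hom_natural_left := fun {X Y} f X' => hom_ext fun ⟨⟨⟩⟩ =>
        congrArg (Germ.mk (X := tensor (const.obj X) (const.obj X')) _) (by
          change (f ⊗ₘ 𝟙 X') ≫ 𝟙 (Y ⊗ X') = 𝟙 (X ⊗ X') ≫ f ▷ X'
          simp)
      μIso_hom_natural_right := fun {X Y} X' f => hom_ext fun ⟨⟨⟩⟩ =>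
        congrArg (Germ.mk (X := tensor (const.obj X') (const.obj X)) _) (by
          change (𝟙 X' ⊗ₘ f) ≫ 𝟙 (X' ⊗ Y) = 𝟙 (X' ⊗ X) ≫ X' ◁ f
          simp)
      associativity := fun X Y Z => hom_ext fun ⟨⟨⟩⟩ =>
        congrArg (Germ.mk (X := tensor (tensor (const.obj X) (const.obj Y)) (const.obj Z)) _) (by
          change (𝟙 (X ⊗ Y) ⊗ₘ 𝟙 Z) ≫ 𝟙 ((X ⊗ Y) ⊗ Z) ≫ (α_ X Y Z).hom =
            (α_ X Y Z).hom ≫ (𝟙 X ⊗ₘ 𝟙 (Y ⊗ Z)) ≫ 𝟙 (X ⊗ Y ⊗ Z)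
          simp)
      left_unitality := fun X => hom_ext fun ⟨⟨⟩⟩ =>
        congrArg (Germ.mk (X := tensor (const.obj (𝟙_ C)) (const.obj X)) _) (by
          change (λ_ X).hom = (𝟙 (𝟙_ C) ⊗ₘ 𝟙 X) ≫ 𝟙 (𝟙_ C ⊗ X) ≫ (λ_ X).hom
          simp)
      right_unitality := fun X => hom_ext fun ⟨⟨⟩⟩ =>
        congrArg (Germ.mk (X := tensor (const.obj X) (const.obj (𝟙_ C))) _) (by
          change (ρ_ X).hom = (𝟙 X ⊗ₘ 𝟙 (𝟙_ C)) ≫ 𝟙 (X ⊗ 𝟙_ C) ≫ (ρ_ X).hom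
          simp) }

end Monoidal

section Symmetric

variable {C : Type u} [Category.{v} C] [MonoidalCategory C] [SymmetricCategory C]

/-- The levelwise symmetry isomorphism. -/
def braid (X Y : ProObj.{v} C) : tensor X Y ⟶ tensor Y X :=
  ofReindex (fun p => (p.2, p.1)) (fun w => (w.2, w.1))
    (fun p => (β_ (X.diag.obj p.2) (Y.diag.obj p.1)).hom)
    (fun _ => BraidedCategory.braiding_naturality _ _)

theorem braid_braid (X Y : ProObj.{v} C) : braid X Y ≫ braid Y X = 𝟙 (tensor X Y) :=
  hom_ext fun b => congrArg (Germ.mk (X := tensor X Y) b) (SymmetricCategory.symmetry _ _)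

theorem pull_braid {X Y : ProObj.{v} C} {c d : C} (p : Germ Y c) (q : Germ X d) :
    Hom.pull (braid X Y) (Germ.tensor p q) = (Germ.tensor q p).push (β_ d c).hom := by
  induction p using Germ.ind
  induction q using Germ.ind
  exact congrArg (Germ.mk (X := tensor X Y) _) (BraidedCategory.braiding_naturality _ _).symm

theorem hexagon_forward_tensorHom (X Y Z : C) :
    (α_ X Y Z).hom ≫ (β_ X (Y ⊗ Z)).hom ≫ (α_ Y Z X).hom =
      ((β_ X Y).hom ⊗ₘ 𝟙 Z) ≫ (α_ Y X Z).hom ≫ (𝟙 Y ⊗ₘ (β_ X Z).hom) := by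
  rw [tensorHom_id, id_tensorHom]
  exact BraidedCategory.hexagon_forward X Y Z

theorem hexagon_reverse_tensorHom (X Y Z : C) :
    (α_ X Y Z).inv ≫ (β_ (X ⊗ Y) Z).hom ≫ (α_ Z X Y).inv =
      (𝟙 X ⊗ₘ (β_ Y Z).hom) ≫ (α_ X Z Y).inv ≫ ((β_ X Z).hom ⊗ₘ 𝟙 Y) := by
  rw [tensorHom_id, id_tensorHom]
  exact BraidedCategory.hexagon_reverse X Y Z

instance : SymmetricCategory (ProObj.{v} C) where
  braiding X Y := ⟨braid X Y, braid Y X, braid_braid X Y, braid_braid Y X⟩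
  braiding_naturality_right X Y _ f := hom_ext fun b =>
    (pull_braid (X := X) (Y := Y) (Hom.val f b.1) (Germ.mk b.2 (𝟙 (X.diag.obj b.2)))).symm
  braiding_naturality_left {X _} f Z := hom_ext fun b =>
    (pull_braid (X := X) (Y := Z) (Germ.mk b.1 (𝟙 (Z.diag.obj b.1))) (Hom.val f b.2)).symm
  hexagon_forward X Y Z := hom_ext fun b =>
    congrArg (Germ.mk (X := tensor (tensor X Y) Z) _)
      (hexagon_forward_tensorHom (X.diag.obj b.2.2) (Y.diag.obj b.1) (Z.diag.obj b.2.1))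
  hexagon_reverse X Y Z := hom_ext fun b =>
    congrArg (Germ.mk (X := tensor X (tensor Y Z)) _)
      (hexagon_reverse_tensorHom (X.diag.obj b.1.2) (Y.diag.obj b.2) (Z.diag.obj b.1.1))
  symmetry X Y := braid_braid X Y

end Symmetric

end ProObj

/-! ### Symmetric operads -/

/-- A symmetric operad in sets, in coordinate-free form: `obj S` is the set of operations whose
inputs are labelled by the finite set `S`; `act` relabels inputs; `comp a b` substitutes
the operation `b t` into the input `t` of `a`. -/
structure SetOperad where
  obj : (S : Type) → [Finite S] → Type v
  act : ∀ {S T : Type} [Finite S] [Finite T], (S ≃ T) → obj S → obj T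
  one : obj (Fin 1)
  comp : ∀ {T : Type} [Finite T] {S : T → Type} [∀ t, Finite (S t)],
    obj T → (∀ t, obj (S t)) → obj (Σ t, S t)
  act_refl : ∀ {S : Type} [Finite S] (a : obj S), act (Equiv.refl S) a = a
  act_trans : ∀ {S T U : Type} [Finite S] [Finite T] [Finite U] (σ : S ≃ T) (τ : T ≃ U)
    (a : obj S), act (σ.trans τ) a = act τ (act σ a)
  one_comp : ∀ {S : Type} [Finite S] (a : obj S),
    act (Equiv.uniqueSigma fun _ : Fin 1 => S) (comp one fun _ => a) = a
  comp_one : ∀ {T : Type} [Finite T] (a : obj T),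
    act (Equiv.sigmaUnique T fun _ => Fin 1) (comp a fun _ => one) = a
  comp_assoc : ∀ {T : Type} [Finite T] {S : T → Type} [∀ t, Finite (S t)]
    {R : ∀ t, S t → Type} [∀ t s, Finite (R t s)]
    (a : obj T) (b : ∀ t, obj (S t)) (c : ∀ t s, obj (R t s)),
    act (Equiv.sigmaAssoc R) (comp (comp a b) fun p : Σ t, S t => c p.1 p.2) =
      comp a fun t => comp (b t) (c t)
  act_comp : ∀ {T T' : Type} [Finite T] [Finite T'] {S : T' → Type} [∀ t, Finite (S t)]
    (σ : T ≃ T') (a : obj T) (b : ∀ t, obj (S t)),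
    comp (act σ a) b = act (Equiv.sigmaCongrLeft σ) (comp a fun t => b (σ t))
  comp_act : ∀ {T : Type} [Finite T] {S S' : T → Type} [∀ t, Finite (S t)]
    [∀ t, Finite (S' t)] (τ : ∀ t, S t ≃ S' t) (a : obj T) (b : ∀ t, obj (S t)),
    comp a (fun t => act (τ t) (b t)) = act (Equiv.sigmaCongrRight τ) (comp a b)

namespace SetOperad

/-- Morphisms of operads. -/
@[ext]
structure Hom (P Q : SetOperad.{v}) where
  app : ∀ {S : Type} [Finite S], P.obj S → Q.obj S
  app_act : ∀ {S T : Type} [Finite S] [Finite T] (σ : S ≃ T) (a : P.obj S),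
    app (P.act σ a) = Q.act σ (app a)
  app_one : app P.one = Q.one
  app_comp : ∀ {T : Type} [Finite T] {S : T → Type} [∀ t, Finite (S t)] (a : P.obj T)
    (b : ∀ t, P.obj (S t)), app (P.comp a b) = Q.comp (app a) fun t => app (b t)

instance : Category SetOperad.{v} where
  Hom := Hom
  id P := ⟨fun a => a, fun _ _ => rfl, rfl, fun _ _ => rfl⟩
  comp f g := ⟨fun a => g.app (f.app a), fun σ a => by rw [f.app_act, g.app_act],
    by rw [f.app_one, g.app_one], fun a b => by rw [f.app_comp, g.app_comp]⟩

/-- The set of operations with inputs labelled by `S`, as a functor. -/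
def eval (S : Type) [Finite S] : SetOperad.{v} ⥤ Type v where
  obj P := P.obj S
  map f := TypeCat.ofHom (Hom.app f)

end SetOperad

/-- Operads in simplicial sets. -/
abbrev SOperad := SimplicialObject SetOperad.{v}

/-- The simplicial set of operations with inputs labelled by `S`. -/
def SOperad.space (O : SOperad.{v}) (S : Type) [Finite S] : SSet.{v} := O ⋙ SetOperad.eval S

/-- The map induced on simplicial sets of operations. -/
def SOperad.spaceMap {P Q : SOperad.{v}} (p : P ⟶ Q) (S : Type) [Finite S] :
    P.space S ⟶ Q.space S := Functor.whiskerRight p (SetOperad.eval S)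

section Kan

open Simplicial

/-- A trivial Kan fibration of simplicial sets. -/
def IsTrivialKanFibration {X Y : SSet.{v}} (p : X ⟶ Y) : Prop :=
  ∀ n : ℕ, HasLiftingProperty ∂Δ[n].ι p

/-- A simplicial operad is cofibrant (for the model structure whose weak equivalences and
fibrations are levelwise those of simplicial sets) if it lifts against all the acyclic fibrations,
that is, the maps that are trivial Kan fibrations in every arity. -/
def SOperad.IsCofibrant (O : SOperad.{v}) : Prop :=
  ∀ ⦃P Q : SOperad.{v}⦄ (p : P ⟶ Q),
    (∀ (S : Type) [Finite S], IsTrivialKanFibration (SOperad.spaceMap p S)) →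
    ∀ f : O ⟶ Q, ∃ g : O ⟶ P, g ≫ p = f

/-- A simplicial set is contractible: `X ⟶ *` is a trivial Kan fibration. -/
def IsContractibleKan (X : SSet.{v}) : Prop :=
  ∀ (n : ℕ) (f : (∂Δ[n] : SSet.{v}) ⟶ X), ∃ g : Δ[n] ⟶ X, ∂Δ[n].ι ≫ g = f

/-- A map of Kan complexes is a weak equivalence: up to homotopy relative to `∂Δ[n]`, every
simplex of `Y` whose boundary is lifted to `X` can be lifted to `X` with that boundary. -/
def IsKanEquivalence {X Y : SSet.{v}} (f : X ⟶ Y) : Prop :=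
  ∀ (n : ℕ) (u : (∂Δ[n] : SSet.{v}) ⟶ X) (t : Δ[n] ⟶ Y), u ≫ f = ∂Δ[n].ι ≫ t →
    ∃ (g : Δ[n] ⟶ X) (h : Δ[n] ⊗ Δ[1] ⟶ Y), ∂Δ[n].ι ≫ g = u ∧ SSet.ι₀ ≫ h = g ≫ f ∧
      SSet.ι₁ ≫ h = t ∧ ∂Δ[n].ι ▷ Δ[1] ≫ h = SemiCartesianMonoidalCategory.fst _ _ ≫ u ≫ f

end Kan

/-! ### Tensor powers -/

section Powers

variable {D : Type u} [Category.{v} D] [MonoidalCategory D]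

/-- The `n`-th tensor power `((I ⊗ x) ⊗ ⋯) ⊗ x`. -/
def tpow (x : D) : ℕ → D
  | 0 => 𝟙_ D
  | n + 1 => tpow x n ⊗ x

/-- The `n`-th tensor power of a morphism. -/
def tpowMap {x y : D} (f : x ⟶ y) : ∀ n, tpow x n ⟶ tpow y n
  | 0 => 𝟙 _
  | n + 1 => tpowMap f n ⊗ₘ f

/-- `x^{⊗ m} ⊗ x^{⊗ n} ≅ x^{⊗ (m + n)}`. -/
def tpowAdd (x : D) (m : ℕ) : ∀ n, tpow x m ⊗ tpow x n ≅ tpow x (m + n)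
  | 0 => ρ_ _
  | n + 1 => (α_ _ _ _).symm ≪≫ whiskerRightIso (tpowAdd x m n) x

/-- The transposition of the adjacent tensor factors `q` and `q + 1` (counted from `0`)
of `x^{⊗ (q + 2 + p)}`. -/
def tpowSwap [BraidedCategory D] (x : D) (q : ℕ) : ∀ p, tpow x (q + 2 + p) ⟶ tpow x (q + 2 + p)
  | 0 => (α_ (tpow x q) x x).hom ≫ tpow x q ◁ (β_ x x).hom ≫ (α_ (tpow x q) x x).inv
  | p + 1 => tpowSwap x q p ▷ x

end Powers

/-! ### Algebras over operads

A functor `ι : SSet ⥤ D` that is strong symmetric monoidal for the cartesian product of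
simplicial sets makes `D` tensored over simplicial sets by `K ⊗ x := ι K ⊗ x`; a morphism
`ι Δ[m] ⊗ x ⟶ y` is an `m`-simplex of the mapping space from `x` to `y`. -/

section Algebras

variable {D : Type u} [Category.{v} D] [MonoidalCategory D]
variable (ι : SSet.{v} ⥤ D) [ι.Monoidal] (K : SSet.{v})

/-- The image of `K ⟶ *`. -/
def counit : ι.obj K ⟶ 𝟙_ D :=
  ι.map (SemiCartesianMonoidalCategory.toUnit K) ≫ Functor.OplaxMonoidal.η ι

/-- The image of the diagonal of `K`. -/
def diagonal : ι.obj K ⟶ ι.obj K ⊗ ι.obj K :=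
  ι.map (CartesianMonoidalCategory.lift (𝟙 K) (𝟙 K)) ≫ Functor.OplaxMonoidal.δ ι K K

/-- Composition of `K`-families of morphisms. -/
def kcomp {x y z : D} (f : ι.obj K ⊗ x ⟶ y) (g : ι.obj K ⊗ y ⟶ z) : ι.obj K ⊗ x ⟶ z :=
  diagonal ι K ▷ x ≫ (α_ _ _ _).hom ≫ ι.obj K ◁ f ≫ g

/-- Tensor product of `K`-families of morphisms. -/
def ktensor [BraidedCategory D] {x x' y y' : D} (f : ι.obj K ⊗ x ⟶ y) (g : ι.obj K ⊗ x' ⟶ y') :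
    ι.obj K ⊗ (x ⊗ x') ⟶ y ⊗ y' :=
  diagonal ι K ▷ (x ⊗ x') ≫ tensorμ _ _ _ _ ≫ (f ⊗ₘ g)

/-- The tensor product of the `K`-families `f i : x^{⊗ n i} ⟶ x`. -/
def kmulti [BraidedCategory D] (x : D) : ∀ (k : ℕ) (n : Fin k → ℕ)
    (_ : ∀ i, ι.obj K ⊗ tpow x (n i) ⟶ x), ι.obj K ⊗ tpow x (∑ i, n i) ⟶ tpow x k
  | 0, _, _ => ι.obj K ◁ eqToHom (congrArg (tpow x) (Fin.sum_univ_zero _)) ≫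
      (ρ_ _).hom ≫ counit ι K
  | k + 1, n, f => ι.obj K ◁ (eqToHom (congrArg (tpow x) (Fin.sum_univ_castSucc n)) ≫
      (tpowAdd x _ _).inv) ≫
        ktensor ι K (kmulti x k (fun i => n i.castSucc) fun i => f i.castSucc) (f (Fin.last k))

/-- `act` is a morphism from the operad `P` to the endomorphism operad of `x`
in the category of `K`-families of morphisms. -/
structure IsAction [BraidedCategory D] (P : SetOperad.{v}) (x : D)
    (act : ∀ n : ℕ, P.obj (Fin n) → (ι.obj K ⊗ tpow x n ⟶ x)) : Prop where
  one : act 1 P.one = counit ι K ▷ _ ≫ (λ_ _).hom ≫ (λ_ x).hom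
  perm : ∀ (q p : ℕ) (o : P.obj (Fin (q + 2 + p))),
    act _ (P.act (Equiv.swap ⟨q, by omega⟩ ⟨q + 1, by omega⟩) o) =
      ι.obj K ◁ tpowSwap x q p ≫ act _ o
  comp : ∀ (k : ℕ) (n : Fin k → ℕ) (o : P.obj (Fin k)) (b : ∀ i, P.obj (Fin (n i))),
    act _ (P.act finSigmaFinEquiv (P.comp o b)) =
      kcomp ι K (kmulti ι K x k n fun i => act (n i) (b i)) (act k o)

/-- An `L`-indexed family of algebra structures on `x` over the simplicial operad `O`, for a
simplicial set `L`: a map of simplicial operads from `O` to the operad of maps from `L` to the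
endomorphism operad of `x` (whose `m`-simplices in arity `n` are the morphisms
`ι Δ[m] ⊗ x^{⊗ n} ⟶ x`). -/
@[ext]
structure AlgFamily [BraidedCategory D] (O : SOperad.{v}) (L : SSet.{v}) (x : D) where
  act : ∀ (m : SimplexCategoryᵒᵖ) (_ : L.obj m) (n : ℕ) (_ : (O.obj m).obj (Fin n)),
    ι.obj (SSet.stdSimplex.obj m.unop) ⊗ tpow x n ⟶ x
  isAction : ∀ (m : SimplexCategoryᵒᵖ) (l : L.obj m),
    IsAction ι (SSet.stdSimplex.obj m.unop) (O.obj m) x (act m l)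
  naturality : ∀ {m m' : SimplexCategoryᵒᵖ} (φ : m ⟶ m') (l : L.obj m) (n : ℕ)
    (o : (O.obj m).obj (Fin n)),
    act m' (L.map φ l) n (SetOperad.Hom.app (O.map φ) o) =
      ι.map (SSet.stdSimplex.map φ.unop) ▷ _ ≫ act m l n o

/-- An algebra structure on `x` over the simplicial operad `O`: a map of simplicial operads from
`O` to the endomorphism operad of `x`. -/
structure OAlgebra [BraidedCategory D] (O : SOperad.{v}) (x : D) where
  act : ∀ (m : SimplexCategoryᵒᵖ) (n : ℕ) (_ : (O.obj m).obj (Fin n)),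
    ι.obj (SSet.stdSimplex.obj m.unop) ⊗ tpow x n ⟶ x
  isAction : ∀ m : SimplexCategoryᵒᵖ,
    IsAction ι (SSet.stdSimplex.obj m.unop) (O.obj m) x (act m)
  naturality : ∀ {m m' : SimplexCategoryᵒᵖ} (φ : m ⟶ m') (n : ℕ) (o : (O.obj m).obj (Fin n)),
    act m' n (SetOperad.Hom.app (O.map φ) o) =
      ι.map (SSet.stdSimplex.map φ.unop) ▷ _ ≫ act m n o

end Algebras

/-! ### Lifting algebra structures to pro-objects -/

section Lift

variable {C : Type u} [Category.{v} C] [MonoidalCategory C] [SymmetricCategory C]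
variable (ι : SSet.{v} ⥤ C) [ι.Monoidal] {O : SOperad.{v}} {y : C} {W : ProObj.{v} C}

/-- The tensor powers of a constant pro-object are constant. -/
def tpowConst (y : C) : ∀ n, tpow (ProObj.const.obj y) n ⟶ ProObj.const.obj (tpow y n)
  | 0 => Functor.LaxMonoidal.ε ProObj.const
  | n + 1 => tpowConst y n ▷ _ ≫ Functor.LaxMonoidal.μ ProObj.const _ _

/-- A family of algebra structures on the pro-object `W` is compatible with the algebra structure
`θ` on `y` if `η : y ⟶ W` is a map of algebras for every member of the family. -/
def AlgFamily.Compatible {L : SSet.{v}} (θ : OAlgebra ι O y) (η : ProObj.const.obj y ⟶ W)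
    (A : AlgFamily (ι ⋙ ProObj.const) O L W) : Prop :=
  ∀ (m : SimplexCategoryᵒᵖ) (l : L.obj m) (n : ℕ) (o : (O.obj m).obj (Fin n)),
    ProObj.const.obj (ι.obj (SSet.stdSimplex.obj m.unop)) ◁ tpowConst y n ≫
        Functor.LaxMonoidal.μ ProObj.const _ _ ≫ ProObj.const.map (θ.act m n o) ≫ η =
      ProObj.const.obj (ι.obj (SSet.stdSimplex.obj m.unop)) ◁ tpowMap η n ≫ A.act m l n o

/-- Restriction of a family of algebra structures along `L' ⟶ L`. -/
def AlgFamily.restrict {D : Type u} [Category.{v} D] [MonoidalCategory D] [BraidedCategory D]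
    {ι : SSet.{v} ⥤ D} [ι.Monoidal] {x : D} {L L' : SSet.{v}} (A : AlgFamily ι O L x)
    (r : L' ⟶ L) : AlgFamily ι O L' x where
  act m l := A.act m (r.app m l)
  isAction m l := A.isAction m (r.app m l)
  naturality φ l n o := by
    rw [← A.naturality φ]
    exact congrArg (fun t => A.act _ t n _) (NatTrans.naturality_apply r φ l)

/-- The space of `O`-algebra structures on the pro-object `W` that are compatible with the
`O`-algebra structure `θ` on `y`; its `k`-simplices are the compatible `Δ[k]`-indexed families. -/
def liftSpace (θ : OAlgebra ι O y) (η : ProObj.const.obj y ⟶ W) : SSet.{v} where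
  obj k := { A : AlgFamily (ι ⋙ ProObj.const) O (SSet.stdSimplex.obj k.unop) W //
    A.Compatible ι θ η }
  map φ := TypeCat.ofHom fun A => ⟨A.1.restrict (SSet.stdSimplex.map φ.unop),
    fun m l n o => A.2 m _ n o⟩
  map_id k := by
    refine ConcreteCategory.hom_ext _ _ fun A => ?_
    refine Subtype.ext (AlgFamily.ext (funext fun m => funext fun l => ?_))
    exact congrArg (fun r : SSet.stdSimplex.obj _ ⟶ SSet.stdSimplex.obj _ => A.1.act m (r.app m l))
      (SSet.stdSimplex.map_id k.unop)
  map_comp φ ψ := by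
    refine ConcreteCategory.hom_ext _ _ fun A => ?_
    refine Subtype.ext (AlgFamily.ext (funext fun m => funext fun l => ?_))
    exact congrArg (fun r : SSet.stdSimplex.obj _ ⟶ SSet.stdSimplex.obj _ => A.1.act m (r.app m l))
      (SSet.stdSimplex.map_comp ψ.unop φ.unop)

end Lift

/-! ### Model categories -/

section Model

variable (C : Type u) [Category.{v} C]

/-- A symmetric monoidal model category with a compatible simplicial structure and
cofibrant unit.  The simplicial structure is given by the strong symmetric monoidal left
adjoint `ι : SSet ⥤ C`, `K ↦ K ⊗ I`; the tensor of `x` with `K` is `ι K ⊗ x` and the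
`n`-simplices of the mapping space from `x` to `y` are the morphisms `ι Δ[n] ⊗ x ⟶ y`. The last two
fields say that `ι` is a left Quillen functor; with the pushout-product axiom this is the axiom
SM7, and for `n = 0` the first of them says that the unit is cofibrant. -/
structure IsOperadicModelCategory [MonoidalCategory C] [SymmetricCategory C] [ModelCategory C]
    (ι : SSet.{v} ⥤ C) [ι.Braided] [ι.IsLeftAdjoint] : Prop where
  pushout_product : ∀ {A B A' B' : C} (f : A ⟶ B) (g : A' ⟶ B') [Cofibration f] [Cofibration g]
    (sq : (curriedTensor C).PushoutObjObj f g), Cofibration sq.ι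
  pushout_product_acyclic : ∀ {A B A' B' : C} (f : A ⟶ B) (g : A' ⟶ B') [Cofibration f]
    [Cofibration g] (sq : (curriedTensor C).PushoutObjObj f g),
    WeakEquivalence f ∨ WeakEquivalence g → WeakEquivalence sq.ι
  tensor_weakEquivalence : ∀ (x : C) [IsCofibrant x] {A B : C} (f : A ⟶ B) [WeakEquivalence f],
    WeakEquivalence (x ◁ f)
  cofibration_boundary : ∀ n : ℕ, Cofibration (ι.map (SSet.boundary n).ι)
  acyclic_horn : ∀ (n : ℕ) (i : Fin (n + 2)), Cofibration (ι.map (SSet.horn (n + 1) i).ι) ∧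
    WeakEquivalence (ι.map (SSet.horn (n + 1) i).ι)

variable [ModelCategory C]

/-- Properness: weak equivalences are stable under pushouts along cofibrations and under
pullbacks along fibrations. -/
structure IsProper : Prop where
  left : ∀ {A B A' B' : C} {f : A ⟶ B} {g : A ⟶ A'} {h : B ⟶ B'} {k : A' ⟶ B'}
    (_ : IsPushout f g h k) [Cofibration f] [WeakEquivalence g], WeakEquivalence h
  right : ∀ {A B A' B' : C} {f : A ⟶ B} {g : A ⟶ A'} {h : B ⟶ B'} {k : A' ⟶ B'}
    (_ : IsPullback f g h k) [Fibration h] [WeakEquivalence k], WeakEquivalence f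

/-- Filtered colimits preserve fibrations, represent homotopy colimits (that is, preserve weak
equivalences) and commute with finite limits. -/
structure HasGoodFilteredColimits [HasColimits C] : Prop where
  fibration : ∀ (J : Type v) [SmallCategory J] [IsFiltered J],
    (fibrations C).IsStableUnderColimitsOfShape J
  weakEquivalence : ∀ (J : Type v) [SmallCategory J] [IsFiltered J],
    (weakEquivalences C).IsStableUnderColimitsOfShape J
  exact : ∀ (J : Type v) [SmallCategory J] [IsFiltered J], HasExactColimitsOfShape J C

variable {C}

/-- A commutative square
`A --f--> B`, `A --g--> A'`, `B --h--> B'`, `A' --k--> B'`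
is a homotopy pushout (in a left proper model category): after factoring `f` as a cofibration
followed by a weak equivalence, the pushout maps to `B'` by a weak equivalence. -/
def IsHoPushout {A B A' B' : C} (f : A ⟶ B) (g : A ⟶ A') (h : B ⟶ B') (k : A' ⟶ B') : Prop :=
  f ≫ h = g ≫ k ∧ ∃ (M : C) (i : A ⟶ M) (p : M ⟶ B) (Q : C) (a : M ⟶ Q) (b : A' ⟶ Q) (c : Q ⟶ B'),
    Cofibration i ∧ WeakEquivalence p ∧ i ≫ p = f ∧ IsPushout i g a b ∧
      a ≫ c = p ≫ h ∧ b ≫ c = k ∧ WeakEquivalence c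

/-- The dual notion of homotopy pullback (in a right proper model category): after
factoring `h` as a weak equivalence followed by a fibration, `A` maps to the pullback by a weak
equivalence. -/
def IsHoPullback {A B A' B' : C} (f : A ⟶ B) (g : A ⟶ A') (h : B ⟶ B') (k : A' ⟶ B') : Prop :=
  f ≫ h = g ≫ k ∧ ∃ (M : C) (j : B ⟶ M) (p : M ⟶ B') (Q : C) (a : Q ⟶ M) (b : Q ⟶ A') (c : A ⟶ Q),
    WeakEquivalence j ∧ Fibration p ∧ j ≫ p = h ∧ IsPullback a b p k ∧
      c ≫ a = f ≫ j ∧ c ≫ b = g ∧ WeakEquivalence c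

/-- The object `P` is weakly equivalent to the terminal object. -/
def IsWeaklyTrivial (P : C) : Prop := WeakEquivalence (terminal.from P)

/-- `A ⟶ B ⟶ B'`, with the composite trivialized through the weakly trivial object `P`, is a
homotopy cofiber sequence. -/
structure IsCofiberSquare {A B P B' : C} (f : A ⟶ B) (g : A ⟶ P) (h : B ⟶ B') (k : P ⟶ B') :
    Prop where
  trivial : IsWeaklyTrivial P
  isHoPushout : IsHoPushout f g h k

variable (C) in
/-- Stability of a proper model category: it is pointed, and suspension and loop functors are
inverse to each other, that is, the squares with weakly trivial off-diagonal corners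
that are homotopy pushouts are those that are homotopy pullbacks. -/
structure IsStable : Prop where
  hasZeroObject : HasZeroObject C
  isHoPushout_iff : ∀ {A P P' B : C} (f : A ⟶ P) (g : A ⟶ P') (h : P ⟶ B) (k : P' ⟶ B),
    IsWeaklyTrivial P → IsWeaklyTrivial P' → f ≫ h = g ≫ k →
      (IsHoPushout f g h k ↔ IsHoPullback f g h k)

end Model

section Nilpotent

variable {C : Type u} [Category.{v} C] [MonoidalCategory C] [ModelCategory C]

/-- The class of `E`-nilpotent objects: the smallest class of objects of the homotopy category
that contains `E` and is closed under retracts (in particular isomorphisms), cofiber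
sequences, and derived tensor products with arbitrary objects. -/
inductive IsNilObject (E : C) : C → Prop
  | base : IsNilObject E E
  | retract {X Y : C} (hX : IsNilObject E X)
      (r : Retract ((weakEquivalences C).Q.obj Y) ((weakEquivalences C).Q.obj X)) :
      IsNilObject E Y
  | cofiber₁ {X Y Z P : C} {f : X ⟶ Y} {g : X ⟶ P} {h : Y ⟶ Z} {k : P ⟶ Z}
      (s : IsCofiberSquare f g h k) (hY : IsNilObject E Y) (hZ : IsNilObject E Z) :
      IsNilObject E X
  | cofiber₂ {X Y Z P : C} {f : X ⟶ Y} {g : X ⟶ P} {h : Y ⟶ Z} {k : P ⟶ Z}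
      (s : IsCofiberSquare f g h k) (hX : IsNilObject E X) (hZ : IsNilObject E Z) :
      IsNilObject E Y
  | cofiber₃ {X Y Z P : C} {f : X ⟶ Y} {g : X ⟶ P} {h : Y ⟶ Z} {k : P ⟶ Z}
      (s : IsCofiberSquare f g h k) (hX : IsNilObject E X) (hY : IsNilObject E Y) :
      IsNilObject E Z
  | tensor {X : C} (hX : IsNilObject E X) (hX' : IsCofibrant X) (A : C) (hA : IsCofibrant A) :
      IsNilObject E (A ⊗ X)

/-- The cofibrant object `E`, with unit `e` and multiplication `m`, is a `μ`-ring in the homotopy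
category: the multiplication is left unital there. -/
def IsMuRing (E : C) (e : 𝟙_ C ⟶ E) (m : E ⊗ E ⟶ E) : Prop :=
  (weakEquivalences C).Q.map (e ▷ E ≫ m) = (weakEquivalences C).Q.map (λ_ E).hom

/-- Given evaluations `q : D ⟶ F(x, u)` and `r : u ⊗ y ⟶ z`, the adjoint
`D ⊗ y ⟶ F(x, z)` of `x ⊗ (D ⊗ y) ⟶ u ⊗ y ⟶ z`. -/
def dualityMap [MonoidalClosed C] {x u D y z : C} (q : D ⟶ (ihom x).obj u) (r : u ⊗ y ⟶ z) :
    D ⊗ y ⟶ (ihom x).obj z :=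
  MonoidalClosed.curry ((α_ x D y).inv ≫ MonoidalClosed.uncurry q ▷ y ≫ r)

/-- The cofibrant object `x` is dualizable in the homotopy category: for its derived dual
`D ≃ F(x, u)`, where `u` is a fibrant replacement of the unit, and all `y`, the map
`D ⊗ y ⟶ F(x, z)` is a weak equivalence, where `z` is a fibrant replacement of `y ≃ u ⊗ y`. -/
def IsDualizable [MonoidalClosed C] (x : C) : Prop :=
  ∀ (u : C) (i : 𝟙_ C ⟶ u) [Cofibration i] [WeakEquivalence i] [IsFibrant u]
    (D : C) (q : D ⟶ (ihom x).obj u) [IsCofibrant D] [WeakEquivalence q]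
    (y z : C) (r : u ⊗ y ⟶ z) [IsCofibrant y] [IsFibrant z] [WeakEquivalence r],
    WeakEquivalence (dualityMap q r)

/-- The unit is compact: mapping spaces out of the unit commute with filtered homotopy colimits.
`ι.rightAdjoint.obj x` is the mapping space from the unit to `x`, a Kan complex if `x` is
fibrant. -/
def IsUnitCompact [HasColimits C] (ι : SSet.{v} ⥤ C) [ι.IsLeftAdjoint] : Prop :=
  ∀ (J : Type v) [SmallCategory J] [IsFiltered J] (F : J ⥤ C), (∀ j, IsFibrant (F.obj j)) →
    IsKanEquivalence (colimit.post F ι.rightAdjoint)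

/-! ### Towers -/

/-- A tower `w` under `y` that represents a cofibration `y ⟶ w` to a fibrant pro-object. -/
structure IsFibrantTower {y : C} {w : ℕᵒᵖ ⥤ C} (η : (Functor.const ℕᵒᵖ).obj y ⟶ w) : Prop where
  cofibration : ∀ s, Cofibration (η.app s)
  isFibrant : IsFibrant (w.obj (op 0))
  fibration : ∀ s : ℕ, Fibration (w.map (homOfLE s.le_succ).op)

/-- For a tower `w` under `y` and an object `z`, the cocone of the internal function objects
`F(w_s, z)` with vertex `F(y, z)`. -/
def functionCocone [MonoidalClosed C] {y : C} {w : ℕᵒᵖ ⥤ C} (η : (Functor.const ℕᵒᵖ).obj y ⟶ w)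
    (z : C) : Cocone (w.rightOp ⋙ MonoidalClosed.internalHom.flip.obj z) where
  pt := (ihom y).obj z
  ι :=
    { app := fun s => (MonoidalClosed.pre (η.app (op s))).app z
      naturality := fun s t f => by
        have h := η.naturality f.op
        have h' : (MonoidalClosed.pre (w.map f.op)) ≫ MonoidalClosed.pre (η.app (op t)) =
            MonoidalClosed.pre (η.app (op s)) := by
          rw [← MonoidalClosed.pre_map, ← h]
          exact congrArg MonoidalClosed.pre (Category.id_comp _)
        exact (congrArg (fun φ => NatTrans.app φ z) h').trans (Category.comp_id _).symm }

/-- The tower `w` (of cofibrant objects) under the cofibrant object `y` is an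
`E`-nilpotent resolution of `y`: its terms are `E`-nilpotent and
`hocolim_s F(w_s, z) ⟶ F(y, z)` is a weak equivalence for all `E`-nilpotent `z`. -/
structure IsNilpotentResolution [MonoidalClosed C] [HasColimits C] (E : C) {y : C} {w : ℕᵒᵖ ⥤ C}
    (η : (Functor.const ℕᵒᵖ).obj y ⟶ w) : Prop where
  nilpotent : ∀ s, IsNilObject E (w.obj s)
  weakEquivalence : ∀ (z : C) [IsFibrant z], IsNilObject E z →
    WeakEquivalence (colimit.desc _ (functionCocone η z))

/-- The tensor powers `J^n = J ⊗ (J ⊗ ⋯)`. -/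
def adamsPow (J : C) : ℕ → C
  | 0 => 𝟙_ C
  | n + 1 => J ⊗ adamsPow J n

/-- The map `J^{n+1} = J ⊗ J^n ⟶ I ⊗ J^n ≅ J^n`. -/
def adamsStep {J : C} (j : J ⟶ 𝟙_ C) (n : ℕ) : adamsPow J (n + 1) ⟶ adamsPow J n :=
  j ▷ adamsPow J n ≫ (λ_ _).hom

/-- The composite `J^n ⟶ I^n ≅ I`. -/
def adamsAug {J : C} (j : J ⟶ 𝟙_ C) : ∀ n, adamsPow J n ⟶ 𝟙_ C
  | 0 => 𝟙 _
  | n + 1 => adamsStep j n ≫ adamsAug j n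

/-- The tower `w` under `y` is an Adams tower `{(I / J^n) ⊗ y}` of `y`, where `J ⟶ I ⟶ E` is a
fiber sequence: it is the tower of homotopy cofibers of the maps `J^n ⊗ y ⟶ I ⊗ y ≅ y`. -/
def IsAdamsTower {E : C} (e : 𝟙_ C ⟶ E) {y : C} {w : ℕᵒᵖ ⥤ C}
    (η : (Functor.const ℕᵒᵖ).obj y ⟶ w) : Prop :=
  ∃ (J P : C) (j : J ⟶ 𝟙_ C) (g : J ⟶ P) (k : P ⟶ E) (T : ℕ → C) (t : ∀ n, T (n + 1) ⟶ T n)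
    (a : ∀ n, adamsPow J n ⊗ y ⟶ T n) (b : ∀ n, T n ⟶ w.obj (op n)),
    IsCofibrant J ∧ IsCofiberSquare j g e k ∧ (∀ n, IsCofibrant (T n)) ∧
    (∀ n, a (n + 1) ≫ t n = adamsStep j n ▷ y ≫ a n) ∧
    (∀ n, b (n + 1) ≫ w.map (homOfLE n.le_succ).op = t n ≫ b n) ∧
    ∀ n, IsCofiberSquare (adamsAug j n ▷ y ≫ (λ_ y).hom) (a n) (η.app (op n)) (b n)

end Nilpotent

section TowerPro

variable {C : Type u} [Category.{v} C]

/-- A tower, as a pro-object. -/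
def towerPro (w : ℕᵒᵖ ⥤ C) : ProObj.{v} C where
  J := (ULift.{v} ℕ)ᵒᵖ
  diag := (Monotone.functor (f := ULift.down.{v} (α := ℕ)) fun _ _ h => h).op ⋙ w

/-- A tower under `y`, as a morphism of pro-objects from the constant pro-object `y`. -/
def towerProMap {y : C} {w : ℕᵒᵖ ⥤ C} (η : (Functor.const ℕᵒᵖ).obj y ⟶ w) :
    ProObj.const.obj y ⟶ towerPro w :=
  ProObj.ofReindex (fun _ => ⟨⟨⟩⟩) (fun _ => 𝟙 _) (fun s => η.app (op s.unop.down))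
    fun _ => η.naturality _

end TowerPro

end ProCompletion

open ProCompletion

universe u'

set_option linter.unusedSectionVars false

namespace ProCompletion

section

/-! ### Families of morphisms indexed by a simplicial set -/

section KFamilies

variable {D : Type u} [Category.{v} D] [MonoidalCategory D]

section Comon

attribute [local simp] CartesianMonoidalCategory.lift_whiskerRight in
/-- The comonoid structure of a simplicial set. -/
@[reducible]
def ssetComon (K : SSet.{v}) : ComonObj K where
  counit := SemiCartesianMonoidalCategory.toUnit K
  comul := CartesianMonoidalCategory.lift (𝟙 K) (𝟙 K)
  counit_comul := by ext <;> simp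
  comul_counit := by ext <;> simp
  comul_assoc := by ext <;> simp

variable (ι : SSet.{v} ⥤ D) [ι.Monoidal] (K : SSet.{v})

theorem diagonal_coassoc :
    diagonal ι K ≫ diagonal ι K ▷ ι.obj K ≫ (α_ _ _ _).hom =
      diagonal ι K ≫ ι.obj K ◁ diagonal ι K := by
  let _ : ComonObj K := ssetComon K
  let _ : ComonObj (ι.obj K) := Functor.obj.instComonObj K ι
  have := ComonObj.comul_assoc (ι.obj K)
  exact this.symm

theorem diagonal_counit_left :
    diagonal ι K ≫ counit ι K ▷ ι.obj K = (λ_ _).inv := by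
  let _ : ComonObj K := ssetComon K
  let _ : ComonObj (ι.obj K) := Functor.obj.instComonObj K ι
  exact ComonObj.counit_comul (ι.obj K)

theorem diagonal_counit_right :
    diagonal ι K ≫ ι.obj K ◁ counit ι K = (ρ_ _).inv := by
  let _ : ComonObj K := ssetComon K
  let _ : ComonObj (ι.obj K) := Functor.obj.instComonObj K ι
  exact ComonObj.comul_counit (ι.obj K)

theorem map_counit {K K' : SSet.{v}} (r : K' ⟶ K) : ι.map r ≫ counit ι K = counit ι K' := by
  unfold counit
  rw [← Category.assoc, ← ι.map_comp]
  congr 2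

theorem map_diagonal {K K' : SSet.{v}} (r : K' ⟶ K) :
    ι.map r ≫ diagonal ι K = diagonal ι K' ≫ (ι.map r ⊗ₘ ι.map r) := by
  unfold diagonal
  rw [Category.assoc, Functor.OplaxMonoidal.δ_natural, ← Category.assoc, ← ι.map_comp,
    ← Category.assoc, ← ι.map_comp]
  congr 2

end Comon

/-- The tensorator of a monoidal functor from simplicial sets is compatible with the symmetry. -/
class PreservesBraiding [BraidedCategory D] (ι : SSet.{v} ⥤ D) [ι.Monoidal] : Prop where
  braided : ∀ X Y : SSet.{v}, Functor.LaxMonoidal.μ ι X Y ≫ ι.map (β_ X Y).hom =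
    (β_ _ _).hom ≫ Functor.LaxMonoidal.μ ι Y X

instance [BraidedCategory D] (ι : SSet.{v} ⥤ D) [ι.Braided] : PreservesBraiding ι where
  braided X Y := Functor.LaxBraided.braided X Y

section Symm

variable [SymmetricCategory D] (ι : SSet.{v} ⥤ D) [ι.Monoidal] [PreservesBraiding ι] (K : SSet.{v})

theorem diagonal_braiding : diagonal ι K ≫ (β_ _ _).hom = diagonal ι K := by
  unfold diagonal
  have h : Functor.OplaxMonoidal.δ ι K K ≫ (β_ (ι.obj K) (ι.obj K)).hom =
      ι.map (β_ K K).hom ≫ Functor.OplaxMonoidal.δ ι K K := by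
    rw [← cancel_epi (Functor.LaxMonoidal.μ ι K K), ← cancel_mono (Functor.LaxMonoidal.μ ι K K)]
    simp [PreservesBraiding.braided]
  rw [Category.assoc, h, ← Category.assoc, ← ι.map_comp]
  congr 2

theorem diagonal_diagonal :
    diagonal ι K ≫ (diagonal ι K ⊗ₘ diagonal ι K) ≫ tensorμ _ _ _ _ =
      diagonal ι K ≫ (diagonal ι K ⊗ₘ diagonal ι K) := by
  have key : diagonal ι K ≫ (diagonal ι K ⊗ₘ diagonal ι K) ≫ (α_ _ _ _).hom ≫
      ι.obj K ◁ (α_ _ _ _).inv = diagonal ι K ≫ ι.obj K ◁ (diagonal ι K ≫ diagonal ι K ▷ _) := by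
    rw [MonoidalCategory.tensorHom_def, Category.assoc, associator_naturality_right_assoc,
      reassoc_of% @diagonal_coassoc, ← whiskerLeft_comp, ← whiskerLeft_comp]
    congr 2
    rw [← reassoc_of% @diagonal_coassoc]; simp
  have h2 : diagonal ι K ≫ (diagonal ι K ⊗ₘ diagonal ι K) = 
     (diagonal ι K ≫ ι.obj K ◁ (diagonal ι K ≫ diagonal ι K ▷ _)) ≫ ι.obj K ◁ (α_ _ _ _).hom ≫
      (α_ _ _ _).inv := by
    rw [← key]; simp
  unfold tensorμ
  have h3 := congrArg (· ≫ ι.obj K ◁ ((β_ (ι.obj K) (ι.obj K)).hom ▷ (ι.obj K)) ≫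
     ι.obj K ◁ (α_ _ _ _).hom ≫ (α_ _ _ _).inv) key
  simp only [Category.assoc, whiskerLeft_comp] at h3 h2 ⊢
  rw [h3, h2]
  slice_lhs 3 4 => rw [← whiskerLeft_comp, ← comp_whiskerRight, diagonal_braiding]
  simp

end Symm

section Laws

variable (ι : SSet.{v} ⥤ D) [ι.Monoidal] (K : SSet.{v})

/-- The constant family at the identity. -/
def kid (x : D) : ι.obj K ⊗ x ⟶ x := counit ι K ▷ x ≫ (λ_ x).hom

variable {ι K}

theorem whiskerLeft_kid {x y : D} (f : x ⟶ y) : ι.obj K ◁ f ≫ kid ι K y = kid ι K x ≫ f := by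
  unfold kid
  rw [whisker_exchange_assoc, leftUnitor_naturality, Category.assoc]

theorem whiskerLeft_kcomp {x' x y z : D} (a : x' ⟶ x) (f : ι.obj K ⊗ x ⟶ y) (g : ι.obj K ⊗ y ⟶ z) :
    ι.obj K ◁ a ≫ kcomp ι K f g = kcomp ι K (ι.obj K ◁ a ≫ f) g := by
  unfold kcomp
  rw [whisker_exchange_assoc, whiskerLeft_comp]
  simp

theorem kcomp_comp {x y z z' : D} (f : ι.obj K ⊗ x ⟶ y) (g : ι.obj K ⊗ y ⟶ z) (a : z ⟶ z') :
    kcomp ι K f g ≫ a = kcomp ι K f (g ≫ a) := by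
  simp [kcomp]

theorem kcomp_whiskerLeft {x y y' z : D} (f : ι.obj K ⊗ x ⟶ y) (a : y ⟶ y') (g : ι.obj K ⊗ y' ⟶ z) :
    kcomp ι K f (ι.obj K ◁ a ≫ g) = kcomp ι K (f ≫ a) g := by
  simp [kcomp]

theorem kid_kcomp {x y : D} (f : ι.obj K ⊗ x ⟶ y) : kcomp ι K (kid ι K x) f = f := by
  unfold kcomp kid
  rw [whiskerLeft_comp, Category.assoc]
  rw [← associator_naturality_middle_assoc, ← comp_whiskerRight_assoc, diagonal_counit_right]
  rw [triangle_assoc, ← comp_whiskerRight_assoc, Iso.inv_hom_id, id_whiskerRight,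
    Category.id_comp]

theorem kcomp_kid {x y : D} (f : ι.obj K ⊗ x ⟶ y) : kcomp ι K f (kid ι K y) = f := by
  unfold kcomp kid
  rw [whisker_exchange_assoc, ← associator_naturality_left_assoc, ← comp_whiskerRight_assoc,
    diagonal_counit_left, leftUnitor_naturality, ← leftUnitor_whiskerRight_assoc, ← comp_whiskerRight_assoc, Iso.inv_hom_id, id_whiskerRight,
    Category.id_comp]

theorem kcomp_assoc {x y z w : D} (f : ι.obj K ⊗ x ⟶ y) (g : ι.obj K ⊗ y ⟶ z)
    (h : ι.obj K ⊗ z ⟶ w) : kcomp ι K (kcomp ι K f g) h = kcomp ι K f (kcomp ι K g h) := by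
  unfold kcomp
  rw [whisker_exchange_assoc]
  simp only [whiskerLeft_comp, Category.assoc, tensor_whiskerLeft, Iso.inv_hom_id_assoc]
  rw [← associator_naturality_left_assoc, ← comp_whiskerRight_assoc]
  rw [← associator_naturality_middle_assoc, ← comp_whiskerRight_assoc, ← diagonal_coassoc]
  simp

/-- Restriction of composites along a map of index sets. -/
theorem map_kcomp {K' : SSet.{v}} (r : K' ⟶ K) {x y z : D} (f : ι.obj K ⊗ x ⟶ y)
    (g : ι.obj K ⊗ y ⟶ z) :
    ι.map r ▷ x ≫ kcomp ι K f g = kcomp ι K' (ι.map r ▷ x ≫ f) (ι.map r ▷ y ≫ g) := by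
  unfold kcomp
  rw [← comp_whiskerRight_assoc, map_diagonal, MonoidalCategory.tensorHom_def']
  simp only [comp_whiskerRight, Category.assoc, whiskerLeft_comp,
    associator_naturality_left_assoc, associator_naturality_middle_assoc]
  rw [← whisker_exchange_assoc]

theorem map_kid {K' : SSet.{v}} (r : K' ⟶ K) (x : D) :
    ι.map r ▷ x ≫ kid ι K x = kid ι K' x := by
  unfold kid
  rw [← comp_whiskerRight_assoc, map_counit]

variable [SymmetricCategory D]

theorem map_ktensor {K' : SSet.{v}} (r : K' ⟶ K) {x x' y y' : D} (f : ι.obj K ⊗ x ⟶ y)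
    (g : ι.obj K ⊗ x' ⟶ y') :
    ι.map r ▷ _ ≫ ktensor ι K f g = ktensor ι K' (ι.map r ▷ x ≫ f) (ι.map r ▷ x' ≫ g) := by
  unfold ktensor
  rw [← comp_whiskerRight_assoc, map_diagonal, comp_whiskerRight, Category.assoc,
    tensorμ_natural_left_assoc, tensorHom_comp_tensorHom]

theorem whiskerLeft_ktensor {x x' y y' z z' : D} (a : z ⟶ x) (b : z' ⟶ x') (f : ι.obj K ⊗ x ⟶ y)
    (g : ι.obj K ⊗ x' ⟶ y') :
    ι.obj K ◁ (a ⊗ₘ b) ≫ ktensor ι K f g = ktensor ι K (ι.obj K ◁ a ≫ f) (ι.obj K ◁ b ≫ g) := by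
  unfold ktensor
  rw [whisker_exchange_assoc, tensorμ_natural_right_assoc, tensorHom_comp_tensorHom]

theorem ktensor_comp {x x' y y' z z' : D} (f : ι.obj K ⊗ x ⟶ y)
    (g : ι.obj K ⊗ x' ⟶ y') (a : y ⟶ z) (b : y' ⟶ z') :
    ktensor ι K f g ≫ (a ⊗ₘ b) = ktensor ι K (f ≫ a) (g ≫ b) := by
  simp [ktensor]

theorem ktensor_associator {x x' x'' y y' y'' : D} (f : ι.obj K ⊗ x ⟶ y)
    (g : ι.obj K ⊗ x' ⟶ y') (h : ι.obj K ⊗ x'' ⟶ y'') :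
    ktensor ι K (ktensor ι K f g) h ≫ (α_ _ _ _).hom =
      ι.obj K ◁ (α_ _ _ _).hom ≫ ktensor ι K f (ktensor ι K g h) := by
  unfold ktensor
  have e₁ : ((diagonal ι K ▷ (x ⊗ x') ≫ tensorμ _ _ _ _ ≫ (f ⊗ₘ g)) ⊗ₘ h) =
      (diagonal ι K ▷ (x ⊗ x') ⊗ₘ 𝟙 (ι.obj K) ▷ x'') ≫ tensorμ _ _ _ _ ▷ _ ≫ ((f ⊗ₘ g) ⊗ₘ h) := by
    rw [← tensorHom_id (tensorμ _ _ _ _), tensorHom_comp_tensorHom, tensorHom_comp_tensorHom,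
      id_whiskerRight, Category.id_comp, Category.id_comp]
  have e₂ : (f ⊗ₘ (diagonal ι K ▷ (x' ⊗ x'') ≫ tensorμ _ _ _ _ ≫ (g ⊗ₘ h))) =
      (𝟙 (ι.obj K) ▷ x ⊗ₘ diagonal ι K ▷ (x' ⊗ x'')) ≫ _ ◁ tensorμ _ _ _ _ ≫ (f ⊗ₘ (g ⊗ₘ h)) := by
    rw [← id_tensorHom _ (tensorμ _ _ _ _), tensorHom_comp_tensorHom, tensorHom_comp_tensorHom,
      id_whiskerRight, Category.id_comp, Category.id_comp]
  rw [e₁, e₂, Category.assoc, Category.assoc, Category.assoc, Category.assoc,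
    ← tensorμ_natural_left_assoc, ← tensorμ_natural_left_assoc, associator_naturality,
    associator_monoidal_assoc, whisker_exchange_assoc, tensorHom_id, id_tensorHom,
    whisker_exchange_assoc, ← comp_whiskerRight_assoc, ← comp_whiskerRight_assoc,
    ← diagonal_coassoc, MonoidalCategory.tensorHom_def (α_ _ _ _).hom]
  simp only [comp_whiskerRight, Category.assoc]

theorem tensorμ_braiding (X₁ X₂ Y₁ Y₂ : D) :
    tensorμ X₁ X₂ Y₁ Y₂ ≫ (β_ (X₁ ⊗ Y₁) (X₂ ⊗ Y₂)).hom =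
      ((β_ X₁ X₂).hom ⊗ₘ (β_ Y₁ Y₂).hom) ≫ tensorμ X₂ X₁ Y₂ Y₁ := by
  simp [tensorμ, SymmetricCategory.braiding_swap_eq_inv_braiding Y₁ X₂,
    MonoidalCategory.tensorHom_def]

theorem ktensor_braiding [PreservesBraiding ι] {x x' y y' : D} (f : ι.obj K ⊗ x ⟶ y)
    (g : ι.obj K ⊗ x' ⟶ y') :
    ktensor ι K f g ≫ (β_ _ _).hom = ι.obj K ◁ (β_ _ _).hom ≫ ktensor ι K g f := by
  unfold ktensor
  rw [Category.assoc, Category.assoc, BraidedCategory.braiding_naturality, ← Category.assoc (tensorμ _ _ _ _),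
    tensorμ_braiding, MonoidalCategory.tensorHom_def, Category.assoc, Category.assoc,
    ← comp_whiskerRight_assoc, diagonal_braiding, whisker_exchange_assoc]

theorem ktensor_leftUnitor {x y : D} (f : ι.obj K ⊗ x ⟶ y) :
    ktensor ι K (kid ι K (𝟙_ D)) f ≫ (λ_ y).hom = ι.obj K ◁ (λ_ x).hom ≫ f := by
  unfold ktensor kid
  have e : ((counit ι K ▷ 𝟙_ D ≫ (λ_ (𝟙_ D)).hom) ⊗ₘ f) =
      (counit ι K ▷ 𝟙_ D ⊗ₘ 𝟙 (ι.obj K) ▷ x) ≫ (λ_ (𝟙_ D)).hom ▷ _ ≫ _ ◁ f := by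
    rw [← tensorHom_id (λ_ _).hom, ← id_tensorHom _ f, tensorHom_comp_tensorHom, tensorHom_comp_tensorHom,
      id_whiskerRight, Category.id_comp, Category.id_comp, Category.comp_id]
  rw [e, Category.assoc, Category.assoc, Category.assoc, Category.assoc, leftUnitor_naturality,
    ← tensorμ_natural_left_assoc, ← leftUnitor_monoidal_assoc, tensorHom_id,
    ← comp_whiskerRight_assoc, diagonal_counit_left, MonoidalCategory.tensorHom_def,
    Category.assoc, ← comp_whiskerRight_assoc, Iso.inv_hom_id, id_whiskerRight, Category.id_comp]

theorem ktensor_rightUnitor [PreservesBraiding ι] {x y : D} (f : ι.obj K ⊗ x ⟶ y) :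
    ktensor ι K f (kid ι K (𝟙_ D)) ≫ (ρ_ y).hom = ι.obj K ◁ (ρ_ x).hom ≫ f := by
  have h := ktensor_leftUnitor f
  rw [← braiding_leftUnitor, reassoc_of% @ktensor_braiding, h, ← whiskerLeft_comp_assoc,
    braiding_leftUnitor]

theorem ktensor_kid (x y : D) : ktensor ι K (kid ι K x) (kid ι K y) = kid ι K (x ⊗ y) := by
  unfold ktensor kid
  rw [← tensorHom_comp_tensorHom, ← tensorμ_natural_left_assoc, tensor_left_unitality,
    ← comp_whiskerRight_assoc, ← comp_whiskerRight_assoc, MonoidalCategory.tensorHom_def,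
    reassoc_of% @diagonal_counit_left, leftUnitor_inv_naturality]

theorem ktensor_kcomp [PreservesBraiding ι] {x y z x' y' z' : D} (f : ι.obj K ⊗ x ⟶ y)
    (g : ι.obj K ⊗ y ⟶ z) (f' : ι.obj K ⊗ x' ⟶ y') (g' : ι.obj K ⊗ y' ⟶ z') :
    ktensor ι K (kcomp ι K f g) (kcomp ι K f' g') =
      kcomp ι K (ktensor ι K f f') (ktensor ι K g g') := by
  have e : (kcomp ι K f g ⊗ₘ kcomp ι K f' g') =
      (diagonal ι K ▷ x ⊗ₘ diagonal ι K ▷ x') ≫ ((α_ _ _ _).hom ⊗ₘ (α_ _ _ _).hom) ≫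
        (ι.obj K ◁ f ⊗ₘ ι.obj K ◁ f') ≫ (g ⊗ₘ g') := by
    simp only [kcomp, tensorHom_comp_tensorHom]
  unfold ktensor
  rw [e, ← tensorμ_natural_left_assoc]
  unfold kcomp
  simp only [whiskerLeft_comp, Category.assoc]
  rw [whisker_exchange_assoc, whisker_exchange_assoc, whisker_exchange_assoc,
    tensorμ_natural_right_assoc, ← associator_naturality_left_assoc,
    ← associator_naturality_middle_assoc, ← tensor_associativity_assoc,
    ← comp_whiskerRight_assoc, ← comp_whiskerRight_assoc, ← comp_whiskerRight_assoc,
    ← comp_whiskerRight_assoc]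
  simp only [Category.assoc]
  rw [← MonoidalCategory.tensorHom_def_assoc, diagonal_diagonal]

end Laws

end KFamilies

end

section

/-! ### Coherence for symmetric monoidal categories -/

/-- Binary trees with labelled leaves. -/
inductive OTree (S : Type) : Type
  | nil : OTree S
  | leaf (a : S) : OTree S
  | node (l r : OTree S) : OTree S

namespace OTree

variable {S T R : Type}

/-- The labels of the leaves, from left to right. -/
def labels : OTree S → List S
  | nil => []
  | leaf a => [a]
  | node l r => l.labels ++ r.labels

/-- Substitution of trees for the leaves. -/
def bind : OTree S → (S → OTree T) → OTree T
  | nil, _ => nil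
  | leaf a, q => q a
  | node l r, q => node (l.bind q) (r.bind q)

/-- Relabelling of the leaves. -/
def map (g : S → T) (s : OTree S) : OTree T := s.bind fun a => leaf (g a)

theorem labels_bind (s : OTree S) (q : S → OTree T) :
    (s.bind q).labels = s.labels.flatMap fun a => (q a).labels := by
  induction s with
  | nil => rfl
  | leaf a => simp [bind, labels]
  | node l r hl hr => simp [bind, labels, hl, hr]

theorem labels_map (g : S → T) (s : OTree S) : (s.map g).labels = s.labels.map g := by
  rw [map, labels_bind]
  exact (List.map_eq_flatMap).symm

/-- The tree lists every element of `S` exactly once. -/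
def IsOrd (s : OTree S) : Prop := s.labels.Nodup ∧ ∀ a, a ∈ s.labels

theorem IsOrd.perm {s t : OTree S} (hs : s.IsOrd) (ht : t.IsOrd) : s.labels.Perm t.labels :=
  (List.perm_ext_iff_of_nodup hs.1 ht.1).2 fun a => ⟨fun _ => ht.2 a, fun _ => hs.2 a⟩

theorem IsOrd.map {s : OTree S} (hs : s.IsOrd) (e : S ≃ T) : (s.map e).IsOrd := by
  refine ⟨?_, fun a => ?_⟩
  · rw [labels_map]; exact hs.1.map e.injective
  · rw [labels_map]; exact List.mem_map.2 ⟨e.symm a, hs.2 _, by simp⟩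

theorem exists_isOrd (S : Type) [Finite S] : ∃ s : OTree S, s.IsOrd := by
  classical
  have := Fintype.ofFinite S
  have h : ∀ l : List S, ∃ s : OTree S, s.labels = l := fun l => by
    induction l with
    | nil => exact ⟨nil, rfl⟩
    | cons a l ih =>
      obtain ⟨s, hs⟩ := ih
      exact ⟨node (leaf a) s, by simp [labels, hs]⟩
  obtain ⟨s, hs⟩ := h (Finset.univ : Finset S).toList
  exact ⟨s, by rw [hs]; exact Finset.nodup_toList _, fun a => by rw [hs]; simp⟩

section Tens

variable {D : Type u} [Category.{v} D] [MonoidalCategory D] (x : D)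

/-- The tensor power of `x` of the given shape. -/
def tens : OTree S → D
  | nil => 𝟙_ D
  | leaf _ => x
  | node l r => tens l ⊗ tens r

/-- Relabelling does not change the tensor power. -/
def mapIso (g : S → T) : ∀ s : OTree S, tens x (s.map g) ≅ tens x s
  | nil => Iso.refl _
  | leaf _ => Iso.refl _
  | node l r => MonoidalCategory.tensorIso (mapIso g l) (mapIso g r)

theorem mapIso_node (g : S → T) (l r : OTree S) :
    (mapIso x g (node l r)).hom = ((mapIso x g l).hom ⊗ₘ (mapIso x g r).hom) := rfl

theorem mapIso_node_inv (g : S → T) (l r : OTree S) :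
    (mapIso x g (node l r)).inv = ((mapIso x g l).inv ⊗ₘ (mapIso x g r).inv) := rfl

/-- The isomorphism `(A ⊗ x) ⊗ B ≅ (A ⊗ B) ⊗ x`. -/
def shuffle [BraidedCategory D] (A x B : D) : (A ⊗ x) ⊗ B ≅ (A ⊗ B) ⊗ x :=
  α_ A x B ≪≫ whiskerLeftIso A (β_ x B) ≪≫ (α_ A B x).symm

variable [SymmetricCategory D]

/-- The canonical morphisms between tensor powers that preserve the labels. -/
inductive Coh : ∀ {s t : OTree S}, (tens x s ⟶ tens x t) → Prop
  | id (s : OTree S) : Coh (𝟙 (tens x s))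
  | comp {s t r : OTree S} {f : tens x s ⟶ tens x t} {g : tens x t ⟶ tens x r} (hf : Coh f)
      (hg : Coh g) : Coh (f ≫ g)
  | tensor {s t s' t' : OTree S} {f : tens x s ⟶ tens x t} {g : tens x s' ⟶ tens x t'} (hf : Coh f)
      (hg : Coh g) : Coh (s := node s s') (t := node t t') (f ⊗ₘ g)
  | assoc (a b c : OTree S) : Coh (s := node (node a b) c) (t := node a (node b c))
      (α_ (tens x a) (tens x b) (tens x c)).hom
  | assoc_inv (a b c : OTree S) : Coh (s := node a (node b c)) (t := node (node a b) c)
      (α_ (tens x a) (tens x b) (tens x c)).inv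
  | left_unit (a : OTree S) : Coh (s := node nil a) (t := a) (λ_ (tens x a)).hom
  | left_unit_inv (a : OTree S) : Coh (s := a) (t := node nil a) (λ_ (tens x a)).inv
  | right_unit (a : OTree S) : Coh (s := node a nil) (t := a) (ρ_ (tens x a)).hom
  | right_unit_inv (a : OTree S) : Coh (s := a) (t := node a nil) (ρ_ (tens x a)).inv
  | braid (a b : OTree S) : Coh (s := node a b) (t := node b a) (β_ (tens x a) (tens x b)).hom

variable {x}

theorem Coh.whiskerRight {s t : OTree S} {f : tens x s ⟶ tens x t} (hf : Coh x f) (r : OTree S) :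
    Coh (s := node s r) (t := node t r) x (f ▷ tens x r) := by
  have := hf.tensor (Coh.id r)
  rwa [tensorHom_id] at this

theorem Coh.whiskerLeft {s t : OTree S} {f : tens x s ⟶ tens x t} (hf : Coh x f) (r : OTree S) :
    Coh (s := node r s) (t := node r t) x (tens x r ◁ f) := by
  have := (Coh.id r).tensor hf
  rwa [id_tensorHom] at this

theorem Coh.exists_inv {s t : OTree S} {f : tens x s ⟶ tens x t} (hf : Coh x f) :
    ∃ g : tens x t ⟶ tens x s, Coh x g ∧ f ≫ g = 𝟙 _ ∧ g ≫ f = 𝟙 _ := by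
  induction hf with
  | id s => exact ⟨𝟙 _, .id s, by simp, by simp⟩
  | comp _ _ h h' =>
    obtain ⟨g, h₁, h₂, h₃⟩ := h
    obtain ⟨g', h₁', h₂', h₃'⟩ := h'
    exact ⟨g' ≫ g, h₁'.comp h₁, by simp [reassoc_of% h₂', h₂], by simp [reassoc_of% h₃, h₃']⟩
  | tensor _ _ h h' =>
    obtain ⟨g, h₁, h₂, h₃⟩ := h
    obtain ⟨g', h₁', h₂', h₃'⟩ := h'
    exact ⟨g ⊗ₘ g', h₁.tensor h₁', (tensorHom_comp_tensorHom _ _ _ _).trans (by rw [h₂, h₂', id_tensorHom_id]; rfl),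
      (tensorHom_comp_tensorHom _ _ _ _).trans (by rw [h₃, h₃', id_tensorHom_id]; rfl)⟩
  | assoc a b c => exact ⟨_, .assoc_inv a b c, Iso.hom_inv_id _, Iso.inv_hom_id _⟩
  | assoc_inv a b c => exact ⟨_, .assoc a b c, Iso.inv_hom_id _, Iso.hom_inv_id _⟩
  | left_unit a => exact ⟨_, .left_unit_inv a, Iso.hom_inv_id _, Iso.inv_hom_id _⟩
  | left_unit_inv a => exact ⟨_, .left_unit a, Iso.inv_hom_id _, Iso.hom_inv_id _⟩
  | right_unit a => exact ⟨_, .right_unit_inv a, Iso.hom_inv_id _, Iso.inv_hom_id _⟩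
  | right_unit_inv a => exact ⟨_, .right_unit a, Iso.inv_hom_id _, Iso.hom_inv_id _⟩
  | braid a b => exact ⟨_, .braid b a, SymmetricCategory.symmetry _ _,
      SymmetricCategory.symmetry _ _⟩

theorem Coh.perm {s t : OTree S} {f : tens x s ⟶ tens x t} (hf : Coh x f) :
    s.labels.Perm t.labels := by
  induction hf with
  | id s => exact .refl _
  | comp _ _ h h' => exact h.trans h'
  | tensor _ _ h h' => exact h.append h'
  | assoc a b c => simp [labels]
  | assoc_inv a b c => simp [labels]
  | left_unit a => simp [labels]
  | left_unit_inv a => simp [labels]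
  | right_unit a => simp [labels]
  | right_unit_inv a => simp [labels]
  | braid a b => exact List.perm_append_comm

theorem Coh.isIso {s t : OTree S} {f : tens x s ⟶ tens x t} (hf : Coh x f) : IsIso f := by
  obtain ⟨g, -, h⟩ := hf.exists_inv
  exact ⟨g, h⟩

variable (x) in
/-- The isomorphisms that move a leaf with label `p` to the right. -/
inductive Ext (p : S) : ∀ {s t : OTree S}, (tens x s ⟶ tens x t ⊗ x) → Prop
  | leaf : Ext p (s := leaf p) (t := nil) (λ_ x).inv
  | left {l l' : OTree S} {f : tens x l ⟶ tens x l' ⊗ x} (hf : Ext p f) (r : OTree S) :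
      Ext p (s := node l r) (t := node l' r) (f ▷ tens x r ≫ (shuffle _ _ _).hom)
  | right {r r' : OTree S} {f : tens x r ⟶ tens x r' ⊗ x} (hf : Ext p f) (l : OTree S) :
      Ext p (s := node l r) (t := node l r') (tens x l ◁ f ≫ (α_ _ _ _).inv)

theorem Ext.coh {p : S} {s t : OTree S} {f : tens x s ⟶ tens x t ⊗ x} (h : Ext x p f) :
    Coh x (s := s) (t := node t (OTree.leaf p)) f := by
  induction h with
  | leaf => exact .left_unit_inv _
  | @left l l' f hf r ih =>
    refine (ih.whiskerRight r).comp (t := node (node l' (OTree.leaf p)) r) ?_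
    refine (Coh.assoc l' (OTree.leaf p) r).comp (t := node l' (node (OTree.leaf p) r)) (.comp
      (t := node l' (node r (OTree.leaf p))) ?_ (.assoc_inv l' r (OTree.leaf p)))
    exact (Coh.braid (OTree.leaf p) r).whiskerLeft l'
  | @right r r' f hf l ih =>
    exact (ih.whiskerLeft l).comp (t := node l (node r' (OTree.leaf p))) (.assoc_inv l r' (OTree.leaf p))

theorem Ext.perm {p : S} {s t : OTree S} {f : tens x s ⟶ tens x t ⊗ x} (h : Ext x p f) :
    s.labels.Perm (p :: t.labels) := by
  refine h.coh.perm.trans ?_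
  exact List.perm_append_comm (l₁ := t.labels) (l₂ := [p])

variable (x) in
theorem exists_ext {p : S} {s : OTree S} (h : p ∈ s.labels) :
    ∃ (t : OTree S) (f : tens x s ⟶ tens x t ⊗ x), Ext x p f := by
  induction s with
  | nil => simp [labels] at h
  | leaf a =>
    obtain rfl : p = a := by simpa [labels] using h
    exact ⟨nil, _, .leaf⟩
  | node l r hl hr =>
    rcases List.mem_append.1 h with h | h
    · obtain ⟨t, f, hf⟩ := hl h
      exact ⟨_, _, hf.left r⟩
    · obtain ⟨t, f, hf⟩ := hr h
      exact ⟨_, _, hf.right l⟩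

theorem Ext.mem {p : S} {s t : OTree S} {f : tens x s ⟶ tens x t ⊗ x} (h : Ext x p f) :
    p ∈ s.labels := h.perm.mem_iff.2 (by simp)

theorem Ext.unique {p : S} {s t t' : OTree S} {f : tens x s ⟶ tens x t ⊗ x}
    {f' : tens x s ⟶ tens x t' ⊗ x} (h : Ext x p f) (h' : Ext x p f') (hs : s.labels.Nodup) :
    t = t' ∧ HEq f f' := by
  induction h generalizing t' with
  | leaf => cases h'; exact ⟨rfl, HEq.rfl⟩
  | left hf r ih =>
    have hd := List.disjoint_of_nodup_append hs
    cases h' with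
    | left hf' =>
      obtain ⟨rfl, h⟩ := ih hf' (List.nodup_append.1 hs).1
      obtain rfl := eq_of_heq h
      exact ⟨rfl, HEq.rfl⟩
    | right hf' => exact (hd hf.mem hf'.mem).elim
  | right hf l ih =>
    have hd := List.disjoint_of_nodup_append hs
    cases h' with
    | right hf' =>
      obtain ⟨rfl, h⟩ := ih hf' (List.nodup_append.1 hs).2.1
      obtain rfl := eq_of_heq h
      exact ⟨rfl, HEq.rfl⟩
    | left hf' => exact (hd hf'.mem hf.mem).elim

end Tens

section Shuffle

variable {D : Type u} [Category.{v} D] [MonoidalCategory D] [SymmetricCategory D]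

theorem shuffle_natural {A A' x B B' : D} (f : A ⟶ A') (g : B ⟶ B') :
    ((f ▷ x) ⊗ₘ g) ≫ (shuffle A' x B').hom = (shuffle A x B).hom ≫ (f ⊗ₘ g) ▷ x := by
  simp only [shuffle, Iso.trans_hom, whiskerLeftIso_hom, Iso.symm_hom, Category.assoc]
  rw [← tensorHom_id f, associator_naturality_assoc, ← tensorHom_id (f ⊗ₘ g), ← associator_inv_naturality,
    ← id_tensorHom, ← id_tensorHom, tensorHom_comp_tensorHom_assoc, tensorHom_comp_tensorHom_assoc,
    BraidedCategory.braiding_naturality, Category.comp_id, Category.id_comp]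

theorem shuffle_assoc_left (A x B C : D) :
    (α_ (A ⊗ x) B C).hom ≫ (shuffle A x (B ⊗ C)).hom =
      (shuffle A x B).hom ▷ C ≫ (shuffle (A ⊗ B) x C).hom ≫ (α_ A B C).hom ▷ x := by
  simp [shuffle]

theorem shuffle_assoc_middle (A B x C : D) :
    (α_ A (B ⊗ x) C).hom ≫ A ◁ (shuffle B x C).hom ≫ (α_ _ _ _).inv =
      (α_ A B x).inv ▷ C ≫ (shuffle (A ⊗ B) x C).hom ≫ (α_ A B C).hom ▷ x := by
  simp [shuffle]

theorem shuffle_unit (A x : D) :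
    (ρ_ (A ⊗ x)).hom = (shuffle A x (𝟙_ D)).hom ≫ (ρ_ A).hom ▷ x := by
  simp [shuffle]

theorem shuffle_braiding (A x B : D) :
    (β_ (A ⊗ x) B).hom ≫ (α_ B A x).inv = (shuffle A x B).hom ≫ (β_ A B).hom ▷ x := by
  simp [shuffle]

theorem shuffle_braiding' (A B x : D) :
    (β_ A (B ⊗ x)).hom ≫ (shuffle B x A).hom = (α_ A B x).inv ≫ (β_ A B).hom ▷ x := by
  simp [shuffle, ← whiskerLeft_comp_assoc]

theorem tensor_ext_left {S T S' T' x B B' : D} {u : S ⟶ T} (w : B ⟶ B') {f : S ⟶ S' ⊗ x}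
    {g : T ⟶ T' ⊗ x} {φ : S' ⟶ T'} (e : u ≫ g = f ≫ φ ▷ x) :
    (u ⊗ₘ w) ≫ g ▷ B' ≫ (shuffle T' x B').hom = (f ▷ B ≫ (shuffle S' x B).hom) ≫ (φ ⊗ₘ w) ▷ x := by
  rw [Category.assoc, ← shuffle_natural, ← tensorHom_id g, ← tensorHom_id f,
    tensorHom_comp_tensorHom_assoc, tensorHom_comp_tensorHom_assoc, e, Category.comp_id,
    Category.id_comp]

theorem tensor_ext_right {S T S' T' x B B' : D} {u : S ⟶ T} (w : B ⟶ B') {f : S ⟶ S' ⊗ x}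
    {g : T ⟶ T' ⊗ x} {φ : S' ⟶ T'} (e : u ≫ g = f ≫ φ ▷ x) :
    (w ⊗ₘ u) ≫ B' ◁ g ≫ (α_ _ _ _).inv = (B ◁ f ≫ (α_ _ _ _).inv) ≫ (w ⊗ₘ φ) ▷ x := by
  rw [Category.assoc, ← tensorHom_id (w ⊗ₘ φ), ← associator_inv_naturality, ← id_tensorHom,
    ← id_tensorHom, tensorHom_comp_tensorHom_assoc, tensorHom_comp_tensorHom_assoc, tensorHom_id,
    e, Category.comp_id, Category.id_comp]

theorem assoc_ext_left {A A' x : D} (B C : D) (f : A ⟶ A' ⊗ x) :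
    (α_ A B C).hom ≫ f ▷ (B ⊗ C) ≫ (shuffle A' x (B ⊗ C)).hom =
      ((f ▷ B ≫ (shuffle A' x B).hom) ▷ C ≫ (shuffle (A' ⊗ B) x C).hom) ≫ (α_ A' B C).hom ▷ x := by
  rw [← associator_naturality_left_assoc, shuffle_assoc_left]
  simp

theorem assoc_ext_middle {B B' x : D} (A C : D) (f : B ⟶ B' ⊗ x) :
    (α_ A B C).hom ≫ A ◁ (f ▷ C ≫ (shuffle B' x C).hom) ≫ (α_ _ _ _).inv =
      ((A ◁ f ≫ (α_ _ _ _).inv) ▷ C ≫ (shuffle (A ⊗ B') x C).hom) ≫ (α_ A B' C).hom ▷ x := by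
  rw [whiskerLeft_comp, Category.assoc, ← associator_naturality_middle_assoc,
    shuffle_assoc_middle]
  simp

theorem assoc_ext_right {C' C x : D} (A B : D) (f : C' ⟶ C ⊗ x) :
    (α_ A B C').hom ≫ A ◁ (B ◁ f ≫ (α_ _ _ _).inv) ≫ (α_ _ _ _).inv =
      ((A ⊗ B) ◁ f ≫ (α_ _ _ _).inv) ≫ (α_ A B C).hom ▷ x := by
  simp

theorem inv_ext {A B A' B' x : D} {α : A ≅ B} {α' : A' ≅ B'} {f : A ⟶ A' ⊗ x} {g : B ⟶ B' ⊗ x}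
    (h : α.hom ≫ g = f ≫ α'.hom ▷ x) : α.inv ≫ f = g ≫ α'.inv ▷ x := by
  rw [Iso.inv_comp_eq, reassoc_of% h, ← comp_whiskerRight, Iso.hom_inv_id, id_whiskerRight,
    Category.comp_id]

theorem left_unit_ext {A A' x : D} (f : A ⟶ A' ⊗ x) :
    (λ_ A).hom ≫ f = (𝟙_ D ◁ f ≫ (α_ _ _ _).inv) ≫ (λ_ A').hom ▷ x := by
  simp

theorem right_unit_ext {A A' x : D} (f : A ⟶ A' ⊗ x) :
    (ρ_ A).hom ≫ f = (f ▷ 𝟙_ D ≫ (shuffle A' x (𝟙_ D)).hom) ≫ (ρ_ A').hom ▷ x := by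
  rw [Category.assoc, ← shuffle_unit, rightUnitor_naturality]

theorem braid_ext_left {A A' x : D} (B : D) (f : A ⟶ A' ⊗ x) :
    (β_ A B).hom ≫ B ◁ f ≫ (α_ _ _ _).inv =
      (f ▷ B ≫ (shuffle A' x B).hom) ≫ (β_ A' B).hom ▷ x := by
  rw [← BraidedCategory.braiding_naturality_left_assoc, shuffle_braiding, Category.assoc]

theorem braid_ext_right {B B' x : D} (A : D) (f : B ⟶ B' ⊗ x) :
    (β_ A B).hom ≫ f ▷ A ≫ (shuffle B' x A).hom =
      (A ◁ f ≫ (α_ _ _ _).inv) ≫ (β_ A B').hom ▷ x := by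
  rw [← BraidedCategory.braiding_naturality_right_assoc, shuffle_braiding', Category.assoc]

theorem assoc_nul {A B C : D} (f : A ⟶ 𝟙_ D) (g : B ⟶ 𝟙_ D) (h : C ⟶ 𝟙_ D) :
    (((f ⊗ₘ g) ≫ (λ_ _).hom) ⊗ₘ h) ≫ (λ_ _).hom =
      (α_ A B C).hom ≫ (f ⊗ₘ (g ⊗ₘ h) ≫ (λ_ _).hom) ≫ (λ_ _).hom := by
  simp [MonoidalCategory.tensorHom_def]

theorem right_unit_nul {A : D} (f : A ⟶ 𝟙_ D) :
    (f ⊗ₘ 𝟙 (𝟙_ D)) ≫ (λ_ _).hom = (ρ_ A).hom ≫ f := by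
  simp [unitors_equal]

theorem braid_nul {A B : D} (f : A ⟶ 𝟙_ D) (g : B ⟶ 𝟙_ D) :
    (f ⊗ₘ g) ≫ (λ_ _).hom = (β_ A B).hom ≫ (g ⊗ₘ f) ≫ (λ_ _).hom := by
  rw [← BraidedCategory.braiding_naturality_assoc, braiding_leftUnitor, unitors_equal]

end Shuffle

section Uniqueness

variable {D : Type u} [Category.{v} D] [MonoidalCategory D] [SymmetricCategory D] {x : D}

theorem Coh.ext {s t : OTree S} {φ : tens x s ⟶ tens x t} (hφ : Coh x φ) {p : S} {s' : OTree S}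
    {f : tens x s ⟶ tens x s' ⊗ x} (hf : Ext x p f) :
    ∃ (t' : OTree S) (g : tens x t ⟶ tens x t' ⊗ x) (φ' : tens x s' ⟶ tens x t'),
      Ext x p g ∧ Coh x φ' ∧ φ ≫ g = f ≫ φ' ▷ x := by
  induction hφ generalizing s' with
  | id s => exact ⟨s', f, 𝟙 _, hf, .id _, by simp⟩
  | comp _ _ h h' =>
    obtain ⟨t', g, φ', hg, hφ', e⟩ := h hf
    obtain ⟨t'', g', φ'', hg', hφ'', e'⟩ := h' hg
    exact ⟨t'', g', φ' ≫ φ'', hg', hφ'.comp hφ'', by rw [Category.assoc, e', reassoc_of% e, comp_whiskerRight]⟩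
  | @tensor s t s₁ t₁ u w hu hw h h' =>
    cases hf with
    | @left _ a' f hf =>
      obtain ⟨t', g, φ', hg, hφ', e⟩ := h hf
      exact ⟨node t' t₁, _, (φ' ⊗ₘ w : tens x a' ⊗ _ ⟶ tens x t' ⊗ _), hg.left t₁, hφ'.tensor hw,
        tensor_ext_left w e⟩
    | @right _ a' f hf =>
      obtain ⟨t', g, φ', hg, hφ', e⟩ := h' hf
      exact ⟨node t t', _, (u ⊗ₘ φ' : _ ⊗ tens x a' ⟶ _ ⊗ tens x t'), hg.right t, hu.tensor hφ',
        tensor_ext_right u e⟩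
  | assoc a b c =>
    cases hf with
    | left hf =>
      cases hf with
      | @left _ a' f hf =>
        exact ⟨node a' (node b c), _, _, hf.left _, .assoc a' b c, assoc_ext_left _ _ f⟩
      | @right _ b' f hf =>
        exact ⟨node a (node b' c), _, _, (hf.left _).right _, .assoc a b' c, assoc_ext_middle _ _ f⟩
    | @right _ c' f hf =>
      exact ⟨node a (node b c'), _, _, (hf.right _).right _, .assoc a b c', assoc_ext_right _ _ f⟩
  | assoc_inv a b c =>
    cases hf with
    | @left _ a' f hf =>
      exact ⟨node (node a' b) c, _, _, (hf.left _).left _, .assoc_inv a' b c,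
        inv_ext (assoc_ext_left _ _ f)⟩
    | right hf =>
      cases hf with
      | @left _ b' f hf =>
        exact ⟨node (node a b') c, _, _, (hf.right _).left _, .assoc_inv a b' c,
          inv_ext (assoc_ext_middle _ _ f)⟩
      | @right _ c' f hf =>
        exact ⟨node (node a b) c', _, _, hf.right _, .assoc_inv a b c',
          inv_ext (assoc_ext_right _ _ f)⟩
  | left_unit a =>
    cases hf with
    | left hf => cases hf
    | @right _ a' f hf => exact ⟨a', _, _, hf, .left_unit a', left_unit_ext f⟩
  | left_unit_inv a =>
    exact ⟨node nil s', _, _, hf.right _, .left_unit_inv s', inv_ext (left_unit_ext f)⟩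
  | right_unit a =>
    cases hf with
    | right hf => cases hf
    | @left _ a' f hf => exact ⟨a', _, _, hf, .right_unit a', right_unit_ext f⟩
  | right_unit_inv a =>
    exact ⟨node s' nil, _, _, hf.left _, .right_unit_inv s', inv_ext (right_unit_ext f)⟩
  | braid a b =>
    cases hf with
    | @left _ a' f hf => exact ⟨node b a', _, _, hf.right _, .braid a' b, braid_ext_left _ f⟩
    | @right _ b' f hf => exact ⟨node b' a, _, _, hf.left _, .braid a b', braid_ext_right _ f⟩

variable (x) in
/-- The canonical morphisms from tensor powers without factors to the unit. -/
inductive Nul : ∀ {s : OTree S}, (tens x s ⟶ 𝟙_ D) → Prop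
  | nil : Nul (s := nil) (𝟙 _)
  | node {l r : OTree S} {f : tens x l ⟶ 𝟙_ D} {g : tens x r ⟶ 𝟙_ D} (hf : Nul f) (hg : Nul g) :
      Nul (s := node l r) ((f ⊗ₘ g) ≫ (λ_ _).hom)

theorem Nul.unique {s : OTree S} {f g : tens x s ⟶ 𝟙_ D} (hf : Nul x f) (hg : Nul x g) : f = g := by
  induction hf with
  | nil => cases hg; rfl
  | node _ _ h h' =>
    cases hg with
    | node hu hv => rw [h hu, h' hv]

theorem Coh.nul {s t : OTree S} {φ : tens x s ⟶ tens x t} (hφ : Coh x φ) {f : tens x s ⟶ 𝟙_ D}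
    (hf : Nul x f) : ∃ g : tens x t ⟶ 𝟙_ D, Nul x g ∧ f = φ ≫ g := by
  induction hφ with
  | id s => exact ⟨f, hf, by simp⟩
  | comp _ _ h h' =>
    obtain ⟨g₁, hg₁, rfl⟩ := h hf
    obtain ⟨g₂, hg₂, rfl⟩ := h' hg₁
    exact ⟨g₂, hg₂, by simp⟩
  | tensor _ _ h h' =>
    cases hf with
    | node hu hv =>
      obtain ⟨g, hg, rfl⟩ := h hu
      obtain ⟨g', hg', rfl⟩ := h' hv
      exact ⟨_, hg.node hg', ((congrArg (· ≫ _) (tensorHom_comp_tensorHom _ _ _ _)).symm.trans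
        (Category.assoc _ _ _))⟩
  | assoc a b c =>
    cases hf with
    | node hu hv =>
      cases hu with
      | node hu hw => exact ⟨_, hu.node (hw.node hv), assoc_nul _ _ _⟩
  | assoc_inv a b c =>
    cases hf with
    | node hu hv =>
      cases hv with
      | node hw hv =>
        exact ⟨_, (hu.node hw).node hv, ((Iso.inv_comp_eq _).2 (assoc_nul _ _ _)).symm⟩
  | left_unit a =>
    cases hf with
    | @node _ _ _ g hu hv =>
      cases hu
      exact ⟨_, hv, (congrArg (· ≫ _) (id_tensorHom _ g)).trans (leftUnitor_naturality g)⟩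
  | left_unit_inv a =>
    exact ⟨_, Nul.nil.node hf, ((Iso.inv_comp_eq _).2
      ((congrArg (· ≫ _) (id_tensorHom _ f)).trans (leftUnitor_naturality f))).symm⟩
  | right_unit a =>
    cases hf with
    | node hu hv =>
      cases hv
      exact ⟨_, hu, right_unit_nul _⟩
  | right_unit_inv a =>
    exact ⟨_, hf.node Nul.nil, ((Iso.inv_comp_eq _).2 (right_unit_nul f)).symm⟩
  | braid a b =>
    cases hf with
    | node hu hv => exact ⟨_, hv.node hu, braid_nul _ _⟩

theorem exists_nul (s : OTree S) (hs : s.labels = []) :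
    ∃ f : tens x s ⟶ 𝟙_ D, Nul x f ∧ Coh x (s := s) (t := nil) f := by
  induction s with
  | nil => exact ⟨_, .nil, .id _⟩
  | leaf a => simp [labels] at hs
  | node l r hl hr =>
    rw [labels, List.append_eq_nil_iff] at hs
    obtain ⟨f, hf, hf'⟩ := hl hs.1
    obtain ⟨g, hg, hg'⟩ := hr hs.2
    exact ⟨_, hf.node hg, (hf'.tensor hg').comp (.left_unit _)⟩

/-- **Coherence**: canonical morphisms between tensor powers with distinct labels are unique. -/
theorem Coh.unique {s t : OTree S} {φ ψ : tens x s ⟶ tens x t} (hφ : Coh x φ) (hψ : Coh x ψ)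
    (hs : s.labels.Nodup) : φ = ψ := by
  induction hn : s.labels.length generalizing s t with
  | zero =>
    obtain ⟨f, hf, -⟩ := exists_nul (x := x) s (List.length_eq_zero_iff.1 hn)
    obtain ⟨g, hg, e⟩ := hφ.nul hf
    obtain ⟨g', hg', e'⟩ := hψ.nul hf
    obtain rfl := hg.unique hg'
    obtain ⟨f', -, hf'⟩ := exists_nul (x := x) t
      (List.length_eq_zero_iff.1 (hφ.perm.length_eq ▸ hn))
    obtain ⟨g', hg', e''⟩ := hf'.nul hg
    obtain rfl := hg'.unique .nil
    have : @IsIso D _ (tens x t) (𝟙_ D) f' := hf'.isIso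
    refine (cancel_mono f').1 ?_
    rw [← Category.comp_id f']
    exact (congrArg (φ ≫ ·) e'').symm.trans ((e.symm.trans e').trans (congrArg (ψ ≫ ·) e''))
  | succ n ih =>
    obtain ⟨p, hp⟩ := List.exists_mem_of_length_pos (l := s.labels) (by omega)
    obtain ⟨s', f, hf⟩ := exists_ext x hp
    obtain ⟨t', g, φ', hg, hφ', e⟩ := hφ.ext hf
    obtain ⟨t'', g', ψ', hg', hψ', e'⟩ := hψ.ext hf
    obtain ⟨rfl, h⟩ := hg.unique hg' (hφ.perm.nodup_iff.1 hs)
    obtain rfl := eq_of_heq h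
    have hp := hf.perm
    have := ih hφ' hψ' (List.nodup_cons.1 (hp.nodup_iff.1 hs)).2 (by
      have := hp.length_eq
      simp only [List.length_cons] at this
      omega)
    have : @IsIso D _ (tens x t) (tens x t' ⊗ x) g := hg.coh.isIso
    have e₂ : φ ≫ g = ψ ≫ g := by rw [e, e', ‹φ' = ψ'›]
    exact (cancel_mono g).1 e₂

variable (x) in
theorem exists_coh {s t : OTree S} (h : s.labels.Perm t.labels) :
    ∃ φ : tens x s ⟶ tens x t, Coh x φ := by
  induction hn : s.labels.length generalizing s t with
  | zero =>
    obtain ⟨f, -, hf⟩ := exists_nul (x := x) s (List.length_eq_zero_iff.1 hn)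
    obtain ⟨g, -, hg⟩ := exists_nul (x := x) t (List.length_eq_zero_iff.1 (h.length_eq ▸ hn))
    obtain ⟨g', hg', -⟩ := hg.exists_inv
    exact ⟨_, hf.comp hg'⟩
  | succ n ih =>
    obtain ⟨p, hp⟩ := List.exists_mem_of_length_pos (l := s.labels) (by omega)
    obtain ⟨s', f, hf⟩ := exists_ext x hp
    obtain ⟨t', g, hg⟩ := exists_ext x (h.mem_iff.1 hp)
    obtain ⟨φ, hφ⟩ := ih (s := s') (t := t')
      ((List.perm_cons p).1 (hf.perm.symm.trans (h.trans hg.perm))) (by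
        have := hf.perm.length_eq
        simp only [List.length_cons] at this
        omega)
    obtain ⟨g', hg', -⟩ := hg.coh.exists_inv
    exact ⟨_, hf.coh.comp ((hφ.whiskerRight _).comp hg')⟩

end Uniqueness

end OTree

end

section

namespace OTree

variable {S T R : Type}

section Natural

variable {D : Type u} [Category.{v} D] [MonoidalCategory D] [SymmetricCategory D] {x : D}

theorem Coh.map {s t : OTree S} {φ : tens x s ⟶ tens x t} (h : Coh x φ) (g : S → T) :
    Coh x ((mapIso x g s).hom ≫ φ ≫ (mapIso x g t).inv) := by
  induction h with
  | id s => simpa using Coh.id (s.map g)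
  | comp _ _ h h' => simpa using h.comp h'
  | @tensor s t s' t' f f' _ _ h h' =>
    have e : (mapIso x g (node s s')).hom ≫ (f ⊗ₘ f') ≫ (mapIso x g (node t t')).inv =
        (((mapIso x g s).hom ≫ f ≫ (mapIso x g t).inv) ⊗ₘ
          ((mapIso x g s').hom ≫ f' ≫ (mapIso x g t').inv)) := by
      rw [mapIso_node, mapIso_node_inv, ← tensorHom_comp_tensorHom, ← tensorHom_comp_tensorHom]
      rfl
    exact e ▸ h.tensor h'
  | assoc a b c =>
    have e : (((mapIso x g a).hom ⊗ₘ (mapIso x g b).hom) ⊗ₘ (mapIso x g c).hom) ≫ (α_ _ _ _).hom ≫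
        ((mapIso x g a).inv ⊗ₘ ((mapIso x g b).inv ⊗ₘ (mapIso x g c).inv)) = (α_ _ _ _).hom := by
      rw [associator_naturality_assoc]; simp
    exact e ▸ .assoc (a.map g) (b.map g) (c.map g)
  | assoc_inv a b c =>
    have e : ((mapIso x g a).hom ⊗ₘ ((mapIso x g b).hom ⊗ₘ (mapIso x g c).hom)) ≫ (α_ _ _ _).inv ≫
        (((mapIso x g a).inv ⊗ₘ (mapIso x g b).inv) ⊗ₘ (mapIso x g c).inv) = (α_ _ _ _).inv := by
      rw [associator_inv_naturality_assoc]; simp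
    exact e ▸ .assoc_inv (a.map g) (b.map g) (c.map g)
  | left_unit a =>
    have e : (𝟙 (𝟙_ D) ⊗ₘ (mapIso x g a).hom) ≫ (λ_ _).hom ≫ (mapIso x g a).inv = (λ_ _).hom := by
      rw [id_tensorHom, leftUnitor_naturality_assoc, Iso.hom_inv_id, Category.comp_id]
    exact e ▸ .left_unit (a.map g)
  | left_unit_inv a =>
    have e : (mapIso x g a).hom ≫ (λ_ _).inv ≫ (𝟙 (𝟙_ D) ⊗ₘ (mapIso x g a).inv) = (λ_ _).inv := by
      rw [id_tensorHom, ← leftUnitor_inv_naturality, Iso.hom_inv_id_assoc]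
    exact e ▸ .left_unit_inv (a.map g)
  | right_unit a =>
    have e : ((mapIso x g a).hom ⊗ₘ 𝟙 (𝟙_ D)) ≫ (ρ_ _).hom ≫ (mapIso x g a).inv = (ρ_ _).hom := by
      rw [tensorHom_id, rightUnitor_naturality_assoc, Iso.hom_inv_id, Category.comp_id]
    exact e ▸ .right_unit (a.map g)
  | right_unit_inv a =>
    have e : (mapIso x g a).hom ≫ (ρ_ _).inv ≫ ((mapIso x g a).inv ⊗ₘ 𝟙 (𝟙_ D)) = (ρ_ _).inv := by
      rw [tensorHom_id, ← rightUnitor_inv_naturality, Iso.hom_inv_id_assoc]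
    exact e ▸ .right_unit_inv (a.map g)
  | braid a b =>
    have e : ((mapIso x g a).hom ⊗ₘ (mapIso x g b).hom) ≫ (β_ _ _).hom ≫
        ((mapIso x g b).inv ⊗ₘ (mapIso x g a).inv) = (β_ _ _).hom := by
      rw [BraidedCategory.braiding_naturality_assoc]; simp
    exact e ▸ .braid (a.map g) (b.map g)

/-- The tensor power of a morphism. -/
def tensMap {y x : D} (η : y ⟶ x) : ∀ s : OTree S, tens y s ⟶ tens x s
  | nil => 𝟙 _
  | leaf _ => η
  | node l r => tensMap η l ⊗ₘ tensMap η r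

theorem exists_tensMap_coh {y : D} (η : y ⟶ x) {s t : OTree S} {φ : tens y s ⟶ tens y t}
    (h : Coh y φ) : ∃ ψ : tens x s ⟶ tens x t, Coh x ψ ∧ φ ≫ tensMap η t = tensMap η s ≫ ψ := by
  induction h with
  | id s => exact ⟨𝟙 _, .id s, by simp⟩
  | comp _ _ h h' =>
    obtain ⟨ψ, hψ, e⟩ := h
    obtain ⟨ψ', hψ', e'⟩ := h'
    exact ⟨_, hψ.comp hψ', by rw [Category.assoc, e', reassoc_of% e]⟩
  | tensor _ _ h h' =>
    obtain ⟨ψ, hψ, e⟩ := h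
    obtain ⟨ψ', hψ', e'⟩ := h'
    refine ⟨_, hψ.tensor hψ', ?_⟩
    exact (tensorHom_comp_tensorHom _ _ _ _).trans (by
      rw [e, e', ← tensorHom_comp_tensorHom]; rfl)
  | assoc a b c => exact ⟨_, .assoc a b c, (associator_naturality _ _ _).symm⟩
  | assoc_inv a b c => exact ⟨_, .assoc_inv a b c, (associator_inv_naturality _ _ _).symm⟩
  | left_unit a => exact ⟨_, .left_unit a, ((congrArg (· ≫ _) (id_tensorHom _ _)).trans
      (leftUnitor_naturality _)).symm⟩
  | left_unit_inv a => exact ⟨_, .left_unit_inv a, ((leftUnitor_inv_naturality _).trans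
      (congrArg (_ ≫ ·) (id_tensorHom _ _).symm)).symm⟩
  | right_unit a => exact ⟨_, .right_unit a, ((congrArg (· ≫ _) (tensorHom_id _ _)).trans
      (rightUnitor_naturality _)).symm⟩
  | right_unit_inv a => exact ⟨_, .right_unit_inv a, ((rightUnitor_inv_naturality _).trans
      (congrArg (_ ≫ ·) (tensorHom_id _ _).symm)).symm⟩
  | braid a b => exact ⟨_, .braid a b, (BraidedCategory.braiding_naturality _ _).symm⟩

theorem Coh.tensMap {y : D} (η : y ⟶ x) {s t : OTree S} {φ : tens y s ⟶ tens y t}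
    (h : Coh y φ) {ψ : tens x s ⟶ tens x t} (h' : Coh x ψ) (hs : s.labels.Nodup) :
    φ ≫ OTree.tensMap η t = OTree.tensMap η s ≫ ψ := by
  obtain ⟨ψ', hψ', e⟩ := exists_tensMap_coh η h
  rw [e, hψ'.unique h' hs]

theorem mapIso_tensMap {y : D} (η : y ⟶ x) (g : S → T) (s : OTree S) :
    (mapIso y g s).hom ≫ tensMap η s = tensMap η (s.map g) ≫ (mapIso x g s).hom := by
  induction s with
  | nil => rfl
  | leaf a => exact (Category.id_comp _).trans (Category.comp_id _).symm
  | node l r hl hr =>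
    exact (tensorHom_comp_tensorHom _ _ _ _).trans ((congrArg₂ (· ⊗ₘ ·) hl hr).trans
      (tensorHom_comp_tensorHom _ _ _ _).symm)

end Natural

section Bind

variable {D : Type u} [Category.{v} D] [MonoidalCategory D] [SymmetricCategory D] {x : D}
variable (ι : SSet.{v} ⥤ D) [ι.Monoidal] (K : SSet.{v})

/-- The tensor product of the `K`-families `b a`. -/
def kbind (q : S → OTree T) (b : ∀ a, ι.obj K ⊗ tens x (q a) ⟶ x) :
    ∀ s : OTree S, ι.obj K ⊗ tens x (s.bind q) ⟶ tens x s
  | nil => kid ι K _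
  | leaf a => b a
  | node l r => ktensor ι K (kbind q b l) (kbind q b r)

variable {ι K}

theorem kbind_tensMap {y : D} (η : y ⟶ x) (q : S → OTree T) (b : ∀ a, ι.obj K ⊗ tens x (q a) ⟶ x)
    (c : ∀ a, ι.obj K ⊗ tens y (q a) ⟶ y) (h : ∀ a, c a ≫ η = ι.obj K ◁ tensMap η (q a) ≫ b a)
    (s : OTree S) :
    kbind ι K q c s ≫ tensMap η s = ι.obj K ◁ tensMap η (s.bind q) ≫ kbind ι K q b s := by
  induction s with
  | nil => exact (whiskerLeft_kid (ι := ι) (K := K) (𝟙 (𝟙_ D))).symm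
  | leaf a => exact h a
  | node l r hl hr =>
    exact (ktensor_comp _ _ _ _).trans ((congrArg₂ (ktensor ι K) hl hr).trans (whiskerLeft_ktensor _ _ _ _).symm)

theorem map_kbind {K' : SSet.{v}} (r : K' ⟶ K) (q : S → OTree T)
    (b : ∀ a, ι.obj K ⊗ tens x (q a) ⟶ x) (s : OTree S) :
    ι.map r ▷ _ ≫ kbind ι K q b s = kbind ι K' q (fun a => ι.map r ▷ _ ≫ b a) s := by
  induction s with
  | nil => exact map_kid r _
  | leaf a => rfl
  | node l r' hl hr =>
    exact (map_ktensor r _ _).trans (congrArg₂ (ktensor ι K') hl hr)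

theorem kbind_congr {q q' : S → OTree T} {b : ∀ a, ι.obj K ⊗ tens x (q a) ⟶ x}
    {b' : ∀ a, ι.obj K ⊗ tens x (q' a) ⟶ x}
    (h : ∀ a, ∃ χ : tens x (q a) ⟶ tens x (q' a), Coh x χ ∧ b a = ι.obj K ◁ χ ≫ b' a)
    (s : OTree S) : ∃ ψ : tens x (s.bind q) ⟶ tens x (s.bind q'), Coh x ψ ∧
      kbind ι K q b s = ι.obj K ◁ ψ ≫ kbind ι K q' b' s := by
  induction s with
  | nil => exact ⟨𝟙 _, .id nil, ((congrArg (· ≫ _) (whiskerLeft_id _ _)).trans (Category.id_comp _)).symm⟩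
  | leaf a => exact h a
  | node l r hl hr =>
    obtain ⟨ψ, hψ, e⟩ := hl
    obtain ⟨ψ', hψ', e'⟩ := hr
    exact ⟨_, hψ.tensor hψ', (congrArg₂ (ktensor ι K) e e').trans
      (whiskerLeft_ktensor _ _ _ _).symm⟩

theorem kbind_leaf (g : S → T) (s : OTree S) :
    kbind ι K (fun a => leaf (g a)) (fun _ => kid ι K x) s = kid ι K _ ≫ (mapIso x g s).hom := by
  induction s with
  | nil => exact (Category.comp_id _).symm
  | leaf a => exact (Category.comp_id _).symm
  | node l r hl hr =>
    exact (congrArg₂ (ktensor ι K) hl hr).trans ((ktensor_comp _ _ _ _).symm.trans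
      (congrArg (· ≫ _) (ktensor_kid _ _)))

theorem kbind_map (g : S → T) (q : T → OTree R) (b : ∀ a, ι.obj K ⊗ tens x (q a) ⟶ x)
    (s : OTree S) : ∃ ψ : tens x ((s.map g).bind q) ⟶ tens x (s.bind fun a => q (g a)), Coh x ψ ∧
      kbind ι K q b (s.map g) ≫ (mapIso x g s).hom =
        ι.obj K ◁ ψ ≫ kbind ι K (fun a => q (g a)) (fun a => b (g a)) s := by
  induction s with
  | nil => exact ⟨𝟙 _, .id nil, (whiskerLeft_kid (ι := ι) (K := K) (𝟙 (𝟙_ D))).symm⟩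
  | leaf a => exact ⟨𝟙 _, .id (q (g a)), (Category.comp_id _).trans
      ((congrArg (· ≫ _) (whiskerLeft_id _ _)).trans (Category.id_comp _)).symm⟩
  | node l r hl hr =>
    obtain ⟨ψ, hψ, e⟩ := hl
    obtain ⟨ψ', hψ', e'⟩ := hr
    exact ⟨_, hψ.tensor hψ', (ktensor_comp _ _ _ _).trans ((congrArg₂ (ktensor ι K) e e').trans
      (whiskerLeft_ktensor _ _ _ _).symm)⟩

variable [PreservesBraiding ι]

theorem kbind_coh (q : S → OTree T) (b : ∀ a, ι.obj K ⊗ tens x (q a) ⟶ x) {s t : OTree S}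
    {φ : tens x s ⟶ tens x t} (h : Coh x φ) :
    ∃ ψ : tens x (s.bind q) ⟶ tens x (t.bind q), Coh x ψ ∧
      kbind ι K q b s ≫ φ = ι.obj K ◁ ψ ≫ kbind ι K q b t := by
  have inv : ∀ {A B A' B' : D} (u : A ≅ B) (w : A' ≅ B') {f : ι.obj K ⊗ A ⟶ A'}
      {g : ι.obj K ⊗ B ⟶ B'}, f ≫ w.hom = ι.obj K ◁ u.hom ≫ g → g ≫ w.inv = ι.obj K ◁ u.inv ≫ f := by
    intro A B A' B' u w f g e
    rw [Iso.comp_inv_eq, Category.assoc, e, ← whiskerLeft_comp_assoc, Iso.inv_hom_id,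
      MonoidalCategory.whiskerLeft_id, Category.id_comp]
  induction h with
  | id s => exact ⟨𝟙 _, .id _, by simp⟩
  | comp _ _ h h' =>
    obtain ⟨ψ, hψ, e⟩ := h
    obtain ⟨ψ', hψ', e'⟩ := h'
    exact ⟨_, hψ.comp hψ', by rw [reassoc_of% e, e', whiskerLeft_comp_assoc]⟩
  | tensor _ _ h h' =>
    obtain ⟨ψ, hψ, e⟩ := h
    obtain ⟨ψ', hψ', e'⟩ := h'
    exact ⟨_, hψ.tensor hψ', (ktensor_comp _ _ _ _).trans ((congrArg₂ (ktensor ι K) e e').trans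
      (whiskerLeft_ktensor _ _ _ _).symm)⟩
  | assoc a b c => exact ⟨_, .assoc (a.bind q) (b.bind q) (c.bind q), ktensor_associator _ _ _⟩
  | assoc_inv a b c =>
    exact ⟨_, .assoc_inv (a.bind q) (b.bind q) (c.bind q), inv _ _ (ktensor_associator _ _ _)⟩
  | left_unit a => exact ⟨_, .left_unit (a.bind q), ktensor_leftUnitor _⟩
  | left_unit_inv a => exact ⟨_, .left_unit_inv (a.bind q), inv _ _ (ktensor_leftUnitor _)⟩
  | right_unit a => exact ⟨_, .right_unit (a.bind q), ktensor_rightUnitor _⟩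
  | right_unit_inv a => exact ⟨_, .right_unit_inv (a.bind q), inv _ _ (ktensor_rightUnitor _)⟩
  | braid a b => exact ⟨_, .braid (a.bind q) (b.bind q), ktensor_braiding _ _⟩

theorem kbind_bind (q : S → OTree T) (w : T → OTree R) (b : ∀ a, ι.obj K ⊗ tens x (q a) ⟶ x)
    (c : ∀ a, ι.obj K ⊗ tens x (w a) ⟶ x) (s : OTree S) :
    ∃ ψ : tens x ((s.bind q).bind w) ⟶ tens x (s.bind fun a => (q a).bind w), Coh x ψ ∧
      kcomp ι K (kbind ι K w c (s.bind q)) (kbind ι K q b s) =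
        ι.obj K ◁ ψ ≫ kbind ι K (fun a => (q a).bind w)
          (fun a => kcomp ι K (kbind ι K w c (q a)) (b a)) s := by
  induction s with
  | nil => exact ⟨𝟙 _, .id nil, (kcomp_kid _).trans ((congrArg (· ≫ _) (whiskerLeft_id _ _)).trans
      (Category.id_comp _)).symm⟩
  | leaf a => exact ⟨𝟙 _, .id ((q a).bind w), ((congrArg (· ≫ _) (whiskerLeft_id _ _)).trans
      (Category.id_comp _)).symm⟩
  | node l r hl hr =>
    obtain ⟨ψ, hψ, e⟩ := hl
    obtain ⟨ψ', hψ', e'⟩ := hr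
    exact ⟨_, hψ.tensor hψ', (ktensor_kcomp _ _ _ _).symm.trans ((congrArg₂ (ktensor ι K) e e').trans
      (whiskerLeft_ktensor _ _ _ _).symm)⟩

end Bind

end OTree

end

section

namespace OTree

variable {S T R X : Type}

/-- The tree lists the image of the injective map `j`. -/
structure Enum (j : S → X) (s : OTree X) : Prop where
  inj : Function.Injective j
  nodup : s.labels.Nodup
  mem_iff : ∀ a, a ∈ s.labels ↔ a ∈ Set.range j

theorem IsOrd.enum {s : OTree X} (h : s.IsOrd) (e : S ≃ X) : Enum e s :=
  ⟨e.injective, h.1, fun a => ⟨fun _ => e.surjective a, fun _ => h.2 a⟩⟩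

theorem IsOrd.enum_map {s : OTree S} (h : s.IsOrd) {j : S → X} (hj : Function.Injective j) :
    Enum j (s.map j) := by
  refine ⟨hj, ?_, fun a => ?_⟩
  · rw [labels_map]; exact h.1.map hj
  · rw [labels_map, List.mem_map]
    exact ⟨fun ⟨b, _, e⟩ => ⟨b, e⟩, fun ⟨b, e⟩ => ⟨b, h.2 b, e⟩⟩

theorem Enum.perm {j : S → X} {s t : OTree X} (hs : Enum j s) (ht : Enum j t) :
    s.labels.Perm t.labels :=
  (List.perm_ext_iff_of_nodup hs.nodup ht.nodup).2 fun a => (hs.mem_iff a).trans (ht.mem_iff a).symm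

theorem Enum.map {j : S → X} {s : OTree X} (hs : Enum j s) {g : X → T}
    (hg : Function.Injective g) : Enum (g ∘ j) (s.map g) := by
  refine ⟨hg.comp hs.inj, ?_, fun a => ?_⟩
  · rw [labels_map]; exact hs.nodup.map hg
  · rw [labels_map, List.mem_map]
    constructor
    · rintro ⟨b, hb, rfl⟩
      obtain ⟨c, rfl⟩ := (hs.mem_iff b).1 hb
      exact ⟨c, rfl⟩
    · rintro ⟨c, rfl⟩
      exact ⟨j c, (hs.mem_iff _).2 ⟨c, rfl⟩, rfl⟩

theorem Enum.comp_equiv {j : S → X} {s : OTree X} (hs : Enum j s) (e : T ≃ S) :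
    Enum (j ∘ e) s :=
  ⟨hs.inj.comp e.injective, hs.nodup, fun a => (hs.mem_iff a).trans (by
    rw [e.surjective.range_comp])⟩

theorem Enum.isOrd {s : OTree X} {e : S ≃ X} (h : Enum e s) : s.IsOrd :=
  ⟨h.nodup, fun a => (h.mem_iff a).2 (e.surjective a)⟩

theorem Enum.bind {Y : T → Type} {r : OTree T} (hr : r.IsOrd) {j : (Σ t, Y t) → X}
    (hj : Function.Injective j) {Q : T → OTree X} (hQ : ∀ t, Enum (fun y => j ⟨t, y⟩) (Q t)) :
    Enum j (r.bind Q) := by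
  refine ⟨hj, ?_, fun a => ?_⟩
  · rw [labels_bind, List.nodup_flatMap]
    refine ⟨fun t _ => (hQ t).nodup, hr.1.imp fun {t t'} h => ?_⟩
    simp only [Function.onFun, List.disjoint_left]
    intro a ha ha'
    obtain ⟨b, rfl⟩ := ((hQ t).mem_iff a).1 ha
    obtain ⟨b', e⟩ := ((hQ t').mem_iff _).1 ha'
    exact h (congrArg Sigma.fst (hj e)).symm
  · rw [labels_bind, List.mem_flatMap]
    constructor
    · rintro ⟨t, -, ha⟩
      obtain ⟨b, rfl⟩ := ((hQ t).mem_iff a).1 ha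
      exact ⟨_, rfl⟩
    · rintro ⟨⟨t, b⟩, rfl⟩
      exact ⟨t, hr.2 t, ((hQ t).mem_iff _).2 ⟨b, rfl⟩⟩

section Maps

variable {D : Type u} [Category.{v} D] [MonoidalCategory D] [SymmetricCategory D] (x : D)

theorem exists_mapIso_mapIso (j : S → T) (g : T → X) (s : OTree S) :
    ∃ ψ : tens x ((s.map j).map g) ⟶ tens x (s.map (g ∘ j)), Coh x ψ ∧
      ψ ≫ (mapIso x (g ∘ j) s).hom = (mapIso x g (s.map j)).hom ≫ (mapIso x j s).hom := by
  induction s with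
  | nil => exact ⟨𝟙 _, .id nil, rfl⟩
  | leaf a => exact ⟨𝟙 _, .id (leaf (g (j a))), rfl⟩
  | node l r hl hr =>
    obtain ⟨ψ, hψ, e⟩ := hl
    obtain ⟨ψ', hψ', e'⟩ := hr
    exact ⟨_, hψ.tensor hψ', (tensorHom_comp_tensorHom _ _ _ _).trans
      ((congrArg₂ (· ⊗ₘ ·) e e').trans (tensorHom_comp_tensorHom _ _ _ _).symm)⟩

theorem exists_mapIso_id (s : OTree S) :
    ∃ ψ : tens x s ⟶ tens x (s.map id), Coh x ψ ∧ ψ ≫ (mapIso x id s).hom = 𝟙 _ := by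
  induction s with
  | nil => exact ⟨𝟙 _, .id nil, Category.comp_id _⟩
  | leaf a => exact ⟨𝟙 _, .id (leaf a), Category.comp_id _⟩
  | node l r hl hr =>
    obtain ⟨ψ, hψ, e⟩ := hl
    obtain ⟨ψ', hψ', e'⟩ := hr
    exact ⟨_, hψ.tensor hψ', (tensorHom_comp_tensorHom _ _ _ _).trans
      ((congrArg₂ (· ⊗ₘ ·) e e').trans (id_tensorHom_id _ _))⟩

variable {x} (ι : SSet.{v} ⥤ D) [ι.Monoidal] (K : SSet.{v})

theorem kbind_map_right (g : T → X) (q : S → OTree T) (b : ∀ a, ι.obj K ⊗ tens x (q a) ⟶ x)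
    (s : OTree S) : ∃ ψ : tens x (s.bind fun a => (q a).map g) ⟶ tens x ((s.bind q).map g),
      Coh x ψ ∧ kbind ι K (fun a => (q a).map g) (fun a => ι.obj K ◁ (mapIso x g (q a)).hom ≫ b a) s =
        ι.obj K ◁ (ψ ≫ (mapIso x g (s.bind q)).hom) ≫ kbind ι K q b s := by
  induction s with
  | nil => exact ⟨𝟙 _, .id nil, ((congrArg (fun z => ι.obj K ◁ z ≫ _) (Category.comp_id _)).trans
      ((congrArg (· ≫ _) (whiskerLeft_id _ _)).trans (Category.id_comp _))).symm⟩
  | leaf a => exact ⟨𝟙 _, .id ((q a).map g), (congrArg (fun z => ι.obj K ◁ z ≫ b a)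
      (Category.id_comp _)).symm⟩
  | node l r hl hr =>
    obtain ⟨ψ, hψ, e⟩ := hl
    obtain ⟨ψ', hψ', e'⟩ := hr
    exact ⟨_, hψ.tensor hψ', (congrArg₂ (ktensor ι K) e e').trans
      ((whiskerLeft_ktensor _ _ _ _).symm.trans (congrArg (fun z => ι.obj K ◁ z ≫ _)
        (tensorHom_comp_tensorHom _ _ _ _).symm))⟩

end Maps

end OTree

open OTree

section EndOperad

variable {D : Type u} [Category.{v} D] [MonoidalCategory D] [SymmetricCategory D]
variable (ι : SSet.{v} ⥤ D) [ι.Monoidal] (K : SSet.{v}) (x : D)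

/-- A `K`-family of morphisms from the tensor power of `x` with factors labelled by `S`
to `x`: compatible families of morphisms, one for each way of forming the tensor power. -/
@[ext]
structure CohFam (S : Type) : Type v where
  val : ∀ s : OTree S, s.IsOrd → (ι.obj K ⊗ tens x s ⟶ x)
  coh : ∀ {s t : OTree S} (hs : s.IsOrd) (ht : t.IsOrd) {φ : tens x s ⟶ tens x t}, Coh x φ →
    val s hs = ι.obj K ◁ φ ≫ val t ht

namespace CohFam

variable {ι K x} {S T X : Type}

theorem ext_of_val {a b : CohFam ι K x S} {s : OTree S} (hs : s.IsOrd)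
    (h : a.val s hs = b.val s hs) : a = b := by
  refine CohFam.ext (funext fun t => funext fun ht => ?_)
  obtain ⟨φ, hφ⟩ := exists_coh x (ht.perm hs)
  rw [a.coh ht hs hφ, b.coh ht hs hφ, h]

/-- The family determined by its value on a given tensor power. -/
noncomputable def mk' {s₀ : OTree S} (h₀ : s₀.IsOrd) (f : ι.obj K ⊗ tens x s₀ ⟶ x) :
    CohFam ι K x S where
  val s hs := ι.obj K ◁ (exists_coh x (hs.perm h₀)).choose ≫ f
  coh {s t} hs ht {φ} hφ := by
    rw [← whiskerLeft_comp_assoc, (exists_coh x (hs.perm h₀)).choose_spec.unique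
      (hφ.comp (exists_coh x (ht.perm h₀)).choose_spec) hs.1]

theorem mk'_val {s₀ : OTree S} (h₀ : s₀.IsOrd) (f : ι.obj K ⊗ tens x s₀ ⟶ x) :
    (mk' h₀ f).val s₀ h₀ = f := by
  change ι.obj K ◁ (exists_coh x (h₀.perm h₀)).choose ≫ f = f
  rw [(exists_coh x (h₀.perm h₀)).choose_spec.unique (.id _) h₀.1, MonoidalCategory.whiskerLeft_id,
    Category.id_comp]

/-- Restriction along a map of simplicial sets. -/
def restr {K' : SSet.{v}} (r : K' ⟶ K) (a : CohFam ι K x S) : CohFam ι K' x S where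
  val s hs := ι.map r ▷ _ ≫ a.val s hs
  coh {s t} hs ht {φ} hφ := by rw [a.coh hs ht hφ, whisker_exchange_assoc]

variable [Finite S] [Finite T]

theorem exists_ev (j : S → X) (s : OTree X) (h : Enum j s) :
    ∃ (s₀ : OTree S) (φ : tens x s ⟶ tens x (s₀.map j)), s₀.IsOrd ∧ Coh x φ := by
  obtain ⟨s₀, h₀⟩ := exists_isOrd S
  obtain ⟨φ, hφ⟩ := exists_coh x (h.perm (h₀.enum_map h.inj))
  exact ⟨s₀, φ, h₀, hφ⟩

/-- The value of a family after relabelling along an injective map. -/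
noncomputable def ev (a : CohFam ι K x S) (j : S → X) (s : OTree X) (h : Enum j s) :
    ι.obj K ⊗ tens x s ⟶ x :=
  ι.obj K ◁ ((exists_ev j s h).choose_spec.choose ≫ (mapIso x j _).hom) ≫
    a.val _ (exists_ev (x := x) j s h).choose_spec.choose_spec.1

theorem ev_eq (a : CohFam ι K x S) {j : S → X} {s : OTree X} (h : Enum j s) {s₀ : OTree S}
    (h₀ : s₀.IsOrd) {φ : tens x s ⟶ tens x (s₀.map j)} (hφ : Coh x φ) :
    a.ev j s h = ι.obj K ◁ (φ ≫ (mapIso x j s₀).hom) ≫ a.val s₀ h₀ := by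
  obtain ⟨h₁, hφ₁⟩ := (exists_ev (x := x) j s h).choose_spec.choose_spec
  obtain ⟨χ, hχ⟩ := exists_coh x (h₁.perm h₀)
  unfold ev
  rw [a.coh h₁ h₀ hχ, ← whiskerLeft_comp_assoc, ← (hφ₁.comp (hχ.map j)).unique hφ h.nodup]
  simp

theorem ev_coh (a : CohFam ι K x S) {j : S → X} {s t : OTree X} (hs : Enum j s) (ht : Enum j t)
    {φ : tens x s ⟶ tens x t} (hφ : Coh x φ) : a.ev j s hs = ι.obj K ◁ φ ≫ a.ev j t ht := by
  obtain ⟨s₀, ψ, h₀, hψ⟩ := exists_ev (x := x) j t ht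
  rw [a.ev_eq ht h₀ hψ, a.ev_eq hs h₀ (hφ.comp hψ), ← whiskerLeft_comp_assoc, Category.assoc]

theorem ev_map_self (a : CohFam ι K x S) {s : OTree S} (h : s.IsOrd) {j : S → X}
    (hj : Function.Injective j) :
    a.ev j (s.map j) (h.enum_map hj) = ι.obj K ◁ (mapIso x j s).hom ≫ a.val s h := by
  rw [a.ev_eq _ h (.id _), Category.id_comp]

theorem ev_id (a : CohFam ι K x S) {s : OTree S} (h : s.IsOrd) (h' : Enum (fun i => i) s) :
    a.ev (fun i => i) s h' = a.val s h := by
  obtain ⟨ψ, hψ, e⟩ := exists_mapIso_id x s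
  refine (a.ev_eq h' h hψ).trans ?_
  refine (congrArg (fun z => ι.obj K ◁ z ≫ a.val s h) e).trans ?_
  simp

/-- Relabelling of the factors. -/
noncomputable def act (σ : S ≃ T) (a : CohFam ι K x S) : CohFam ι K x T where
  val s hs := a.ev σ s (hs.enum σ)
  coh {_ _} _ _ {_} hφ := a.ev_coh _ _ hφ

theorem ev_act (σ : S ≃ T) (a : CohFam ι K x S) {j : T → X} {s : OTree X} (h : Enum j s) :
    (a.act σ).ev j s h = a.ev (j ∘ σ) s (h.comp_equiv σ) := by
  obtain ⟨s₀, φ, h₀, hφ⟩ := exists_ev (x := x) j s h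
  rw [ev_eq _ h h₀ hφ]
  change _ ≫ a.ev σ s₀ (h₀.enum σ) = _
  rw [a.ev_coh (h.comp_equiv σ) ((h₀.enum σ).map h.inj) hφ]
  obtain ⟨s₁, φ₁, h₁, hφ₁⟩ := exists_ev (x := x) σ s₀ (h₀.enum σ)
  obtain ⟨ψ, hψ, e⟩ := exists_mapIso_mapIso x σ j s₁
  rw [a.ev_eq (h₀.enum σ) h₁ hφ₁, a.ev_eq ((h₀.enum σ).map h.inj) h₁ ((hφ₁.map j).comp hψ)]
  rw [← whiskerLeft_comp_assoc, ← whiskerLeft_comp_assoc]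
  congr 2
  simp [e]

/-- The identity. -/
noncomputable def one : CohFam ι K x (Fin 1) :=
  mk' (s₀ := leaf 0) ⟨by simp [labels], fun a => by simp [labels, Subsingleton.elim a 0]⟩
    (kid ι K x)

theorem isOrd_leaf : (leaf (0 : Fin 1)).IsOrd :=
  ⟨by simp [labels], fun a => by simp [labels, Subsingleton.elim a 0]⟩

theorem one_val (h : (leaf (0 : Fin 1)).IsOrd) :
    (one : CohFam ι K x (Fin 1)).val (leaf 0) h = kid ι K x := mk'_val _ _

theorem one_ev {j : Fin 1 → X} (h : Enum j (leaf (j 0))) :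
    (one : CohFam ι K x (Fin 1)).ev j (leaf (j 0)) h = kid ι K x := by
  refine (ev_eq one h (s₀ := leaf 0) isOrd_leaf (.id (leaf (j 0)))).trans ?_
  refine (congrArg (_ ≫ ·) (one_val _)).trans ?_
  refine (congrArg (fun z => ι.obj K ◁ z ≫ kid ι K x) (Category.comp_id (𝟙 x))).trans ?_
  simp

section Comp

variable {Y : T → Type} [∀ t, Finite (Y t)]

theorem enum_sigma {r : OTree T} (hr : r.IsOrd) {Q : T → OTree (Σ t, Y t)}
    (hQ : ∀ t, Enum (Sigma.mk t) (Q t)) : (r.bind Q).IsOrd :=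
  (Enum.bind (j := Equiv.refl _) hr (Equiv.refl _).injective hQ).isOrd

variable (T) in
/-- A chosen listing of the elements of a finite type. -/
noncomputable def ord : OTree T := (exists_isOrd T).choose

variable (T) in
theorem isOrd_ord : (ord T).IsOrd := (exists_isOrd T).choose_spec

theorem enum_ord (t : T) : Enum (Sigma.mk t) ((ord (Y t)).map (Sigma.mk t)) :=
  (isOrd_ord (Y t)).enum_map sigma_mk_injective

/-- Substitution. -/
noncomputable def comp (a : CohFam ι K x T) (b : ∀ t, CohFam ι K x (Y t)) :
    CohFam ι K x (Σ t, Y t) :=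
  mk' (s₀ := (ord T).bind fun t => (ord (Y t)).map (Sigma.mk t)) (enum_sigma (isOrd_ord T) enum_ord)
    (kcomp ι K (kbind ι K (fun t => (ord (Y t)).map (Sigma.mk t))
      (fun t => (b t).ev (Sigma.mk t) _ (enum_ord t)) (ord T)) (a.val _ (isOrd_ord T)))

theorem comp_ev [PreservesBraiding ι] (a : CohFam ι K x T) (b : ∀ t, CohFam ι K x (Y t))
    {j : (Σ t, Y t) → X} {r : OTree T} (hr : r.IsOrd) {Q : T → OTree X}
    (hQ : ∀ t, Enum (fun y => j ⟨t, y⟩) (Q t)) (h : Enum j (r.bind Q)) :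
    (comp a b).ev j (r.bind Q) h = kcomp ι K (kbind ι K Q
      (fun t => (b t).ev (fun y => j ⟨t, y⟩) (Q t) (hQ t)) r) (a.val r hr) := by
  obtain ⟨χ, hχ⟩ := exists_coh x (hr.perm (isOrd_ord T))
  obtain ⟨ψ₁, hψ₁, e₁⟩ := kbind_coh Q (fun t => (b t).ev (fun y => j ⟨t, y⟩) (Q t) (hQ t)) hχ
  obtain ⟨ψ₂, hψ₂, e₂⟩ := kbind_congr (ι := ι) (K := K) (x := x) (q := Q)
    (q' := fun t => ((ord (Y t)).map (Sigma.mk t)).map j)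
    (b := fun t => (b t).ev (fun y => j ⟨t, y⟩) (Q t) (hQ t))
    (b' := fun t => ι.obj K ◁ (mapIso x j ((ord (Y t)).map (Sigma.mk t))).hom ≫
      (b t).ev (Sigma.mk t) _ (enum_ord t)) (fun t => by
        have hm : Enum (fun y => j ⟨t, y⟩) (((ord (Y t)).map (Sigma.mk t)).map j) :=
          (enum_ord t).map h.inj
        obtain ⟨χ, hχ⟩ := exists_coh x ((hQ t).perm hm)
        refine ⟨χ, hχ, ?_⟩
        rw [(b t).ev_coh (hQ t) hm hχ]
        congr 1
        obtain ⟨ψ, hψ, e⟩ := exists_mapIso_mapIso x (Sigma.mk t) j (ord (Y t))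
        rw [(b t).ev_eq hm (isOrd_ord _) hψ, ev_map_self _ (isOrd_ord _) sigma_mk_injective,
          ← whiskerLeft_comp_assoc]
        exact congrArg (fun z => ι.obj K ◁ z ≫ _) e) (ord T)
  obtain ⟨ψ₃, hψ₃, e₃⟩ := kbind_map_right ι K j (fun t => (ord (Y t)).map (Sigma.mk t))
    (fun t => (b t).ev (Sigma.mk t) _ (enum_ord t)) (ord T)
  rw [a.coh hr (isOrd_ord T) hχ, kcomp_whiskerLeft, e₁, e₂, e₃, ← whiskerLeft_kcomp,
    ← whiskerLeft_kcomp, ← whiskerLeft_kcomp, ev_eq _ h (enum_sigma (isOrd_ord T) enum_ord)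
    ((hψ₁.comp hψ₂).comp hψ₃), comp, mk'_val]
  simp only [whiskerLeft_comp, Category.assoc]

theorem comp_val [PreservesBraiding ι] (a : CohFam ι K x T) (b : ∀ t, CohFam ι K x (Y t))
    {r : OTree T} (hr : r.IsOrd) {Q : T → OTree (Σ t, Y t)}
    (hQ : ∀ t, Enum (Sigma.mk t) (Q t)) (h : (r.bind Q).IsOrd) :
    (comp a b).val (r.bind Q) h = kcomp ι K (kbind ι K Q
      (fun t => (b t).ev (Sigma.mk t) (Q t) (hQ t)) r) (a.val r hr) := by
  rw [← ev_id _ h (h.enum (Equiv.refl _))]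
  exact comp_ev a b hr hQ _

end Comp

end CohFam

open CohFam

variable [PreservesBraiding ι]

/-- The operad of `K`-families of endomorphisms of `x`. -/
noncomputable def endOp : SetOperad.{v} where
  obj S := CohFam ι K x S
  act := act
  one := one
  comp := comp
  act_refl {S} _ a := by
    obtain ⟨s, hs⟩ := exists_isOrd S
    exact ext_of_val hs (ev_id a hs (hs.enum (Equiv.refl S)))
  act_trans {S T U} _ _ _ σ τ a := by
    obtain ⟨s, hs⟩ := exists_isOrd U
    exact ext_of_val hs (ev_act σ a (hs.enum τ)).symm
  one_comp {S} _ a := by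
    obtain ⟨s, hs⟩ := exists_isOrd S
    refine ext_of_val hs ?_
    have h := comp_ev (one : CohFam ι K x (Fin 1)) (fun _ => a) (r := leaf 0) (Q := fun _ => s)
      (j := Equiv.uniqueSigma fun _ : Fin 1 => S)
      ⟨by simp [labels], fun a => by simp [labels, Subsingleton.elim a 0]⟩
      (fun t => by obtain rfl := Subsingleton.elim 0 t; exact hs.enum (Equiv.refl S)) (hs.enum _)
    refine h.trans ?_
    refine (congrArg (kcomp ι K _) (one_val _)).trans ?_
    exact (kcomp_kid _).trans (ev_id a hs (hs.enum (Equiv.refl S)))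
  comp_one {T} _ a := by
    obtain ⟨s, hs⟩ := exists_isOrd T
    have hs' : (s.bind fun t => leaf t).IsOrd := hs.map (Equiv.refl T)
    refine ext_of_val hs' ?_
    have hl : ∀ t : T, Enum (fun y : Fin 1 => t) (leaf t) := fun t =>
      ⟨fun _ _ _ => Subsingleton.elim _ _, by simp [labels], fun a => by
        simp [labels, eq_comm]⟩
    have h := comp_ev a (fun _ => (one : CohFam ι K x (Fin 1))) (r := s)
      (Q := fun t => leaf t) (j := Equiv.sigmaUnique T fun _ => Fin 1) hs hl (hs'.enum _)
    refine h.trans ?_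
    have e : ∀ t : T, (one : CohFam ι K x (Fin 1)).ev (fun _ => t) (leaf t) (hl t) = kid ι K x :=
      fun t => one_ev (hl t)
    refine (congrArg (fun z => kcomp ι K z (a.val s hs)) ((congrArg (fun b => kbind ι K _ b s)
      (funext e)).trans (kbind_leaf (fun t => t) s))).trans ?_
    refine (kcomp_whiskerLeft _ _ _).symm.trans ((kid_kcomp _).trans ?_)
    have h₂ := ev_map_self a hs (j := fun t => t) Function.injective_id
    exact h₂.symm.trans (ev_id a hs' (hs'.enum (Equiv.refl T)))
  comp_assoc {T} _ {S} _ {R} _ a b c := by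
    have hmk : ∀ (t : T) (s : S t), Enum (fun y => Equiv.sigmaAssoc R ⟨⟨t, s⟩, y⟩)
        (((ord (R t s)).map (Sigma.mk s)).map (Sigma.mk t)) := fun t s =>
      have hg : Function.Injective (fun p : Σ s, R t s => (⟨t, p⟩ : Σ t, Σ s, R t s)) :=
        fun _ _ h => eq_of_heq (Sigma.mk.inj_iff.1 h).2
      (enum_ord (Y := R t) s).map hg
    have hr := isOrd_ord T
    have hq : ((ord T).bind fun t => (ord (S t)).map (Sigma.mk t)).IsOrd := enum_sigma hr enum_ord
    let w : (Σ t, S t) → OTree (Σ t, Σ s, R t s) := fun p =>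
      ((ord (R p.1 p.2)).map (Sigma.mk p.2)).map (Sigma.mk p.1)
    have hw : ∀ t, Enum (Sigma.mk t) ((ord (S t)).bind fun s => w ⟨t, s⟩) := fun t =>
      Enum.bind (isOrd_ord (S t)) sigma_mk_injective (fun s => hmk t s)
    have hs : (((ord T).bind fun t => (ord (S t)).map (Sigma.mk t)).bind w).IsOrd :=
      (Enum.bind (j := Equiv.sigmaAssoc R) hq (Equiv.injective _) (fun p => hmk p.1 p.2)).isOrd
    have hs' : ((ord T).bind fun t => (ord (S t)).bind fun s => w ⟨t, s⟩).IsOrd := enum_sigma hr hw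
    refine ext_of_val hs ?_
    let γ := fun p : Σ t, S t => (c p.1 p.2).ev (fun y => Equiv.sigmaAssoc R ⟨p, y⟩) (w p)
      (hmk p.1 p.2)
    have h₁ := comp_ev (CohFam.comp a b) (fun p : Σ t, S t => c p.1 p.2)
      (j := Equiv.sigmaAssoc R) hq (Q := w) (fun p => hmk p.1 p.2) (hs.enum _)
    refine h₁.trans ?_
    rw [comp_val a b hr enum_ord hq, ← kcomp_assoc]
    obtain ⟨ψ, hψ, e⟩ := kbind_bind (ι := ι) (K := K) (fun t => (ord (S t)).map (Sigma.mk t)) w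
      (fun t => (b t).ev (Sigma.mk t) _ (enum_ord t)) γ (ord T)
    let δ : ∀ t, ι.obj K ⊗ tens x ((ord (S t)).bind fun s => w ⟨t, s⟩) ⟶ x := fun t =>
      CohFam.ev (S := Σ s, R t s) (X := Σ t, Σ s, R t s) (CohFam.comp (b t) (c t))
        (fun y => ⟨t, y⟩) _ (hw t)
    obtain ⟨ψ', hψ', e'⟩ := kbind_congr (ι := ι) (K := K)
      (b := fun t => kcomp ι K (kbind ι K w γ ((ord (S t)).map (Sigma.mk t)))
        ((b t).ev (Sigma.mk t) _ (enum_ord t)))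
      (b' := δ) (fun t => by
      obtain ⟨ψ, hψ, e⟩ := kbind_map (ι := ι) (K := K) (Sigma.mk t) w γ (ord (S t))
      refine ⟨ψ, hψ, ?_⟩
      rw [ev_map_self _ (isOrd_ord _) sigma_mk_injective, kcomp_whiskerLeft, e, ← whiskerLeft_kcomp]
      exact congrArg (_ ≫ ·) (comp_ev (b t) (c t) (isOrd_ord (S t)) (hmk t) (hw t)).symm) (ord T)
    change kcomp ι K (kcomp ι K (kbind ι K w γ _) _) _ = _
    rw [e, e', ← whiskerLeft_kcomp, ← whiskerLeft_kcomp]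
    rw [CohFam.coh _ hs hs' (hψ.comp hψ'), comp_val a _ hr hw hs', whiskerLeft_comp_assoc]
  act_comp {T T'} _ _ {S} _ σ a b := by
    have hr := isOrd_ord T
    have hr' : ((ord T).map σ).IsOrd := hr.map σ
    let Q : T' → OTree (Σ t, S t) := fun t => (ord (S t)).map (Sigma.mk t)
    have hs : (((ord T).map σ).bind Q).IsOrd := enum_sigma hr' enum_ord
    have hs₂ : Enum (Equiv.sigmaCongrLeft (β := S) σ) ((ord T).bind fun t => Q (σ t)) :=
      Enum.bind hr (Equiv.injective _) (fun t => enum_ord (σ t))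
    refine ext_of_val hs ?_
    rw [comp_val _ b hr' enum_ord hs]
    have h₁ := ev_map_self a hr σ.injective
    obtain ⟨ψ, hψ, e⟩ := kbind_map (ι := ι) (K := K) σ Q (fun t => (b t).ev (Sigma.mk t) _ (enum_ord t))
      (ord T)
    change kcomp ι K _ (a.ev σ ((ord T).map σ) (hr.enum_map σ.injective)) = _
    rw [h₁, kcomp_whiskerLeft, e, ← whiskerLeft_kcomp]
    refine Eq.trans ?_ (ev_coh _ (hs.enum _) hs₂ hψ).symm
    exact congrArg (_ ≫ ·) (comp_ev a (fun t => b (σ t)) hr (fun t => enum_ord (σ t)) hs₂).symm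
  comp_act {T} _ {S S'} _ _ τ a b := by
    have hr := isOrd_ord T
    let Q : T → OTree (Σ t, S' t) := fun t => (ord (S' t)).map (Sigma.mk t)
    have hs : ((ord T).bind Q).IsOrd := enum_sigma hr enum_ord
    refine ext_of_val hs ?_
    rw [comp_val _ _ hr enum_ord hs]
    refine Eq.trans ?_ (comp_ev a b (j := Equiv.sigmaCongrRight τ) hr
      (fun t => (enum_ord t).comp_equiv (τ t)) (hs.enum _)).symm
    congr 2
    funext t
    exact ev_act (τ t) (b t) (enum_ord t)

end EndOperad

end

section

theorem sset_congr {X Y : SSet.{v}} {f g : X ⟶ Y} (h : f = g) (m : SimplexCategoryᵒᵖ)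
    (x : X.obj m) : f.app m x = g.app m x := by rw [h]

section Cotensor

open Simplicial

variable {R R' : SOperad.{v}}

/-- An operation of `R'` in degree `m` together with a lift to `R` of its image in the operad of
maps from `L` to `R'`. -/
@[ext]
structure LiftedOp (p : R ⟶ R') (L : SSet.{v}) (m : SimplexCategoryᵒᵖ) (S : Type) [Finite S] : Type v where
  val : ∀ {m' : SimplexCategoryᵒᵖ} (_ : m ⟶ m') (_ : L.obj m'), (R.obj m').obj S
  base : (R'.obj m).obj S
  nat : ∀ {m' m'' : SimplexCategoryᵒᵖ} (α : m ⟶ m') (β : m' ⟶ m'') (l : L.obj m'),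
    val (α ≫ β) (L.map β l) = SetOperad.Hom.app (R.map β) (val α l)
  compat : ∀ {m' : SimplexCategoryᵒᵖ} (α : m ⟶ m') (l : L.obj m'),
    SetOperad.Hom.app (p.app m') (val α l) = SetOperad.Hom.app (R'.map α) base

/-- The operad of operations of `R'` with lifts to `R` over `L`. -/
def liftedOperad (p : R ⟶ R') (L : SSet.{v}) (m : SimplexCategoryᵒᵖ) : SetOperad.{v} where
  obj S := LiftedOp p L m S
  act σ a :=
    { val := fun α l => (R.obj _).act σ (a.val α l)
      base := (R'.obj _).act σ a.base
      nat := fun α β l => by rw [a.nat, SetOperad.Hom.app_act]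
      compat := fun α l => by rw [SetOperad.Hom.app_act, SetOperad.Hom.app_act, a.compat] }
  one :=
    { val := fun α l => (R.obj _).one
      base := (R'.obj _).one
      nat := fun α β l => by rw [SetOperad.Hom.app_one]
      compat := fun α l => by rw [SetOperad.Hom.app_one, SetOperad.Hom.app_one] }
  comp a b :=
    { val := fun α l => (R.obj _).comp (a.val α l) fun t => (b t).val α l
      base := (R'.obj _).comp a.base fun t => (b t).base
      nat := fun α β l => by
        rw [SetOperad.Hom.app_comp, a.nat]
        exact congrArg _ (funext fun t => (b t).nat α β l)
      compat := fun α l => by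
        rw [SetOperad.Hom.app_comp, SetOperad.Hom.app_comp, a.compat]
        exact congrArg _ (funext fun t => (b t).compat α l) }
  act_refl a := LiftedOp.ext (funext fun _ => funext fun _ => funext fun _ =>
    SetOperad.act_refl _ _) (SetOperad.act_refl _ _)
  act_trans σ τ a := LiftedOp.ext (funext fun _ => funext fun _ => funext fun _ =>
    SetOperad.act_trans _ _ _ _) (SetOperad.act_trans _ _ _ _)
  one_comp a := LiftedOp.ext (funext fun _ => funext fun _ => funext fun _ =>
    SetOperad.one_comp _ _) (SetOperad.one_comp _ _)
  comp_one a := LiftedOp.ext (funext fun _ => funext fun _ => funext fun _ =>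
    SetOperad.comp_one _ _) (SetOperad.comp_one _ _)
  comp_assoc a b c := LiftedOp.ext (funext fun _ => funext fun α => funext fun l =>
    SetOperad.comp_assoc _ (a.val α l) (fun t => (b t).val α l) fun t s => (c t s).val α l)
      (SetOperad.comp_assoc _ a.base (fun t => (b t).base) fun t s => (c t s).base)
  act_comp σ a b := LiftedOp.ext (funext fun _ => funext fun _ => funext fun _ =>
    SetOperad.act_comp _ _ _ _) (SetOperad.act_comp _ _ _ _)
  comp_act τ a b := LiftedOp.ext (funext fun _ => funext fun _ => funext fun _ =>
    SetOperad.comp_act _ _ _ _) (SetOperad.comp_act _ _ _ _)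

theorem SetOperad.hom_ext' {P Q : SetOperad.{v}} {f g : P ⟶ Q}
    (h : ∀ (S : Type) [Finite S] (a : P.obj S), SetOperad.Hom.app f a = SetOperad.Hom.app g a) :
    f = g :=
  SetOperad.Hom.ext (funext fun S => funext fun _ => funext fun a => h S a)

/-- The simplicial operad of operations of `R'` with lifts to `R` over `L`. -/
def liftedSOperad (p : R ⟶ R') (L : SSet.{v}) : SOperad.{v} where
  obj m := liftedOperad p L m
  map {m m'} γ :=
    ({ app := fun {S} _ a =>
        { val := fun α l => a.val (γ ≫ α) l
          base := SetOperad.Hom.app (R'.map γ) a.base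
          nat := fun α β l => by rw [← Category.assoc, a.nat]
          compat := fun α l => by rw [a.compat, R'.map_comp]; rfl }
       app_act := fun σ a => LiftedOp.ext rfl (SetOperad.Hom.app_act _ _ _)
       app_one := LiftedOp.ext rfl (SetOperad.Hom.app_one _)
       app_comp := fun a b => LiftedOp.ext rfl (SetOperad.Hom.app_comp _ _ _) } :
      SetOperad.Hom (liftedOperad p L m) (liftedOperad p L m'))
  map_id m := SetOperad.hom_ext' fun S _ a => LiftedOp.ext
    (funext fun _ => funext fun α => funext fun l => congrArg (fun β => a.val β l)
      (Category.id_comp α)) (by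
      change SetOperad.Hom.app (R'.map (𝟙 m)) a.base = a.base
      rw [R'.map_id]; rfl)
  map_comp γ δ := SetOperad.hom_ext' fun S _ a => LiftedOp.ext
    (funext fun _ => funext fun α => funext fun l => congrArg (fun β => a.val β l)
      (Category.assoc γ δ α)) (by
      change SetOperad.Hom.app (R'.map (γ ≫ δ)) a.base = _
      rw [R'.map_comp]; rfl)

/-- Restriction of the lifts along `L' ⟶ L`. -/
def liftedRestrict (p : R ⟶ R') {L L' : SSet.{v}} (i : L' ⟶ L) : liftedSOperad p L ⟶ liftedSOperad p L' where
  app m :=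
    ({ app := fun a =>
        { val := fun α l => a.val α (i.app _ l)
          base := a.base
          nat := fun α β l => by rw [← a.nat]; congr 1; exact NatTrans.naturality_apply i β l
          compat := fun α l => a.compat α _ }
       app_act := fun σ a => rfl
       app_one := rfl
       app_comp := fun a b => rfl } :
      SetOperad.Hom (liftedOperad p L m) (liftedOperad p L' m))
  naturality _ _ _ := rfl

/-- `p` has the right lifting property against all the monomorphisms in every arity. -/
def IsAcyclicFibrationOfOperads (p : R ⟶ R') : Prop :=
  ∀ (S : Type) [Finite S] {A B : SSet.{v}} (i : A ⟶ B) [Mono i],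
    HasLiftingProperty i (SOperad.spaceMap p S)

variable {p : R ⟶ R'}

theorem IsAcyclicFibrationOfOperads.isTrivialKanFibration (hp : IsAcyclicFibrationOfOperads p) (k : ℕ)
    (S : Type) [Finite S] :
    IsTrivialKanFibration (SOperad.spaceMap (liftedRestrict p ∂Δ[k].ι) S) := by
  intro n
  refine ⟨fun {u t} sq => ?_⟩
  obtain ⟨T, rfl⟩ : ∃ T : LiftedOp p (∂Δ[k] : SSet.{v}) (op ⦋n⦌) S, t = SSet.yonedaEquiv.symm T :=
    ⟨SSet.yonedaEquiv t, by simp⟩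
  have hu : ∀ {m : SimplexCategoryᵒᵖ} (α : (∂Δ[n] : SSet.{v}).obj m)
      (l : (∂Δ[k] : SSet.{v}).obj m), LiftedOp.val (u.app m α) (𝟙 m) (∂Δ[k].ι.app _ l) =
        T.val (SSet.stdSimplex.objEquiv α.1).op l := by
    intro m α l
    have h := sset_congr sq.w m α
    have h' := congrArg (fun z : LiftedOp p (∂Δ[k] : SSet.{v}) m S => z.val (𝟙 m) l) h
    refine h'.trans ?_
    change T.val ((SSet.stdSimplex.objEquiv α.1).op ≫ 𝟙 m) l = _
    rw [Category.comp_id]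
  have hu' : ∀ {m : SimplexCategoryᵒᵖ} (α : (∂Δ[n] : SSet.{v}).obj m),
      LiftedOp.base (u.app m α) =
        SetOperad.Hom.app (R'.map (SSet.stdSimplex.objEquiv α.1).op) T.base := by
    intro m α
    have h := sset_congr sq.w m α
    exact congrArg (fun z : LiftedOp p (∂Δ[k] : SSet.{v}) m S => z.base) h
  have hnat : ∀ {m m' : SimplexCategoryᵒᵖ} (β : m ⟶ m') (α : (∂Δ[n] : SSet.{v}).obj m),
      u.app m' ((∂Δ[n] : SSet.{v}).map β α) =
        SetOperad.Hom.app ((liftedSOperad p _).map β) (u.app m α) := fun β α =>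
    NatTrans.naturality_apply u β α
  let v₁ : (Δ[n] : SSet.{v}) ⊗ (∂Δ[k] : SSet.{v}) ⟶ R.space S :=
    { app := fun m => TypeCat.ofHom fun x => T.val (SSet.stdSimplex.objEquiv x.1).op x.2
      naturality := fun m m' β => by
        ext x
        exact T.nat (SSet.stdSimplex.objEquiv x.1).op β x.2 }
  let v₂ : (∂Δ[n] : SSet.{v}) ⊗ Δ[k] ⟶ R.space S :=
    { app := fun m => TypeCat.ofHom fun x => LiftedOp.val (u.app m x.1) (𝟙 m) x.2
      naturality := fun m m' β => by
        ext x
        have h := LiftedOp.nat (u.app m x.1) (𝟙 m) β x.2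
        refine Eq.trans ?_ h
        refine (congrArg (fun z : LiftedOp p (Δ[k] : SSet.{v}) m' S => z.val (𝟙 m')
          ((Δ[k] : SSet.{v}).map β x.2)) (hnat β x.1)).trans ?_
        change LiftedOp.val (u.app m x.1) (β ≫ 𝟙 m') _ = _
        rw [Category.comp_id, Category.id_comp] }
  let d := (SSet.Subcomplex.unionProd.isPushout ∂Δ[n] ∂Δ[k]).desc v₁ v₂ (by
    ext m x
    exact (hu x.1 x.2).symm)
  let b : (Δ[n] : SSet.{v}) ⊗ Δ[k] ⟶ R'.space S :=
    { app := fun m => TypeCat.ofHom fun x =>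
        SetOperad.Hom.app (R'.map (SSet.stdSimplex.objEquiv x.1).op) T.base
      naturality := fun m m' β => by
        ext x
        change SetOperad.Hom.app (R'.map ((SSet.stdSimplex.objEquiv x.1).op ≫ β)) T.base = _
        rw [R'.map_comp]
        rfl }
  have sq' : CommSq d (SSet.Subcomplex.unionProd ∂Δ[n] ∂Δ[k]).ι (SOperad.spaceMap p S) b := by
    refine ⟨(SSet.Subcomplex.unionProd.isPushout ∂Δ[n] ∂Δ[k]).hom_ext ?_ ?_⟩
    · rw [IsPushout.inl_desc_assoc]
      ext m x
      exact T.compat (SSet.stdSimplex.objEquiv x.1).op x.2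
    · rw [IsPushout.inr_desc_assoc]
      ext m x
      refine (LiftedOp.compat (u.app m x.1) (𝟙 m) x.2).trans ?_
      rw [R'.map_id]
      exact hu' x.1
  have := hp S (SSet.Subcomplex.unionProd ∂Δ[n] ∂Δ[k]).ι
  have hl : ∀ {m : SimplexCategoryᵒᵖ} (α : (Δ[n] : SSet.{v}).obj m) (l : (∂Δ[k] : SSet.{v}).obj m),
      sq'.lift.app m (α, ∂Δ[k].ι.app _ l) = T.val (SSet.stdSimplex.objEquiv α).op l := by
    intro m α l
    have e : SSet.Subcomplex.unionProd.ι₁ ∂Δ[n] ∂Δ[k] ≫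
        (SSet.Subcomplex.unionProd ∂Δ[n] ∂Δ[k]).ι ≫ sq'.lift = v₁ := by
      rw [sq'.fac_left, IsPushout.inl_desc]
    exact sset_congr e m (α, l)
  have hl' : ∀ {m : SimplexCategoryᵒᵖ} (α : (∂Δ[n] : SSet.{v}).obj m) (l : (Δ[k] : SSet.{v}).obj m),
      sq'.lift.app m (α.1, l) = LiftedOp.val (u.app m α) (𝟙 m) l := by
    intro m α l
    have e : SSet.Subcomplex.unionProd.ι₂ ∂Δ[n] ∂Δ[k] ≫
        (SSet.Subcomplex.unionProd ∂Δ[n] ∂Δ[k]).ι ≫ sq'.lift = v₂ := by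
      rw [sq'.fac_left, IsPushout.inr_desc]
    exact sset_congr e m (α, l)
  let G : LiftedOp p (Δ[k] : SSet.{v}) (op ⦋n⦌) S :=
    { val := fun α l => sq'.lift.app _ (SSet.stdSimplex.objEquiv.symm α.unop, l)
      base := T.base
      nat := fun {m m'} α β l => by
        let z : ((Δ[n] : SSet.{v}) ⊗ Δ[k]).obj m := (SSet.stdSimplex.objEquiv.symm α.unop, l)
        exact NatTrans.naturality_apply sq'.lift β z
      compat := fun {m} α l => by
        let z : ((Δ[n] : SSet.{v}) ⊗ Δ[k]).obj m := (SSet.stdSimplex.objEquiv.symm α.unop, l)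
        exact sset_congr sq'.fac_right m z }
  refine ⟨⟨⟨SSet.yonedaEquiv.symm G, ?_, ?_⟩⟩⟩
  · ext m α
    refine LiftedOp.ext ?_ (hu' α).symm
    funext m' β l
    change sq'.lift.app m' (SSet.stdSimplex.objEquiv.symm
      ((SSet.stdSimplex.objEquiv α.1).op ≫ β).unop, l) = _
    refine (hl' ((∂Δ[n] : SSet.{v}).map β α) l).trans ?_
    refine (congrArg (fun z : LiftedOp p (Δ[k] : SSet.{v}) m' S => z.val (𝟙 m') l) (hnat β α)).trans ?_
    change LiftedOp.val (u.app m α) (β ≫ 𝟙 m') _ = _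
    rw [Category.comp_id]
    rfl
  · refine SSet.yonedaEquiv.injective ((SSet.yonedaEquiv_comp _ _).trans (Eq.trans
      (congrArg _ (Equiv.apply_symm_apply _ G)) (Eq.trans ?_ (Equiv.apply_symm_apply _ T).symm)))
    refine LiftedOp.ext ?_ rfl
    funext m' β l
    exact hl (SSet.stdSimplex.objEquiv.symm β.unop) l

/-- A family of operad maps from a cofibrant operad to `R` over a map to `R'`, indexed by `∂Δ[k]`,
extends to `Δ[k]`. -/
theorem IsAcyclicFibrationOfOperads.exists_extension (hp : IsAcyclicFibrationOfOperads p)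
    {O : SOperad.{v}} (hO : O.IsCofibrant) (θ : O ⟶ R') (k : ℕ)
    (A : ∀ m : SimplexCategoryᵒᵖ, (∂Δ[k] : SSet.{v}).obj m → (O.obj m ⟶ R.obj m))
    (hA : ∀ {m m' : SimplexCategoryᵒᵖ} (φ : m ⟶ m') (l : (∂Δ[k] : SSet.{v}).obj m),
      O.map φ ≫ A m' ((∂Δ[k] : SSet.{v}).map φ l) = A m l ≫ R.map φ)
    (hθ : ∀ (m : SimplexCategoryᵒᵖ) (l : (∂Δ[k] : SSet.{v}).obj m), A m l ≫ p.app m = θ.app m) :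
    ∃ B : ∀ m : SimplexCategoryᵒᵖ, (Δ[k] : SSet.{v}).obj m → (O.obj m ⟶ R.obj m),
      (∀ {m m' : SimplexCategoryᵒᵖ} (φ : m ⟶ m') (l : (Δ[k] : SSet.{v}).obj m),
        O.map φ ≫ B m' ((Δ[k] : SSet.{v}).map φ l) = B m l ≫ R.map φ) ∧
      (∀ (m : SimplexCategoryᵒᵖ) (l : (Δ[k] : SSet.{v}).obj m), B m l ≫ p.app m = θ.app m) ∧
      ∀ (m : SimplexCategoryᵒᵖ) (l : (∂Δ[k] : SSet.{v}).obj m), B m (∂Δ[k].ι.app m l) = A m l := by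
  have hA' : ∀ {m m' : SimplexCategoryᵒᵖ} (φ : m ⟶ m') (l : (∂Δ[k] : SSet.{v}).obj m)
      {S : Type} [Finite S] (o : (O.obj m).obj S),
      SetOperad.Hom.app (A m' ((∂Δ[k] : SSet.{v}).map φ l)) (SetOperad.Hom.app (O.map φ) o) =
        SetOperad.Hom.app (R.map φ) (SetOperad.Hom.app (A m l) o) := fun {_ _} φ l {S} _ o =>
    congrArg (fun z : O.obj _ ⟶ R.obj _ => SetOperad.Hom.app z o) (hA φ l)
  have hθ' : ∀ (m : SimplexCategoryᵒᵖ) (l : (∂Δ[k] : SSet.{v}).obj m) {S : Type} [Finite S]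
      (o : (O.obj m).obj S), SetOperad.Hom.app (p.app m) (SetOperad.Hom.app (A m l) o) =
        SetOperad.Hom.app (θ.app m) o := fun m l {S} _ o =>
    congrArg (fun z : O.obj _ ⟶ R'.obj _ => SetOperad.Hom.app z o) (hθ m l)
  have hn : ∀ {m m' : SimplexCategoryᵒᵖ} (φ : m ⟶ m') {S : Type} [Finite S] (o : (O.obj m).obj S),
      SetOperad.Hom.app (θ.app m') (SetOperad.Hom.app (O.map φ) o) =
        SetOperad.Hom.app (R'.map φ) (SetOperad.Hom.app (θ.app m) o) := fun {_ _} φ {S} _ o =>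
    congrArg (fun z : O.obj _ ⟶ R'.obj _ => SetOperad.Hom.app z o) (θ.naturality φ)
  have hc : ∀ {m m' m'' : SimplexCategoryᵒᵖ} (φ : m ⟶ m') (ψ : m' ⟶ m'') {S : Type} [Finite S]
      (o : (O.obj m).obj S), SetOperad.Hom.app (O.map (φ ≫ ψ)) o =
        SetOperad.Hom.app (O.map ψ) (SetOperad.Hom.app (O.map φ) o) := fun {_ _ _} φ ψ {S} _ o =>
    congrArg (fun z : O.obj _ ⟶ O.obj _ => SetOperad.Hom.app z o) (O.map_comp φ ψ)
  let f : O ⟶ liftedSOperad p (∂Δ[k] : SSet.{v}) :=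
    { app := fun m =>
        ({ app := fun {S} _ o =>
            { val := fun α l => SetOperad.Hom.app (A _ l) (SetOperad.Hom.app (O.map α) o)
              base := SetOperad.Hom.app (θ.app m) o
              nat := fun α β l => by rw [hc, hA']
              compat := fun α l => by rw [hθ', hn] }
           app_act := fun σ o => LiftedOp.ext (by
            funext m' α l; exact SetOperad.Hom.app_act (O.map α ≫ A m' l) σ o)
              (SetOperad.Hom.app_act _ _ _)
           app_one := LiftedOp.ext (by
            funext m' α l; exact SetOperad.Hom.app_one (O.map α ≫ A m' l))
              (SetOperad.Hom.app_one _)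
           app_comp := fun a b => LiftedOp.ext (by
            funext m' α l; exact SetOperad.Hom.app_comp (O.map α ≫ A m' l) a b)
              (SetOperad.Hom.app_comp _ _ _) } :
          SetOperad.Hom (O.obj m) (liftedOperad p (∂Δ[k] : SSet.{v}) m))
      naturality := fun m m' φ => SetOperad.hom_ext' fun S _ o => LiftedOp.ext (by
        funext m'' α l
        exact congrArg (SetOperad.Hom.app (A _ l)) (hc φ α o).symm) (hn φ o) }
  obtain ⟨g, hg⟩ := hO _ (hp.isTrivialKanFibration k) f
  have hg' : ∀ (m : SimplexCategoryᵒᵖ) {S : Type} [Finite S] (o : (O.obj m).obj S),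
      SetOperad.Hom.app ((liftedRestrict p ∂Δ[k].ι).app m) (SetOperad.Hom.app (g.app m) o) =
        SetOperad.Hom.app (f.app m) o := fun m {S} _ o =>
    congrArg (fun z : O ⟶ liftedSOperad p _ => SetOperad.Hom.app (z.app m) o) hg
  have hgn : ∀ {m m' : SimplexCategoryᵒᵖ} (φ : m ⟶ m') {S : Type} [Finite S] (o : (O.obj m).obj S),
      SetOperad.Hom.app (g.app m') (SetOperad.Hom.app (O.map φ) o) =
        SetOperad.Hom.app ((liftedSOperad p _).map φ) (SetOperad.Hom.app (g.app m) o) :=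
    fun {_ _} φ {S} _ o => congrArg (fun z : O.obj _ ⟶ (liftedSOperad p _).obj _ =>
      SetOperad.Hom.app z o) (g.naturality φ)
  refine ⟨fun m l =>
    ({ app := fun o => LiftedOp.val (SetOperad.Hom.app (g.app m) o) (𝟙 m) l
       app_act := fun σ o => congrArg (fun z : LiftedOp p (Δ[k] : SSet.{v}) m _ => z.val (𝟙 m) l)
        (SetOperad.Hom.app_act (g.app m) σ o)
       app_one := congrArg (fun z : LiftedOp p (Δ[k] : SSet.{v}) m _ => z.val (𝟙 m) l)
        (SetOperad.Hom.app_one (g.app m))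
       app_comp := fun a b => congrArg (fun z : LiftedOp p (Δ[k] : SSet.{v}) m _ => z.val (𝟙 m) l)
        (SetOperad.Hom.app_comp (g.app m) a b) } : SetOperad.Hom (O.obj m) (R.obj m)), ?_, ?_, ?_⟩
  · intro m m' φ l
    refine SetOperad.hom_ext' fun S _ o => ?_
    refine (congrArg (fun z : LiftedOp p (Δ[k] : SSet.{v}) m' S => z.val (𝟙 m')
      ((Δ[k] : SSet.{v}).map φ l)) (hgn φ o)).trans ?_
    refine Eq.trans ?_ (LiftedOp.nat (SetOperad.Hom.app (g.app m) o) (𝟙 m) φ l)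
    change LiftedOp.val (SetOperad.Hom.app (g.app m) o) (φ ≫ 𝟙 m') _ = _
    rw [Category.comp_id, Category.id_comp]
  · intro m l
    refine SetOperad.hom_ext' fun S _ o => ?_
    refine (LiftedOp.compat (SetOperad.Hom.app (g.app m) o) (𝟙 m) l).trans ?_
    rw [R'.map_id]
    exact congrArg (fun z : LiftedOp p (∂Δ[k] : SSet.{v}) m S => z.base) (hg' m o)
  · intro m l
    refine SetOperad.hom_ext' fun S _ o => ?_
    refine (congrArg (fun z : LiftedOp p (∂Δ[k] : SSet.{v}) m S => z.val (𝟙 m) l) (hg' m o)).trans ?_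
    change SetOperad.Hom.app (A m l) (SetOperad.Hom.app (O.map (𝟙 m)) o) = _
    rw [O.map_id]
    rfl

end Cotensor

end

section

namespace OTree

variable {X Y : Type}

/-- The left-nested tree with the given labels. -/
def linOf : ∀ {n : ℕ}, (Fin n → X) → OTree X
  | 0, _ => nil
  | n + 1, f => node (linOf fun i : Fin n => f i.castSucc) (leaf (f (Fin.last n)))

theorem labels_linOf : ∀ {n : ℕ} (f : Fin n → X), (linOf f).labels = List.ofFn f
  | 0, _ => rfl
  | n + 1, f => by
    rw [List.ofFn_succ_last, linOf, labels, labels_linOf]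
    rfl

theorem isOrd_linOf {n : ℕ} (e : Fin n ≃ X) : (linOf e).IsOrd := by
  refine ⟨?_, fun a => ?_⟩
  · rw [labels_linOf]; exact List.nodup_ofFn_ofInjective e.injective
  · rw [labels_linOf, List.mem_ofFn]; exact e.surjective a

theorem enum_linOf {n : ℕ} {f : Fin n → X} (hf : Function.Injective f) : Enum f (linOf f) := by
  refine ⟨hf, ?_, fun a => ?_⟩
  · rw [labels_linOf]; exact List.nodup_ofFn_ofInjective hf
  · rw [labels_linOf, List.mem_ofFn]; rfl

variable {D : Type u} [Category.{v} D] [MonoidalCategory D] (x : D)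

/-- The tensor power of left-nested shape is the standard one. -/
def linIso : ∀ {n : ℕ} (f : Fin n → X), tens x (linOf f) ≅ tpow x n
  | 0, _ => Iso.refl _
  | n + 1, f => whiskerRightIso (linIso fun i : Fin n => f i.castSucc) x

theorem linIso_tensMap {y x : D} (η : y ⟶ x) : ∀ {n : ℕ} (f : Fin n → X),
    (linIso y f).hom ≫ tpowMap η n = tensMap η (linOf f) ≫ (linIso x f).hom
  | 0, _ => rfl
  | n + 1, f => by
    have h := linIso_tensMap η fun i : Fin n => f i.castSucc
    have e : (linIso y fun i : Fin n => f i.castSucc).hom ▷ y ≫ (tpowMap η n ⊗ₘ η) =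
        (tensMap η (linOf fun i : Fin n => f i.castSucc) ⊗ₘ η) ≫
          (linIso x fun i : Fin n => f i.castSucc).hom ▷ x := by
      rw [← tensorHom_id, ← tensorHom_id, tensorHom_comp_tensorHom, tensorHom_comp_tensorHom, h,
        Category.id_comp, Category.comp_id]
    exact e

variable [SymmetricCategory D]

theorem exists_linOf_congr {n : ℕ} {f g : Fin n → X} (h : f = g) :
    ∃ φ : tens x (linOf f) ⟶ tens x (linOf g), Coh x φ ∧
      φ ≫ (linIso x g).hom = (linIso x f).hom := by
  subst h
  exact ⟨𝟙 _, .id _, Category.id_comp _⟩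

theorem exists_linOf_cast {n m : ℕ} (h : n = m) (f : Fin m → X) :
    ∃ φ : tens x (linOf f) ⟶ tens x (linOf fun i : Fin n => f (i.cast h)), Coh x φ ∧
      φ ≫ (linIso x _).hom ≫ eqToHom (congrArg (tpow x) h) = (linIso x f).hom := by
  subst h
  exact ⟨𝟙 _, .id _, by simp⟩

theorem exists_linOf_map (j : X → Y) : ∀ {n : ℕ} (f : Fin n → X),
    ∃ φ : tens x (linOf (j ∘ f)) ⟶ tens x ((linOf f).map j), Coh x φ ∧
      φ ≫ (mapIso x j (linOf f)).hom ≫ (linIso x f).hom = (linIso x (j ∘ f)).hom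
  | 0, _ => ⟨𝟙 _, .id nil, (Category.id_comp _).trans (Category.id_comp _)⟩
  | n + 1, f => by
    obtain ⟨φ, hφ, e⟩ := exists_linOf_map j fun i : Fin n => f i.castSucc
    refine ⟨_, hφ.tensor (.id (leaf (j (f (Fin.last n))))), ?_⟩
    have e' : (φ ⊗ₘ 𝟙 x) ≫ ((mapIso x j (linOf fun i : Fin n => f i.castSucc)).hom ⊗ₘ 𝟙 x) ≫
        (linIso x fun i : Fin n => f i.castSucc).hom ▷ x =
        (linIso x (j ∘ fun i : Fin n => f i.castSucc)).hom ▷ x := by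
      rw [tensorHom_id, tensorHom_id, ← comp_whiskerRight, ← comp_whiskerRight, e]
    exact e'

theorem linOf_add_aux {A A' B B' C C' : D} {φ : A ⟶ B ⊗ C} {l₁ : B ⟶ B'} {l₂ : C ⟶ C'} {l : A ⟶ A'}
    {t : A' ⟶ B' ⊗ C'} (h : φ ≫ (l₁ ⊗ₘ l₂) = l ≫ t) :
    ((φ ⊗ₘ 𝟙 x) ≫ (α_ _ _ _).hom) ≫ (l₁ ⊗ₘ l₂ ▷ x) = l ▷ x ≫ t ▷ x ≫ (α_ _ _ _).hom := by
  rw [Category.assoc, ← tensorHom_id l₂, ← associator_naturality, ← comp_whiskerRight_assoc,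
    ← h, tensorHom_id, tensorHom_id, comp_whiskerRight_assoc]

theorem linOf_swap_aux {A A' : D} (l : A ⟶ A') :
    ((α_ A x x).hom ≫ A ◁ (β_ x x).hom ≫ (α_ A x x).inv) ≫ l ▷ x ▷ x =
      l ▷ x ▷ x ≫ (α_ A' x x).hom ≫ A' ◁ (β_ x x).hom ≫ (α_ A' x x).inv := by
  rw [associator_naturality_left_assoc, ← whisker_exchange_assoc, associator_inv_naturality_left]
  simp only [Category.assoc]

theorem exists_linOf_add (m : ℕ) : ∀ (n : ℕ) (f : Fin (m + n) → X),
    ∃ φ : tens x (linOf f) ⟶ tens x (node (linOf fun i : Fin m => f (i.castAdd n))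
      (linOf fun i : Fin n => f (i.natAdd m))), Coh x φ ∧
      φ ≫ ((linIso x fun i : Fin m => f (i.castAdd n)).hom ⊗ₘ
        (linIso x fun i : Fin n => f (i.natAdd m)).hom) = (linIso x f).hom ≫ (tpowAdd x m n).inv
  | 0, f => by
    refine ⟨_, .right_unit_inv _, ?_⟩
    have e : (ρ_ (tens x (linOf fun i : Fin m => f (i.castAdd 0)))).inv ≫
        ((linIso x fun i : Fin m => f (i.castAdd 0)).hom ⊗ₘ 𝟙 (𝟙_ D)) =
        (linIso x fun i : Fin m => f (i.castAdd 0)).hom ≫ (ρ_ _).inv := by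
      rw [tensorHom_id, rightUnitor_inv_naturality]
    exact e
  | n + 1, f => by
    obtain ⟨φ, hφ, e⟩ := exists_linOf_add m n fun i : Fin (m + n) => f i.castSucc
    refine ⟨_, (hφ.tensor (.id (leaf (f (Fin.last (m + n)))))).comp (.assoc _ _ _), ?_⟩
    exact linOf_add_aux x e

theorem exists_linOf_swap (q : ℕ) : ∀ (p : ℕ) (f g : Fin (q + 2 + p) → X)
    (_ : ∀ i, f i = g (Equiv.swap ⟨q, by omega⟩ ⟨q + 1, by omega⟩ i)),
    ∃ φ : tens x (linOf f) ⟶ tens x (linOf g), Coh x φ ∧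
      φ ≫ (linIso x g).hom = (linIso x f).hom ≫ tpowSwap x q p
  | 0, f, g, h => by
    obtain ⟨φ, hφ, e⟩ := exists_linOf_congr x
      (f := fun i : Fin q => f i.castSucc.castSucc) (g := fun i : Fin q => g i.castSucc.castSucc)
      (funext fun i => (h _).trans (congrArg g (Equiv.swap_apply_of_ne_of_ne
        (fun h => i.2.ne (congrArg Fin.val h)) (fun h => by
          have := congrArg Fin.val h
          have h' := i.2
          simp at this
          omega))))
    have h₁ : f (Fin.last q).castSucc = g (Fin.last (q + 1)) :=
      (h _).trans (congrArg g (Equiv.swap_apply_left _ _))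
    have h₂ : f (Fin.last (q + 1)) = g (Fin.last q).castSucc :=
      (h _).trans (congrArg g (Equiv.swap_apply_right _ _))
    let a := linOf fun i : Fin q => f i.castSucc.castSucc
    let b := linOf fun i : Fin q => g i.castSucc.castSucc
    have c₁ : Coh (s := node (node a (leaf (f (Fin.last q).castSucc))) (leaf (f (Fin.last (q + 1)))))
        (t := node (node a (leaf (g (Fin.last q).castSucc))) (leaf (g (Fin.last (q + 1)))))
        x ((α_ (tens x a) x x).hom ≫ tens x a ◁ (β_ x x).hom ≫ (α_ (tens x a) x x).inv) := by
      rw [← h₁, ← h₂]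
      exact (Coh.assoc a (leaf _) (leaf _)).comp (.comp ((Coh.braid (leaf _) (leaf _)).whiskerLeft a)
        (.assoc_inv a (leaf _) (leaf _)))
    refine ⟨_, c₁.comp ((hφ.tensor (.id (leaf _))).tensor (.id (leaf _))), ?_⟩
    have e' : ((φ ⊗ₘ 𝟙 x) ⊗ₘ 𝟙 x) ≫ (linIso x fun i : Fin q => g i.castSucc.castSucc).hom ▷ x ▷ x =
        (linIso x fun i : Fin q => f i.castSucc.castSucc).hom ▷ x ▷ x := by
      rw [tensorHom_id, tensorHom_id, ← comp_whiskerRight, ← comp_whiskerRight, e]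
    exact (Category.assoc _ _ _).trans ((congrArg (_ ≫ ·) e').trans (linOf_swap_aux x _))
  | p + 1, f, g, h => by
    have hs : ∀ i : Fin (q + 2 + p), f i.castSucc =
        g (Equiv.swap (⟨q, by omega⟩ : Fin (q + 2 + p)) ⟨q + 1, by omega⟩ i).castSucc := by
      intro i
      rw [h]
      congr 1
      rcases eq_or_ne i ⟨q, by omega⟩ with rfl | h₁
      · rw [Equiv.swap_apply_left]; exact Equiv.swap_apply_left _ _
      rcases eq_or_ne i ⟨q + 1, by omega⟩ with rfl | h₂
      · rw [Equiv.swap_apply_right]; exact Equiv.swap_apply_right _ _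
      rw [Equiv.swap_apply_of_ne_of_ne h₁ h₂]
      exact Equiv.swap_apply_of_ne_of_ne
        (fun h => h₁ (by have := congrArg Fin.val h; exact Fin.ext this))
        (fun h => h₂ (by have := congrArg Fin.val h; exact Fin.ext this))
    obtain ⟨φ, hφ, e⟩ := exists_linOf_swap q p (fun i => f i.castSucc) (fun i => g i.castSucc) hs
    have hl : f (Fin.last _) = g (Fin.last _) := by
      rw [h]
      congr 1
      refine Equiv.swap_apply_of_ne_of_ne (fun h => ?_) (fun h => ?_) <;>
      · have := congrArg Fin.val h
        simp at this
        omega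
    have c : Coh (s := linOf f) (t := linOf g) x (φ ⊗ₘ 𝟙 x) := by
      have := hφ.tensor (.id (leaf (f (Fin.last _))))
      change Coh (s := node (linOf fun i => f i.castSucc) (leaf (f (Fin.last _))))
        (t := node (linOf fun i => g i.castSucc) (leaf (g (Fin.last _)))) x (φ ⊗ₘ 𝟙 x)
      rw [← hl]
      exact this
    refine ⟨_, c, ?_⟩
    have e' : (φ ⊗ₘ 𝟙 x) ≫ (linIso x fun i : Fin (q + 2 + p) => g i.castSucc).hom ▷ x =
      (linIso x fun i : Fin (q + 2 + p) => f i.castSucc).hom ▷ x ≫ tpowSwap x q p ▷ x := by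
      rw [tensorHom_id, ← comp_whiskerRight, e, comp_whiskerRight]
    exact e'

section Multi

variable {x} (ι : SSet.{v} ⥤ D) [ι.Monoidal] (K : SSet.{v})

variable {ι K} in
theorem kmulti_aux {A₀ A₁ B C B' C' P₁ P₂ T U Z : D} {φ₁ : A₀ ⟶ A₁} {φ₂ : A₁ ⟶ B ⊗ C} {φ₃ : B ⟶ B'}
    {φ₄ : C ⟶ C'} {l : A₀ ⟶ T} {t : T ⟶ P₁ ⊗ P₂} {l₁ : B ⟶ P₁} {l₂ : C ⟶ P₂} {l₂' : C' ⟶ P₂}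
    {M : ι.obj K ⊗ P₁ ⟶ U} {c : ι.obj K ⊗ P₂ ⟶ x} {N : ι.obj K ⊗ B' ⟶ Z} {l' : Z ⟶ U}
    (h : l ≫ t = φ₁ ≫ φ₂ ≫ (l₁ ⊗ₘ l₂)) (hM : ι.obj K ◁ l₁ ≫ M = ι.obj K ◁ φ₃ ≫ N ≫ l')
    (h₄ : φ₄ ≫ l₂' = l₂) :
    ι.obj K ◁ l ≫ ι.obj K ◁ t ≫ ktensor ι K M c =
      ι.obj K ◁ ((φ₁ ≫ φ₂) ≫ (φ₃ ⊗ₘ φ₄)) ≫ ktensor ι K N (ι.obj K ◁ l₂' ≫ c) ≫ l' ▷ x := by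
  rw [← whiskerLeft_comp_assoc, h, ← tensorHom_id, ktensor_comp, Category.comp_id]
  simp only [whiskerLeft_comp, Category.assoc]
  rw [whiskerLeft_ktensor, whiskerLeft_ktensor, hM, ← h₄]
  simp only [whiskerLeft_comp, Category.assoc]

theorem exists_kmulti {k₀ : ℕ} (n₀ : Fin k₀ → ℕ) (F : ∀ i, Fin (n₀ i) → X)
    (c : ∀ i, ι.obj K ⊗ tpow x (n₀ i) ⟶ x) :
    ∀ (k : ℕ) (g : Fin k → Fin k₀) (f : Fin (∑ i, n₀ (g i)) → X)
      (_ : ∀ i (j : Fin (n₀ (g i))), f (finSigmaFinEquiv ⟨i, j⟩) = F (g i) j),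
    ∃ φ : tens x (linOf f) ⟶ tens x ((linOf g).bind fun i => linOf (F i)), Coh x φ ∧
      ι.obj K ◁ (linIso x f).hom ≫ kmulti ι K x k (fun i => n₀ (g i)) (fun i => c (g i)) =
        ι.obj K ◁ φ ≫ kbind ι K (fun i => linOf (F i))
          (fun i => ι.obj K ◁ (linIso x (F i)).hom ≫ c i) (linOf g) ≫ (linIso x g).hom
  | 0, g, f, h => by
    obtain ⟨φ, hφ, e⟩ := exists_linOf_cast x (Fin.sum_univ_zero (fun i : Fin 0 => n₀ (g i))).symm f
    refine ⟨φ, hφ, ?_⟩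
    rw [← e]
    change _ = _ ≫ kid ι K (𝟙_ D) ≫ 𝟙 _
    have e₁ : (ρ_ (ι.obj K)).hom ≫ counit ι K = kid ι K (𝟙_ D) := by
      rw [kid, unitors_equal, rightUnitor_naturality]
    change _ ≫ ι.obj K ◁ eqToHom _ ≫ (ρ_ _).hom ≫ counit ι K = _
    rw [e₁, Category.comp_id, ← whiskerLeft_comp_assoc]
    congr 2
    simp only [Category.assoc]
    have aux : ∀ {A B T : D} (φ : A ⟶ B) (p : B = T), φ ≫ 𝟙 B ≫ eqToHom p ≫ eqToHom p.symm = φ := by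
      rintro _ _ _ φ rfl
      simp
    exact aux φ (congrArg (tpow x) (Fin.sum_univ_zero (fun i : Fin 0 => n₀ (g i))).symm)
  | k + 1, g, f, h => by
    obtain ⟨φ₁, hφ₁, e₁⟩ := exists_linOf_cast x (Fin.sum_univ_castSucc fun i => n₀ (g i)).symm f
    obtain ⟨φ₂, hφ₂, e₂⟩ := exists_linOf_add x (∑ i : Fin k, n₀ (g i.castSucc)) (n₀ (g (Fin.last k)))
      fun i => f (i.cast (Fin.sum_univ_castSucc fun i => n₀ (g i)).symm)
    obtain ⟨φ₃, hφ₃, e₃⟩ := exists_kmulti n₀ F c k (fun i => g i.castSucc)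
      (fun i => f ((i.castAdd _).cast (Fin.sum_univ_castSucc fun i => n₀ (g i)).symm))
      (fun i j => by
        rw [← h]
        congr 1
        refine Fin.ext ?_
        rw [finSigmaFinEquiv_apply, Fin.val_cast, Fin.val_castAdd, finSigmaFinEquiv_apply]
        rfl)
    obtain ⟨φ₄, hφ₄, e₄⟩ := exists_linOf_congr x
      (f := fun j : Fin (n₀ (g (Fin.last k))) => f ((j.natAdd _).cast
        (Fin.sum_univ_castSucc fun i => n₀ (g i)).symm)) (g := F (g (Fin.last k)))
      (funext fun j => by
        rw [← h]
        congr 1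
        refine Fin.ext ?_
        rw [finSigmaFinEquiv_apply, Fin.val_cast, Fin.val_natAdd]
        rfl)
    refine ⟨_, (hφ₁.comp hφ₂).comp (hφ₃.tensor hφ₄), ?_⟩
    refine kmulti_aux ?_ e₃ e₄
    rw [← e₁]
    simp only [Category.assoc, eqToHom_trans_assoc, eqToHom_refl, Category.id_comp]
    exact congrArg (φ₁ ≫ ·) e₂.symm

end Multi

end OTree

open OTree CohFam

section Action

variable {D : Type u} [Category.{v} D] [MonoidalCategory D] [SymmetricCategory D]
variable {ι : SSet.{v} ⥤ D} [ι.Monoidal] {K : SSet.{v}} {x : D}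
variable {P : SetOperad.{v}} {act : ∀ n : ℕ, P.obj (Fin n) → (ι.obj K ⊗ tpow x n ⟶ x)}

theorem IsAction.act_perm (h : IsAction ι K P x act) {n : ℕ} (σ : Equiv.Perm (Fin n))
    (o : P.obj (Fin n)) {X : Type} {g : Fin n → X} (hg : Function.Injective g)
    {φ : tens x (linOf (g ∘ σ.symm)) ⟶ tens x (linOf g)} (hφ : Coh x φ) :
    ι.obj K ◁ (linIso x (g ∘ σ.symm)).hom ≫ act n (P.act σ o) =
      ι.obj K ◁ (φ ≫ (linIso x g).hom) ≫ act n o := by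
  have swp : ∀ (N : ℕ) (q p : ℕ) (_ : N = q + 2 + p) (i j : Fin N) (_ : i.1 = q) (_ : j.1 = q + 1)
      (o : P.obj (Fin N)) (g : Fin N → X) (_ : Function.Injective g)
      (φ : tens x (linOf (g ∘ (Equiv.swap i j).symm)) ⟶ tens x (linOf g)) (_ : Coh x φ),
      ι.obj K ◁ (linIso x (g ∘ (Equiv.swap i j).symm)).hom ≫ act N (P.act (Equiv.swap i j) o) =
        ι.obj K ◁ (φ ≫ (linIso x g).hom) ≫ act N o := by
    rintro _ q p rfl ⟨i, hi'⟩ ⟨j, hj'⟩ hi hj o g hg φ hφ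
    obtain rfl : i = q := hi
    obtain rfl : j = i + 1 := hj
    obtain ⟨ψ, hψ, e⟩ := exists_linOf_swap x i p (g ∘ (Equiv.swap _ _).symm) g (fun i => rfl)
    rw [h.perm, hφ.unique hψ (enum_linOf (hg.comp (Equiv.injective _))).nodup, e,
      whiskerLeft_comp_assoc]
  induction n with
  | zero =>
    obtain rfl : σ = Equiv.refl _ := Subsingleton.elim _ _
    rw [P.act_refl, hφ.unique (.id (linOf g)) (enum_linOf hg).nodup]
    congr 2
    exact (Category.id_comp _).symm
  | succ n _ =>
    have hσ : σ ∈ Submonoid.closure (Set.range fun i : Fin n => Equiv.swap i.castSucc i.succ) := by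
      rw [Equiv.Perm.mclosure_swap_castSucc_succ]; trivial
    induction hσ using Submonoid.closure_induction generalizing g o with
    | mem σ hσ =>
      obtain ⟨i, rfl⟩ := hσ
      exact swp (n + 1) i (n - 1 - i) (by omega) i.castSucc i.succ rfl (by simp) o g hg φ hφ
    | one =>
      have e : P.act (1 : Equiv.Perm (Fin (n + 1))) o = o := P.act_refl o
      rw [e, hφ.unique (.id (linOf g)) (enum_linOf hg).nodup]
      congr 2
      exact (Category.id_comp _).symm
    | mul σ τ _ _ hσ hτ =>
      have e : P.act (σ * τ) o = P.act σ (P.act τ o) := P.act_trans τ σ o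
      have hg' : Function.Injective (g ∘ τ.symm) := hg.comp (Equiv.injective _)
      have hg'' : Function.Injective (g ∘ (σ * τ).symm) := hg.comp (Equiv.injective _)
      have en : ∀ {n : ℕ} (f : Fin n → X) (ρ : Equiv.Perm (Fin n)) (_ : Function.Injective f),
          (linOf (f ∘ ρ)).labels.Perm (linOf f).labels := fun f ρ hf =>
        ((enum_linOf hf).comp_equiv ρ).perm (enum_linOf (hf.comp ρ.injective)) |>.symm
      obtain ⟨φ₁, hφ₁⟩ := exists_coh x (en (g ∘ τ.symm) σ.symm hg')
      obtain ⟨φ₂, hφ₂⟩ := exists_coh x (en g τ.symm hg)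
      rw [e]
      refine (hσ (P.act τ o) hg' hφ₁).trans ?_
      rw [whiskerLeft_comp_assoc, hτ o hg hφ₂, ← whiskerLeft_comp_assoc, ← Category.assoc]
      rw [(hφ₁.comp hφ₂).unique hφ (enum_linOf hg'').nodup]
      rfl

/-- The value of the operation `o` on the tensor power labelled by means of `e`. -/
theorem IsAction.act_labelled (h : IsAction ι K P x act) {S : Type} [Finite S] (o : P.obj S)
    {n n' : ℕ} (e : S ≃ Fin n) (e' : S ≃ Fin n') {φ : tens x (linOf e'.symm) ⟶ tens x (linOf e.symm)}
    (hφ : Coh x φ) : ι.obj K ◁ (linIso x e'.symm).hom ≫ act n' (P.act e' o) =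
      ι.obj K ◁ (φ ≫ (linIso x e.symm).hom) ≫ act n (P.act e o) := by
  obtain rfl : n = n' := by simpa using Nat.card_congr (e.symm.trans e')
  obtain ⟨σ, rfl⟩ : ∃ σ : Equiv.Perm (Fin n), e' = e.trans σ := ⟨e.symm.trans e', by ext; simp⟩
  rw [P.act_trans]
  exact h.act_perm σ (P.act e o) e.symm.injective hφ

variable [PreservesBraiding ι]

/-- The coherent family determined by an operation. -/
noncomputable def IsAction.fam (_ : IsAction ι K P x act) {S : Type} [Finite S] (o : P.obj S) :
    CohFam ι K x S :=
  mk' (isOrd_linOf (Finite.equivFin S).symm)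
    (ι.obj K ◁ (linIso x (Finite.equivFin S).symm).hom ≫ act _ (P.act (Finite.equivFin S) o))

theorem IsAction.fam_val (h : IsAction ι K P x act) {S : Type} [Finite S] (o : P.obj S)
    {n : ℕ} (e : S ≃ Fin n) : (h.fam o).val (linOf e.symm) (isOrd_linOf e.symm) =
      ι.obj K ◁ (linIso x e.symm).hom ≫ act n (P.act e o) := by
  obtain ⟨φ, hφ⟩ := exists_coh x
    ((isOrd_linOf e.symm).perm (isOrd_linOf (Finite.equivFin S).symm))
  rw [(h.fam o).coh (isOrd_linOf e.symm) (isOrd_linOf (Finite.equivFin S).symm) hφ,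
    h.act_labelled o (Finite.equivFin S) e hφ, whiskerLeft_comp_assoc]
  congr 1
  exact mk'_val _ _

theorem IsAction.fam_val_fin (h : IsAction ι K P x act) {n : ℕ} (o : P.obj (Fin n)) :
    (h.fam o).val (linOf fun i => i) (isOrd_linOf (Equiv.refl _)) =
      ι.obj K ◁ (linIso x fun i : Fin n => i).hom ≫ act n o := by
  refine (h.fam_val o (Equiv.refl (Fin n))).trans ?_
  rw [P.act_refl]
  rfl

theorem CohFam.ev_linOf {S X : Type} [Finite S] (a : CohFam ι K x S) {n : ℕ} (e : Fin n ≃ S)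
    {a' : ι.obj K ⊗ tpow x n ⟶ x}
    (ha : a.val (linOf e) (isOrd_linOf e) = ι.obj K ◁ (linIso x e).hom ≫ a') {j : S → X}
    {f : Fin n → X} (hf : f = j ∘ e) (h : Enum j (linOf f)) :
    a.ev j (linOf f) h = ι.obj K ◁ (linIso x f).hom ≫ a' := by
  subst hf
  obtain ⟨φ, hφ, e'⟩ := exists_linOf_map x j e
  rw [a.ev_eq h (isOrd_linOf e) hφ, ha, ← e']
  simp

theorem IsAction.fam_act (h : IsAction ι K P x act) {S T : Type} [Finite S] [Finite T] (σ : S ≃ T)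
    (o : P.obj S) : h.fam (P.act σ o) = CohFam.act σ (h.fam o) := by
  let e := Finite.equivFin T
  refine ext_of_val (isOrd_linOf e.symm) ?_
  rw [h.fam_val, ← P.act_trans]
  exact ((h.fam o).ev_linOf (σ.trans e).symm (h.fam_val o (σ.trans e)) (by ext; simp)
    ((isOrd_linOf e.symm).enum σ)).symm

theorem IsAction.fam_one (h : IsAction ι K P x act) : h.fam P.one = CohFam.one := by
  refine ext_of_val (isOrd_linOf (Equiv.refl (Fin 1))) ((h.fam_val_fin P.one).trans ?_)
  refine Eq.trans ?_ (CohFam.coh _ (isOrd_linOf (Equiv.refl (Fin 1))) isOrd_leaf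
    (Coh.left_unit (leaf (0 : Fin 1)))).symm
  refine Eq.trans ?_ (congrArg (_ ≫ ·) (one_val isOrd_leaf).symm)
  rw [h.one]
  have e : (linIso x fun i : Fin 1 => i).hom = 𝟙 (𝟙_ D ⊗ x) := id_whiskerRight _ _
  refine (congrArg (fun z => ι.obj K ◁ z ≫ _) e).trans ?_
  refine ((congrArg (· ≫ _) (whiskerLeft_id _ _)).trans (Category.id_comp _)).trans ?_
  refine Eq.trans ?_ (whiskerLeft_kid (λ_ x).hom).symm
  rw [kid, Category.assoc]

theorem CohFam.comp_fin (k : ℕ) (n : Fin k → ℕ) (a : CohFam ι K x (Fin k))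
    (b : ∀ i, CohFam ι K x (Fin (n i))) (a' : ι.obj K ⊗ tpow x k ⟶ x)
    (b' : ∀ i, ι.obj K ⊗ tpow x (n i) ⟶ x)
    (ha : a.val (linOf fun i => i) (isOrd_linOf (Equiv.refl _)) =
      ι.obj K ◁ (linIso x fun i : Fin k => i).hom ≫ a')
    (hb : ∀ i, (b i).val (linOf fun i => i) (isOrd_linOf (Equiv.refl _)) =
      ι.obj K ◁ (linIso x fun i : Fin (n i) => i).hom ≫ b' i) :
    (CohFam.comp a b).val (linOf (finSigmaFinEquiv (n := n)).symm) (isOrd_linOf _) =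
      ι.obj K ◁ (linIso x finSigmaFinEquiv.symm).hom ≫ kcomp ι K (kmulti ι K x k n b') a' := by
  obtain ⟨φ, hφ, e⟩ := exists_kmulti ι K n (fun i j => (⟨i, j⟩ : Σ i, Fin (n i))) b' k (fun i => i)
    (finSigmaFinEquiv (n := n)).symm (fun i j => by simp)
  have hr : (linOf fun i : Fin k => i).IsOrd := isOrd_linOf (Equiv.refl _)
  have hQ : ∀ i, Enum (Sigma.mk i) (linOf fun j => (⟨i, j⟩ : Σ i, Fin (n i))) := fun i =>
    enum_linOf sigma_mk_injective
  have hs := enum_sigma hr hQ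
  rw [CohFam.coh _ (isOrd_linOf _) hs hφ, comp_val a b hr hQ, ha, kcomp_whiskerLeft,
    whiskerLeft_kcomp, whiskerLeft_kcomp, e]
  congr 4
  funext i
  exact (b i).ev_linOf (Equiv.refl _) (hb i) rfl (hQ i)

theorem IsAction.fam_comp_fin (h : IsAction ι K P x act) (k : ℕ) (n : Fin k → ℕ) (o : P.obj (Fin k))
    (b : ∀ i, P.obj (Fin (n i))) :
    h.fam (P.comp o b) = CohFam.comp (h.fam o) fun i => h.fam (b i) := by
  refine ext_of_val (isOrd_linOf (finSigmaFinEquiv (n := n)).symm) ?_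
  rw [h.fam_val (P.comp o b) finSigmaFinEquiv, h.comp,
    CohFam.comp_fin k n _ _ _ _ (h.fam_val_fin o) fun i => h.fam_val_fin (b i)]

/-- A map of operads is determined by its effect on composites of operations with inputs in the
standard finite sets. -/
theorem SetOperad.app_comp_of_fin {P Q : SetOperad.{v}}
    (F : ∀ (S : Type) [Finite S], P.obj S → Q.obj S)
    (hact : ∀ {S T : Type} [Finite S] [Finite T] (σ : S ≃ T) (o : P.obj S),
      F T (P.act σ o) = Q.act σ (F S o))
    (hcomp : ∀ (k : ℕ) (n : Fin k → ℕ) (o : P.obj (Fin k)) (b : ∀ i, P.obj (Fin (n i))),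
      F _ (P.comp o b) = Q.comp (F _ o) fun i => F _ (b i))
    {T : Type} [Finite T] {Y : T → Type} [∀ t, Finite (Y t)] (o : P.obj T) (b : ∀ t, P.obj (Y t)) :
    F _ (P.comp o b) = Q.comp (F _ o) fun t => F _ (b t) := by
  let e := Finite.equivFin T
  let e' := fun t => Finite.equivFin (Y t)
  obtain ⟨o, rfl⟩ : ∃ o', o = P.act e.symm o' := ⟨P.act e o, by
    rw [← P.act_trans, Equiv.self_trans_symm, P.act_refl]⟩
  obtain ⟨b, rfl⟩ : ∃ b' : ∀ t, P.obj (Fin (Nat.card (Y t))),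
      b = fun t => P.act (e' t).symm (b' t) :=
    ⟨fun t => P.act (e' t) (b t), funext fun t => by
      rw [← P.act_trans, Equiv.self_trans_symm, P.act_refl]⟩
  simp only [hact]
  rw [P.comp_act, P.act_comp, hact, hact, hcomp, Q.comp_act, Q.act_comp]

/-- An action of `P` on `x` as a map of operads. -/
noncomputable def IsAction.hom (h : IsAction ι K P x act) : P ⟶ endOp ι K x :=
  ({ app := fun o => h.fam o
     app_act := fun σ o => h.fam_act σ o
     app_one := h.fam_one
     app_comp := fun o b => SetOperad.app_comp_of_fin (Q := endOp ι K x) (fun _ _ o => h.fam o)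
       (fun σ o => h.fam_act σ o) (fun k n o b => h.fam_comp_fin k n o b) o b } :
    SetOperad.Hom P (endOp ι K x))

/-- The operations given by a map to the endomorphism operad. -/
def homAct (f : P ⟶ endOp ι K x) (n : ℕ) (o : P.obj (Fin n)) : ι.obj K ⊗ tpow x n ⟶ x :=
  ι.obj K ◁ (linIso x fun i : Fin n => i).inv ≫
    CohFam.val (SetOperad.Hom.app f o) (linOf fun i => i) (isOrd_linOf (Equiv.refl _))

theorem val_eq_homAct (f : P ⟶ endOp ι K x) {n : ℕ} (o : P.obj (Fin n)) :
    CohFam.val (SetOperad.Hom.app f o) (linOf fun i => i) (isOrd_linOf (Equiv.refl _)) =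
      ι.obj K ◁ (linIso x fun i : Fin n => i).hom ≫ homAct f n o := by
  rw [homAct, ← whiskerLeft_comp_assoc, Iso.hom_inv_id, MonoidalCategory.whiskerLeft_id,
    Category.id_comp]

theorem IsAction.homAct_hom (h : IsAction ι K P x act) (n : ℕ) (o : P.obj (Fin n)) :
    homAct h.hom n o = act n o := by
  rw [homAct]
  refine (congrArg (_ ≫ ·) (h.fam_val_fin o)).trans ?_
  rw [← whiskerLeft_comp_assoc, Iso.inv_hom_id, MonoidalCategory.whiskerLeft_id, Category.id_comp]

theorem homAct_act (f : P ⟶ endOp ι K x) {n m : ℕ} (σ : Fin m ≃ Fin n) (o : P.obj (Fin m))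
    {φ : tens x (linOf fun i : Fin n => i) ⟶ tens x (linOf σ)} (hφ : Coh x φ) :
    ι.obj K ◁ (linIso x fun i : Fin n => i).hom ≫ homAct f n (P.act σ o) =
      ι.obj K ◁ (φ ≫ (linIso x σ).hom) ≫ homAct f m o := by
  rw [← val_eq_homAct, SetOperad.Hom.app_act]
  refine ((SetOperad.Hom.app f o).ev_coh ((isOrd_linOf (Equiv.refl _)).enum σ)
    ((isOrd_linOf σ).enum σ) hφ).trans ?_
  rw [whiskerLeft_comp_assoc]
  congr 1
  exact (SetOperad.Hom.app f o).ev_linOf (Equiv.refl _) (val_eq_homAct f o) rfl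
    ((isOrd_linOf σ).enum σ)

theorem isAction_homAct (f : P ⟶ endOp ι K x) : IsAction ι K P x (homAct f) where
  one := by
    rw [homAct, SetOperad.Hom.app_one]
    refine (congrArg (_ ≫ ·) (CohFam.coh _ (isOrd_linOf (Equiv.refl (Fin 1))) isOrd_leaf
      (Coh.left_unit (leaf (0 : Fin 1))))).trans ?_
    refine (congrArg (fun z => _ ≫ _ ≫ z) (one_val isOrd_leaf)).trans ?_
    have e : (linIso x fun i : Fin 1 => i).inv = 𝟙 (𝟙_ D ⊗ x) := id_whiskerRight _ _
    refine (congrArg (fun z => ι.obj K ◁ z ≫ _) e).trans ?_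
    refine ((congrArg (· ≫ _) (whiskerLeft_id _ _)).trans (Category.id_comp _)).trans ?_
    refine (whiskerLeft_kid (λ_ x).hom).trans ?_
    rw [kid, Category.assoc]
  perm q p o := by
    obtain ⟨φ, hφ, e⟩ := exists_linOf_swap x q p (fun i => i)
      (Equiv.swap (⟨q, by omega⟩ : Fin (q + 2 + p)) ⟨q + 1, by omega⟩) (fun i => by simp)
    have h := homAct_act f _ o hφ
    rw [e, whiskerLeft_comp_assoc] at h
    have : IsIso (ι.obj K ◁ (linIso x fun i : Fin (q + 2 + p) => i).hom) := inferInstance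
    exact (cancel_epi _).1 h
  comp k n o b := by
    have h := CohFam.comp_fin k n (SetOperad.Hom.app f o) (fun i => SetOperad.Hom.app f (b i)) _ _
      (val_eq_homAct f o) fun i => val_eq_homAct f (b i)
    have h₂ := SetOperad.Hom.app_comp f o b
    have h₃ := val_eq_homAct f (P.act finSigmaFinEquiv (P.comp o b))
    rw [SetOperad.Hom.app_act, h₂] at h₃
    have h₄ := CohFam.ev_linOf (CohFam.comp (SetOperad.Hom.app f o) fun i => SetOperad.Hom.app f (b i))
      (finSigmaFinEquiv (n := n)).symm h (j := finSigmaFinEquiv (n := n)) (f := fun i => i)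
      (by ext; simp) ((isOrd_linOf (Equiv.refl _)).enum _)
    exact (cancel_epi (ι.obj K ◁ (linIso x fun i : Fin (∑ i, n i) => i).hom)).1 (h₃.symm.trans h₄)

end Action

end

section

open OTree CohFam

section Relative

variable {D : Type u} [Category.{v} D] [MonoidalCategory D] [SymmetricCategory D]
variable {ι : SSet.{v} ⥤ D} [ι.Monoidal] {K : SSet.{v}} {x y : D} {S T X : Type}

namespace CohFam

theorem restr_id (a : CohFam ι K x S) : a.restr (𝟙 K) = a := by
  refine CohFam.ext (funext fun s => funext fun hs => ?_)
  change ι.map (𝟙 K) ▷ _ ≫ a.val s hs = _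
  rw [ι.map_id, id_whiskerRight, Category.id_comp]

theorem restr_eq_self {r : K ⟶ K} (h : r = 𝟙 K) (a : CohFam ι K x S) : a.restr r = a := by
  rw [h, restr_id]

theorem restr_restr {K' K'' : SSet.{v}} (r : K' ⟶ K) (r' : K'' ⟶ K') (a : CohFam ι K x S) :
    a.restr (r' ≫ r) = (a.restr r).restr r' := by
  refine CohFam.ext (funext fun s => funext fun hs => ?_)
  change ι.map (r' ≫ r) ▷ _ ≫ a.val s hs = ι.map r' ▷ _ ≫ ι.map r ▷ _ ≫ a.val s hs
  rw [ι.map_comp, comp_whiskerRight_assoc]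

/-- The families `a` on `x` and `b` on `y` are compatible with `η`. -/
def Rel (η : y ⟶ x) (a : CohFam ι K x S) (b : CohFam ι K y S) : Prop :=
  ∀ s hs, b.val s hs ≫ η = ι.obj K ◁ tensMap η s ≫ a.val s hs

variable {η : y ⟶ x}

theorem Rel.of_val {a : CohFam ι K x S} {b : CohFam ι K y S} {s : OTree S} (hs : s.IsOrd)
    (h : b.val s hs ≫ η = ι.obj K ◁ tensMap η s ≫ a.val s hs) : Rel η a b := by
  intro t ht
  obtain ⟨φ, hφ⟩ := exists_coh x (ht.perm hs)
  obtain ⟨ψ, hψ⟩ := exists_coh y (ht.perm hs)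
  rw [a.coh ht hs hφ, b.coh ht hs hψ, Category.assoc, h, ← whiskerLeft_comp_assoc,
    ← whiskerLeft_comp_assoc, hψ.tensMap η hφ ht.1]

theorem Rel.restr {K' : SSet.{v}} (r : K' ⟶ K) {a : CohFam ι K x S} {b : CohFam ι K y S}
    (h : Rel η a b) : Rel η (a.restr r) (b.restr r) := by
  intro s hs
  change (ι.map r ▷ _ ≫ b.val s hs) ≫ η = _ ≫ ι.map r ▷ _ ≫ a.val s hs
  rw [Category.assoc, h, whisker_exchange_assoc]

variable [Finite S] [Finite T]

theorem Rel.ev {a : CohFam ι K x S} {b : CohFam ι K y S} (h : Rel η a b) (j : S → X) (s : OTree X)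
    (hj : Enum j s) : b.ev j s hj ≫ η = ι.obj K ◁ tensMap η s ≫ a.ev j s hj := by
  obtain ⟨s₀, h₀⟩ := exists_isOrd S
  obtain ⟨φ, hφ⟩ := exists_coh x (hj.perm (h₀.enum_map hj.inj))
  obtain ⟨ψ, hψ⟩ := exists_coh y (hj.perm (h₀.enum_map hj.inj))
  rw [a.ev_eq hj h₀ hφ, b.ev_eq hj h₀ hψ, Category.assoc, h, ← whiskerLeft_comp_assoc,
    ← whiskerLeft_comp_assoc, Category.assoc, mapIso_tensMap, ← Category.assoc,
    hψ.tensMap η hφ hj.nodup, Category.assoc]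

theorem Rel.act {a : CohFam ι K x S} {b : CohFam ι K y S} (h : Rel η a b) (σ : S ≃ T) :
    Rel η (a.act σ) (b.act σ) := fun s hs => h.ev σ s (hs.enum σ)

theorem Rel.one : Rel η (CohFam.one : CohFam ι K x (Fin 1)) CohFam.one := by
  refine Rel.of_val isOrd_leaf ?_
  rw [one_val, one_val]
  exact (whiskerLeft_kid η).symm

theorem Rel.comp {Y : T → Type} [∀ t, Finite (Y t)] {a : CohFam ι K x T} {b : CohFam ι K y T}
    (h : Rel η a b) {a' : ∀ t, CohFam ι K x (Y t)} {b' : ∀ t, CohFam ι K y (Y t)}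
    (h' : ∀ t, Rel η (a' t) (b' t)) : Rel η (CohFam.comp a a') (CohFam.comp b b') := by
  refine Rel.of_val (enum_sigma (isOrd_ord T) enum_ord) ?_
  rw [CohFam.comp, CohFam.comp, mk'_val, mk'_val, kcomp_comp, h, kcomp_whiskerLeft,
    kbind_tensMap η _ _ _ fun t => (h' t).ev _ _ _, whiskerLeft_kcomp]

end CohFam

variable {K' : SSet.{v}} (r : K' ⟶ K)

theorem CohFam.restr_act [Finite S] [Finite T] (σ : S ≃ T) (a : CohFam ι K x S) :
    (a.act σ).restr r = (a.restr r).act σ := by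
  refine CohFam.ext (funext fun s => funext fun hs => ?_)
  obtain ⟨s₀, h₀⟩ := exists_isOrd S
  obtain ⟨φ, hφ⟩ := exists_coh x ((hs.enum σ).perm (h₀.enum_map σ.injective))
  change ι.map r ▷ _ ≫ a.ev σ s (hs.enum σ) = (a.restr r).ev σ s (hs.enum σ)
  rw [a.ev_eq (hs.enum σ) h₀ hφ, (a.restr r).ev_eq (hs.enum σ) h₀ hφ]
  exact (whisker_exchange_assoc _ _ _).symm

theorem CohFam.restr_ev [Finite S] (a : CohFam ι K x S) (j : S → X) (s : OTree X) (h : Enum j s) :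
    ι.map r ▷ _ ≫ a.ev j s h = (a.restr r).ev j s h := by
  obtain ⟨s₀, h₀⟩ := exists_isOrd S
  obtain ⟨φ, hφ⟩ := exists_coh x (h.perm (h₀.enum_map h.inj))
  rw [a.ev_eq h h₀ hφ, (a.restr r).ev_eq h h₀ hφ]
  exact (whisker_exchange_assoc _ _ _).symm

theorem CohFam.restr_one : (CohFam.one : CohFam ι K x (Fin 1)).restr r = CohFam.one := by
  refine ext_of_val isOrd_leaf ?_
  refine Eq.trans ?_ (one_val isOrd_leaf).symm
  exact (congrArg (_ ≫ ·) (one_val isOrd_leaf)).trans (map_kid r x)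

theorem CohFam.restr_comp [Finite T] {Y : T → Type} [∀ t, Finite (Y t)] (a : CohFam ι K x T)
    (b : ∀ t, CohFam ι K x (Y t)) :
    (CohFam.comp a b).restr r = CohFam.comp (a.restr r) fun t => (b t).restr r := by
  refine ext_of_val (enum_sigma (isOrd_ord T) enum_ord) ?_
  refine Eq.trans (congrArg (_ ≫ ·) (mk'_val _ _)) (Eq.trans ?_ (mk'_val _ _).symm)
  rw [map_kcomp, map_kbind]
  simp only [restr_ev]
  rfl

variable [PreservesBraiding ι]

variable (ι K) in
/-- The operad of `K`-families of endomorphisms of `η : y ⟶ x`. -/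
noncomputable def relEndOp (η : y ⟶ x) : SetOperad.{v} where
  obj S := { p : CohFam ι K x S × CohFam ι K y S // Rel η p.1 p.2 }
  act σ p := ⟨(p.1.1.act σ, p.1.2.act σ), p.2.act σ⟩
  one := ⟨(CohFam.one, CohFam.one), Rel.one⟩
  comp p q := ⟨(CohFam.comp p.1.1 fun t => (q t).1.1, CohFam.comp p.1.2 fun t => (q t).1.2),
    p.2.comp fun t => (q t).2⟩
  act_refl p := Subtype.ext (Prod.ext ((endOp ι K x).act_refl p.1.1) ((endOp ι K y).act_refl p.1.2))
  act_trans σ τ p := Subtype.ext (Prod.ext ((endOp ι K x).act_trans σ τ p.1.1)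
    ((endOp ι K y).act_trans σ τ p.1.2))
  one_comp p := Subtype.ext (Prod.ext ((endOp ι K x).one_comp p.1.1) ((endOp ι K y).one_comp p.1.2))
  comp_one p := Subtype.ext (Prod.ext ((endOp ι K x).comp_one p.1.1) ((endOp ι K y).comp_one p.1.2))
  comp_assoc a b c := Subtype.ext (Prod.ext
    ((endOp ι K x).comp_assoc a.1.1 (fun t => (b t).1.1) fun t s => (c t s).1.1)
    ((endOp ι K y).comp_assoc a.1.2 (fun t => (b t).1.2) fun t s => (c t s).1.2))
  act_comp σ a b := Subtype.ext (Prod.ext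
    ((endOp ι K x).act_comp σ a.1.1 fun t => (b t).1.1)
    ((endOp ι K y).act_comp σ a.1.2 fun t => (b t).1.2))
  comp_act τ a b := Subtype.ext (Prod.ext
    ((endOp ι K x).comp_act τ a.1.1 fun t => (b t).1.1)
    ((endOp ι K y).comp_act τ a.1.2 fun t => (b t).1.2))

/-- Restriction along a map of simplicial sets. -/
noncomputable def endOpRestr (x : D) : endOp ι K x ⟶ endOp ι K' x :=
  ({ app := fun a => CohFam.restr r a
     app_act := fun σ a => restr_act r σ a
     app_one := restr_one r
     app_comp := fun a b => restr_comp r a b } : SetOperad.Hom (endOp ι K x) (endOp ι K' x))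

/-- Restriction along a map of simplicial sets. -/
noncomputable def relEndOpRestr (η : y ⟶ x) : relEndOp ι K η ⟶ relEndOp ι K' η :=
  ({ app := fun p => ⟨(p.1.1.restr r, p.1.2.restr r), p.2.restr r⟩
     app_act := fun σ p => Subtype.ext (Prod.ext (restr_act r σ p.1.1) (restr_act r σ p.1.2))
     app_one := Subtype.ext (Prod.ext (restr_one r) (restr_one r))
     app_comp := fun p q => Subtype.ext (Prod.ext (restr_comp r p.1.1 fun t => (q t).1.1)
      (restr_comp r p.1.2 fun t => (q t).1.2)) } :
    SetOperad.Hom (relEndOp ι K η) (relEndOp ι K' η))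

variable (K) in
/-- The projection to the endomorphisms of the target. -/
noncomputable def relEndOpFst (η : y ⟶ x) : relEndOp ι K η ⟶ endOp ι K x :=
  ({ app := fun p => p.1.1
     app_act := fun _ _ => rfl
     app_one := rfl
     app_comp := fun _ _ => rfl } : SetOperad.Hom (relEndOp ι K η) (endOp ι K x))

variable (K) in
/-- The projection to the endomorphisms of the source. -/
noncomputable def relEndOpSnd (η : y ⟶ x) : relEndOp ι K η ⟶ endOp ι K y :=
  ({ app := fun p => p.1.2
     app_act := fun _ _ => rfl
     app_one := rfl
     app_comp := fun _ _ => rfl } : SetOperad.Hom (relEndOp ι K η) (endOp ι K y))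

open Simplicial

variable (ι)

/-- The simplicial endomorphism operad of `x`. -/
noncomputable def endSOp (x : D) : SOperad.{v} where
  obj m := endOp ι (SSet.stdSimplex.obj m.unop) x
  map φ := endOpRestr (SSet.stdSimplex.map φ.unop) x
  map_id m := SetOperad.hom_ext' fun _ _ a =>
    restr_eq_self (SSet.stdSimplex.map_id m.unop) a
  map_comp φ ψ := SetOperad.hom_ext' fun S _ a => by
    change CohFam.restr (SSet.stdSimplex.map (ψ.unop ≫ φ.unop)) a = _
    rw [SSet.stdSimplex.map_comp]
    exact restr_restr _ _ a

/-- The simplicial endomorphism operad of `η`. -/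
noncomputable def relEndSOp (η : y ⟶ x) : SOperad.{v} where
  obj m := relEndOp ι (SSet.stdSimplex.obj m.unop) η
  map φ := relEndOpRestr (SSet.stdSimplex.map φ.unop) η
  map_id m := SetOperad.hom_ext' fun _ _ a => Subtype.ext <| Prod.ext
    (restr_eq_self (SSet.stdSimplex.map_id m.unop) a.1.1)
    (restr_eq_self (SSet.stdSimplex.map_id m.unop) a.1.2)
  map_comp φ ψ := SetOperad.hom_ext' fun S _ a => Subtype.ext <| Prod.ext (by
      change CohFam.restr (SSet.stdSimplex.map (ψ.unop ≫ φ.unop)) a.1.1 = _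
      rw [SSet.stdSimplex.map_comp]; exact restr_restr _ _ _) (by
      change CohFam.restr (SSet.stdSimplex.map (ψ.unop ≫ φ.unop)) a.1.2 = _
      rw [SSet.stdSimplex.map_comp]; exact restr_restr _ _ _)

/-- The projection from the endomorphisms of `η` to those of its source. -/
noncomputable def relEndSOpSnd (η : y ⟶ x) : relEndSOp ι η ⟶ endSOp ι y where
  app m := relEndOpSnd _ η
  naturality _ _ _ := rfl

variable {O : SOperad.{v}} {L : SSet.{v}}

variable {ι}

theorem IsAction.fam_congr {P P' : SetOperad.{v}} {K : SSet.{v}}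
    {act : ∀ n : ℕ, P.obj (Fin n) → (ι.obj K ⊗ tpow x n ⟶ x)}
    {act' : ∀ n : ℕ, P'.obj (Fin n) → (ι.obj K' ⊗ tpow x n ⟶ x)} (h : IsAction ι K P x act)
    (h' : IsAction ι K' P' x act') (r : K' ⟶ K) (f : P ⟶ P')
    (hf : ∀ n o, act' n (SetOperad.Hom.app f o) = ι.map r ▷ _ ≫ act n o) {S : Type} [Finite S]
    (o : P.obj S) : h'.fam (SetOperad.Hom.app f o) = (h.fam o).restr r := by
  let e := Finite.equivFin S
  refine ext_of_val (isOrd_linOf e.symm) ?_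
  rw [h'.fam_val, ← SetOperad.Hom.app_act, hf]
  refine Eq.trans ?_ (congrArg (ι.map r ▷ _ ≫ ·) (h.fam_val o e)).symm
  exact whisker_exchange_assoc _ _ _

theorem IsAction.rel_fam {P : SetOperad.{v}} {K : SSet.{v}}
    {act : ∀ n : ℕ, P.obj (Fin n) → (ι.obj K ⊗ tpow x n ⟶ x)}
    {act' : ∀ n : ℕ, P.obj (Fin n) → (ι.obj K ⊗ tpow y n ⟶ y)} (h : IsAction ι K P x act)
    (h' : IsAction ι K P y act') (η : y ⟶ x)
    (hη : ∀ n o, act' n o ≫ η = ι.obj K ◁ tpowMap η n ≫ act n o) {S : Type} [Finite S]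
    (o : P.obj S) : Rel η (h.fam o) (h'.fam o) := by
  let e := Finite.equivFin S
  refine Rel.of_val (isOrd_linOf e.symm) ?_
  rw [h'.fam_val, h.fam_val, Category.assoc, hη, ← whiskerLeft_comp_assoc, ← whiskerLeft_comp_assoc,
    linIso_tensMap]

theorem Rel.homAct {P : SetOperad.{v}} {K : SSet.{v}} {η : y ⟶ x} (f : P ⟶ relEndOp ι K η) (n : ℕ)
    (o : P.obj (Fin n)) : homAct (f ≫ relEndOpSnd K η) n o ≫ η =
      ι.obj K ◁ tpowMap η n ≫ homAct (f ≫ relEndOpFst K η) n o := by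
  have h : Rel η _ _ := (SetOperad.Hom.app f o).2
  have h' := h (linOf fun i => i) (isOrd_linOf (Equiv.refl (Fin n)))
  have e₁ := val_eq_homAct (f ≫ relEndOpFst K η) o
  have e₂ := val_eq_homAct (f ≫ relEndOpSnd K η) o
  have : IsIso (ι.obj K ◁ (linIso y fun i : Fin n => i).hom) := inferInstance
  refine (cancel_epi (ι.obj K ◁ (linIso y fun i : Fin n => i).hom)).1 ?_
  rw [← Category.assoc]
  refine (congrArg (· ≫ η) e₂).symm.trans (h'.trans ((congrArg (_ ≫ ·) e₁).trans ?_))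
  rw [← whiskerLeft_comp_assoc, ← whiskerLeft_comp_assoc, linIso_tensMap]

/-- An algebra structure as a map to the endomorphism operad. -/
noncomputable def OAlgebra.hom (θ : OAlgebra ι O y) : O ⟶ endSOp ι y where
  app m := (θ.isAction m).hom
  naturality m m' φ := SetOperad.hom_ext' fun _ _ o =>
    (θ.isAction m).fam_congr (θ.isAction m') (SSet.stdSimplex.map φ.unop) (O.map φ)
      (fun n o => θ.naturality φ n o) o

end Relative

end

section

open Functor.LaxMonoidal Functor.OplaxMonoidal

section Transport

variable {C : Type u} [Category.{v} C] [MonoidalCategory C] [SymmetricCategory C]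
variable {D : Type u'} [Category.{v} D] [MonoidalCategory D] [SymmetricCategory D]
variable (ι : SSet.{v} ⥤ C) [ι.Monoidal] (G : C ⥤ D) [G.Braided] {K : SSet.{v}}

theorem counit_comp : counit (ι ⋙ G) K = G.map (counit ι K) ≫ η G := by
  unfold counit
  rw [comp_η, G.map_comp, Category.assoc]
  rfl

theorem diagonal_comp : diagonal (ι ⋙ G) K = G.map (diagonal ι K) ≫ δ G _ _ := by
  unfold diagonal
  rw [comp_δ, G.map_comp, Category.assoc]
  rfl

variable {ι}

/-- The image under `G` of a `K`-family of morphisms. -/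
def kmap {x y : C} (f : ι.obj K ⊗ x ⟶ y) : (ι ⋙ G).obj K ⊗ G.obj x ⟶ G.obj y :=
  μ G (ι.obj K) x ≫ G.map f

theorem kmap_whiskerLeft {x x' y : C} (a : x' ⟶ x) (f : ι.obj K ⊗ x ⟶ y) :
    (ι ⋙ G).obj K ◁ G.map a ≫ kmap G f = kmap G (ι.obj K ◁ a ≫ f) := by
  unfold kmap
  rw [G.map_comp, ← μ_natural_right_assoc]
  rfl

theorem kmap_comp {x y y' : C} (f : ι.obj K ⊗ x ⟶ y) (a : y ⟶ y') :
    kmap G f ≫ G.map a = kmap G (f ≫ a) := by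
  unfold kmap
  rw [G.map_comp, Category.assoc]

theorem kmap_kcomp {x y z : C} (f : ι.obj K ⊗ x ⟶ y) (g : ι.obj K ⊗ y ⟶ z) :
    kcomp (ι ⋙ G) K (kmap G f) (kmap G g) = kmap G (kcomp ι K f g) := by
  have h : ∀ {A : C} (d : A ⟶ ι.obj K ⊗ ι.obj K), (G.map d ≫ δ G _ _) ▷ G.obj x ≫ (α_ _ _ _).hom ≫
      G.obj (ι.obj K) ◁ (μ G _ _ ≫ G.map f) ≫ μ G _ _ ≫ G.map g =
      μ G _ _ ≫ G.map (d ▷ x ≫ (α_ _ _ _).hom ≫ ι.obj K ◁ f ≫ g) := by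
    intro A d
    simp only [MonoidalCategory.whiskerLeft_comp, Category.assoc, G.map_comp, comp_whiskerRight]
    rw [μ_natural_right_assoc, ← μ_natural_left_assoc]
    congr 1
    rw [← Functor.LaxMonoidal.associativity_assoc, ← comp_whiskerRight_assoc, Functor.Monoidal.δ_μ, id_whiskerRight,
      Category.id_comp]
  rw [kcomp, diagonal_comp]
  exact h _

theorem kmap_ktensor {x x' y y' : C} (f : ι.obj K ⊗ x ⟶ y) (g : ι.obj K ⊗ x' ⟶ y') :
    ktensor (ι ⋙ G) K (kmap G f) (kmap G g) ≫ μ G y y' =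
      (ι ⋙ G).obj K ◁ μ G x x' ≫ kmap G (ktensor ι K f g) := by
  have h : ∀ {A : C} (d : A ⟶ ι.obj K ⊗ ι.obj K), ((G.map d ≫ δ G _ _) ▷ (G.obj x ⊗ G.obj x') ≫
      tensorμ _ _ _ _ ≫ ((μ G _ _ ≫ G.map f) ⊗ₘ (μ G _ _ ≫ G.map g))) ≫ μ G _ _ =
      G.obj A ◁ μ G x x' ≫ μ G _ _ ≫ G.map (d ▷ (x ⊗ x') ≫ tensorμ _ _ _ _ ≫ (f ⊗ₘ g)) := by
    intro A d
    simp only [Category.assoc, G.map_comp, comp_whiskerRight, ← tensorHom_comp_tensorHom]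
    rw [μ_natural]
    have e := tensorμ_comp_μ_tensorHom_μ_comp_μ G (ι.obj K) (ι.obj K) x x'
    rw [reassoc_of% e]
    rw [← μ_natural_left_assoc, whisker_exchange_assoc]
    congr 1
    rw [MonoidalCategory.tensorHom_def_assoc, ← comp_whiskerRight_assoc, Functor.Monoidal.δ_μ,
      id_whiskerRight, Category.id_comp]
  rw [ktensor, diagonal_comp]
  exact h _

/-- The comparison between the tensor powers of `G y` and of `y`. -/
def tpowFun (y : C) : ∀ n, tpow (G.obj y) n ⟶ G.obj (tpow y n)
  | 0 => ε G
  | n + 1 => tpowFun y n ▷ _ ≫ μ G _ _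

theorem tpowFun_eqToHom (y : C) {m n : ℕ} (h : m = n) :
    tpowFun G y m ≫ G.map (eqToHom (congrArg (tpow y) h)) =
      eqToHom (congrArg (tpow (G.obj y)) h) ≫ tpowFun G y n := by
  subst h
  simp

theorem tpowFun_add (y : C) (m : ℕ) : ∀ n, (tpowFun G y m ⊗ₘ tpowFun G y n) ≫ μ G _ _ ≫
    G.map (tpowAdd y m n).hom = (tpowAdd (G.obj y) m n).hom ≫ tpowFun G y (m + n)
  | 0 => by
    have h : (tpowFun G y m ⊗ₘ ε G) ≫ μ G _ _ ≫ G.map (ρ_ (tpow y m)).hom =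
        (ρ_ (tpow (G.obj y) m)).hom ≫ tpowFun G y m := by
      rw [MonoidalCategory.tensorHom_def, Category.assoc, ← Functor.LaxMonoidal.right_unitality, rightUnitor_naturality]
    exact h
  | n + 1 => by
    have h := tpowFun_add y m n
    have h' : (tpowFun G y m ⊗ₘ (tpowFun G y n ▷ G.obj y ≫ μ G _ _)) ≫ μ G _ _ ≫
        G.map ((α_ _ _ _).inv ≫ (tpowAdd y m n).hom ▷ y) =
        ((α_ _ _ _).inv ≫ (tpowAdd (G.obj y) m n).hom ▷ G.obj y) ≫
          tpowFun G y (m + n) ▷ G.obj y ≫ μ G _ _ := by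
      rw [Category.assoc, ← comp_whiskerRight_assoc, ← h, G.map_comp, comp_whiskerRight,
        comp_whiskerRight, Category.assoc, Category.assoc, μ_natural_left]
      have e₀ : (α_ _ _ _).inv ≫ (tpowFun G y m ⊗ₘ tpowFun G y n) ▷ G.obj y =
          (tpowFun G y m ⊗ₘ tpowFun G y n ▷ G.obj y) ≫ (α_ _ _ _).inv := by
        rw [← tensorHom_id, ← associator_inv_naturality, tensorHom_id]
      rw [reassoc_of% e₀]
      have e : (tpowFun G y m ⊗ₘ (tpowFun G y n ▷ G.obj y ≫ μ G (tpow y n) y)) =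
          (tpowFun G y m ⊗ₘ tpowFun G y n ▷ G.obj y) ≫ _ ◁ μ G (tpow y n) y := by
        rw [← id_tensorHom, tensorHom_comp_tensorHom, Category.comp_id]
      rw [e, Category.assoc, Functor.LaxMonoidal.associativity_inv_assoc]
    exact h'

theorem tpowFun_swap (y : C) (q : ℕ) : ∀ p, tpowFun G y (q + 2 + p) ≫ G.map (tpowSwap y q p) =
    tpowSwap (G.obj y) q p ≫ tpowFun G y (q + 2 + p)
  | 0 => by
    have h : ((tpowFun G y q ▷ G.obj y ≫ μ G _ _) ▷ G.obj y ≫ μ G _ _) ≫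
        G.map ((α_ (tpow y q) y y).hom ≫ tpow y q ◁ (β_ y y).hom ≫ (α_ (tpow y q) y y).inv) =
        ((α_ _ _ _).hom ≫ tpow (G.obj y) q ◁ (β_ _ _).hom ≫ (α_ _ _ _).inv) ≫
          (tpowFun G y q ▷ G.obj y ≫ μ G _ _) ▷ G.obj y ≫ μ G _ _ := by
      simp only [comp_whiskerRight, Category.assoc, G.map_comp]
      have e := Functor.LaxMonoidal.associativity_inv (F := G) (tpow y q) y y
      rw [Functor.LaxMonoidal.associativity_assoc, ← μ_natural_right_assoc, ← whiskerLeft_comp_assoc,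
        Functor.LaxBraided.braided, whiskerLeft_comp_assoc, e,
        associator_naturality_left_assoc, ← whisker_exchange_assoc,
        associator_inv_naturality_left_assoc]
    exact h
  | p + 1 => by
    have h := tpowFun_swap y q p
    have h' : (tpowFun G y (q + 2 + p) ▷ G.obj y ≫ μ G _ _) ≫ G.map (tpowSwap y q p ▷ y) =
        tpowSwap (G.obj y) q p ▷ G.obj y ≫ tpowFun G y (q + 2 + p) ▷ G.obj y ≫ μ G _ _ := by
      rw [Category.assoc, ← μ_natural_left, ← comp_whiskerRight_assoc, h, comp_whiskerRight_assoc]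
    exact h'

variable (ι K) in
theorem kmulti_zero_aux {A : C} {T : D} (a : A ⟶ 𝟙_ C) (t : T ⟶ G.obj A) (b : T ⟶ 𝟙_ D)
    (h : t ≫ G.map a = b ≫ ε G) :
    ((ι ⋙ G).obj K ◁ b ≫ (ρ_ _).hom ≫ counit (ι ⋙ G) K) ≫ ε G =
      (ι ⋙ G).obj K ◁ t ≫ kmap G (ι.obj K ◁ a ≫ (ρ_ _).hom ≫ counit ι K) := by
  rw [← kmap_whiskerLeft, ← whiskerLeft_comp_assoc, h, whiskerLeft_comp_assoc, Category.assoc]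
  congr 1
  rw [kmap, G.map_comp, counit_comp, Category.assoc, Category.assoc, Functor.Monoidal.η_ε]
  have e : G.obj (ι.obj K) ◁ ε G ≫ μ G _ _ ≫ G.map (ρ_ (ι.obj K)).hom = (ρ_ _).hom :=
    (Functor.LaxMonoidal.right_unitality (F := G) _).symm
  have e' : (ρ_ (G.obj (ι.obj K))).hom ≫ G.map (counit ι K) ≫ 𝟙 _ =
      G.obj (ι.obj K) ◁ ε G ≫ μ G _ _ ≫ G.map (ρ_ (ι.obj K)).hom ≫ G.map (counit ι K) := by
    rw [reassoc_of% e, Category.comp_id]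
  exact e'

theorem kmulti_succ_aux {A B B' Z y : C} {T S S' U : D} {a : A ⟶ B ⊗ B'} {t : T ⟶ G.obj A}
    {b : T ⟶ S ⊗ S'} {s : S ⟶ G.obj B} {s' : S' ⟶ G.obj B'}
    (h : t ≫ G.map a = b ≫ (s ⊗ₘ s') ≫ μ G _ _) {M : (ι ⋙ G).obj K ⊗ S ⟶ U} {u : U ⟶ G.obj Z}
    {m : ι.obj K ⊗ B ⟶ Z} (hM : M ≫ u = (ι ⋙ G).obj K ◁ s ≫ kmap G m) (f : ι.obj K ⊗ B' ⟶ y) :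
    ((ι ⋙ G).obj K ◁ b ≫ ktensor (ι ⋙ G) K M ((ι ⋙ G).obj K ◁ s' ≫ kmap G f)) ≫
      u ▷ G.obj y ≫ μ G _ _ = (ι ⋙ G).obj K ◁ t ≫ kmap G (ι.obj K ◁ a ≫ ktensor ι K m f) := by
  rw [← kmap_whiskerLeft, ← whiskerLeft_comp_assoc, h, whiskerLeft_comp_assoc, Category.assoc,
    whiskerLeft_comp_assoc]
  congr 1
  rw [← kmap_ktensor, reassoc_of% @whiskerLeft_ktensor, ← hM, ← tensorHom_id, reassoc_of% @ktensor_comp,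
    Category.comp_id]

theorem whiskerLeft_tpowFun_kmap_kmulti (y : C) : ∀ (k : ℕ) (n : Fin k → ℕ)
    (f : ∀ i, ι.obj K ⊗ tpow y (n i) ⟶ y),
    kmulti (ι ⋙ G) K (G.obj y) k n (fun i => (ι ⋙ G).obj K ◁ tpowFun G y (n i) ≫ kmap G (f i)) ≫
      tpowFun G y k = (ι ⋙ G).obj K ◁ tpowFun G y (∑ i, n i) ≫ kmap G (kmulti ι K y k n f)
  | 0, n, f => kmulti_zero_aux ι G K _ _ _ (tpowFun_eqToHom G y (Fin.sum_univ_zero n))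
  | k + 1, n, f => by
    have h := tpowFun_eqToHom G y (Fin.sum_univ_castSucc n)
    have ih := whiskerLeft_tpowFun_kmap_kmulti y k (fun i => n i.castSucc) fun i => f i.castSucc
    have ha : tpowFun G y (∑ i : Fin k, n i.castSucc + n (Fin.last k)) ≫
        G.map (tpowAdd y (∑ i : Fin k, n i.castSucc) (n (Fin.last k))).inv =
        (tpowAdd (G.obj y) _ _).inv ≫ (tpowFun G y _ ⊗ₘ tpowFun G y _) ≫ μ G _ _ := by
      rw [Iso.eq_inv_comp, ← Category.assoc, ← tpowFun_add]
      simp [← G.map_comp]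
    refine kmulti_succ_aux G ?_ ih (f (Fin.last k))
    rw [G.map_comp, reassoc_of% h, ha, Category.assoc]

variable {G} in
theorem IsAction.map {P : SetOperad.{v}} {y : C} {act : ∀ n : ℕ, P.obj (Fin n) → (ι.obj K ⊗ tpow y n ⟶ y)}
    (h : IsAction ι K P y act) :
    IsAction (ι ⋙ G) K P (G.obj y) fun n o =>
      (ι ⋙ G).obj K ◁ tpowFun G y n ≫ kmap G (act n o) where
  one := by
    rw [h.one]
    have e : tpowFun G y 1 ≫ G.map (λ_ y).hom = (λ_ (G.obj y)).hom := by
      have : (ε G ▷ G.obj y ≫ μ G _ _) ≫ G.map (λ_ y).hom = (λ_ (G.obj y)).hom := by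
        rw [Category.assoc, ← Functor.LaxMonoidal.left_unitality]
      exact this
    have e' : ∀ {A : C} {T : D} (t : T ⟶ G.obj A), (ι ⋙ G).obj K ◁ t ≫
        kmap G (counit ι K ▷ A ≫ (λ_ A).hom) = counit (ι ⋙ G) K ▷ T ≫ (λ_ T).hom ≫ t := by
      intro A T t
      rw [kmap, G.map_comp, ← μ_natural_left_assoc, counit_comp, ← leftUnitor_naturality]
      have := Functor.LaxMonoidal.left_unitality (F := G) A
      rw [this, comp_whiskerRight_assoc, whisker_exchange_assoc, whisker_exchange_assoc,
        ← comp_whiskerRight_assoc (η G), Functor.Monoidal.η_ε, id_whiskerRight, Category.id_comp]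
    have h₁ := e' (tpowFun G y 1)
    have h₂ := congrArg (· ≫ G.map (λ_ y).hom) h₁
    rw [← e]
    refine Eq.trans ?_ (h₂.trans ?_)
    · refine Eq.trans ?_ (Category.assoc _ _ _).symm
      refine congrArg (_ ≫ ·) ((congrArg (kmap G) (Category.assoc _ _ _).symm).trans
        (kmap_comp G _ _).symm)
    · exact (Category.assoc _ _ _).trans (congrArg (_ ≫ ·) (Category.assoc _ _ _))
  perm q p o := by
    rw [h.perm, ← kmap_whiskerLeft, ← whiskerLeft_comp_assoc, ← whiskerLeft_comp_assoc, tpowFun_swap]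
  comp k n o b := by
    rw [h.comp, ← kmap_kcomp, whiskerLeft_kcomp, kcomp_whiskerLeft]
    congr 1
    exact (whiskerLeft_tpowFun_kmap_kmulti G y k n fun i => act (n i) (b i)).symm

variable {O : SOperad.{v}}

variable {G} in
/-- The image of an algebra under a braided functor. -/
def OAlgebra.mapFun {y : C} (θ : OAlgebra ι O y) : OAlgebra (ι ⋙ G) O (G.obj y) where
  act m n o := (ι ⋙ G).obj _ ◁ tpowFun G y n ≫ kmap G (θ.act m n o)
  isAction m := (θ.isAction m).map
  naturality {m m'} φ n o := by
    have e : ∀ {A B T X : C} {S : D} (a : A ⟶ B) (t : S ⟶ G.obj T) (f : B ⊗ T ⟶ X),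
        G.obj A ◁ t ≫ μ G A T ≫ G.map (a ▷ T ≫ f) = G.map a ▷ S ≫ G.obj B ◁ t ≫ μ G B T ≫ G.map f := by
      intro A B T X S a t f
      rw [G.map_comp, ← μ_natural_left_assoc, whisker_exchange_assoc]
    rw [θ.naturality]
    exact e _ _ _

end Transport

namespace ProObj

variable {C : Type u} [Category.{v} C] [MonoidalCategory C] [SymmetricCategory C]

instance : (const : C ⥤ ProObj.{v} C).Braided where
  braided X Y := hom_ext fun ⟨⟨⟩⟩ =>
    congrArg (Germ.mk (X := tensor (const.obj X) (const.obj Y)) _) (by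
      change 𝟙 (X ⊗ Y) ≫ (β_ X Y).hom = (β_ X Y).hom ≫ 𝟙 (Y ⊗ X)
      simp)

end ProObj

section Lift

variable {C : Type u} [Category.{v} C] [MonoidalCategory C] [SymmetricCategory C]
variable (ι : SSet.{v} ⥤ C) [ι.Monoidal] {O : SOperad.{v}} {y : C} {W : ProObj.{v} C}

instance [PreservesBraiding ι] : PreservesBraiding (ι ⋙ (ProObj.const : C ⥤ ProObj.{v} C)) where
  braided X Y := by
    have h := PreservesBraiding.braided (ι := ι) X Y
    have h' := Functor.LaxBraided.braided (F := (ProObj.const : C ⥤ ProObj.{v} C)) (ι.obj X) (ι.obj Y)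
    rw [comp_μ, comp_μ, Category.assoc]
    refine (congrArg (_ ≫ ·) ((ProObj.const.map_comp _ _).symm.trans (congrArg _ h))).trans ?_
    rw [Functor.map_comp, ← Category.assoc, h', Category.assoc]
    rfl

theorem tpowConst_eq (y : C) : ∀ n, tpowConst y n = tpowFun ProObj.const y n
  | 0 => rfl
  | n + 1 => congrArg (fun z => z ▷ _ ≫ μ ProObj.const _ _) (tpowConst_eq y n)

theorem AlgFamily.compatible_iff {L : SSet.{v}} (θ : OAlgebra ι O y) (η : ProObj.const.obj y ⟶ W)
    (A : AlgFamily (ι ⋙ ProObj.const) O L W) :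
    A.Compatible ι θ η ↔ ∀ (m : SimplexCategoryᵒᵖ) (l : L.obj m) (n : ℕ) (o : (O.obj m).obj (Fin n)),
      θ.mapFun.act m n o ≫ η = (ι ⋙ ProObj.const).obj _ ◁ tpowMap η n ≫ A.act m l n o := by
  unfold Compatible
  refine forall_congr' fun m => forall_congr' fun l => forall_congr' fun n => forall_congr' fun o => ?_
  have : θ.mapFun.act m n o ≫ η = ProObj.const.obj (ι.obj (SSet.stdSimplex.obj m.unop)) ◁ tpowConst y n ≫
      μ ProObj.const _ _ ≫ ProObj.const.map (θ.act m n o) ≫ η := by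
    rw [tpowConst_eq]
    exact (Category.assoc _ _ _).trans (congrArg (_ ≫ ·) (Category.assoc _ _ _))
  rw [this]
  rfl

end Lift

end

section

open OTree CohFam

section RelHom

variable {D : Type u} [Category.{v} D] [MonoidalCategory D] [SymmetricCategory D]
variable {ι : SSet.{v} ⥤ D} [ι.Monoidal] [PreservesBraiding ι] {K : SSet.{v}} {x y : D}
variable {P : SetOperad.{v}} {act : ∀ n : ℕ, P.obj (Fin n) → (ι.obj K ⊗ tpow x n ⟶ x)}
variable {act' : ∀ n : ℕ, P.obj (Fin n) → (ι.obj K ⊗ tpow y n ⟶ y)}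

/-- Compatible actions on the source and the target of `η` as a map of operads. -/
noncomputable def IsAction.relHom (h : IsAction ι K P x act) (h' : IsAction ι K P y act') (η : y ⟶ x)
    (hη : ∀ n o, act' n o ≫ η = ι.obj K ◁ tpowMap η n ≫ act n o) : P ⟶ relEndOp ι K η :=
  ({ app := fun o => ⟨(h.fam o, h'.fam o), h.rel_fam h' η hη o⟩
     app_act := fun σ o => Subtype.ext (Prod.ext (SetOperad.Hom.app_act h.hom σ o)
      (SetOperad.Hom.app_act h'.hom σ o))
     app_one := Subtype.ext (Prod.ext (SetOperad.Hom.app_one h.hom) (SetOperad.Hom.app_one h'.hom))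
     app_comp := fun o b => Subtype.ext (Prod.ext (SetOperad.Hom.app_comp h.hom o b)
      (SetOperad.Hom.app_comp h'.hom o b)) } : SetOperad.Hom P (relEndOp ι K η))

theorem homAct_comp_endOpRestr {P P' : SetOperad.{v}} {K K' : SSet.{v}} (r : K' ⟶ K)
    (f : P ⟶ endOp ι K x) (g : P' ⟶ endOp ι K' x) (t : P ⟶ P') (h : t ≫ g = f ≫ endOpRestr r x) (n : ℕ)
    (o : P.obj (Fin n)) :
    homAct g n (SetOperad.Hom.app t o) = ι.map r ▷ _ ≫ homAct f n o := by
  have e : SetOperad.Hom.app g (SetOperad.Hom.app t o) = CohFam.restr r (SetOperad.Hom.app f o) :=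
    congrArg (fun z : P ⟶ endOp ι K' x => SetOperad.Hom.app z o) h
  rw [homAct, e]
  exact whisker_exchange_assoc _ _ _

end RelHom

section Lift

open Simplicial

variable {C : Type u} [Category.{v} C] [MonoidalCategory C] [SymmetricCategory C]
variable (ι : SSet.{v} ⥤ C) [ι.Monoidal] [PreservesBraiding ι] {O : SOperad.{v}} {y : C}
  {W : ProObj.{v} C}

/-- The fundamental simplex. -/
def fundSimplex (m : SimplexCategoryᵒᵖ) : (SSet.stdSimplex.{v}.obj m.unop).obj m :=
  SSet.stdSimplex.objEquiv.symm (𝟙 m.unop)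

theorem isContractibleKan_liftSpace (hO : O.IsCofibrant) (θ : OAlgebra ι O y)
    (η : ProObj.const.obj y ⟶ W)
    (hp : IsAcyclicFibrationOfOperads (relEndSOpSnd (ι ⋙ ProObj.const) η)) :
    IsContractibleKan (liftSpace ι θ η) := by
  intro k f
  have hc : ∀ (m : SimplexCategoryᵒᵖ) (l : (∂Δ[k] : SSet.{v}).obj m) (n : ℕ)
      (o : (O.obj m).obj (Fin n)), θ.mapFun.act m n o ≫ η =
        (ι ⋙ ProObj.const).obj _ ◁ tpowMap η n ≫ (f.app m l).1.act m (fundSimplex m) n o :=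
    fun m l n o => (AlgFamily.compatible_iff ι θ η _).1 (f.app m l).2 m (fundSimplex m) n o
  have hf : ∀ {m m' : SimplexCategoryᵒᵖ} (φ : m ⟶ m') (l : (∂Δ[k] : SSet.{v}).obj m) (n : ℕ)
      (o : (O.obj m').obj (Fin n)),
      (f.app m' ((∂Δ[k] : SSet.{v}).map φ l)).1.act m' (fundSimplex m') n o =
        (f.app m l).1.act m' (SSet.stdSimplex.objEquiv.symm φ.unop) n o := by
    intro m m' φ l n o
    have h := NatTrans.naturality_apply f φ l
    rw [h]
    change (f.app m l).1.act m' ((SSet.stdSimplex.map φ.unop).app m' (fundSimplex m')) n o = _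
    congr 1
    change SSet.stdSimplex.objEquiv.symm (𝟙 m'.unop ≫ φ.unop) = _
    rw [Category.id_comp]
  let A : ∀ m : SimplexCategoryᵒᵖ, (∂Δ[k] : SSet.{v}).obj m →
      (O.obj m ⟶ (relEndSOp (ι ⋙ ProObj.const) η).obj m) := fun m l =>
    ((f.app m l).1.isAction m (fundSimplex m)).relHom (θ.mapFun.isAction m) η (hc m l)
  obtain ⟨B, hB, hBθ, hBA⟩ := hp.exists_extension hO θ.mapFun.hom k A
    (fun {m m'} φ l => SetOperad.hom_ext' fun S _ o => Subtype.ext (Prod.ext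
      (IsAction.fam_congr ((f.app m l).1.isAction m (fundSimplex m))
        ((f.app m' ((∂Δ[k] : SSet.{v}).map φ l)).1.isAction m' (fundSimplex m'))
        (SSet.stdSimplex.map φ.unop) (O.map φ) (fun n o => by
          rw [hf, ← (f.app m l).1.naturality φ]
          congr 1
          change SSet.stdSimplex.objEquiv.symm φ.unop = SSet.stdSimplex.objEquiv.symm (φ.unop ≫ 𝟙 _)
          rw [Category.comp_id]) o)
      (congrArg (fun z : O.obj m ⟶ _ => SetOperad.Hom.app z o) (θ.mapFun.hom.naturality φ))))
    (fun m l => rfl)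
  let G : AlgFamily (ι ⋙ ProObj.const) O (Δ[k] : SSet.{v}) W :=
    { act := fun m l => homAct (B m l ≫ relEndOpFst _ η)
      isAction := fun m l => isAction_homAct _
      naturality := fun φ l n o => by
        refine homAct_comp_endOpRestr (SSet.stdSimplex.map φ.unop) _ _ (O.map φ) ?_ n o
        refine SetOperad.hom_ext' fun S _ o => ?_
        exact congrArg (fun z : O.obj _ ⟶ (relEndSOp (ι ⋙ ProObj.const) η).obj _ =>
          (SetOperad.Hom.app z o).1.1) (hB φ l) }
  have hG : G.Compatible ι θ η := by
    refine (AlgFamily.compatible_iff ι θ η _).2 fun m l n o => ?_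
    have h := Rel.homAct (B m l) n o
    refine Eq.trans ?_ h
    refine congrArg (· ≫ η) ?_
    have e : B m l ≫ relEndOpSnd _ η = (θ.mapFun.isAction m).hom := hBθ m l
    exact ((congrArg (fun z => homAct z n o) e).trans ((θ.mapFun.isAction m).homAct_hom n o)).symm
  refine ⟨SSet.yonedaEquiv.symm ⟨G, hG⟩, ?_⟩
  refine NatTrans.ext (funext fun m => ?_)
  ext l
  refine Subtype.ext (AlgFamily.ext ?_)
  funext m' l' n o
  change homAct (B m' (∂Δ[k].ι.app m' ((∂Δ[k] : SSet.{v}).map (SSet.stdSimplex.objEquiv l').op l)) ≫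
    relEndOpFst _ η) n o = _
  rw [hBA]
  refine (IsAction.homAct_hom ((f.app m' ((∂Δ[k] : SSet.{v}).map
    (SSet.stdSimplex.objEquiv l').op l)).1.isAction m' (fundSimplex m')) n o).trans ?_
  rw [hf]
  congr 1

end Lift

end

section

open Simplicial

section Families

variable {C : Type u} [Category.{v} C] [MonoidalCategory C] [SymmetricCategory C] [MonoidalClosed C]
variable (ι : SSet.{v} ⥤ C) [ι.IsLeftAdjoint]

instance isLeftAdjoint_tensorRight (x : C) : (tensorRight x).IsLeftAdjoint :=
  Functor.isLeftAdjoint_of_iso (BraidedCategory.tensorLeftIsoTensorRight x)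

instance isLeftAdjoint_comp_tensorRight (x : C) : (ι ⋙ tensorRight x).IsLeftAdjoint := inferInstance

variable {ι} {L : SSet.{v}} {x c : C}

theorem family_ext {f g : ι.obj L ⊗ x ⟶ c}
    (h : ∀ (m : SimplexCategoryᵒᵖ) (l : L.obj m),
      ι.map (SSet.yonedaEquiv.symm l) ▷ x ≫ f = ι.map (SSet.yonedaEquiv.symm l) ▷ x ≫ g) : f = g := by
  let adj := Adjunction.ofIsLeftAdjoint (ι ⋙ tensorRight x)
  refine (adj.homEquiv L c).injective ?_
  refine NatTrans.ext (funext fun m => ?_)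
  ext l
  have h' := congrArg (adj.homEquiv _ c) (h m l)
  have e : ∀ f : ι.obj L ⊗ x ⟶ c, adj.homEquiv _ c (ι.map (SSet.yonedaEquiv.symm l) ▷ x ≫ f) =
      SSet.yonedaEquiv.symm l ≫ adj.homEquiv L c f := fun f => adj.homEquiv_naturality_left _ _
  rw [e, e] at h'
  have h₂ := congrArg SSet.yonedaEquiv h'
  rw [SSet.yonedaEquiv_comp, SSet.yonedaEquiv_comp] at h₂
  simpa using h₂

theorem exists_of_family (φ : ∀ m : SimplexCategoryᵒᵖ, L.obj m →
      (ι.obj (SSet.stdSimplex.obj m.unop) ⊗ x ⟶ c))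
    (hφ : ∀ {m m' : SimplexCategoryᵒᵖ} (α : m ⟶ m') (l : L.obj m), φ m' (L.map α l) =
      ι.map (SSet.stdSimplex.map α.unop) ▷ x ≫ φ m l) :
    ∃ f : ι.obj L ⊗ x ⟶ c, ∀ (m : SimplexCategoryᵒᵖ) (l : L.obj m),
      ι.map (SSet.yonedaEquiv.symm l) ▷ x ≫ f = φ m l := by
  let adj := Adjunction.ofIsLeftAdjoint (ι ⋙ tensorRight x)
  have e : ∀ {A B : SSet.{v}} (a : A ⟶ B) (f : ι.obj B ⊗ x ⟶ c), adj.homEquiv _ c (ι.map a ▷ x ≫ f) =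
      a ≫ adj.homEquiv B c f := fun a f => adj.homEquiv_naturality_left _ _
  let g : L ⟶ (ι ⋙ tensorRight x).rightAdjoint.obj c :=
    { app := fun m => TypeCat.ofHom fun l => SSet.yonedaEquiv (adj.homEquiv _ c (φ m l))
      naturality := fun m m' α => by
        ext l
        change SSet.yonedaEquiv (adj.homEquiv _ c (φ m' (L.map α l))) =
          ((ι ⋙ tensorRight x).rightAdjoint.obj c).map α (SSet.yonedaEquiv (adj.homEquiv _ c (φ m l)))
        rw [hφ, e]
        exact (SSet.yonedaEquiv_naturality _ _).symm }
  refine ⟨(adj.homEquiv L c).symm g, fun m l => ?_⟩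
  refine (adj.homEquiv _ c).injective ?_
  rw [e, Equiv.apply_symm_apply]
  refine SSet.yonedaEquiv.injective ?_
  rw [SSet.yonedaEquiv_comp, Equiv.apply_symm_apply]
  rfl

end Families

section Pro

namespace ProObj

variable {C : Type u} [Category.{v} C]

theorem Germ.exists_of_mk_eq_mk {X : ProObj.{v} C} {c : C} {a b : X.J} {f : X.diag.obj a ⟶ c}
    {g : X.diag.obj b ⟶ c} (h : Germ.mk a f = Germ.mk b g) :
    ∃ (d : X.J) (p : d ⟶ a) (q : d ⟶ b), X.diag.map p ≫ f = X.diag.map q ≫ g := by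
  have key : ∀ p q : (Σ a : X.J, (X.diag.obj a ⟶ c)), Relation.EqvGen
      (fun p q : (Σ a : X.J, (X.diag.obj a ⟶ c)) => ∃ w : q.1 ⟶ p.1, q.2 = X.diag.map w ≫ p.2) p q →
      ∃ (d : X.J) (r : d ⟶ p.1) (s : d ⟶ q.1), X.diag.map r ≫ p.2 = X.diag.map s ≫ q.2 := by
    intro p q h
    induction h with
    | rel p q h =>
      obtain ⟨w, hw⟩ := h
      exact ⟨q.1, w, 𝟙 _, by rw [hw, X.diag.map_id, Category.id_comp]⟩
    | refl p => exact ⟨p.1, 𝟙 _, 𝟙 _, rfl⟩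
    | symm p q _ h =>
      obtain ⟨d, r, s, h⟩ := h
      exact ⟨d, s, r, h.symm⟩
    | trans p q r _ _ h h' =>
      obtain ⟨d, r₁, s₁, h⟩ := h
      obtain ⟨d', r₂, s₂, h'⟩ := h'
      obtain ⟨e, t, t', w⟩ := IsCofiltered.cospan s₁ r₂
      refine ⟨e, t ≫ r₁, t' ≫ s₂, ?_⟩
      rw [X.diag.map_comp, X.diag.map_comp, Category.assoc, Category.assoc, h, ← h',
        ← Category.assoc, ← Category.assoc, ← X.diag.map_comp, ← X.diag.map_comp, w]
  exact key _ _ (Quot.eqvGen_exact h)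

end ProObj

open ProObj Functor.LaxMonoidal

variable {C : Type u} [Category.{v} C]

theorem down_le_of_hom {s t : ULift.{v} ℕ} (f : s ⟶ t) : s.down ≤ t.down :=
  ULift.down_le.2 (leOfHom f)

/-- The projection of a tower to its `t`-th term. -/
def towerProj (w : ℕᵒᵖ ⥤ C) (t : ℕ) : towerPro w ⟶ const.obj (w.obj (op t)) :=
  Hom.mk (fun _ => Germ.mk (X := towerPro w) (op ⟨t⟩) (𝟙 _)) fun _ =>
    congrArg (Germ.mk (X := towerPro w) _) (Category.comp_id _)

theorem comp_towerProj_val {P : ProObj.{v} C} {w : ℕᵒᵖ ⥤ C} (φ : P ⟶ towerPro w) (t : ℕ)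
    (b : (const.obj (w.obj (op t))).J) : Hom.val (φ ≫ towerProj w t) b = Hom.val φ (op ⟨t⟩) :=
  Germ.push_id _

/-- The germ that defines a morphism to a constant pro-object. -/
def constVal {P : ProObj.{v} C} {c : C} (φ : P ⟶ const.obj c) : Germ P c := Hom.val φ ⟨⟨⟩⟩

theorem towerPro_hom_ext {P : ProObj.{v} C} {w : ℕᵒᵖ ⥤ C} {φ ψ : P ⟶ towerPro w}
    (h : ∀ t, φ ≫ towerProj w t = ψ ≫ towerProj w t) : φ = ψ :=
  hom_ext fun b => by
    have := congrArg constVal (h b.unop.down)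
    exact (comp_towerProj_val _ _ _).symm.trans (this.trans (comp_towerProj_val _ _ _))

theorem const_hom_ext {P : ProObj.{v} C} {c : C} {φ ψ : P ⟶ const.obj c}
    (h : Hom.val φ ⟨⟨⟩⟩ = Hom.val ψ ⟨⟨⟩⟩) : φ = ψ :=
  hom_ext fun ⟨⟨⟩⟩ => h

theorem exists_towerPro_lift {P : ProObj.{v} C} {w : ℕᵒᵖ ⥤ C} (φ : ∀ t, P ⟶ const.obj (w.obj (op t)))
    (h : ∀ t : ℕ, φ (t + 1) ≫ const.map (w.map (homOfLE t.le_succ).op) = φ t) :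
    ∃ ψ : P ⟶ towerPro w, ∀ t, ψ ≫ towerProj w t = φ t := by
  have h' : ∀ {s t : ℕ} (hst : s ≤ t), φ t ≫ const.map (w.map (homOfLE hst).op) = φ s := by
    intro s t hst
    induction t, hst using Nat.le_induction with
    | base =>
      have : (homOfLE (le_refl s)).op = 𝟙 (op s) := rfl
      rw [this, w.map_id, const.map_id, Category.comp_id]
    | succ t hst ih =>
      have : (homOfLE (hst.trans t.le_succ)).op = (homOfLE t.le_succ).op ≫ (homOfLE hst).op := rfl
      rw [this, w.map_comp, const.map_comp, ← Category.assoc, h, ih]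
  refine ⟨Hom.mk (fun b => Hom.val (φ b.unop.down) ⟨⟨⟩⟩) fun {b b'} f => ?_, fun t => const_hom_ext ?_⟩
  · have := congrArg constVal (h' (down_le_of_hom f.unop))
    exact this
  · exact comp_towerProj_val _ _ _

theorem towerProj_map (w : ℕᵒᵖ ⥤ C) {s t : ℕ} (h : s ≤ t) :
    towerProj w t ≫ const.map (w.map (homOfLE h).op) = towerProj w s :=
  const_hom_ext ((congrArg (Germ.mk (X := towerPro w) (op ⟨t⟩))
    ((Category.id_comp _).trans (Category.comp_id _).symm)).trans
      (Germ.mk_map (X := towerPro w) (b := op ⟨t⟩) (a := op ⟨s⟩)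
        (homOfLE (show (⟨s⟩ : ULift.{v} ℕ) ≤ ⟨t⟩ from h)).op (𝟙 _)))

theorem towerProMap_towerProj {y : C} {w : ℕᵒᵖ ⥤ C} (η : (Functor.const ℕᵒᵖ).obj y ⟶ w) (t : ℕ) :
    towerProMap η ≫ towerProj w t = const.map (η.app (op t)) :=
  const_hom_ext (comp_towerProj_val _ _ _)

theorem const_map_injective {a b : C} {f g : a ⟶ b}
    (h : (const : C ⥤ ProObj.{v} C).map f = const.map g) : f = g := by
  obtain ⟨d, p, q, e⟩ := Germ.exists_of_mk_eq_mk (congrArg constVal h)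
  exact (Category.id_comp _).symm.trans (e.trans (Category.id_comp _))

theorem const_map_surjective {a b : C} (φ : (const : C ⥤ ProObj.{v} C).obj a ⟶ const.obj b) :
    ∃ f : a ⟶ b, const.map f = φ := by
  obtain ⟨⟨i, f⟩, hf⟩ := Quot.exists_rep (Hom.val φ ⟨⟨⟩⟩)
  refine ⟨f, const_hom_ext ?_⟩
  rw [← hf]
  rfl

variable [MonoidalCategory C]

/-- The morphism of pro-objects represented by a morphism defined on the `t`-th term. -/
def proRep {A c : C} (X : ℕᵒᵖ ⥤ C) (t : ℕ) (f : A ⊗ X.obj (op t) ⟶ c) :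
    const.obj A ⊗ towerPro X ⟶ const.obj c :=
  const.obj A ◁ towerProj X t ≫ μ const _ _ ≫ const.map f

variable {A A' c c' : C} {X : ℕᵒᵖ ⥤ C}

theorem proRep_comp {t : ℕ} (f : A ⊗ X.obj (op t) ⟶ c) (g : c ⟶ c') :
    proRep X t f ≫ const.map g = proRep X t (f ≫ g) := by
  simp only [proRep, Category.assoc, Functor.map_comp]

theorem whiskerRight_proRep {t : ℕ} (f : A ⊗ X.obj (op t) ⟶ c) (g : A' ⟶ A) :
    const.map g ▷ towerPro X ≫ proRep X t f = proRep X t (g ▷ _ ≫ f) := by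
  simp only [proRep]
  rw [← whisker_exchange_assoc, Functor.map_comp, μ_natural_left_assoc]

theorem proRep_map {s t : ℕ} (h : s ≤ t) (f : A ⊗ X.obj (op s) ⟶ c) :
    proRep X t (A ◁ X.map (homOfLE h).op ≫ f) = proRep X s f := by
  simp only [proRep]
  rw [Functor.map_comp, ← μ_natural_right_assoc, ← whiskerLeft_comp_assoc, towerProj_map]

theorem whiskerLeft_towerProMap_proRep {x : C} (ξ : (Functor.const ℕᵒᵖ).obj x ⟶ X) {t : ℕ}
    (f : A ⊗ X.obj (op t) ⟶ c) : const.obj A ◁ towerProMap ξ ≫ proRep X t f =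
      μ const _ _ ≫ const.map (A ◁ ξ.app (op t) ≫ f) := by
  simp only [proRep]
  rw [← whiskerLeft_comp_assoc, towerProMap_towerProj, Functor.map_comp, μ_natural_right_assoc]

theorem proRep_val {t : ℕ} (f : A ⊗ X.obj (op t) ⟶ c) : Hom.val (proRep X t f) ⟨⟨⟩⟩ =
    Germ.mk (X := ProObj.tensor (const.obj A) (towerPro X)) (⟨⟨⟩⟩, op ⟨t⟩) f := by
  refine congrArg (Germ.mk (X := ProObj.tensor (const.obj A) (towerPro X)) (⟨⟨⟩⟩, op ⟨t⟩)) ?_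
  change (𝟙 A ⊗ₘ 𝟙 (X.obj (op t))) ≫ 𝟙 (A ⊗ X.obj (op t)) ≫ f = f
  rw [id_tensorHom_id, Category.id_comp, Category.id_comp]

theorem exists_proRep (φ : const.obj A ⊗ towerPro X ⟶ const.obj c) :
    ∃ (t : ℕ) (f : A ⊗ X.obj (op t) ⟶ c), proRep X t f = φ := by
  obtain ⟨⟨⟨⟨⟨⟩⟩, ⟨⟨t⟩⟩⟩, f⟩, hf⟩ := Quot.exists_rep (Hom.val φ ⟨⟨⟩⟩)
  exact ⟨t, f, const_hom_ext ((proRep_val f).trans hf)⟩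

theorem exists_of_proRep_eq {s t : ℕ} {f : A ⊗ X.obj (op s) ⟶ c} {g : A ⊗ X.obj (op t) ⟶ c}
    (h : proRep X s f = proRep X t g) : ∃ (r : ℕ) (hs : s ≤ r) (ht : t ≤ r),
      A ◁ X.map (homOfLE hs).op ≫ f = A ◁ X.map (homOfLE ht).op ≫ g := by
  have h' := congrArg constVal h
  rw [constVal, constVal, proRep_val, proRep_val] at h'
  obtain ⟨⟨d, ⟨⟨r⟩⟩⟩, ⟨p₁, p⟩, ⟨q₁, q⟩, e⟩ := Germ.exists_of_mk_eq_mk h'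
  refine ⟨r, down_le_of_hom p.unop, down_le_of_hom q.unop, ?_⟩
  change (𝟙 A ⊗ₘ X.map (homOfLE (down_le_of_hom p.unop)).op) ≫ f =
    (𝟙 A ⊗ₘ X.map (homOfLE (down_le_of_hom q.unop)).op) ≫ g at e
  rwa [id_tensorHom, id_tensorHom] at e

end Pro

section Colimit

open ProObj

variable {C : Type u} [Category.{v} C] [MonoidalCategory C] (ι : SSet.{v} ⥤ C)

/-- The mapping space from `x` to `c`. -/
def mapSSet (x c : C) : SSet.{v} where
  obj m := ι.obj (SSet.stdSimplex.obj m.unop) ⊗ x ⟶ c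
  map α := TypeCat.ofHom fun f => ι.map (SSet.stdSimplex.map α.unop) ▷ x ≫ f
  map_id m := by
    ext f
    have h : ι.map (SSet.stdSimplex.map (𝟙 m.unop)) = 𝟙 _ :=
      (congrArg ι.map (SSet.stdSimplex.map_id _)).trans (ι.map_id _)
    exact (congrArg (fun z => z ▷ x ≫ f) h).trans (by simp)
  map_comp α β := by
    ext f
    have h : ι.map (SSet.stdSimplex.map (β.unop ≫ α.unop)) = _ :=
      (congrArg ι.map (SSet.stdSimplex.map_comp _ _)).trans (ι.map_comp _ _)
    exact (congrArg (fun z => z ▷ x ≫ f) h).trans (by simp)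

/-- Functoriality of the mapping space in the source. -/
def mapSSetPre {x x' : C} (a : x' ⟶ x) (c : C) : mapSSet ι x c ⟶ mapSSet ι x' c where
  app m := TypeCat.ofHom fun f => ι.obj (SSet.stdSimplex.obj m.unop) ◁ a ≫ f
  naturality m m' α := by
    ext f
    exact whisker_exchange_assoc _ _ _

/-- The mapping space from a tower to `c`. -/
def germSSet (X : ℕᵒᵖ ⥤ C) (c : C) : SSet.{v} where
  obj m := const.obj (ι.obj (SSet.stdSimplex.obj m.unop)) ⊗ towerPro X ⟶ const.obj c
  map α := TypeCat.ofHom fun f => const.map (ι.map (SSet.stdSimplex.map α.unop)) ▷ towerPro X ≫ f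
  map_id m := by
    refine ConcreteCategory.hom_ext _ _ fun f => ?_
    have h : ι.map (SSet.stdSimplex.map (𝟙 m.unop)) = 𝟙 _ :=
      (congrArg ι.map (SSet.stdSimplex.map_id _)).trans (ι.map_id _)
    exact (congrArg (fun z => const.map z ▷ towerPro X ≫ f) h).trans (by
      rw [const.map_id, id_whiskerRight, Category.id_comp]
      rfl)
  map_comp α β := by
    refine ConcreteCategory.hom_ext _ _ fun f => ?_
    have h : ι.map (SSet.stdSimplex.map (β.unop ≫ α.unop)) = _ :=
      (congrArg ι.map (SSet.stdSimplex.map_comp _ _)).trans (ι.map_comp _ _)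
    exact (congrArg (fun z => const.map z ▷ towerPro X ≫ f) h).trans (by
      rw [const.map_comp, comp_whiskerRight, Category.assoc]
      rfl)

/-- The mapping spaces from the terms of a tower. -/
def mapDiagram (X : ℕᵒᵖ ⥤ C) (c : C) : ULift.{v} ℕ ⥤ SSet.{v} where
  obj t := mapSSet ι (X.obj (op t.down)) c
  map {s t} f := mapSSetPre ι (X.map (homOfLE (down_le_of_hom f)).op) c
  map_id t := by
    refine NatTrans.ext (funext fun m => ?_)
    refine ConcreteCategory.hom_ext _ _ fun f => ?_
    have h : X.map (homOfLE (le_refl t.down)).op = 𝟙 _ := X.map_id _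
    refine (congrArg (fun z => ι.obj (SSet.stdSimplex.obj m.unop) ◁ z ≫ f) h).trans ?_
    exact (congrArg (· ≫ f) (MonoidalCategory.whiskerLeft_id _ _)).trans (Category.id_comp f)
  map_comp {r s t} a b := by
    refine NatTrans.ext (funext fun m => ?_)
    refine ConcreteCategory.hom_ext _ _ fun f => ?_
    have ha : r.down ≤ s.down := down_le_of_hom a
    have hb : s.down ≤ t.down := down_le_of_hom b
    have h : X.map (homOfLE (ha.trans hb)).op = X.map (homOfLE hb).op ≫ X.map (homOfLE ha).op :=
      X.map_comp (homOfLE hb).op (homOfLE ha).op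
    refine (congrArg (fun z => ι.obj (SSet.stdSimplex.obj m.unop) ◁ z ≫ f) h).trans ?_
    exact whiskerLeft_comp_assoc _ _ _ _

/-- The mapping space from a tower is the colimit of the mapping spaces from its terms. -/
def germCocone (X : ℕᵒᵖ ⥤ C) (c : C) : Cocone (mapDiagram ι X c) where
  pt := germSSet ι X c
  ι :=
    { app := fun t =>
        { app := fun m => TypeCat.ofHom fun f => proRep X t.down f
          naturality := fun m m' α => by
            ext f
            exact (whiskerRight_proRep _ _).symm }
      naturality := fun s t a => by
        refine NatTrans.ext (funext fun m => ?_)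
        ext f
        exact proRep_map (down_le_of_hom a) f }

/-- The mapping space from a tower is the colimit of the mapping spaces from its terms. -/
noncomputable def isColimitGermCocone (X : ℕᵒᵖ ⥤ C) (c : C) : IsColimit (germCocone ι X c) := by
  refine evaluationJointlyReflectsColimits _ fun m => Types.FilteredColimit.isColimitOf _ _ ?_ ?_
  · intro φ
    obtain ⟨t, f, h⟩ := exists_proRep φ
    exact ⟨⟨t⟩, f, h.symm⟩
  · intro s t f g h
    obtain ⟨r, hs, ht, e⟩ := exists_of_proRep_eq (f := f) (g := g) h
    exact ⟨⟨r⟩, homOfLE hs, homOfLE ht, e⟩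

end Colimit

end

section

open Simplicial ProObj Functor.LaxMonoidal

section Stage

variable {C : Type u} [Category.{v} C] [MonoidalCategory C]

/-- Lifting problems for the pushout-products of `i` with the maps `x ⟶ X_t` against `q` can be
solved after replacing `t` by a larger number. -/
def StageLift {x : C} {X : ℕᵒᵖ ⥤ C} (ξ : (Functor.const ℕᵒᵖ).obj x ⟶ X) {L M : C} (i : L ⟶ M)
    {Z Z' : C} (q : Z ⟶ Z') : Prop :=
  ∀ (t : ℕ) (a : L ⊗ X.obj (op t) ⟶ Z) (b : M ⊗ x ⟶ Z) (d : M ⊗ X.obj (op t) ⟶ Z'),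
    L ◁ ξ.app (op t) ≫ a = i ▷ x ≫ b → a ≫ q = i ▷ X.obj (op t) ≫ d →
    b ≫ q = M ◁ ξ.app (op t) ≫ d →
    ∃ (t' : ℕ) (h : t ≤ t') (e : M ⊗ X.obj (op t') ⟶ Z),
      i ▷ _ ≫ e = L ◁ X.map (homOfLE h).op ≫ a ∧ M ◁ ξ.app (op t') ≫ e = b ∧
      e ≫ q = M ◁ X.map (homOfLE h).op ≫ d

variable [SymmetricCategory C] [MonoidalClosed C]
variable (ι : SSet.{v} ⥤ C) [ι.IsLeftAdjoint] {X : ℕᵒᵖ ⥤ C}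

theorem exists_rep_of_family {L : SSet.{v}} [L.Finite] {c : C}
    (U : ∀ m : SimplexCategoryᵒᵖ, L.obj m →
      (const.obj (ι.obj (SSet.stdSimplex.obj m.unop)) ⊗ towerPro X ⟶ const.obj c))
    (hU : ∀ {m m' : SimplexCategoryᵒᵖ} (α : m ⟶ m') (l : L.obj m), U m' (L.map α l) =
      const.map (ι.map (SSet.stdSimplex.map α.unop)) ▷ _ ≫ U m l) :
    ∃ (t : ℕ) (a : ι.obj L ⊗ X.obj (op t) ⟶ c), ∀ (m : SimplexCategoryᵒᵖ) (l : L.obj m),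
      proRep X t (ι.map (SSet.yonedaEquiv.symm l) ▷ _ ≫ a) = U m l := by
  let f : L ⟶ (germCocone ι X c).pt :=
    { app := fun m => TypeCat.ofHom fun l => U m l
      naturality := fun m m' α => by ext l; exact hU α l }
  obtain ⟨t, p, hp⟩ := IsFinitelyPresentable.exists_hom_of_isColimit (isColimitGermCocone ι X c) f
  obtain ⟨a, ha⟩ := exists_of_family (ι := ι) (x := X.obj (op t.down)) (c := c)
    (fun m l => p.app m l) (fun α l => NatTrans.naturality_apply p α l)
  refine ⟨t.down, a, fun m l => ?_⟩
  rw [ha]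
  exact sset_congr hp m l

theorem exists_eq_of_family {L : SSet.{v}} [L.Finite] {c : C} {t : ℕ}
    {a a' : ι.obj L ⊗ X.obj (op t) ⟶ c} (h : ∀ (m : SimplexCategoryᵒᵖ) (l : L.obj m),
      proRep X t (ι.map (SSet.yonedaEquiv.symm l) ▷ _ ≫ a) =
        proRep X t (ι.map (SSet.yonedaEquiv.symm l) ▷ _ ≫ a')) :
    ∃ (r : ℕ) (hr : t ≤ r), ι.obj L ◁ X.map (homOfLE hr).op ≫ a =
      ι.obj L ◁ X.map (homOfLE hr).op ≫ a' := by
  have nat : ∀ {m m' : SimplexCategoryᵒᵖ} (α : m ⟶ m') (l : L.obj m),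
      ι.map (SSet.yonedaEquiv.symm (L.map α l)) =
        ι.map (SSet.stdSimplex.map α.unop) ≫ ι.map (SSet.yonedaEquiv.symm l) := by
    intro m m' α l
    rw [← ι.map_comp]
    congr 1
    exact SSet.yonedaEquiv.injective (by
      rw [Equiv.apply_symm_apply, SSet.yonedaEquiv_comp, SSet.yonedaEquiv_map]
      exact (SSet.yonedaEquiv_symm_app_objEquiv_symm _ _).symm)
  let f : ∀ _ : ι.obj L ⊗ X.obj (op t) ⟶ c, (L ⟶ (mapDiagram ι X c).obj ⟨t⟩) := fun a =>
    { app := fun m => TypeCat.ofHom fun l => ι.map (SSet.yonedaEquiv.symm l) ▷ _ ≫ a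
      naturality := fun m m' α => by
        ext l
        change ι.map (SSet.yonedaEquiv.symm (L.map α l)) ▷ _ ≫ a =
          ι.map (SSet.stdSimplex.map α.unop) ▷ _ ≫ ι.map (SSet.yonedaEquiv.symm l) ▷ _ ≫ a
        rw [nat, comp_whiskerRight, Category.assoc] }
  obtain ⟨r, p, q, e⟩ := IsFinitelyPresentable.exists_eq_of_isColimit (isColimitGermCocone ι X c)
    (f a) (f a') (NatTrans.ext (funext fun m => by ext l; exact h m l))
  refine ⟨r.down, down_le_of_hom p, family_ext fun m l => ?_⟩
  rw [← whisker_exchange_assoc, ← whisker_exchange_assoc]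
  exact sset_congr e m l

theorem StageLift.exists_proRep_lift [ι.Monoidal] {x : C} {ξ : (Functor.const ℕᵒᵖ).obj x ⟶ X}
    {Z Z' : C} {q : Z ⟶ Z'} {k : ℕ} (hq : StageLift ξ (ι.map ∂Δ[k].ι) q)
    (U : ∀ m : SimplexCategoryᵒᵖ, (∂Δ[k] : SSet.{v}).obj m →
      (const.obj (ι.obj (SSet.stdSimplex.obj m.unop)) ⊗ towerPro X ⟶ const.obj Z))
    (hU : ∀ {m m' : SimplexCategoryᵒᵖ} (α : m ⟶ m') (l : (∂Δ[k] : SSet.{v}).obj m),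
      U m' ((∂Δ[k] : SSet.{v}).map α l) =
        const.map (ι.map (SSet.stdSimplex.map α.unop)) ▷ _ ≫ U m l)
    (b : ι.obj Δ[k] ⊗ x ⟶ Z)
    (hb : ∀ (m : SimplexCategoryᵒᵖ) (l : (∂Δ[k] : SSet.{v}).obj m),
      const.obj _ ◁ towerProMap ξ ≫ U m l = μ const _ _ ≫
        const.map (ι.map (SSet.yonedaEquiv.symm (∂Δ[k].ι.app m l)) ▷ x ≫ b))
    (t : ℕ) (d : ι.obj Δ[k] ⊗ X.obj (op t) ⟶ Z')
    (hd : ∀ (m : SimplexCategoryᵒᵖ) (l : (∂Δ[k] : SSet.{v}).obj m), U m l ≫ const.map q =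
      proRep X t (ι.map (SSet.yonedaEquiv.symm (∂Δ[k].ι.app m l)) ▷ _ ≫ d))
    (hbd : b ≫ q = ι.obj Δ[k] ◁ ξ.app (op t) ≫ d) :
    ∃ (t' : ℕ) (e : ι.obj Δ[k] ⊗ X.obj (op t') ⟶ Z),
      (∀ (m : SimplexCategoryᵒᵖ) (l : (∂Δ[k] : SSet.{v}).obj m),
        proRep X t' (ι.map (SSet.yonedaEquiv.symm (∂Δ[k].ι.app m l)) ▷ _ ≫ e) = U m l) ∧
      ι.obj Δ[k] ◁ ξ.app (op t') ≫ e = b ∧ proRep X t' (e ≫ q) = proRep X t d := by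
  have hι : ∀ {m : SimplexCategoryᵒᵖ} (l : (∂Δ[k] : SSet.{v}).obj m),
      ι.map (SSet.yonedaEquiv.symm (∂Δ[k].ι.app m l)) =
        ι.map (SSet.yonedaEquiv.symm l) ≫ ι.map ∂Δ[k].ι := by
    intro m l
    rw [← ι.map_comp]
    congr 1
  obtain ⟨s, a, ha⟩ := exists_rep_of_family ι U hU
  obtain ⟨r, hr, e⟩ := exists_eq_of_family ι (t := max s t)
    (a := ι.obj (∂Δ[k] : SSet.{v}) ◁ X.map (homOfLE (le_max_left s t)).op ≫ a ≫ q)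
    (a' := ι.map ∂Δ[k].ι ▷ _ ≫ ι.obj Δ[k] ◁ X.map (homOfLE (le_max_right s t)).op ≫ d) (by
      intro m l
      rw [← whisker_exchange_assoc, proRep_map (le_max_left s t), ← Category.assoc, ← proRep_comp, ha,
        hd, hι, ← whisker_exchange_assoc, ← whisker_exchange_assoc, proRep_map (le_max_right s t),
        comp_whiskerRight, Category.assoc])
  have comp : ∀ {A B : C} {i j l : ℕ} (h : i ≤ j) (h' : j ≤ l) (f : A ⊗ X.obj (op i) ⟶ B),
      A ◁ X.map (homOfLE h').op ≫ A ◁ X.map (homOfLE h).op ≫ f =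
        A ◁ X.map (homOfLE (h.trans h')).op ≫ f := by
    intro A B i j l h h' f
    rw [← whiskerLeft_comp_assoc, ← X.map_comp]
    rfl
  have hξ : ∀ {i j : ℕ} (h : i ≤ j), ξ.app (op j) ≫ X.map (homOfLE h).op = ξ.app (op i) := by
    intro i j h
    rw [← ξ.naturality]
    exact Category.id_comp _
  have hs : s ≤ r := (le_max_left s t).trans hr
  have ht : t ≤ r := (le_max_right s t).trans hr
  obtain ⟨t', h', e', h₁, h₂, h₃⟩ := hq r (ι.obj _ ◁ X.map (homOfLE hs).op ≫ a) b
    (ι.obj _ ◁ X.map (homOfLE ht).op ≫ d) (by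
      refine family_ext fun m l => ?_
      have e₂ : ι.map (SSet.yonedaEquiv.symm l) ▷ x ≫ ι.map ∂Δ[k].ι ▷ x ≫ b =
          ι.map (SSet.yonedaEquiv.symm (∂Δ[k].ι.app m l)) ▷ x ≫ b := by
        rw [← comp_whiskerRight_assoc, ← hι]
      rw [← whiskerLeft_comp_assoc, hξ, ← whisker_exchange_assoc]
      refine Eq.trans ?_ e₂.symm
      have h := hb m l
      rw [← ha, whiskerLeft_towerProMap_proRep] at h
      have h' := const_map_injective ((cancel_epi (μ const _ _)).1 h)
      exact h') (by
      rw [comp, whisker_exchange_assoc, comp] at e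
      rw [Category.assoc, e]) (by
      rw [hbd, ← whiskerLeft_comp_assoc, hξ])
  refine ⟨t', e', fun m l => ?_, h₂, ?_⟩
  · rw [hι, comp_whiskerRight, Category.assoc, h₁, comp, ← whisker_exchange_assoc, proRep_map, ha]
  · rw [h₃, comp, proRep_map]

/-- Lifting problems of pro-objects are solved one term of the target at a time. -/
theorem exists_towerPro_extension [HasTerminal C] [ι.Monoidal] {x y : C}
    {ξ : (Functor.const ℕᵒᵖ).obj x ⟶ X}
    {w : ℕᵒᵖ ⥤ C} (η : (Functor.const ℕᵒᵖ).obj y ⟶ w) {k : ℕ}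
    (h₀ : StageLift ξ (ι.map ∂Δ[k].ι) (terminal.from (w.obj (op 0))))
    (hs : ∀ s : ℕ, StageLift ξ (ι.map ∂Δ[k].ι) (w.map (homOfLE s.le_succ).op))
    (U : ∀ m : SimplexCategoryᵒᵖ, (∂Δ[k] : SSet.{v}).obj m →
      (const.obj (ι.obj (SSet.stdSimplex.obj m.unop)) ⊗ towerPro X ⟶ towerPro w))
    (hU : ∀ {m m' : SimplexCategoryᵒᵖ} (α : m ⟶ m') (l : (∂Δ[k] : SSet.{v}).obj m),
      U m' ((∂Δ[k] : SSet.{v}).map α l) =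
        const.map (ι.map (SSet.stdSimplex.map α.unop)) ▷ _ ≫ U m l)
    (V : const.obj (ι.obj Δ[k]) ⊗ const.obj x ⟶ const.obj y)
    (hV : ∀ (m : SimplexCategoryᵒᵖ) (l : (∂Δ[k] : SSet.{v}).obj m),
      const.obj _ ◁ towerProMap ξ ≫ U m l =
        const.map (ι.map (SSet.yonedaEquiv.symm (∂Δ[k].ι.app m l))) ▷ _ ≫ V ≫ towerProMap η) :
    ∃ H : const.obj (ι.obj Δ[k]) ⊗ towerPro X ⟶ towerPro w,
      (∀ (m : SimplexCategoryᵒᵖ) (l : (∂Δ[k] : SSet.{v}).obj m),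
        const.map (ι.map (SSet.yonedaEquiv.symm (∂Δ[k].ι.app m l))) ▷ _ ≫ H = U m l) ∧
      const.obj (ι.obj Δ[k]) ◁ towerProMap ξ ≫ H = V ≫ towerProMap η := by
  obtain ⟨b, hb⟩ := const_map_surjective (inv (μ const _ _) ≫ V)
  obtain rfl : V = μ const _ _ ≫ const.map b := by rw [hb, IsIso.hom_inv_id_assoc]
  let P : ∀ s : ℕ, (Σ t : ℕ, (ι.obj Δ[k] ⊗ X.obj (op t) ⟶ w.obj (op s))) → Prop := fun s e =>
    (∀ (m : SimplexCategoryᵒᵖ) (l : (∂Δ[k] : SSet.{v}).obj m),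
      proRep X e.1 (ι.map (SSet.yonedaEquiv.symm (∂Δ[k].ι.app m l)) ▷ _ ≫ e.2) =
        U m l ≫ towerProj w s) ∧
    ι.obj Δ[k] ◁ ξ.app (op e.1) ≫ e.2 = b ≫ η.app (op s)
  have hV' : ∀ (s : ℕ) (m : SimplexCategoryᵒᵖ) (l : (∂Δ[k] : SSet.{v}).obj m),
      const.obj _ ◁ towerProMap ξ ≫ U m l ≫ towerProj w s = μ const _ _ ≫
        const.map (ι.map (SSet.yonedaEquiv.symm (∂Δ[k].ι.app m l)) ▷ x ≫ b ≫ η.app (op s)) := by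
    intro s m l
    have h := congrArg (· ≫ towerProj w s) (hV m l)
    simp only [Category.assoc] at h
    rw [h, towerProMap_towerProj, μ_natural_left_assoc, ← Functor.map_comp, ← Functor.map_comp]
  have hU' : ∀ (s : ℕ) {m m' : SimplexCategoryᵒᵖ} (α : m ⟶ m') (l : (∂Δ[k] : SSet.{v}).obj m),
      U m' ((∂Δ[k] : SSet.{v}).map α l) ≫ towerProj w s =
        const.map (ι.map (SSet.stdSimplex.map α.unop)) ▷ _ ≫ U m l ≫ towerProj w s := by
    intro s m m' α l
    rw [hU, Category.assoc]
  have base : ∃ e, P 0 e := by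
    obtain ⟨t, e, h₁, h₂, -⟩ := h₀.exists_proRep_lift ι (fun m l => U m l ≫ towerProj w 0) (hU' 0)
      (b ≫ η.app (op 0)) (hV' 0) 0 (terminal.from _) (fun m l => by
        obtain ⟨t, f, hf⟩ := exists_proRep (U m l ≫ towerProj w 0)
        rw [← hf, proRep_comp, ← proRep_map (Nat.zero_le t)]
        congr 1
        subsingleton) (by subsingleton)
    exact ⟨⟨t, e⟩, h₁, h₂⟩
  have step : ∀ (s : ℕ) (e), P s e → ∃ e', P (s + 1) e' ∧
      proRep X e'.1 (e'.2 ≫ w.map (homOfLE s.le_succ).op) = proRep X e.1 e.2 := by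
    intro s e he
    obtain ⟨t, e', h₁, h₂, h₃⟩ := (hs s).exists_proRep_lift ι (fun m l => U m l ≫ towerProj w (s + 1))
      (hU' (s + 1)) (b ≫ η.app (op (s + 1))) (hV' (s + 1)) e.1 e.2 (fun m l => by
        rw [Category.assoc, towerProj_map w s.le_succ, he.1]) (by
        rw [he.2, Category.assoc, ← η.naturality]
        congr 1
        exact Category.id_comp _)
    exact ⟨⟨t, e'⟩, ⟨h₁, h₂⟩, h₃⟩
  choose next hnext using step
  let e : ∀ s : ℕ, { e // P s e } := fun s => Nat.rec ⟨base.choose, base.choose_spec⟩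
    (fun s e => ⟨next s e.1 e.2, (hnext s e.1 e.2).1⟩) s
  obtain ⟨H, hH⟩ := exists_towerPro_lift (P := const.obj (ι.obj Δ[k]) ⊗ towerPro X) (w := w)
    (fun s => proRep X (e s).1.1 (e s).1.2) (fun s => by
      rw [proRep_comp]
      exact (hnext s (e s).1 (e s).2).2)
  refine ⟨H, fun m l => towerPro_hom_ext fun s => ?_, towerPro_hom_ext fun s => ?_⟩
  · rw [Category.assoc, hH, whiskerRight_proRep, (e s).2.1]
  · rw [Category.assoc, hH, whiskerLeft_towerProMap_proRep, (e s).2.2, Category.assoc,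
      towerProMap_towerProj, Category.assoc, ← Functor.map_comp]
    rfl

end Stage

end

section

open Simplicial ProObj OTree CohFam

section TowerTensor

variable {C : Type u} [Category.{v} C] [MonoidalCategory C]

/-- The levelwise tensor product of two towers. -/
def towerTensor (X X' : ℕᵒᵖ ⥤ C) : ℕᵒᵖ ⥤ C where
  obj n := X.obj n ⊗ X'.obj n
  map f := X.map f ⊗ₘ X'.map f
  map_id n := by rw [X.map_id, X'.map_id, id_tensorHom_id]
  map_comp f g := by rw [X.map_comp, X'.map_comp, tensorHom_comp_tensorHom]

/-- The levelwise tensor product of two towers under objects. -/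
def towerTensorMap {x x' : C} {X X' : ℕᵒᵖ ⥤ C} (ξ : (Functor.const ℕᵒᵖ).obj x ⟶ X)
    (ξ' : (Functor.const ℕᵒᵖ).obj x' ⟶ X') :
    (Functor.const ℕᵒᵖ).obj (x ⊗ x') ⟶ towerTensor X X' where
  app n := ξ.app n ⊗ₘ ξ'.app n
  naturality n m f := by
    have h : 𝟙 x ≫ ξ.app m = ξ.app n ≫ X.map f := ξ.naturality f
    have h' : 𝟙 x' ≫ ξ'.app m = ξ'.app n ≫ X'.map f := ξ'.naturality f
    rw [Category.id_comp] at h h'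
    refine (Category.id_comp _).trans ?_
    refine Eq.trans ?_ (tensorHom_comp_tensorHom _ _ _ _).symm
    rw [← h, ← h']

/-- The pro-object of a tensor product of towers. -/
def towerTensorIso (X X' : ℕᵒᵖ ⥤ C) :
    towerPro X ⊗ towerPro X' ≅ towerPro (towerTensor X X') where
  hom := ofReindex (X := tensor (towerPro X) (towerPro X')) (Y := towerPro (towerTensor X X'))
    (fun t => (t, t)) (fun w => (w, w)) (fun t => 𝟙 _) (fun w => by
      exact (Category.comp_id _).trans (Category.id_comp _).symm)
  inv := ofReindex (X := towerPro (towerTensor X X')) (Y := tensor (towerPro X) (towerPro X'))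
    (fun p => op ⟨max p.1.unop.down p.2.unop.down⟩)
    (fun w => (homOfLE (max_le_max (leOfHom w.1.unop) (leOfHom w.2.unop))).op)
    (fun p => X.map (homOfLE (le_max_left p.1.unop.down p.2.unop.down)).op ⊗ₘ
      X'.map (homOfLE (le_max_right p.1.unop.down p.2.unop.down)).op)
    (fun {p p'} w => by
      refine (tensorHom_comp_tensorHom _ _ _ _).trans
        (Eq.trans ?_ (tensorHom_comp_tensorHom _ _ _ _).symm)
      congr 1
      · refine (X.map_comp _ _).symm.trans (Eq.trans ?_ (X.map_comp _ _))
        rfl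
      · refine (X'.map_comp _ _).symm.trans (Eq.trans ?_ (X'.map_comp _ _))
        rfl)
  hom_inv_id := hom_ext fun p => by
    have h := Germ.mk_map (X := tensor (towerPro X) (towerPro X'))
      (a := p) (b := (op ⟨max p.1.unop.down p.2.unop.down⟩, op ⟨max p.1.unop.down p.2.unop.down⟩))
      ((homOfLE (show p.1.unop ≤ (⟨max p.1.unop.down p.2.unop.down⟩ : ULift.{v} ℕ) from
          le_max_left p.1.unop.down p.2.unop.down)).op,
        (homOfLE (show p.2.unop ≤ (⟨max p.1.unop.down p.2.unop.down⟩ : ULift.{v} ℕ) from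
          le_max_right p.1.unop.down p.2.unop.down)).op) (𝟙 _)
    refine Eq.trans ?_ h
    refine congrArg (Germ.mk (X := tensor (towerPro X) (towerPro X')) _) ?_
    exact (Category.id_comp _).trans (Category.comp_id _).symm
  inv_hom_id := hom_ext fun t => by
    have h := Germ.mk_map (X := towerPro (towerTensor X X'))
      (a := t) (b := op ⟨max t.unop.down t.unop.down⟩)
      (homOfLE (show t.unop ≤ (⟨max t.unop.down t.unop.down⟩ : ULift.{v} ℕ) from
        le_max_left t.unop.down t.unop.down)).op (𝟙 _)
    exact h

theorem tensorMap_towerTensorIso {x x' : C} {X X' : ℕᵒᵖ ⥤ C} (ξ : (Functor.const ℕᵒᵖ).obj x ⟶ X)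
    (ξ' : (Functor.const ℕᵒᵖ).obj x' ⟶ X') :
    (towerProMap ξ ⊗ₘ towerProMap ξ') ≫ (towerTensorIso X X').hom =
      Functor.LaxMonoidal.μ const x x' ≫ towerProMap (towerTensorMap ξ ξ') := by
  refine hom_ext fun t => ?_
  refine congrArg (Germ.mk (X := tensor (const.obj x) (const.obj x')) (⟨⟨⟩⟩, ⟨⟨⟩⟩)) ?_
  exact (Category.comp_id _).trans (Category.id_comp _).symm

/-- The constant tower is isomorphic to the constant pro-object. -/
def constTowerIso (x : C) : const.obj x ≅ towerPro ((Functor.const ℕᵒᵖ).obj x) where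
  hom := towerProMap (𝟙 _)
  inv := towerProj _ 0
  hom_inv_id := towerProMap_towerProj _ _
  inv_hom_id := hom_ext fun t => by
    have h := Germ.mk_map (X := towerPro ((Functor.const ℕᵒᵖ).obj x))
      (a := op ⟨0⟩) (b := t) (homOfLE (show (⟨0⟩ : ULift.{v} ℕ) ≤ t.unop from
        Nat.zero_le t.unop.down)).op (𝟙 _)
    exact (congrArg (Germ.mk (X := towerPro ((Functor.const ℕᵒᵖ).obj x)) (op ⟨0⟩))
      (Category.comp_id (𝟙 x))).trans (h.symm.trans
        (congrArg (Germ.mk (X := towerPro ((Functor.const ℕᵒᵖ).obj x)) t) (Category.comp_id (𝟙 x))))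

end TowerTensor

section Lifting

variable {C : Type u} [Category.{v} C] [MonoidalCategory C] [SymmetricCategory C]
  [MonoidalClosed C] (ι : SSet.{v} ⥤ C) [ι.Braided] [ι.IsLeftAdjoint]
variable {y : C} {w : ℕᵒᵖ ⥤ C} (η : (Functor.const ℕᵒᵖ).obj y ⟶ w) {S : Type}

/-- A tower that represents a tensor power of the pro-object `w`, under the corresponding power of
`y`. -/
structure TowerPower (s : OTree S) where
  {x : C}
  {X : ℕᵒᵖ ⥤ C}
  ξ : (Functor.const ℕᵒᵖ).obj x ⟶ X
  Φ : tens (towerPro w) s ≅ towerPro X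
  Ψ : tens (const.obj y) s ≅ const.obj x
  comm : tensMap (towerProMap η) s ≫ Φ.hom = Ψ.hom ≫ towerProMap ξ

variable {η}

theorem TowerPower.hasLiftingProperty_boundary [HasTerminal C] [Finite S] {s : OTree S}
    (hs : s.IsOrd) (M : TowerPower η s) (k : ℕ)
    (h₀ : StageLift M.ξ (ι.map ∂Δ[k].ι) (terminal.from (w.obj (op 0))))
    (h₁ : ∀ s : ℕ, StageLift M.ξ (ι.map ∂Δ[k].ι) (w.map (homOfLE s.le_succ).op)) :
    HasLiftingProperty ∂Δ[k].ι
      (SOperad.spaceMap (relEndSOpSnd (ι ⋙ const) (towerProMap η)) S) := by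
  refine ⟨fun {u t} sq => ?_⟩
  obtain ⟨B, rfl⟩ : ∃ B : CohFam (ι ⋙ const) (Δ[k] : SSet.{v}) (const.obj y) S,
      t = SSet.yonedaEquiv.symm B := ⟨SSet.yonedaEquiv t, by simp⟩
  let u' : ∀ m : SimplexCategoryᵒᵖ, (∂Δ[k] : SSet.{v}).obj m →
    (relEndOp (ι ⋙ const) (SSet.stdSimplex.obj m.unop) (towerProMap η)).obj S := fun m l => u.app m l
  have hu : ∀ (m : SimplexCategoryᵒᵖ) (l : (∂Δ[k] : SSet.{v}).obj m),
      (u' m l).1.2 = B.restr (SSet.yonedaEquiv.symm (∂Δ[k].ι.app m l)) :=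
    fun m l => sset_congr sq.w m l
  have hu' : ∀ {m m' : SimplexCategoryᵒᵖ} (α : m ⟶ m') (l : (∂Δ[k] : SSet.{v}).obj m),
      (u' m' ((∂Δ[k] : SSet.{v}).map α l)).1.1 =
        (u' m l).1.1.restr (SSet.stdSimplex.map α.unop) := fun α l =>
    congrArg (fun z : (relEndOp (ι ⋙ const) _ (towerProMap η)).obj S => z.1.1)
      (NatTrans.naturality_apply u α l)
  let κ : SSet.{v} → ProObj.{v} C := fun K => const.obj (ι.obj K)
  obtain ⟨H, h₁, h₂⟩ := exists_towerPro_extension ι (ξ := M.ξ) η h₀ h₁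
    (fun m l => κ _ ◁ M.Φ.inv ≫ (u' m l).1.1.val s hs)
    (fun {m m'} α l => by
      rw [hu']
      change _ ≫ (ι ⋙ const).map (SSet.stdSimplex.map α.unop) ▷ _ ≫ _ = _
      exact whisker_exchange_assoc _ _ _)
    (κ _ ◁ M.Ψ.inv ≫ B.val s hs)
    (fun m l => by
      have h := (u' m l).2 s hs
      have e : towerProMap M.ξ ≫ M.Φ.inv = M.Ψ.inv ≫ tensMap (towerProMap η) s := by
        rw [Iso.comp_inv_eq, Category.assoc, M.comm, Iso.inv_hom_id_assoc]
      rw [← whiskerLeft_comp_assoc, e, whiskerLeft_comp_assoc]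
      refine (congrArg (_ ≫ ·) h.symm).trans ?_
      rw [hu]
      change _ ≫ ((ι ⋙ const).map _ ▷ _ ≫ B.val s hs) ≫ _ = _
      simp only [Category.assoc]
      exact whisker_exchange_assoc _ _ _)
  let A : CohFam (ι ⋙ const) (Δ[k] : SSet.{v}) (towerPro w) S :=
    CohFam.mk' hs (κ _ ◁ M.Φ.hom ≫ H)
  have hA : A.val s hs = κ _ ◁ M.Φ.hom ≫ H := mk'_val _ _
  have hAB : Rel (towerProMap η) A B := Rel.of_val hs (by
    rw [hA]
    refine Eq.trans ?_ (whiskerLeft_comp_assoc _ _ _ _)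
    rw [M.comm, whiskerLeft_comp_assoc]
    refine Eq.trans ?_ (congrArg (_ ≫ ·) h₂.symm)
    exact (congrArg (· ≫ towerProMap η) (whiskerLeft_hom_inv_assoc _ _ _).symm).trans
      (Category.assoc _ _ _))
  refine ⟨⟨⟨SSet.yonedaEquiv.symm ⟨(A, B), hAB⟩, ?_, ?_⟩⟩⟩
  · refine NatTrans.ext (funext fun m => ?_)
    ext l
    refine Subtype.ext (Prod.ext (ext_of_val hs ?_) (hu m l).symm)
    change (ι ⋙ const).map (SSet.yonedaEquiv.symm (∂Δ[k].ι.app m l)) ▷ _ ≫ A.val s hs =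
      (u' m l).1.1.val s hs
    rw [hA]
    refine (whisker_exchange_assoc _ _ _).symm.trans ?_
    refine (congrArg (_ ≫ ·) (h₁ m l)).trans ?_
    exact whiskerLeft_hom_inv_assoc _ _ _
  · refine SSet.yonedaEquiv.injective ?_
    rw [SSet.yonedaEquiv_comp]
    refine Eq.trans ?_ (Equiv.apply_symm_apply _ _).symm
    exact congrArg ((SOperad.spaceMap (relEndSOpSnd (ι ⋙ const) (towerProMap η)) S).app (op ⦋k⦌))
      (Equiv.apply_symm_apply _ _)

theorem isAcyclicFibrationOfOperads_of_towerPower [HasTerminal C]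
    (h : ∀ (S : Type) [Finite S] (s : OTree S), ∃ M : TowerPower η s, ∀ k : ℕ,
      StageLift M.ξ (ι.map ∂Δ[k].ι) (terminal.from (w.obj (op 0))) ∧
      ∀ s : ℕ, StageLift M.ξ (ι.map ∂Δ[k].ι) (w.map (homOfLE s.le_succ).op)) :
    IsAcyclicFibrationOfOperads (relEndSOpSnd (ι ⋙ const) (towerProMap η)) := by
  intro S _ A B i hi
  have : (MorphismProperty.monomorphisms SSet.{v}).rlp
      (SOperad.spaceMap (relEndSOpSnd (ι ⋙ const) (towerProMap η)) S) := by
    rw [SSet.rlp_monomorphisms]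
    rintro _ _ _ ⟨k⟩
    obtain ⟨s, hs⟩ := exists_isOrd S
    obtain ⟨M, hM⟩ := h S s
    exact M.hasLiftingProperty_boundary ι hs k (hM k).1 (hM k).2
  exact this i hi

end Lifting

end

section

open Simplicial ProObj OTree

section Cofibrations

variable {C : Type u} [Category.{v} C] [MonoidalCategory C] [SymmetricCategory C]
  [MonoidalClosed C] [ModelCategory C] [HasLimits C] [HasColimits C]
  {ι : SSet.{v} ⥤ C} [ι.Braided] [ι.IsLeftAdjoint]

instance isLeftAdjoint_tensorLeft (x : C) : (tensorLeft x).IsLeftAdjoint :=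
  (ihom.adjunction x).isLeftAdjoint

theorem whiskerLeft_eq_braiding {A B : C} (x : C) (i : A ⟶ B) :
    x ◁ i = (β_ x A).hom ≫ i ▷ x ≫ (β_ x B).inv := by
  rw [← BraidedCategory.braiding_naturality_right_assoc, Iso.hom_inv_id, Category.comp_id]

theorem whiskerRight_eq_braiding {A B : C} (x : C) (i : A ⟶ B) :
    i ▷ x = (β_ x A).inv ≫ x ◁ i ≫ (β_ x B).hom := by
  rw [BraidedCategory.braiding_naturality_right, Iso.inv_hom_id_assoc]

namespace IsOperadicModelCategory

theorem cofibration_whiskerRight (hC : IsOperadicModelCategory C ι) {A B : C} (i : A ⟶ B)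
    [Cofibration i] (x : C) [IsCofibrant x] : Cofibration (i ▷ x) := by
  have h₁ : PreservesColimitsOfShape (Discrete PEmpty.{1}) ((curriedTensor C).obj A) :=
    inferInstanceAs (PreservesColimitsOfShape _ (tensorLeft A))
  have h₂ : PreservesColimitsOfShape (Discrete PEmpty.{1}) ((curriedTensor C).obj B) :=
    inferInstanceAs (PreservesColimitsOfShape _ (tensorLeft B))
  exact hC.pushout_product i (initial.to x)
    (Functor.PushoutObjObj.ofIsInitialRight (curriedTensor C) i (initial.to x) initialIsInitial)

theorem cofibration_whiskerLeft (hC : IsOperadicModelCategory C ι) {A B : C} (i : A ⟶ B)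
    [Cofibration i] (x : C) [IsCofibrant x] : Cofibration (x ◁ i) := by
  have := hC.cofibration_whiskerRight i x
  rw [whiskerLeft_eq_braiding]
  infer_instance

theorem weakEquivalence_whiskerRight (hC : IsOperadicModelCategory C ι) {A B : C} (i : A ⟶ B)
    [WeakEquivalence i] (x : C) [IsCofibrant x] : WeakEquivalence (i ▷ x) := by
  have := hC.tensor_weakEquivalence x i
  rw [whiskerRight_eq_braiding]
  infer_instance

theorem isCofibrant_tensor (hC : IsOperadicModelCategory C ι) (x x' : C) [IsCofibrant x]
    [IsCofibrant x'] : IsCofibrant (x ⊗ x') := by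
  have h := hC.cofibration_whiskerLeft (initial.to x') x
  exact (isCofibrant_iff_of_isInitial (x ◁ initial.to x')
    (IsInitial.isInitialObj (tensorLeft x) _ initialIsInitial)).2 h

theorem cofibration_map (hC : IsOperadicModelCategory C ι) {K L : SSet.{v}} (i : K ⟶ L) [Mono i] :
    Cofibration (ι.map i) := by
  rw [cofibration_iff, ← trivialFibrations_llp]
  intro Z Z' p hp
  rw [mem_trivialFibrations_iff] at hp
  obtain ⟨_, _⟩ := hp
  rw [(Adjunction.ofIsLeftAdjoint ι).hasLiftingProperty_iff]
  have : (MorphismProperty.monomorphisms SSet.{v}).rlp (ι.rightAdjoint.map p) := by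
    rw [SSet.rlp_monomorphisms]
    rintro _ _ _ ⟨n⟩
    rw [← (Adjunction.ofIsLeftAdjoint ι).hasLiftingProperty_iff]
    have := hC.cofibration_boundary n
    infer_instance
  exact this i ‹_›

theorem isCofibrant_obj (hC : IsOperadicModelCategory C ι) (K : SSet.{v}) :
    IsCofibrant (ι.obj K) :=
  (isCofibrant_iff_of_isInitial (ι.map (initial.to K))
    (IsInitial.isInitialObj ι _ initialIsInitial)).2 (hC.cofibration_map _)

theorem isCofibrant_unit (hC : IsOperadicModelCategory C ι) : IsCofibrant (𝟙_ C) := by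
  have := hC.isCofibrant_obj (𝟙_ SSet.{v})
  exact isCofibrant_of_cofibration (inv (Functor.LaxMonoidal.ε ι))

end IsOperadicModelCategory

variable {y : C} {w : ℕᵒᵖ ⥤ C} {η : (Functor.const ℕᵒᵖ).obj y ⟶ w}

theorem StageLift.refl {x L M Z Z' : C} (i : L ⟶ M) (q : Z ⟶ Z') :
    StageLift (𝟙 ((Functor.const ℕᵒᵖ).obj x)) i q := by
  intro t a b d h₁ h₂ h₃
  change L ◁ 𝟙 x ≫ a = _ at h₁
  change _ = M ◁ 𝟙 x ≫ d at h₃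
  simp only [MonoidalCategory.whiskerLeft_id, Category.id_comp] at h₁ h₃
  refine ⟨t, le_rfl, b, ?_, ?_, ?_⟩
  · change i ▷ x ≫ b = L ◁ 𝟙 x ≫ a
    simp [h₁]
  · change M ◁ 𝟙 x ≫ b = b
    simp
  · change b ≫ q = M ◁ 𝟙 x ≫ d
    simp [h₃]

/-- `M ⊗ (A ⊗ B) ≅ (M ⊗ B) ⊗ A`. -/
def tensorSwap (M A B : C) : M ⊗ (A ⊗ B) ≅ (M ⊗ B) ⊗ A :=
  whiskerLeftIso M (β_ A B) ≪≫ (α_ M B A).symm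

/-- The tensor product of three morphisms. -/
def tensorHom₃ {M M' A A' B B' : C} (f : M ⟶ M') (a : A ⟶ A') (b : B ⟶ B') :
    M ⊗ (A ⊗ B) ⟶ M' ⊗ (A' ⊗ B') := f ⊗ₘ (a ⊗ₘ b)

theorem tensorHom₃_comp {M M' M'' A A' A'' B B' B'' : C} (f : M ⟶ M') (a : A ⟶ A') (b : B ⟶ B')
    (f' : M' ⟶ M'') (a' : A' ⟶ A'') (b' : B' ⟶ B'') :
    tensorHom₃ f a b ≫ tensorHom₃ f' a' b' = tensorHom₃ (f ≫ f') (a ≫ a') (b ≫ b') := by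
  simp [tensorHom₃]

theorem tensorHom₃_comp_assoc {M M' M'' A A' A'' B B' B'' Z : C} (f : M ⟶ M') (a : A ⟶ A')
    (b : B ⟶ B') (f' : M' ⟶ M'') (a' : A' ⟶ A'') (b' : B' ⟶ B'') (h : M'' ⊗ A'' ⊗ B'' ⟶ Z) :
    tensorHom₃ f a b ≫ tensorHom₃ f' a' b' ≫ h = tensorHom₃ (f ≫ f') (a ≫ a') (b ≫ b') ≫ h := by
  rw [← Category.assoc, tensorHom₃_comp]

theorem associator_hom_tensorHom₃_assoc {M M' A A' B B' Z : C} (f : M ⟶ M') (a : A ⟶ A')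
    (b : B ⟶ B') (h : M' ⊗ A' ⊗ B' ⟶ Z) :
    ((f ⊗ₘ a) ⊗ₘ b) ≫ (α_ M' A' B').hom ≫ h = (α_ M A B).hom ≫ tensorHom₃ f a b ≫ h :=
  associator_naturality_assoc f a b h

theorem tensorSwap_hom_tensorHom₃ {M M' A A' B B' : C} (f : M ⟶ M') (a : A ⟶ A') (b : B ⟶ B') :
    tensorHom₃ f a b ≫ (tensorSwap M' A' B').hom =
      (tensorSwap M A B).hom ≫ ((f ⊗ₘ b) ⊗ₘ a) := by
  simp only [tensorSwap, Iso.trans_hom, whiskerLeftIso_hom, Iso.symm_hom, Category.assoc,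
    tensorHom₃]
  rw [← associator_inv_naturality, ← id_tensorHom, ← id_tensorHom, tensorHom_comp_tensorHom_assoc,
    tensorHom_comp_tensorHom_assoc, BraidedCategory.braiding_naturality, Category.comp_id,
    Category.id_comp]

theorem tensorSwap_inv_tensorHom₃ {M M' A A' B B' : C} (f : M ⟶ M') (a : A ⟶ A') (b : B ⟶ B') :
    ((f ⊗ₘ b) ⊗ₘ a) ≫ (tensorSwap M' A' B').inv = (tensorSwap M A B).inv ≫ tensorHom₃ f a b := by
  rw [Iso.comp_inv_eq, Category.assoc, tensorSwap_hom_tensorHom₃, Iso.inv_hom_id_assoc]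

theorem tensorSwap_inv_tensorHom₃_assoc {M M' A A' B B' Z : C} (f : M ⟶ M') (a : A ⟶ A')
    (b : B ⟶ B') (h : M' ⊗ A' ⊗ B' ⟶ Z) : ((f ⊗ₘ b) ⊗ₘ a) ≫ (tensorSwap M' A' B').inv ≫ h =
      (tensorSwap M A B).inv ≫ tensorHom₃ f a b ≫ h := by
  rw [← Category.assoc, tensorSwap_inv_tensorHom₃, Category.assoc]

/-- The lifting condition `StageLift` for a family of objects and maps. -/
def FamilyLift {x : C} {X : ℕ → C} (p : ∀ {i j : ℕ}, i ≤ j → (X j ⟶ X i)) (ζ : ∀ t, x ⟶ X t)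
    {L M : C} (i : L ⟶ M) {Z Z' : C} (q : Z ⟶ Z') : Prop :=
  ∀ (t : ℕ) (a : L ⊗ X t ⟶ Z) (b : M ⊗ x ⟶ Z) (d : M ⊗ X t ⟶ Z'),
    L ◁ ζ t ≫ a = i ▷ x ≫ b → a ≫ q = i ▷ X t ≫ d → b ≫ q = M ◁ ζ t ≫ d →
    ∃ (t' : ℕ) (h : t ≤ t') (e : M ⊗ X t' ⟶ Z),
      i ▷ _ ≫ e = L ◁ p h ≫ a ∧ M ◁ ζ t' ≫ e = b ∧ e ≫ q = M ◁ p h ≫ d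

theorem FamilyLift.tensor {x x' L M Z Z' : C} {X X' : ℕ → C}
    {p : ∀ {i j : ℕ}, i ≤ j → (X j ⟶ X i)} {ζ : ∀ t, x ⟶ X t}
    {p' : ∀ {i j : ℕ}, i ≤ j → (X' j ⟶ X' i)} {ζ' : ∀ t, x' ⟶ X' t}
    (hp : ∀ {i j k : ℕ} (h : i ≤ j) (h' : j ≤ k), p h' ≫ p h = p (h.trans h'))
    (hp' : ∀ {i j k : ℕ} (h : i ≤ j) (h' : j ≤ k), p' h' ≫ p' h = p' (h.trans h'))
    (e : ∀ {i j : ℕ} (h : i ≤ j), ζ j ≫ p h = ζ i)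
    (e' : ∀ {i j : ℕ} (h : i ≤ j), ζ' j ≫ p' h = ζ' i) {i : L ⟶ M}
    {q : Z ⟶ Z'} (h' : FamilyLift p' ζ' (i ▷ x) q) (h : ∀ t, FamilyLift p ζ (i ▷ X' t) q) :
    FamilyLift (X := fun t => X t ⊗ X' t) (fun h => p h ⊗ₘ p' h) (fun t => ζ t ⊗ₘ ζ' t) i q := by
  simp only [FamilyLift, ← id_tensorHom, ← tensorHom_id] at h h' ⊢
  simp only [← id_tensorHom_id]
  change ∀ t a b d, tensorHom₃ (𝟙 L) (ζ t) (ζ' t) ≫ a = tensorHom₃ i (𝟙 x) (𝟙 x') ≫ b →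
    a ≫ q = tensorHom₃ i (𝟙 _) (𝟙 _) ≫ d → b ≫ q = tensorHom₃ (𝟙 M) (ζ t) (ζ' t) ≫ d →
    ∃ (t' : ℕ) (h : t ≤ t') (e : M ⊗ (X t' ⊗ X' t') ⟶ Z),
      tensorHom₃ i (𝟙 _) (𝟙 _) ≫ e = tensorHom₃ (𝟙 L) (p h) (p' h) ≫ a ∧
        tensorHom₃ (𝟙 M) (ζ t') (ζ' t') ≫ e = b ∧ e ≫ q = tensorHom₃ (𝟙 M) (p h) (p' h) ≫ d
  intro t a b d h₁ h₂ h₃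
  obtain ⟨t₁, ht₁, e₁, f₁, f₂, f₃⟩ := h' t ((α_ _ _ _).hom ≫ tensorHom₃ (𝟙 L) (ζ t) (𝟙 _) ≫ a)
    ((α_ _ _ _).hom ≫ b) ((α_ _ _ _).hom ≫ tensorHom₃ (𝟙 M) (ζ t) (𝟙 _) ≫ d)
    (by
      rw [← id_tensorHom_id, associator_hom_tensorHom₃_assoc, tensorHom₃_comp_assoc,
        associator_hom_tensorHom₃_assoc, ← h₁]
      simp only [Category.id_comp, Category.comp_id])
    (by
      rw [associator_hom_tensorHom₃_assoc, tensorHom₃_comp_assoc, Category.assoc, Category.assoc, h₂,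
        tensorHom₃_comp_assoc]
      simp only [Category.id_comp, Category.comp_id])
    (by
      rw [← id_tensorHom_id, associator_hom_tensorHom₃_assoc, tensorHom₃_comp_assoc, Category.assoc,
        h₃]
      simp only [Category.id_comp, Category.comp_id])
  obtain ⟨g, rfl⟩ : ∃ g, e₁ = (α_ _ _ _).hom ≫ g := ⟨(α_ _ _ _).inv ≫ e₁, by simp⟩
  rw [associator_hom_tensorHom₃_assoc, ← id_tensorHom_id, associator_hom_tensorHom₃_assoc,
    cancel_epi, tensorHom₃_comp_assoc] at f₁
  rw [← id_tensorHom_id, associator_hom_tensorHom₃_assoc, cancel_epi] at f₂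
  rw [Category.assoc, ← id_tensorHom_id, associator_hom_tensorHom₃_assoc,
    cancel_epi, tensorHom₃_comp_assoc] at f₃
  simp only [Category.id_comp, Category.comp_id] at f₁ f₃
  obtain ⟨t₂, ht₂, e₂, k₁, k₂, k₃⟩ := h t₁ t₁
    ((tensorSwap _ _ _).inv ≫ tensorHom₃ (𝟙 L) (p ht₁) (p' ht₁) ≫ a)
    ((tensorSwap _ _ _).inv ≫ g)
    ((tensorSwap _ _ _).inv ≫ tensorHom₃ (𝟙 M) (p ht₁) (p' ht₁) ≫ d)
    (by
      rw [← id_tensorHom_id, tensorSwap_inv_tensorHom₃_assoc, tensorHom₃_comp_assoc, e,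
        tensorSwap_inv_tensorHom₃_assoc, f₁]
      simp only [Category.id_comp])
    (by
      rw [tensorSwap_inv_tensorHom₃_assoc, tensorHom₃_comp_assoc, Category.assoc, Category.assoc, h₂,
        tensorHom₃_comp_assoc]
      simp only [Category.id_comp, Category.comp_id])
    (by
      rw [← id_tensorHom_id, tensorSwap_inv_tensorHom₃_assoc, tensorHom₃_comp_assoc, e,
        Category.assoc, f₃]
      simp only [Category.id_comp])
  obtain ⟨g', rfl⟩ : ∃ g', e₂ = (tensorSwap _ _ _).inv ≫ g' := ⟨(tensorSwap _ _ _).hom ≫ e₂, by simp⟩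
  rw [tensorSwap_inv_tensorHom₃_assoc, ← id_tensorHom_id, tensorSwap_inv_tensorHom₃_assoc,
    cancel_epi, tensorHom₃_comp_assoc, hp, Category.id_comp, Category.id_comp] at k₁
  rw [← id_tensorHom_id, tensorSwap_inv_tensorHom₃_assoc, cancel_epi] at k₂
  rw [Category.assoc, ← id_tensorHom_id, tensorSwap_inv_tensorHom₃_assoc,
    cancel_epi, tensorHom₃_comp_assoc, hp, Category.id_comp, Category.id_comp] at k₃
  refine ⟨t₂, ht₁.trans ht₂, tensorHom₃ (𝟙 M) (𝟙 _) (p' ht₂) ≫ g', ?_, ?_, ?_⟩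
  · have k₁' := congrArg (tensorHom₃ (𝟙 L) (𝟙 _) (p' ht₂) ≫ ·) k₁
    simp only [tensorHom₃_comp_assoc, Category.id_comp, Category.comp_id, hp'] at k₁' ⊢
    exact k₁'
  · have k₂' := congrArg (tensorHom₃ (𝟙 M) (𝟙 _) (ζ' t₂ ≫ p' ht₂) ≫ ·) k₂
    simp only [e', tensorHom₃_comp_assoc, Category.id_comp, Category.comp_id] at k₂' ⊢
    exact k₂'.trans f₂
  · have k₃' := congrArg (tensorHom₃ (𝟙 M) (𝟙 _) (p' ht₂) ≫ ·) k₃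
    simp only [tensorHom₃_comp_assoc, Category.id_comp, Category.comp_id, hp',
      Category.assoc] at k₃' ⊢
    exact k₃'

theorem StageLift.tensor {x x' L M Z Z' : C} {X X' : ℕᵒᵖ ⥤ C}
    {ξ : (Functor.const ℕᵒᵖ).obj x ⟶ X} {ξ' : (Functor.const ℕᵒᵖ).obj x' ⟶ X'} {i : L ⟶ M}
    {q : Z ⟶ Z'} (h' : StageLift ξ' (i ▷ x) q) (h : ∀ t, StageLift ξ (i ▷ X'.obj (op t)) q) :
    StageLift (towerTensorMap ξ ξ') i q := by
  have nat : ∀ {x : C} {X : ℕᵒᵖ ⥤ C} (ξ : (Functor.const ℕᵒᵖ).obj x ⟶ X) {i j : ℕ} (h : i ≤ j),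
      ξ.app (op j) ≫ X.map (homOfLE h).op = ξ.app (op i) := by
    intro x X ξ i j h
    rw [← ξ.naturality]
    exact Category.id_comp _
  exact FamilyLift.tensor (X := fun t => X.obj (op t)) (X' := fun t => X'.obj (op t))
    (p := fun h => X.map (homOfLE h).op) (p' := fun h => X'.map (homOfLE h).op)
    (ζ := fun t => ξ.app (op t)) (ζ' := fun t => ξ'.app (op t))
    (fun h h' => (X.map_comp _ _).symm) (fun h h' => (X'.map_comp _ _).symm)
    (nat ξ) (nat ξ') h' h

theorem exists_towerPower (hC : IsOperadicModelCategory C ι) [IsCofibrant y]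
    (hw : ∀ n, IsCofibrant (w.obj n)) (Q : MorphismProperty C)
    (hη : ∀ {L M Z Z' : C} (i : L ⟶ M) (q : Z ⟶ Z') [IsCofibrant L] [Cofibration i], Q q →
      StageLift η i q) {S : Type} (s : OTree S) :
    ∃ M : TowerPower η s, IsCofibrant M.x ∧ (∀ n, IsCofibrant (M.X.obj n)) ∧
      ∀ {L N Z Z' : C} (i : L ⟶ N) (q : Z ⟶ Z') [IsCofibrant L] [Cofibration i], Q q →
        StageLift M.ξ i q := by
  induction s with
  | nil =>
    have := hC.isCofibrant_unit
    exact ⟨⟨𝟙 _, constTowerIso (𝟙_ C), Iso.refl _, rfl⟩, this, fun _ => this,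
      fun i q _ _ _ => .refl i q⟩
  | leaf a =>
    exact ⟨⟨η, Iso.refl _, Iso.refl _, (Category.comp_id _).trans (Category.id_comp _).symm⟩,
      ‹_›, hw, fun i q _ _ h => hη i q h⟩
  | node l r hl hr =>
    obtain ⟨M, h₁, h₂, h₃⟩ := hl
    obtain ⟨M', h₁', h₂', h₃'⟩ := hr
    refine ⟨⟨towerTensorMap M.ξ M'.ξ, (M.Φ ⊗ᵢ M'.Φ) ≪≫ towerTensorIso _ _,
      (M.Ψ ⊗ᵢ M'.Ψ) ≪≫ Functor.Monoidal.μIso const _ _, ?_⟩, hC.isCofibrant_tensor _ _,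
      fun n => ?_, fun {L N Z Z'} i q _ _ h => ?_⟩
    · change (tensMap _ l ⊗ₘ tensMap _ r) ≫ (M.Φ.hom ⊗ₘ M'.Φ.hom) ≫ _ =
        ((M.Ψ.hom ⊗ₘ M'.Ψ.hom) ≫ Functor.LaxMonoidal.μ const _ _) ≫ _
      rw [tensorHom_comp_tensorHom_assoc, M.comm, M'.comm, ← tensorHom_comp_tensorHom_assoc,
        tensorMap_towerTensorIso, Category.assoc]
    · have := h₂ n
      have := h₂' n
      exact hC.isCofibrant_tensor _ _
    · have := hC.isCofibrant_tensor L M.x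
      have := hC.cofibration_whiskerRight i M.x
      refine (h₃' (i ▷ M.x) q h).tensor fun t => ?_
      have := h₂' (op t)
      have := hC.isCofibrant_tensor L (M'.X.obj (op t))
      have := hC.cofibration_whiskerRight i (M'.X.obj (op t))
      exact h₃ _ q h

/-- The lifting condition that remains after all formal reductions. -/
theorem isContractibleKan_liftSpace_of_stageLift (hC : IsOperadicModelCategory C ι) [IsCofibrant y]
    (hw : ∀ n, IsCofibrant (w.obj n)) {O : SOperad.{v}} (hO : O.IsCofibrant) (θ : OAlgebra ι O y)
    (hη₀ : ∀ {L M : C} (i : L ⟶ M) [IsCofibrant L] [Cofibration i],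
      StageLift η i (terminal.from (w.obj (op 0))))
    (hη : ∀ {L M : C} (i : L ⟶ M) (s : ℕ) [IsCofibrant L] [Cofibration i],
      StageLift η i (w.map (homOfLE s.le_succ).op)) :
    IsContractibleKan (liftSpace ι θ (towerProMap η)) := by
  refine isContractibleKan_liftSpace ι hO θ _ (isAcyclicFibrationOfOperads_of_towerPower ι ?_)
  intro S _ s
  obtain ⟨M, -, -, h⟩ := exists_towerPower hC hw
    (fun Z Z' q => ∀ {L M : C} (i : L ⟶ M) [IsCofibrant L] [Cofibration i], StageLift η i q)
    (fun i q _ _ h => h i) s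
  refine ⟨M, fun k => ?_⟩
  have := hC.isCofibrant_obj (∂Δ[k] : SSet.{v})
  have := hC.cofibration_boundary k
  exact ⟨h _ _ hη₀, fun s => h _ _ fun i _ _ => hη i s⟩

end Cofibrations

end

section

variable {C : Type u} [Category.{v} C] [ModelCategory C]

variable (C) in
/-- The localization functor to the homotopy category. -/
abbrev hoQ : C ⥤ (weakEquivalences C).Localization := (weakEquivalences C).Q

/-! ### The homotopy category -/

instance isIso_hoMap {X Y : C} (f : X ⟶ Y) [hf : WeakEquivalence f] : IsIso ((hoQ C).map f) :=
  Localization.inverts (hoQ C) (weakEquivalences C) f (by rwa [← weakEquivalence_iff])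

/-- Homotopy extension: a map defined on a cofibration and extended in the homotopy category
extends. -/
theorem exists_extension_of_hoMap {A B z : C} (i : A ⟶ B) [Cofibration i] [IsCofibrant A]
    [IsFibrant z] (φ : A ⟶ z) (ψ : (hoQ C).obj B ⟶ (hoQ C).obj z) (h : (hoQ C).map i ≫ ψ = (hoQ C).map φ) :
    ∃ χ : B ⟶ z, i ≫ χ = φ ∧ (hoQ C).map χ = ψ := by
  have : IsCofibrant B := isCofibrant_of_cofibration i
  obtain ⟨χ, rfl⟩ := map_surjective_of_isLocalization (hoQ C) B z ψ
  rw [← Functor.map_comp] at h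
  obtain ⟨P, hP, ⟨r⟩⟩ := ((RightHomotopyRel.iff_map_eq (hoQ C) _ _).2 h).exists_good_pathObject
  obtain ⟨χ', r', hr⟩ := r.homotopy_extension i χ rfl
  refine ⟨χ', ?_, ?_⟩
  · rw [← r.h₁, ← hr, Category.assoc, r'.h₁]
  · exact ((RightHomotopyRel.iff_map_eq (hoQ C) _ _).1 r'.rightHomotopyRel).symm

/-- A map of the homotopy category is null if it factors through the terminal object of `C`. -/
def IsNull {a b : (weakEquivalences C).Localization} (φ : a ⟶ b) : Prop :=
  ∃ (p : a ⟶ (hoQ C).obj (⊤_ C)) (q : (hoQ C).obj (⊤_ C) ⟶ b), p ≫ q = φ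

theorem IsNull.precomp {a b c : (weakEquivalences C).Localization} {φ : b ⟶ c} (h : IsNull φ)
    (ψ : a ⟶ b) : IsNull (ψ ≫ φ) := by
  obtain ⟨p, q, rfl⟩ := h
  exact ⟨ψ ≫ p, q, Category.assoc _ _ _⟩

theorem IsNull.postcomp {a b c : (weakEquivalences C).Localization} {φ : a ⟶ b} (h : IsNull φ)
    (ψ : b ⟶ c) : IsNull (φ ≫ ψ) := by
  obtain ⟨p, q, rfl⟩ := h
  exact ⟨p, q ≫ ψ, (Category.assoc _ _ _).symm⟩

theorem isNull_of_factor {a b : (weakEquivalences C).Localization} {P : C} (hP : IsWeaklyTrivial P)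
    (p : a ⟶ (hoQ C).obj P) (q : (hoQ C).obj P ⟶ b) : IsNull (p ≫ q) := by
  have : WeakEquivalence (terminal.from P) := hP
  exact ⟨p ≫ (hoQ C).map (terminal.from P), inv ((hoQ C).map (terminal.from P)) ≫ q, by simp⟩

theorem isWeaklyTrivial_iff {P P' : C} (f : P ⟶ P') [WeakEquivalence f] :
    IsWeaklyTrivial P ↔ IsWeaklyTrivial P' := by
  unfold IsWeaklyTrivial
  rw [← terminal.comp_from f, weakEquivalence_precomp_iff]

theorem weakEquivalence_of_isWeaklyTrivial {P P' : C} (f : P ⟶ P') (h : IsWeaklyTrivial P)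
    (h' : IsWeaklyTrivial P') : WeakEquivalence f := by
  unfold IsWeaklyTrivial at h h'
  exact weakEquivalence_of_postcomp_of_fac (terminal.comp_from f)

/-- A null map extends over any cofibration to a weakly trivial object. -/
theorem exists_extension_of_isNull {A B z : C} (i : A ⟶ B) [Cofibration i] [IsCofibrant A]
    [IsFibrant z] (hB : IsWeaklyTrivial B) {φ : A ⟶ z} (h : IsNull ((hoQ C).map φ)) :
    ∃ χ : B ⟶ z, i ≫ χ = φ := by
  obtain ⟨p, q, h⟩ := h
  have : WeakEquivalence (terminal.from B) := hB
  have : IsFibrant (⊤_ C) := (isFibrant_iff_of_isTerminal (𝟙 (⊤_ C)) terminalIsTerminal).2 inferInstance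
  obtain ⟨p', hp'⟩ : ∃ p' : A ⟶ ⊤_ C, (hoQ C).map p' = p :=
    map_surjective_of_isLocalization (hoQ C) A (⊤_ C) p
  obtain ⟨χ, hχ, -⟩ := exists_extension_of_hoMap i φ ((hoQ C).map (terminal.from B) ≫ q) (by
    rw [← Category.assoc, ← Functor.map_comp, ← h, ← hp']
    exact congrArg (fun r => (hoQ C).map r ≫ q) (Subsingleton.elim _ _))
  exact ⟨χ, hχ⟩

section Functor

variable (F : C ⥤ C) (hF : ∀ {X Y : C} (f : X ⟶ Y) [WeakEquivalence f], WeakEquivalence (F.map f))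
include hF

theorem exists_hoFunctor : ∃ G : (weakEquivalences C).Localization ⥤
    (weakEquivalences C).Localization, Nonempty (hoQ C ⋙ G ≅ F ⋙ hoQ C) := by
  have h : (weakEquivalences C).IsInvertedBy (F ⋙ hoQ C) := fun X Y f hf => by
    have : WeakEquivalence f := by rwa [weakEquivalence_iff]
    have := hF f
    exact isIso_hoMap (F.map f)
  exact ⟨Localization.lift _ h (hoQ C), ⟨Localization.fac _ h (hoQ C)⟩⟩

theorem IsNull.map (hT : IsWeaklyTrivial (F.obj (⊤_ C))) {X Y : C} {f : X ⟶ Y}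
    (h : IsNull ((hoQ C).map f)) : IsNull ((hoQ C).map (F.map f)) := by
  obtain ⟨G, ⟨e⟩⟩ := exists_hoFunctor F hF
  obtain ⟨p, q, h⟩ := h
  have hn := isNull_of_factor hT (e.inv.app X ≫ G.map p ≫ e.hom.app _)
    (e.inv.app _ ≫ G.map q ≫ e.hom.app Y)
  have : (e.inv.app X ≫ G.map p ≫ e.hom.app (⊤_ C)) ≫ e.inv.app (⊤_ C) ≫ G.map q ≫ e.hom.app Y =
      (hoQ C).map (F.map f) := by
    have h1 := e.hom.naturality f
    have h2 : G.map p ≫ G.map q = G.map ((hoQ C).map f) := by rw [← G.map_comp, h]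
    simp only [Category.assoc, Iso.hom_inv_id_app_assoc]
    rw [reassoc_of% h2]
    exact (congrArg (e.inv.app X ≫ ·) h1).trans (by simp)
  rwa [this] at hn

/-- Natural transformations of functors preserving weak equivalences are natural in the homotopy
category. -/
theorem exists_hoMap_comp_eq (τ : F ⟶ 𝟭 C) {X Y : C} (γ : (hoQ C).obj X ⟶ (hoQ C).obj Y) :
    ∃ γ' : (hoQ C).obj (F.obj X) ⟶ (hoQ C).obj (F.obj Y), (hoQ C).map (τ.app X) ≫ γ = γ' ≫ (hoQ C).map (τ.app Y) := by
  have h : (weakEquivalences C).IsInvertedBy (F ⋙ hoQ C) := fun X Y f hf => by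
    have : WeakEquivalence f := by rwa [weakEquivalence_iff]
    have := hF f
    exact isIso_hoMap (F.map f)
  let G := Localization.lift _ h (hoQ C)
  let e : (hoQ C) ⋙ G ≅ F ⋙ hoQ C := Localization.fac _ h (hoQ C)
  have : Localization.Lifting (hoQ C) (weakEquivalences C) (F ⋙ hoQ C) G := ⟨e⟩
  let : Localization.Lifting (hoQ C) (weakEquivalences C) (hoQ C) (𝟭 _) := ⟨Functor.rightUnitor _⟩
  let T : G ⟶ 𝟭 _ := Localization.liftNatTrans (hoQ C) (weakEquivalences C) (F ⋙ hoQ C) (hoQ C) G (𝟭 _)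
    (Functor.whiskerRight τ (hoQ C))
  have hT : ∀ X, ∃ (α : G.obj ((hoQ C).obj X) ≅ (hoQ C).obj (F.obj X)),
      T.app ((hoQ C).obj X) = α.hom ≫ (hoQ C).map (τ.app X) := fun X =>
    ⟨(Localization.Lifting.iso (hoQ C) (weakEquivalences C) (F ⋙ hoQ C) G).app X, by
      have := Localization.liftNatTrans_app (hoQ C) (weakEquivalences C) (F ⋙ hoQ C) (hoQ C) G (𝟭 _)
        (Functor.whiskerRight τ (hoQ C)) X
      exact this.trans (congrArg (_ ≫ ·) (Category.comp_id ((hoQ C).map (τ.app X))))⟩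
  obtain ⟨α, hα⟩ := hT X
  obtain ⟨β, hβ⟩ := hT Y
  refine ⟨α.inv ≫ G.map γ ≫ β.hom, ?_⟩
  have := T.naturality γ
  rw [hα, hβ] at this
  rw [Category.assoc, Category.assoc, this]
  simp

end Functor

end

section

variable {C : Type u} [Category.{v} C] [ModelCategory C]

/-! ### Factorizations and pushouts -/

theorem exists_cofibration_trivialFibration {A B : C} (f : A ⟶ B) :
    ∃ (M : C) (i : A ⟶ M) (p : M ⟶ B), Cofibration i ∧ Fibration p ∧ WeakEquivalence p ∧
      i ≫ p = f :=
  let d := MorphismProperty.factorizationData (cofibrations C) (trivialFibrations C) f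
  ⟨d.Z, d.i, d.p, inferInstance, inferInstance, inferInstance, d.fac⟩

theorem exists_trivialCofibration_fibration {A B : C} (f : A ⟶ B) :
    ∃ (M : C) (i : A ⟶ M) (p : M ⟶ B), Cofibration i ∧ WeakEquivalence i ∧ Fibration p ∧
      i ≫ p = f :=
  let d := MorphismProperty.factorizationData (trivialCofibrations C) (fibrations C) f
  ⟨d.Z, d.i, d.p, inferInstance, inferInstance, inferInstance, d.fac⟩

theorem exists_cofibrant_resolution (X : C) :
    ∃ (X' : C) (p : X' ⟶ X), IsCofibrant X' ∧ Fibration p ∧ WeakEquivalence p := by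
  obtain ⟨M, i, p, _, _, _, -⟩ := exists_cofibration_trivialFibration (initial.to X)
  exact ⟨M, p, (isCofibrant_iff_of_isInitial i initialIsInitial).2 inferInstance, ‹_›, ‹_›⟩

theorem exists_fibrant_resolution (X : C) :
    ∃ (X' : C) (i : X ⟶ X'), IsFibrant X' ∧ Cofibration i ∧ WeakEquivalence i := by
  obtain ⟨M, i, p, _, _, _, -⟩ := exists_trivialCofibration_fibration (terminal.from X)
  exact ⟨M, i, (isFibrant_iff_of_isTerminal p terminalIsTerminal).2 inferInstance, ‹_›, ‹_›⟩

/-- Every object has a cofibration to a weakly trivial fibrant object. -/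
theorem exists_cofibration_isWeaklyTrivial (X : C) :
    ∃ (D : C) (i : X ⟶ D), Cofibration i ∧ IsWeaklyTrivial D ∧ IsFibrant D := by
  obtain ⟨M, i, p, _, _, _, -⟩ := exists_cofibration_trivialFibration (terminal.from X)
  refine ⟨M, i, ‹_›, ?_, (isFibrant_iff_of_isTerminal p terminalIsTerminal).2 inferInstance⟩
  rwa [IsWeaklyTrivial, Subsingleton.elim (terminal.from M) p]

theorem exists_lift {A B X Y : C} (i : A ⟶ B) (p : X ⟶ Y) [Cofibration i] [Fibration p]
    (h : WeakEquivalence i ∨ WeakEquivalence p) (f : A ⟶ X) (g : B ⟶ Y) (w : f ≫ p = i ≫ g) :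
    ∃ l : B ⟶ X, i ≫ l = f ∧ l ≫ p = g := by
  have sq : CommSq f i p g := ⟨w⟩
  obtain h | h := h
  · exact ⟨sq.lift, sq.fac_left, sq.fac_right⟩
  · exact ⟨sq.lift, sq.fac_left, sq.fac_right⟩

theorem exists_extension {A B X : C} (i : A ⟶ B) [Cofibration i] [IsFibrant X]
    (h : WeakEquivalence i ∨ IsWeaklyTrivial X) (f : A ⟶ X) : ∃ l : B ⟶ X, i ≫ l = f := by
  have : Fibration (terminal.from X) :=
    (isFibrant_iff_of_isTerminal (terminal.from X) terminalIsTerminal).1 inferInstance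
  obtain ⟨l, hl, -⟩ := exists_lift i (terminal.from X) h f (terminal.from B) (Subsingleton.elim _ _)
  exact ⟨l, hl⟩

section

variable {A B D P : C} {i : A ⟶ B} {g : A ⟶ D} {a : B ⟶ P} {b : D ⟶ P}

theorem cofibration_of_isPushout (sq : IsPushout i g a b) [hi : Cofibration i] :
    Cofibration b := by
  rw [cofibration_iff] at hi ⊢
  exact MorphismProperty.of_isPushout sq.flip hi

theorem fibration_of_isPullback {A B D P : C} {i : A ⟶ B} {g : A ⟶ D} {a : B ⟶ P} {b : D ⟶ P}
    (sq : IsPullback i g a b) [ha : Fibration a] : Fibration g := by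
  rw [fibration_iff] at ha ⊢
  exact MorphismProperty.of_isPullback sq ha

variable (hp : IsProper C)
include hp

theorem IsProper.weakEquivalence_pushout_desc_right {D' P' : C} {a' : B ⟶ P'} {b' : D' ⟶ P'}
    (d : D ⟶ D') {g' : A ⟶ D'} (hg : g ≫ d = g') (sq : IsPushout i g a b)
    (sq' : IsPushout i g' a' b') (π : P ⟶ P')
    (h₁ : a ≫ π = a') (h₂ : b ≫ π = d ≫ b') [Cofibration i] [WeakEquivalence d] :
    WeakEquivalence π := by
  subst hg
  subst h₁
  have := cofibration_of_isPushout sq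
  exact hp.left (IsPushout.of_top sq' h₂ sq)

theorem IsProper.weakEquivalence_pushout_desc_left {B' P' : C} {i' : A ⟶ B'} {a' : B' ⟶ P'}
    {b' : D ⟶ P'} (β : B ⟶ B') (hβ : i ≫ β = i') (sq : IsPushout i g a b)
    (sq' : IsPushout i' g a' b') (π : P ⟶ P')
    (h₁ : a ≫ π = β ≫ a') (h₂ : b ≫ π = b') [Cofibration i] [Cofibration i'] [WeakEquivalence β] :
    WeakEquivalence π := by
  obtain ⟨D₁, g₁, d, _, _, _, hd⟩ := exists_cofibration_trivialFibration g
  have s₁ := IsPushout.of_hasPushout i g₁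
  have s₁' := IsPushout.of_hasPushout i' g₁
  let π₁ : pushout i g₁ ⟶ pushout i' g₁ := s₁.desc (β ≫ pushout.inl _ _) (pushout.inr _ _) (by
    rw [← Category.assoc, hβ, s₁'.w])
  have h₁l : pushout.inl _ _ ≫ π₁ = β ≫ pushout.inl _ _ := s₁.inl_desc _ _ _
  have h₁r : pushout.inr _ _ ≫ π₁ = pushout.inr _ _ := s₁.inr_desc _ _ _
  have : WeakEquivalence π₁ := by
    have hs : IsPushout (i ≫ β) g₁ (pushout.inl i' g₁) (pushout.inr i g₁ ≫ π₁) := by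
      rw [hβ, h₁r]; exact s₁'
    have hs' := IsPushout.of_left hs h₁l.symm s₁
    have := cofibration_of_isPushout s₁.flip
    exact hp.left hs'.flip
  let q : pushout i g₁ ⟶ P := s₁.desc a (d ≫ b) (by rw [sq.w, ← hd, Category.assoc])
  let q' : pushout i' g₁ ⟶ P' := s₁'.desc a' (d ≫ b') (by rw [sq'.w, ← hd, Category.assoc])
  have := hp.weakEquivalence_pushout_desc_right d hd s₁ sq q (s₁.inl_desc _ _ _) (s₁.inr_desc _ _ _)
  have := hp.weakEquivalence_pushout_desc_right d hd s₁' sq' q' (s₁'.inl_desc _ _ _)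
    (s₁'.inr_desc _ _ _)
  have e : q ≫ π = π₁ ≫ q' := by
    apply s₁.hom_ext
    · rw [← Category.assoc, s₁.inl_desc, h₁, ← Category.assoc, h₁l, Category.assoc,
        s₁'.inl_desc]
    · rw [← Category.assoc, s₁.inr_desc, Category.assoc, h₂, ← Category.assoc, h₁r,
        s₁'.inr_desc]
  have : WeakEquivalence (q ≫ π) := by rw [e]; infer_instance
  exact weakEquivalence_of_precomp q π

/-- The gluing lemma. -/
theorem IsProper.weakEquivalence_pushout_desc {A' B' D' P' : C} {i' : A' ⟶ B'} {g' : A' ⟶ D'}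
    {a' : B' ⟶ P'} {b' : D' ⟶ P'} (sq : IsPushout i g a b) (sq' : IsPushout i' g' a' b')
    (α : A ⟶ A') (β : B ⟶ B') (δ : D ⟶ D') (π : P ⟶ P') (hi : i ≫ β = α ≫ i')
    (hg : g ≫ δ = α ≫ g') (h₁ : a ≫ π = β ≫ a') (h₂ : b ≫ π = δ ≫ b')
    [Cofibration i] [Cofibration i'] [WeakEquivalence α] [WeakEquivalence β] [WeakEquivalence δ] :
    WeakEquivalence π := by
  have s := IsPushout.of_hasPushout i α
  have := cofibration_of_isPushout s
  have : WeakEquivalence (pushout.inl i α) := hp.left s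
  let γ : pushout i α ⟶ B' := s.desc β i' hi
  have : WeakEquivalence γ := weakEquivalence_of_precomp_of_fac (s.inl_desc β i' hi)
  have s' := IsPushout.of_hasPushout (pushout.inr i α) g'
  let π' : pushout (pushout.inr i α) g' ⟶ P' := s'.desc (γ ≫ a') b' (by
    rw [← Category.assoc, s.inr_desc, sq'.w])
  have : WeakEquivalence π' := hp.weakEquivalence_pushout_desc_left γ (s.inr_desc β i' hi) s' sq' π'
    (s'.inl_desc _ _ _) (s'.inr_desc _ _ _)
  have s'' := s.paste_vert s'
  let π'' : P ⟶ pushout (pushout.inr i α) g' := sq.desc (pushout.inl i α ≫ pushout.inl _ _)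
    (δ ≫ pushout.inr _ _) (by
      exact s''.w.trans (by rw [← hg, Category.assoc]))
  have : WeakEquivalence π'' := by
    have hs : IsPushout i (α ≫ g') (pushout.inl i α ≫ pushout.inl (pushout.inr i α) g')
      (pushout.inr (pushout.inr i α) g') := s''
    exact hp.weakEquivalence_pushout_desc_right δ hg sq hs π'' (sq.inl_desc _ _ _)
      (sq.inr_desc _ _ _)
  have e : π'' ≫ π' = π := by
    apply sq.hom_ext
    · rw [← Category.assoc, sq.inl_desc, Category.assoc, s'.inl_desc, ← Category.assoc,
        s.inl_desc, h₁]
    · rw [← Category.assoc, sq.inr_desc, Category.assoc, s'.inr_desc, h₂]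
  rw [← e]
  infer_instance

/-! ### Homotopy pushouts -/

section

variable {A B A' B' : C} {f : A ⟶ B} {g : A ⟶ A'} {h : B ⟶ B'} {k : A' ⟶ B'}

theorem IsProper.isHoPushout_weakEquivalence (H : IsHoPushout f g h k) {M P : C} {i : A ⟶ M}
    {p : M ⟶ B} [Cofibration i] [WeakEquivalence p] (hip : i ≫ p = f) {a : M ⟶ P} {b : A' ⟶ P}
    (sq : IsPushout i g a b) {r : P ⟶ B'} (h₁ : a ≫ r = p ≫ h) (h₂ : b ≫ r = k) :
    WeakEquivalence r := by
  obtain ⟨-, M', i', p', P', a', b', r', _, _, hip', sq', h₁', h₂', _⟩ := H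
  obtain ⟨N, j, q, _, _, _, hjq⟩ := exists_trivialCofibration_fibration p'
  have : WeakEquivalence q := weakEquivalence_of_precomp_of_fac hjq
  obtain ⟨l, hl, hlq⟩ := exists_lift i q (Or.inr ‹_›) (i' ≫ j) p (by
    rw [Category.assoc, hjq, hip, hip'])
  have : WeakEquivalence l := weakEquivalence_of_postcomp_of_fac hlq
  have s := IsPushout.of_hasPushout (i' ≫ j) g
  let π : P ⟶ pushout (i' ≫ j) g := sq.desc (l ≫ pushout.inl _ _) (pushout.inr _ _) (by
    rw [← Category.assoc, hl, s.w])
  let π' : P' ⟶ pushout (i' ≫ j) g := sq'.desc (j ≫ pushout.inl _ _) (pushout.inr _ _) (by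
    rw [← Category.assoc, s.w])
  have := hp.weakEquivalence_pushout_desc_left l hl sq s π (sq.inl_desc _ _ _) (sq.inr_desc _ _ _)
  have := hp.weakEquivalence_pushout_desc_left j rfl sq' s π' (sq'.inl_desc _ _ _)
    (sq'.inr_desc _ _ _)
  let ρ : pushout (i' ≫ j) g ⟶ B' := s.desc (q ≫ h) k (by
    rw [Category.assoc, ← Category.assoc j, hjq, ← h₁', ← h₂', ← Category.assoc, sq'.w,
      Category.assoc])
  have e' : π' ≫ ρ = r' := by
    apply sq'.hom_ext
    · rw [← Category.assoc, sq'.inl_desc, Category.assoc, s.inl_desc, h₁', ← Category.assoc, hjq]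
    · rw [← Category.assoc, sq'.inr_desc, s.inr_desc, h₂']
  have e : π ≫ ρ = r := by
    apply sq.hom_ext
    · rw [← Category.assoc, sq.inl_desc, Category.assoc, s.inl_desc, h₁, ← Category.assoc, hlq]
    · rw [← Category.assoc, sq.inr_desc, s.inr_desc, h₂]
  have : WeakEquivalence ρ := weakEquivalence_of_precomp_of_fac e'
  rw [← e]
  infer_instance

/-- A commutative square is a homotopy pushout if and only if the pushout of a resolution of its
span maps to it by a weak equivalence. -/
theorem IsProper.isHoPushout_iff (w : f ≫ h = g ≫ k) {X M D P : C} {i : X ⟶ M} {c : X ⟶ D}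
    {a : M ⟶ P} {b : D ⟶ P} (sq : IsPushout i c a b) (α : X ⟶ A) (β : M ⟶ B) (δ : D ⟶ A')
    (r : P ⟶ B') (hi : i ≫ β = α ≫ f) (hc : c ≫ δ = α ≫ g) (h₁ : a ≫ r = β ≫ h)
    (h₂ : b ≫ r = δ ≫ k)
    [Cofibration i] [WeakEquivalence α] [WeakEquivalence β] [WeakEquivalence δ] :
    IsHoPushout f g h k ↔ WeakEquivalence r := by
  obtain ⟨N, j, q, _, _, _, hjq⟩ := exists_cofibration_trivialFibration f
  obtain ⟨l, hl, hlq⟩ := exists_lift i q (Or.inr ‹_›) (α ≫ j) β (by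
    rw [Category.assoc, hjq, hi])
  have : WeakEquivalence l := weakEquivalence_of_postcomp_of_fac hlq
  have s := IsPushout.of_hasPushout j g
  let ρ : pushout j g ⟶ B' := s.desc (q ≫ h) k (by rw [← Category.assoc, hjq, w])
  let π : P ⟶ pushout j g := sq.desc (l ≫ pushout.inl _ _) (δ ≫ pushout.inr _ _) (by
    rw [← Category.assoc, hl, Category.assoc, s.w, ← Category.assoc, ← Category.assoc, hc])
  have : WeakEquivalence π := hp.weakEquivalence_pushout_desc sq s α l δ π hl hc
    (sq.inl_desc _ _ _) (sq.inr_desc _ _ _)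
  have e : π ≫ ρ = r := by
    apply sq.hom_ext
    · rw [← Category.assoc, sq.inl_desc, Category.assoc, s.inl_desc, ← Category.assoc, hlq, h₁]
    · rw [← Category.assoc, sq.inr_desc, Category.assoc, s.inr_desc, h₂]
  rw [← e, weakEquivalence_precomp_iff]
  constructor
  · intro H
    exact hp.isHoPushout_weakEquivalence H hjq s (s.inl_desc _ _ _) (s.inr_desc _ _ _)
  · intro H
    exact ⟨w, N, j, q, _, _, _, ρ, ‹_›, ‹_›, hjq, s, s.inl_desc _ _ _, s.inr_desc _ _ _, H⟩

omit hp in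
/-- A resolution of a span by cofibrations of cofibrant objects. -/
theorem exists_span_resolution (f : A ⟶ B) (g : A ⟶ A') :
    ∃ (X M D : C) (i : X ⟶ M) (c : X ⟶ D) (α : X ⟶ A) (β : M ⟶ B) (δ : D ⟶ A'),
      IsCofibrant X ∧ Cofibration i ∧ Cofibration c ∧ WeakEquivalence α ∧ WeakEquivalence β ∧
        WeakEquivalence δ ∧ i ≫ β = α ≫ f ∧ c ≫ δ = α ≫ g := by
  obtain ⟨X, α, _, _, _⟩ := exists_cofibrant_resolution A
  obtain ⟨M, i, β, _, _, _, hi⟩ := exists_cofibration_trivialFibration (α ≫ f)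
  obtain ⟨D, c, δ, _, _, _, hc⟩ := exists_cofibration_trivialFibration (α ≫ g)
  exact ⟨X, M, D, i, c, α, β, δ, ‹_›, ‹_›, ‹_›, ‹_›, ‹_›, ‹_›, hi, hc⟩

theorem IsProper.isHoPushout_flip (H : IsHoPushout f g h k) : IsHoPushout g f k h := by
  obtain ⟨X, M, D, i, c, α, β, δ, _, _, _, _, _, _, hi, hc⟩ := exists_span_resolution f g
  have s := IsPushout.of_hasPushout i c
  have e : i ≫ β ≫ h = c ≫ δ ≫ k := by
    rw [← Category.assoc, hi, Category.assoc, H.1, ← Category.assoc, ← hc, Category.assoc]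
  exact (hp.isHoPushout_iff H.1.symm s.flip α δ β (s.desc (β ≫ h) (δ ≫ k) e) hc hi
    (s.inr_desc _ _ _) (s.inl_desc _ _ _)).2
    ((hp.isHoPushout_iff H.1 s α β δ _ hi hc (s.inl_desc _ _ _) (s.inr_desc _ _ _)).1 H)

theorem IsProper.isHoPushout_of_isPushout [Cofibration f] (sq : IsPushout f g h k) :
    IsHoPushout f g h k :=
  (hp.isHoPushout_iff sq.w sq (𝟙 _) (𝟙 _) (𝟙 _) (𝟙 _) (by simp) (by simp) (by simp)
    (by simp)).2 inferInstance

theorem IsProper.isHoPushout_iff_of_weakEquivalence {A₁ B₁ A₁' B₁' : C} {f₁ : A₁ ⟶ B₁}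
    {g₁ : A₁ ⟶ A₁'} {h₁ : B₁ ⟶ B₁'} {k₁ : A₁' ⟶ B₁'} (w : f ≫ h = g ≫ k) (w₁ : f₁ ≫ h₁ = g₁ ≫ k₁)
    (x : A ⟶ A₁) (y : B ⟶ B₁) (x' : A' ⟶ A₁') (y' : B' ⟶ B₁') (hf : f ≫ y = x ≫ f₁)
    (hg : g ≫ x' = x ≫ g₁) (hh : h ≫ y' = y ≫ h₁) (hk : k ≫ y' = x' ≫ k₁)
    [WeakEquivalence x] [WeakEquivalence y] [WeakEquivalence x'] [WeakEquivalence y'] :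
    IsHoPushout f g h k ↔ IsHoPushout f₁ g₁ h₁ k₁ := by
  obtain ⟨X, M, D, i, c, α, β, δ, _, _, _, _, _, _, hi, hc⟩ := exists_span_resolution f g
  have s := IsPushout.of_hasPushout i c
  have e : i ≫ β ≫ h = c ≫ δ ≫ k := by
    rw [← Category.assoc, hi, Category.assoc, w, ← Category.assoc, ← hc, Category.assoc]
  rw [hp.isHoPushout_iff w s α β δ (s.desc (β ≫ h) (δ ≫ k) e) hi hc (s.inl_desc _ _ _)
    (s.inr_desc _ _ _),
    hp.isHoPushout_iff w₁ s (α ≫ x) (β ≫ y) (δ ≫ x') (s.desc (β ≫ h) (δ ≫ k) e ≫ y')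
      (by rw [← Category.assoc, hi, Category.assoc, hf, Category.assoc])
      (by rw [← Category.assoc, hc, Category.assoc, hg, Category.assoc])
      (by rw [← Category.assoc, s.inl_desc, Category.assoc, hh, Category.assoc])
      (by rw [← Category.assoc, s.inr_desc, Category.assoc, hk, Category.assoc]),
    weakEquivalence_postcomp_iff]

/-- Pasting of homotopy pushouts. -/
theorem IsProper.isHoPushout_paste_iff {B₁ B₁' : C} {f₁ : B ⟶ B₁} {h₁ : B₁ ⟶ B₁'} {k₁ : B' ⟶ B₁'}
    (H : IsHoPushout f g h k) (w : f₁ ≫ h₁ = h ≫ k₁) :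
    IsHoPushout (f ≫ f₁) g h₁ (k ≫ k₁) ↔ IsHoPushout f₁ h h₁ k₁ := by
  obtain ⟨X, M, D, i, c, α, β, δ, _, _, _, _, _, _, hi, hc⟩ := exists_span_resolution f g
  obtain ⟨N, j, ν, _, _, _, hj⟩ := exists_cofibration_trivialFibration (β ≫ f₁)
  have s := IsPushout.of_hasPushout i c
  have s₁ := IsPushout.of_hasPushout j (pushout.inl i c)
  have e : i ≫ β ≫ h = c ≫ δ ≫ k := by
    rw [← Category.assoc, hi, Category.assoc, H.1, ← Category.assoc, ← hc, Category.assoc]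
  let r := s.desc (β ≫ h) (δ ≫ k) e
  have : WeakEquivalence r :=
    (hp.isHoPushout_iff H.1 s α β δ r hi hc (s.inl_desc _ _ _) (s.inr_desc _ _ _)).1 H
  let r₁ := s₁.desc (ν ≫ h₁) (r ≫ k₁) (by
    rw [← Category.assoc, hj, Category.assoc, w, ← Category.assoc, ← Category.assoc, s.inl_desc,
      Category.assoc])
  have w₂ : (f ≫ f₁) ≫ h₁ = g ≫ k ≫ k₁ := by
    rw [Category.assoc, w, ← Category.assoc, H.1, Category.assoc]
  have s₂' : IsPushout (i ≫ j) c (pushout.inl j (pushout.inl i c))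
    (pushout.inr i c ≫ pushout.inr j (pushout.inl i c)) := s.paste_horiz s₁
  rw [hp.isHoPushout_iff w₂ s₂' α ν δ r₁
      (by rw [Category.assoc, hj, ← Category.assoc, hi, Category.assoc]) hc
      (s₁.inl_desc _ _ _)
      (by rw [Category.assoc, s₁.inr_desc, ← Category.assoc, s.inr_desc, Category.assoc]),
    hp.isHoPushout_iff w s₁ β ν r r₁ hj (s.inl_desc _ _ _) (s₁.inl_desc _ _ _) (s₁.inr_desc _ _ _)]

end

end

end

section

/-! ### Cofiber sequences -/

section

variable {C : Type u} [Category.{v} C] [ModelCategory C] (hp : IsProper C)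
include hp

variable {X Y P Z : C} {f : X ⟶ Y} {g : X ⟶ P} {h : Y ⟶ Z} {k : P ⟶ Z}

/-- A cofiber is weakly equivalent to the pushout of any resolution, where the
weakly trivial corner may be resolved by any weakly trivial object. -/
theorem IsCofiberSquare.exists_comparison (H : IsCofiberSquare f g h k) {X' M D S : C} {i : X' ⟶ M}
    {c : X' ⟶ D} {a : M ⟶ S} {b : D ⟶ S} (sq : IsPushout i c a b) (α : X' ⟶ X) (β : M ⟶ Y)
    (hi : i ≫ β = α ≫ f) (hD : IsWeaklyTrivial D) [Cofibration i] [Cofibration c]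
    [WeakEquivalence α] [WeakEquivalence β] :
    ∃ (Z' : C) (z : Z ⟶ Z') (r : S ⟶ Z'), WeakEquivalence z ∧ WeakEquivalence r ∧
      a ≫ r = β ≫ h ≫ z := by
  obtain ⟨P', p, _, _, _⟩ := exists_fibrant_resolution P
  have hP' : IsWeaklyTrivial P' := (isWeaklyTrivial_iff p).1 H.trivial
  have s := IsPushout.of_hasPushout k p
  have w : f ≫ h ≫ pushout.inl k p = (g ≫ p) ≫ pushout.inr k p := by
    rw [← Category.assoc, H.isHoPushout.1, Category.assoc, s.w, Category.assoc]
  have H' : IsHoPushout f (g ≫ p) (h ≫ pushout.inl k p) (pushout.inr k p) :=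
    (hp.isHoPushout_iff_of_weakEquivalence H.isHoPushout.1 w (𝟙 _) (𝟙 _) p (pushout.inl k p)
      (by simp) (by simp) (by simp) s.w).1 H.isHoPushout
  obtain ⟨d, hd⟩ := exists_extension c (Or.inr hP') (α ≫ g ≫ p)
  have := weakEquivalence_of_isWeaklyTrivial d hD hP'
  have e : i ≫ β ≫ h ≫ pushout.inl k p = c ≫ d ≫ pushout.inr k p := by
    rw [← Category.assoc, hi, Category.assoc, w, ← Category.assoc c, hd]
    simp only [Category.assoc]
  exact ⟨_, pushout.inl k p, sq.desc _ _ e, inferInstance, (hp.isHoPushout_iff w sq α β d _ hi hd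
    (sq.inl_desc _ _ e) (sq.inr_desc _ _ e)).1 H', sq.inl_desc _ _ e⟩

theorem IsCofiberSquare.nonempty_iso (H : IsCofiberSquare f g h k) {X' M D S : C} {i : X' ⟶ M}
    {c : X' ⟶ D} {a : M ⟶ S} {b : D ⟶ S} (sq : IsPushout i c a b) (α : X' ⟶ X) (β : M ⟶ Y)
    (hi : i ≫ β = α ≫ f) (hD : IsWeaklyTrivial D) [Cofibration i] [Cofibration c]
    [WeakEquivalence α] [WeakEquivalence β] : Nonempty ((hoQ C).obj Z ≅ (hoQ C).obj S) := by
  obtain ⟨Z', z, r, _, _, -⟩ := H.exists_comparison hp sq α β hi hD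
  exact ⟨asIso ((hoQ C).map z) ≪≫ (asIso ((hoQ C).map r)).symm⟩

/-- Cofibers are unique up to isomorphism in the homotopy category. -/
theorem IsCofiberSquare.nonempty_iso_of_eq (H : IsCofiberSquare f g h k) {P' Z' : C} {g' : X ⟶ P'}
    {h' : Y ⟶ Z'} {k' : P' ⟶ Z'} (H' : IsCofiberSquare f g' h' k') :
    Nonempty ((hoQ C).obj Z ≅ (hoQ C).obj Z') := by
  obtain ⟨M, i, β, _, _, _, hi⟩ := exists_cofibration_trivialFibration f
  obtain ⟨D, c, _, hD, _⟩ := exists_cofibration_isWeaklyTrivial X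
  have sq := IsPushout.of_hasPushout i c
  obtain ⟨e⟩ := H.nonempty_iso hp sq (𝟙 _) β (by simpa using hi) hD
  obtain ⟨e'⟩ := H'.nonempty_iso hp sq (𝟙 _) β (by simpa using hi) hD
  exact ⟨e ≪≫ e'.symm⟩

/-- A cofiber of a map to a weakly trivial object can be computed from any two
cofibrations to weakly trivial objects. -/
theorem IsCofiberSquare.nonempty_iso_suspension (H : IsCofiberSquare f g h k)
    (hY : IsWeaklyTrivial Y) {X' D D' S : C} {c : X' ⟶ D} {c' : X' ⟶ D'} {a : D ⟶ S} {b : D' ⟶ S}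
    (sq : IsPushout c c' a b) (α : X' ⟶ X) (hD : IsWeaklyTrivial D) (hD' : IsWeaklyTrivial D')
    [Cofibration c] [Cofibration c'] [WeakEquivalence α] :
    Nonempty ((hoQ C).obj Z ≅ (hoQ C).obj S) := by
  obtain ⟨M, i, β, _, _, _, hi⟩ := exists_cofibration_trivialFibration (α ≫ f)
  have sq' := IsPushout.of_hasPushout i c'
  obtain ⟨e⟩ := H.nonempty_iso hp sq' α β hi hD'
  have H' : IsCofiberSquare c' i (pushout.inr i c') (pushout.inl i c') :=
    ⟨(isWeaklyTrivial_iff β).2 hY, hp.isHoPushout_of_isPushout sq'.flip⟩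
  obtain ⟨e'⟩ := H'.nonempty_iso hp sq.flip (𝟙 _) (𝟙 _) (by simp) hD
  exact ⟨e ≪≫ e'⟩

/-- Exactness of cofiber sequences. -/
theorem IsCofiberSquare.exists_factor (H : IsCofiberSquare f g h k) {V : C}
    (φ : (hoQ C).obj Y ⟶ (hoQ C).obj V) (hφ : IsNull ((hoQ C).map f ≫ φ)) :
    ∃ ψ : (hoQ C).obj Z ⟶ (hoQ C).obj V, (hoQ C).map h ≫ ψ = φ := by
  obtain ⟨X', M, D, i, c, α, β, δ, _, _, _, _, _, _, hi, hc⟩ := exists_span_resolution f g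
  obtain ⟨V', j, _, _, _⟩ := exists_fibrant_resolution V
  have s := IsPushout.of_hasPushout i c
  have e : i ≫ β ≫ h = c ≫ δ ≫ k := by
    rw [← Category.assoc, hi, Category.assoc, H.isHoPushout.1, ← Category.assoc, ← hc,
      Category.assoc]
  have : WeakEquivalence (s.desc _ _ e) := (hp.isHoPushout_iff H.isHoPushout.1 s α β δ _ hi hc
    (s.inl_desc _ _ e) (s.inr_desc _ _ e)).1 H.isHoPushout
  obtain ⟨r, hr, _⟩ : ∃ r : pushout i c ⟶ Z, pushout.inl i c ≫ r = β ≫ h ∧ WeakEquivalence r :=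
    ⟨_, s.inl_desc _ _ e, this⟩
  have : IsCofibrant M := isCofibrant_of_cofibration i
  obtain ⟨u, hu⟩ := map_surjective_of_isLocalization (hoQ C) M V'
    ((hoQ C).map β ≫ φ ≫ (hoQ C).map j)
  have hn : IsNull ((hoQ C).map (i ≫ u)) := by
    rw [Functor.map_comp, hu, ← Category.assoc, ← Functor.map_comp, hi, Functor.map_comp,
      Category.assoc, ← Category.assoc ((hoQ C).map f)]
    exact (hφ.postcomp _).precomp _
  obtain ⟨d, hd⟩ := exists_extension_of_isNull c ((isWeaklyTrivial_iff δ).2 H.trivial) hn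
  refine ⟨inv ((hoQ C).map r) ≫ (hoQ C).map (s.desc u d hd.symm) ≫
    inv ((hoQ C).map j), ?_⟩
  rw [← cancel_epi ((hoQ C).map β), ← Category.assoc, ← Functor.map_comp,
    ← hr, Functor.map_comp, Category.assoc, IsIso.hom_inv_id_assoc,
    ← Category.assoc, ← Functor.map_comp, s.inl_desc, hu]
  simp

end

/-! ### Functors preserving homotopy pushouts -/

section

variable {C : Type u} [Category.{v} C] [ModelCategory C] (hp : IsProper C)

theorem isWeaklyTrivial_of_isInitial (hz : HasZeroObject C) {P : C} (h : IsInitial P) :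
    IsWeaklyTrivial P := by
  obtain ⟨Z, hZ⟩ := hz.zero
  have : IsIso (terminal.from P) := by
    have e : P ≅ ⊤_ C := (h.uniqueUpToIso hZ.isInitial).trans
      (hZ.isTerminal.uniqueUpToIso terminalIsTerminal)
    rw [Subsingleton.elim (terminal.from P) e.hom]
    infer_instance
  unfold IsWeaklyTrivial
  infer_instance

theorem isWeaklyTrivial_terminal : IsWeaklyTrivial (⊤_ C) := by
  unfold IsWeaklyTrivial
  rw [Subsingleton.elim (terminal.from (⊤_ C)) (𝟙 _)]
  infer_instance

variable (F : C ⥤ C) [F.IsLeftAdjoint]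
  (hF : ∀ {X Y : C} (f : X ⟶ Y) [WeakEquivalence f], WeakEquivalence (F.map f))

include hF in
theorem IsWeaklyTrivial.obj (hz : HasZeroObject C) {P : C} (hP : IsWeaklyTrivial P) :
    IsWeaklyTrivial (F.obj P) := by
  obtain ⟨Z, hZ⟩ := hz.zero
  have : WeakEquivalence (F.map (hZ.isInitial.to P)) := by
    have := weakEquivalence_of_isWeaklyTrivial (hZ.isInitial.to P)
      (isWeaklyTrivial_of_isInitial ⟨Z, hZ⟩ hZ.isInitial) hP
    exact hF _
  exact (isWeaklyTrivial_iff (F.map (hZ.isInitial.to P))).1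
    (isWeaklyTrivial_of_isInitial ⟨Z, hZ⟩ (IsInitial.isInitialObj F _ hZ.isInitial))

variable (hF' : ∀ {X Y : C} (f : X ⟶ Y) [Cofibration f] [IsCofibrant X], Cofibration (F.map f))
  {X Y P Z : C} {f : X ⟶ Y} {g : X ⟶ P} {h : Y ⟶ Z} {k : P ⟶ Z}
include hp hF hF'

theorem IsHoPushout.map (H : IsHoPushout f g h k) :
    IsHoPushout (F.map f) (F.map g) (F.map h) (F.map k) := by
  obtain ⟨X', M, D, i, c, α, β, δ, _, _, _, _, _, _, hi, hc⟩ := exists_span_resolution f g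
  have s := IsPushout.of_hasPushout i c
  have e : i ≫ β ≫ h = c ≫ δ ≫ k := by
    rw [← Category.assoc, hi, Category.assoc, H.1, ← Category.assoc, ← hc,
      Category.assoc]
  have : WeakEquivalence (s.desc _ _ e) := (hp.isHoPushout_iff H.1 s α β δ _ hi hc
    (s.inl_desc _ _ e) (s.inr_desc _ _ e)).1 H
  have := hF α
  have := hF β
  have := hF δ
  have := hF' i
  have w : F.map f ≫ F.map h = F.map g ≫ F.map k := by
    rw [← F.map_comp, H.1, F.map_comp]
  refine (hp.isHoPushout_iff w (s.map F) (F.map α) (F.map β) (F.map δ) (F.map (s.desc _ _ e))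
    ?_ ?_ ?_ ?_).2 (hF _)
  · rw [← F.map_comp, hi, F.map_comp]
  · rw [← F.map_comp, hc, F.map_comp]
  · rw [← F.map_comp, s.inl_desc, F.map_comp]
  · rw [← F.map_comp, s.inr_desc, F.map_comp]

theorem IsCofiberSquare.map (hz : HasZeroObject C) (H : IsCofiberSquare f g h k) :
    IsCofiberSquare (F.map f) (F.map g) (F.map h) (F.map k) :=
  ⟨H.trivial.obj F hF hz, H.isHoPushout.map hp F hF hF'⟩

end

end

section

variable {C : Type u} [Category.{v} C] [MonoidalCategory C] [SymmetricCategory C]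
  [MonoidalClosed C] [ModelCategory C] [HasLimits C] [HasColimits C] {ι : SSet.{v} ⥤ C} [ι.Braided] [ι.IsLeftAdjoint]

/-! ### Spheres -/

section

variable {X Y P Z : C} {f : X ⟶ Y} {g : X ⟶ P} {h : Y ⟶ Z} {k : P ⟶ Z}

theorem IsCofiberSquare.tensorLeft (hC : IsOperadicModelCategory C ι) (hp : IsProper C)
    (hz : HasZeroObject C) (H : IsCofiberSquare f g h k) (K : C) [IsCofibrant K] :
    IsCofiberSquare (K ◁ f) (K ◁ g) (K ◁ h) (K ◁ k) :=
  H.map hp (MonoidalCategory.tensorLeft K) (fun f _ => hC.tensor_weakEquivalence K f)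
    (fun f _ _ => hC.cofibration_whiskerLeft f K) hz

theorem IsCofiberSquare.tensorRight (hC : IsOperadicModelCategory C ι) (hp : IsProper C)
    (hz : HasZeroObject C) (H : IsCofiberSquare f g h k) (K : C) [IsCofibrant K] :
    IsCofiberSquare (f ▷ K) (g ▷ K) (h ▷ K) (k ▷ K) :=
  H.map hp (MonoidalCategory.tensorRight K) (fun f _ => hC.weakEquivalence_whiskerRight f K)
    (fun f _ _ => hC.cofibration_whiskerRight f K) hz

end

theorem IsWeaklyTrivial.tensorLeft (hC : IsOperadicModelCategory C ι) (hz : HasZeroObject C)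
    {P : C} (hP : IsWeaklyTrivial P) (K : C) [IsCofibrant K] : IsWeaklyTrivial (K ⊗ P) :=
  hP.obj (MonoidalCategory.tensorLeft K) (fun f _ => hC.tensor_weakEquivalence K f) hz

theorem IsWeaklyTrivial.tensorRight (hC : IsOperadicModelCategory C ι) (hz : HasZeroObject C)
    {P : C} (hP : IsWeaklyTrivial P) (K : C) [IsCofibrant K] : IsWeaklyTrivial (P ⊗ K) :=
  hP.obj (MonoidalCategory.tensorRight K) (fun f _ => hC.weakEquivalence_whiskerRight f K) hz

theorem isPushout_whiskerRight {A B D P : C} {i : A ⟶ B} {g : A ⟶ D} {a : B ⟶ P} {b : D ⟶ P}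
    (sq : IsPushout i g a b) (K : C) : IsPushout (i ▷ K) (g ▷ K) (a ▷ K) (b ▷ K) :=
  sq.map (MonoidalCategory.tensorRight K)

/-- A circle and its inverse. -/
structure Spheres {D : C} (c : 𝟙_ C ⟶ D) (S : C) : Prop where
  cofibration : Cofibration c
  isWeaklyTrivial : IsWeaklyTrivial D
  isCofibrant : IsCofibrant S
  isCofibrant_pushout : IsCofibrant (pushout c c)
  exists_weakEquivalence : ∃ (u : C) (v : pushout c c ⊗ S ⟶ u) (w : 𝟙_ C ⟶ u),
    WeakEquivalence v ∧ WeakEquivalence w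

theorem exists_spheres (hC : IsOperadicModelCategory C ι) (hp : IsProper C) (hs : IsStable C) :
    ∃ (D : C) (c : 𝟙_ C ⟶ D) (S : C), Spheres c S := by
  have := hC.isCofibrant_unit
  obtain ⟨D, c, _, hD, _⟩ := exists_cofibration_isWeaklyTrivial (𝟙_ C)
  have : IsCofibrant D := isCofibrant_of_cofibration c
  obtain ⟨u, w, _, _, _⟩ := exists_fibrant_resolution (𝟙_ C)
  obtain ⟨O, hO⟩ := hs.hasZeroObject.zero
  obtain ⟨M, o, q, _, _, _, -⟩ := exists_trivialCofibration_fibration (hO.isInitial.to u)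
  have hM : IsWeaklyTrivial M :=
    (isWeaklyTrivial_iff o).1 (isWeaklyTrivial_of_isInitial hs.hasZeroObject hO.isInitial)
  have : IsFibrant M := isFibrant_of_fibration q
  have sq := IsPullback.of_hasPullback q q
  have hsq : IsHoPushout (pullback.fst q q) (pullback.snd q q) q q :=
    (hs.isHoPushout_iff _ _ _ _ hM hM sq.w).2
      ⟨sq.w, M, 𝟙 _, q, _, _, _, 𝟙 _, inferInstance, ‹_›, by simp, sq, by simp, by simp,
        inferInstance⟩
  obtain ⟨S, σ, _, _, _⟩ := exists_cofibrant_resolution (pullback q q)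
  have := hC.cofibration_whiskerRight c S
  have hDS : IsWeaklyTrivial (D ⊗ S) := hD.tensorRight hC hs.hasZeroObject S
  obtain ⟨α, _⟩ : ∃ α : 𝟙_ C ⊗ S ⟶ pullback q q, WeakEquivalence α :=
    ⟨(λ_ S).hom ≫ σ, inferInstance⟩
  obtain ⟨m, hm⟩ := exists_extension (c ▷ S) (Or.inr hM) (α ≫ pullback.fst q q)
  obtain ⟨m', hm'⟩ := exists_extension (c ▷ S) (Or.inr hM) (α ≫ pullback.snd q q)
  have := weakEquivalence_of_isWeaklyTrivial m hDS hM
  have := weakEquivalence_of_isWeaklyTrivial m' hDS hM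
  have s := isPushout_whiskerRight (IsPushout.of_hasPushout c c) S
  have e : c ▷ S ≫ m ≫ q = c ▷ S ≫ m' ≫ q := by
    rw [← Category.assoc, hm, ← Category.assoc, hm', Category.assoc, Category.assoc, sq.w]
  exact ⟨D, c, S, ‹_›, hD, ‹_›, isCofibrant_of_cofibration (pushout.inl c c), u, s.desc _ _ e, w,
    (hp.isHoPushout_iff sq.w s α m m' _ hm hm' (s.inl_desc _ _ e) (s.inr_desc _ _ e)).1 hsq, ‹_›⟩

theorem Spheres.nonempty_iso (hC : IsOperadicModelCategory C ι) {D : C} {c : 𝟙_ C ⟶ D} {S : C}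
    (h : Spheres c S) (X : C) [IsCofibrant X] :
    Nonempty ((hoQ C).obj (S ⊗ (pushout c c ⊗ X)) ≅ (hoQ C).obj X) := by
  obtain ⟨u, v, w, _, _⟩ := h.exists_weakEquivalence
  have := hC.weakEquivalence_whiskerRight v X
  have := hC.weakEquivalence_whiskerRight w X
  exact ⟨(hoQ C).mapIso ((α_ _ _ _).symm ≪≫ whiskerRightIso (β_ _ _) X) ≪≫
    asIso ((hoQ C).map (v ▷ X)) ≪≫ (asIso ((hoQ C).map (w ▷ X))).symm ≪≫
    (hoQ C).mapIso (λ_ X)⟩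

/-- Every cofiber sequence can be continued to the right, by a suspension. -/
theorem IsCofiberSquare.exists_rotate (hC : IsOperadicModelCategory C ι) (hp : IsProper C)
    (hz : HasZeroObject C) {D : C} {c : 𝟙_ C ⟶ D} {S : C} (hS : Spheres c S) {X Y P Z : C}
    {f : X ⟶ Y} {g : X ⟶ P} {h : Y ⟶ Z} {k : P ⟶ Z} (H : IsCofiberSquare f g h k) :
    ∃ (R Q : C) (g' : Y ⟶ Q) (h' : Z ⟶ R) (k' : Q ⟶ R), IsCofiberSquare h g' h' k' ∧
      ∀ (X' : C) (α : X' ⟶ X) [IsCofibrant X'] [WeakEquivalence α],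
        Nonempty ((hoQ C).obj R ≅ (hoQ C).obj (pushout c c ⊗ X')) := by
  obtain ⟨Q, d, _, hQ, _⟩ := exists_cofibration_isWeaklyTrivial Y
  have sq := IsPushout.of_hasPushout d h
  have hsq := hp.isHoPushout_of_isPushout sq
  refine ⟨_, Q, d, pushout.inr d h, pushout.inl d h, ⟨hQ, hp.isHoPushout_flip hsq⟩,
    fun X' α _ _ => ?_⟩
  have H' : IsCofiberSquare (f ≫ d) g (pushout.inl d h) (k ≫ pushout.inr d h) :=
    ⟨H.trivial, (hp.isHoPushout_paste_iff H.isHoPushout sq.w).2 hsq⟩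
  have := hS.cofibration
  have := hC.cofibration_whiskerRight c X'
  have hD : IsWeaklyTrivial (D ⊗ X') := hS.isWeaklyTrivial.tensorRight hC hz X'
  exact H'.nonempty_iso_suspension hp hQ (isPushout_whiskerRight (IsPushout.of_hasPushout c c) X')
    ((λ_ X').hom ≫ α) hD hD

/-! ### Powers of the fiber of the unit -/

section

variable {J : C} (j : J ⟶ 𝟙_ C)

theorem isCofibrant_adamsPow (hC : IsOperadicModelCategory C ι) [IsCofibrant J] (n : ℕ) :
    IsCofibrant (adamsPow J n) := by
  induction n with
  | zero => exact hC.isCofibrant_unit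
  | succ n ih => exact hC.isCofibrant_tensor J (adamsPow J n)

/-- The map `J^{t+n} ⟶ J^n ⊗ J^t`. -/
def adamsSplit (J : C) (t : ℕ) : ∀ n, adamsPow J (t + n) ⟶ adamsPow J n ⊗ adamsPow J t
  | 0 => (λ_ _).inv
  | n + 1 => J ◁ adamsSplit J t n ≫ (α_ _ _ _).inv

/-- The transformation `J^n ⊗ X ⟶ X`. -/
def adamsTrans (n : ℕ) : tensorLeft (adamsPow J n) ⟶ 𝟭 C where
  app X := adamsAug j n ▷ X ≫ (λ_ X).hom
  naturality X Y f := by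
    change adamsPow J n ◁ f ≫ adamsAug j n ▷ Y ≫ (λ_ Y).hom = (adamsAug j n ▷ X ≫ (λ_ X).hom) ≫ f
    simp [whisker_exchange_assoc]

/-- The map `J^{t+n} ⟶ J^t`. -/
def adamsSteps (t n : ℕ) : adamsPow J (t + n) ⟶ adamsPow J t :=
  adamsSplit J t n ≫ (adamsTrans j n).app _

theorem adamsSteps_zero (t : ℕ) : adamsSteps j t 0 = 𝟙 _ := by
  change (λ_ _).inv ≫ (𝟙 (𝟙_ C)) ▷ _ ≫ (λ_ _).hom = _
  simp

theorem adamsSteps_succ (t n : ℕ) :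
    adamsSteps j t (n + 1) = adamsStep j (t + n) ≫ adamsSteps j t n := by
  change (J ◁ adamsSplit J t n ≫ (α_ _ _ _).inv) ≫
    ((j ▷ adamsPow J n ≫ (λ_ _).hom) ≫ adamsAug j n) ▷ adamsPow J t ≫ (λ_ _).hom =
    (j ▷ adamsPow J (t + n) ≫ (λ_ _).hom) ≫ adamsSplit J t n ≫
      adamsAug j n ▷ adamsPow J t ≫ (λ_ _).hom
  have h : j ▷ adamsPow J (t + n) ≫ (λ_ _).hom ≫ adamsSplit J t n = J ◁ adamsSplit J t n ≫
      j ▷ _ ≫ (λ_ _).hom := by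
    rw [← leftUnitor_naturality, whisker_exchange_assoc]
  have h' := reassoc_of% h
  simp only [Category.assoc]
  rw [h']
  simp

theorem adamsSteps_aug (t n : ℕ) : adamsSteps j t n ≫ adamsAug j t = adamsAug j (t + n) := by
  induction n with
  | zero => rw [adamsSteps_zero, Category.id_comp]; rfl
  | succ n ih => rw [adamsSteps_succ, Category.assoc, ih]; rfl

theorem adamsTrans_add (t n : ℕ) (X : C) : (adamsTrans j (t + n)).app X =
    (adamsSplit J t n ▷ X ≫ (α_ _ _ _).hom) ≫ (adamsTrans j n).app (adamsPow J t ⊗ X) ≫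
      (adamsTrans j t).app X := by
  change adamsAug j (t + n) ▷ X ≫ (λ_ X).hom = (adamsSplit J t n ▷ X ≫ (α_ _ _ _).hom) ≫
    (adamsAug j n ▷ (adamsPow J t ⊗ X) ≫ (λ_ _).hom) ≫ adamsAug j t ▷ X ≫ (λ_ X).hom
  rw [← adamsSteps_aug]
  change ((adamsSplit J t n ≫ adamsAug j n ▷ _ ≫ (λ_ _).hom) ≫ _) ▷ _ ≫ _ = _
  simp

theorem adamsTrans_tensor (n : ℕ) (K X : C) : (adamsTrans j n).app (K ⊗ X) =
    ((α_ _ _ _).inv ≫ (β_ (adamsPow J n) K).hom ▷ X ≫ (α_ _ _ _).hom) ≫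
      K ◁ (adamsTrans j n).app X := by
  change adamsAug j n ▷ (K ⊗ X) ≫ (λ_ _).hom = ((α_ _ _ _).inv ≫ (β_ (adamsPow J n) K).hom ▷ X ≫
    (α_ _ _ _).hom) ≫ K ◁ (adamsAug j n ▷ X ≫ (λ_ X).hom)
  have h : (β_ (adamsPow J n) K).hom ▷ X ≫ (K ◁ adamsAug j n) ▷ X =
      (adamsAug j n ▷ K) ▷ X ≫ (β_ _ K).hom ▷ X := by
    rw [← comp_whiskerRight, ← comp_whiskerRight, BraidedCategory.braiding_naturality_left]
  have h' : (β_ (adamsPow J n) K).hom ▷ X ≫ (α_ _ _ _).hom ≫ K ◁ adamsAug j n ▷ X =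
      adamsAug j n ▷ K ▷ X ≫ (β_ _ K).hom ▷ X ≫ (α_ _ _ _).hom := by
    simpa using h =≫ (α_ _ _ _).hom
  have h'' := reassoc_of% h'
  rw [MonoidalCategory.whiskerLeft_comp]
  simp only [Category.assoc]
  rw [h'', braiding_tensorUnit_left]
  simp

/-- The object `X` is annihilated by the `n`-fold power of `j`. -/
def NullAt (n : ℕ) (X : C) : Prop := IsNull ((hoQ C).map ((adamsTrans j n).app X))

variable {j}

theorem NullAt.retract (hC : IsOperadicModelCategory C ι) [IsCofibrant J] {n : ℕ} {X Y : C}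
    (h : NullAt j n X) (r : Retract ((hoQ C).obj Y) ((hoQ C).obj X)) : NullAt j n Y := by
  have := isCofibrant_adamsPow (J := J) hC n
  obtain ⟨γ, hγ⟩ := exists_hoMap_comp_eq (tensorLeft (adamsPow J n))
    (fun f _ => hC.tensor_weakEquivalence _ f) (adamsTrans j n) r.i
  have := (h.precomp γ).postcomp r.r
  rw [← hγ, Category.assoc] at this
  have e : (hoQ C).map ((adamsTrans j n).app Y) ≫ r.i ≫ r.r =
      (hoQ C).map ((adamsTrans j n).app Y) := by
    rw [r.retract]; exact Category.comp_id _
  rwa [e] at this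

theorem NullAt.iso (hC : IsOperadicModelCategory C ι) [IsCofibrant J] {n : ℕ} {X Y : C}
    (h : NullAt j n X) (e : (hoQ C).obj X ≅ (hoQ C).obj Y) : NullAt j n Y :=
  h.retract hC ⟨e.inv, e.hom, e.inv_hom_id⟩

theorem NullAt.tensor (hC : IsOperadicModelCategory C ι) (hz : HasZeroObject C) {n : ℕ} {X : C}
    (h : NullAt j n X) (K : C) [IsCofibrant K] : NullAt j n (K ⊗ X) := by
  unfold NullAt
  rw [adamsTrans_tensor, Functor.map_comp]
  exact (h.map (tensorLeft K) (fun f _ => hC.tensor_weakEquivalence K f)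
    (isWeaklyTrivial_terminal.tensorLeft hC hz K)).precomp _

theorem NullAt.middle (hC : IsOperadicModelCategory C ι) (hp : IsProper C) (hz : HasZeroObject C)
    [IsCofibrant J] {X Y P Z : C} {f : X ⟶ Y} {g : X ⟶ P} {h : Y ⟶ Z} {k : P ⟶ Z}
    (H : IsCofiberSquare f g h k) {n n' : ℕ} (hX : NullAt j n X) (hZ : NullAt j n' Z) :
    NullAt j (n + n') Y := by
  have := isCofibrant_adamsPow (J := J) hC n
  have hn : IsNull ((hoQ C).map (adamsPow J n ◁ f) ≫ (hoQ C).map ((adamsTrans j n).app Y)) := by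
    rw [← Functor.map_comp]
    have := (adamsTrans j n).naturality f
    refine (congrArg (fun r => IsNull ((hoQ C).map r)) this).mpr ?_
    rw [Functor.map_comp]
    exact hX.postcomp _
  obtain ⟨ψ, hψ⟩ := (H.tensorLeft hC hp hz (adamsPow J n)).exists_factor hp _ hn
  unfold NullAt
  rw [adamsTrans_add, Functor.map_comp]
  refine IsNull.precomp ?_ _
  have e := (adamsTrans j n').naturality (adamsPow J n ◁ h)
  have := ((hZ.tensor hC hz (adamsPow J n)).postcomp ψ).precomp
    ((hoQ C).map ((tensorLeft (adamsPow J n')).map (adamsPow J n ◁ h)))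
  rw [← Category.assoc, ← Functor.map_comp, e, Functor.map_comp, Category.assoc] at this
  have e' : (hoQ C).map ((𝟭 C).map (adamsPow J n ◁ h)) ≫ ψ =
    (hoQ C).map ((adamsTrans j n).app Y) := hψ
  rw [e'] at this
  exact (congrArg IsNull ((hoQ C).map_comp _ _)).mpr this

end

theorem nullAt_of_isMuRing (hC : IsOperadicModelCategory C ι) (hz : HasZeroObject C)
    {E J P : C} [IsCofibrant E] {e : 𝟙_ C ⟶ E} {m : E ⊗ E ⟶ E} (hE : IsMuRing E e m)
    {j : J ⟶ 𝟙_ C} {g : J ⟶ P} {k : P ⟶ E} (H : IsCofiberSquare j g e k) : NullAt j 1 E := by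
  have e₁ : (adamsTrans j 1).app E = (ρ_ J).hom ▷ E ≫ j ▷ E ≫ (λ_ E).hom := by
    change ((j ▷ 𝟙_ C ≫ (λ_ _).hom) ≫ 𝟙 _) ▷ E ≫ (λ_ E).hom = _
    have : j ▷ 𝟙_ C ≫ (λ_ (𝟙_ C)).hom = (ρ_ J).hom ≫ j := by
      rw [unitors_equal, rightUnitor_naturality]
    rw [this, Category.comp_id, comp_whiskerRight, Category.assoc]
  have e₂ : (hoQ C).map (j ▷ E) ≫ (hoQ C).map (λ_ E).hom =
      (hoQ C).map (g ▷ E) ≫ (hoQ C).map (k ▷ E ≫ m) := by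
    have : (hoQ C).map (e ▷ E ≫ m) = (hoQ C).map (λ_ E).hom := hE
    rw [← this, ← Functor.map_comp, ← Functor.map_comp, ← Category.assoc, ← comp_whiskerRight,
      H.isHoPushout.1, comp_whiskerRight, Category.assoc]
  have h := (isNull_of_factor (H.trivial.tensorRight hC hz E) ((hoQ C).map (g ▷ E))
    ((hoQ C).map (k ▷ E ≫ m))).precomp ((hoQ C).map ((ρ_ J).hom ▷ E))
  rw [← e₂, ← Functor.map_comp, ← Functor.map_comp, ← e₁] at h
  exact h

theorem IsNilObject.exists_nullAt (hC : IsOperadicModelCategory C ι) (hp : IsProper C)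
    (hs : IsStable C) {E J P : C} [IsCofibrant E] [IsCofibrant J] {e : 𝟙_ C ⟶ E} {m : E ⊗ E ⟶ E}
    (hE : IsMuRing E e m) {j : J ⟶ 𝟙_ C} {g : J ⟶ P} {k : P ⟶ E} (H : IsCofiberSquare j g e k)
    {X : C} (hX : IsNilObject E X) : ∃ n, NullAt j n X := by
  have hz := hs.hasZeroObject
  obtain ⟨D, c, S, hS⟩ := exists_spheres hC hp hs
  have := hS.isCofibrant
  have := hS.isCofibrant_pushout
  induction hX with
  | base => exact ⟨1, nullAt_of_isMuRing hC hz hE H⟩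
  | retract _ r ih => exact ⟨_, ih.choose_spec.retract hC r⟩
  | @cofiber₁ X Y Z P f g h k s _ _ ihY ihZ =>
    obtain ⟨n, hY⟩ := ihY
    obtain ⟨n', hZ⟩ := ihZ
    obtain ⟨R, _, _, _, _, s', hR⟩ := s.exists_rotate hC hp hz hS
    obtain ⟨R', _, _, _, _, s'', hR'⟩ := s'.exists_rotate hC hp hz hS
    obtain ⟨X', α, _, _, _⟩ := exists_cofibrant_resolution X
    obtain ⟨Y', β, _, _, _⟩ := exists_cofibrant_resolution Y
    obtain ⟨i⟩ := hR X' α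
    obtain ⟨i'⟩ := hR' Y' β
    obtain ⟨i''⟩ := hS.nonempty_iso hC X'
    have h₁ := ((hY.iso hC (asIso ((hoQ C).map β)).symm).tensor hC hz (pushout c c)).iso hC i'.symm
    exact ⟨_, ((((NullAt.middle hC hp hz s'' hZ h₁).iso hC i).tensor hC hz S).iso hC i'').iso hC
      (asIso ((hoQ C).map α))⟩
  | cofiber₂ s _ _ ihX ihZ =>
    exact ⟨_, NullAt.middle hC hp hz s ihX.choose_spec ihZ.choose_spec⟩
  | @cofiber₃ X Y Z P f g h k s _ _ ihX ihY =>
    obtain ⟨n, hX⟩ := ihX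
    obtain ⟨n', hY⟩ := ihY
    obtain ⟨R, _, _, _, _, s', hR⟩ := s.exists_rotate hC hp hz hS
    obtain ⟨X', α, _, _, _⟩ := exists_cofibrant_resolution X
    obtain ⟨i⟩ := hR X' α
    exact ⟨_, NullAt.middle hC hp hz s' hY
      (((hX.iso hC (asIso ((hoQ C).map α)).symm).tensor hC hz (pushout c c)).iso hC i.symm)⟩
  | tensor _ _ A _ ih => exact ⟨_, ih.choose_spec.tensor hC hz A⟩

end

section

variable {C : Type u} [Category.{v} C] [MonoidalCategory C] [SymmetricCategory C]
  [MonoidalClosed C] [ModelCategory C] [HasLimits C] [HasColimits C] {ι : SSet.{v} ⥤ C}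
  [ι.Braided] [ι.IsLeftAdjoint]

/-! ### Nilpotent objects -/

theorem IsNilObject.iso {E X Y : C} (h : IsNilObject E X) (e : (hoQ C).obj X ≅ (hoQ C).obj Y) :
    IsNilObject E Y :=
  h.retract ⟨e.inv, e.hom, e.inv_hom_id⟩

theorem IsNilObject.of_weakEquivalence {E X Y : C} (h : IsNilObject E X) (f : X ⟶ Y)
    [WeakEquivalence f] : IsNilObject E Y :=
  h.iso (asIso ((hoQ C).map f))

theorem IsNilObject.of_weakEquivalence' {E X Y : C} (h : IsNilObject E Y) (f : X ⟶ Y)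
    [WeakEquivalence f] : IsNilObject E X :=
  h.iso (asIso ((hoQ C).map f)).symm

theorem IsWeaklyTrivial.isNilObject {E X : C} (h : IsWeaklyTrivial X) : IsNilObject E X := by
  have s : IsCofiberSquare (𝟙 E) (terminal.from E) (terminal.from E) (𝟙 (⊤_ C)) :=
    ⟨isWeaklyTrivial_terminal, by simp, E, 𝟙 _, 𝟙 _, ⊤_ C, terminal.from E, 𝟙 _, 𝟙 _,
      inferInstance, inferInstance, by simp, IsPushout.of_id_fst, by simp, by simp,
      inferInstance⟩
  have : WeakEquivalence (terminal.from X) := h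
  exact (IsNilObject.cofiber₃ s .base .base).of_weakEquivalence' (terminal.from X)

theorem IsCofiberSquare.isWeaklyTrivial {X Y P Z : C} {f : X ⟶ Y} {g : X ⟶ P} {h : Y ⟶ Z}
    {k : P ⟶ Z} (H : IsCofiberSquare f g h k) [WeakEquivalence f] : IsWeaklyTrivial Z := by
  obtain ⟨hP, -, M, i, p, Q, a, b, c, _, _, hip, sq, -, hk, _⟩ := H
  have : WeakEquivalence i := weakEquivalence_of_postcomp_of_fac hip
  have : WeakEquivalence b := by
    rw [weakEquivalence_iff]
    exact (MorphismProperty.of_isPushout sq.flip (mem_trivialCofibrations i)).2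
  have : WeakEquivalence k := by rw [← hk]; infer_instance
  exact (isWeaklyTrivial_iff k).1 hP

/-- The cofiber of `J^n ⊗ x ⟶ x` is nilpotent. -/
theorem isNilObject_of_isCofiberSquare (hC : IsOperadicModelCategory C ι) (hp : IsProper C)
    (hz : HasZeroObject C) {E J P : C} [IsCofibrant E] [IsCofibrant J] {e : 𝟙_ C ⟶ E}
    {j : J ⟶ 𝟙_ C} {g : J ⟶ P} {k : P ⟶ E} (H : IsCofiberSquare j g e k) (x : C) [IsCofibrant x]
    (n : ℕ) {P' W : C} {g' : adamsPow J n ⊗ x ⟶ P'} {h' : x ⟶ W} {k' : P' ⟶ W}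
    (s : IsCofiberSquare (adamsAug j n ▷ x ≫ (λ_ x).hom) g' h' k') : IsNilObject E W := by
  induction n generalizing P' W with
  | zero =>
    have : WeakEquivalence (adamsAug j 0 ▷ x ≫ (λ_ x).hom) := by
      have : IsIso (adamsAug j 0) := inferInstanceAs (IsIso (𝟙 (𝟙_ C)))
      infer_instance
    exact s.isWeaklyTrivial.isNilObject
  | succ n ih =>
    have := isCofibrant_adamsPow (J := J) hC n
    have := hC.isCofibrant_tensor (adamsPow J n) x
    obtain ⟨N, g₁, p, _, _, _, hg₁⟩ := exists_cofibration_trivialFibration g'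
    have sq := IsPushout.of_hasPushout g₁ (adamsStep j n ▷ x)
    have hsq := hp.isHoPushout_flip (hp.isHoPushout_of_isPushout sq)
    let a := pushout.inr g₁ (adamsStep j n ▷ x)
    let b := pushout.inl g₁ (adamsStep j n ▷ x)
    have es : adamsAug j (n + 1) ▷ x ≫ (λ_ x).hom = adamsStep j n ▷ x ≫ adamsAug j n ▷ x ≫
        (λ_ x).hom := by
      rw [← Category.assoc, ← comp_whiskerRight]; rfl
    have we : g₁ ≫ p ≫ k' = adamsStep j n ▷ x ≫ (adamsAug j n ▷ x ≫ (λ_ x).hom) ≫ h' := by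
      rw [← Category.assoc, hg₁, ← s.isHoPushout.1, es, Category.assoc]
    let q := sq.desc (p ≫ k') ((adamsAug j n ▷ x ≫ (λ_ x).hom) ≫ h') we
    have hq : a ≫ q = (adamsAug j n ▷ x ≫ (λ_ x).hom) ≫ h' := sq.inr_desc _ _ we
    have hq' : b ≫ q = p ≫ k' := sq.inl_desc _ _ we
    have hout : IsHoPushout (adamsStep j n ▷ x ≫ adamsAug j n ▷ x ≫ (λ_ x).hom) g₁ h' (b ≫ q) := by
      refine (hp.isHoPushout_iff_of_weakEquivalence ?_ s.isHoPushout.1 (𝟙 _) (𝟙 _) p (𝟙 _) ?_ ?_ ?_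
        ?_).2 s.isHoPushout
      · rw [hq', we, Category.assoc]
      · rw [Category.comp_id, ← es]; exact (Category.id_comp _).symm
      · rw [hg₁]; exact (Category.id_comp _).symm
      · simp
      · rw [Category.comp_id, hq']
    have hr := (hp.isHoPushout_paste_iff hsq hq.symm).1 hout
    have hE : IsNilObject E (pushout g₁ (adamsStep j n ▷ x)) := by
      have s₁ : IsCofiberSquare (adamsStep j n ▷ x) g₁ a b :=
        ⟨(isWeaklyTrivial_iff p).2 s.trivial, hsq⟩
      have s₂ := H.tensorRight hC hp hz (adamsPow J n ⊗ x)
      have s₃ : IsCofiberSquare (adamsStep j n ▷ x) ((α_ J (adamsPow J n) x).hom ≫ g ▷ _)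
          ((λ_ _).inv ≫ e ▷ _) (k ▷ _) := by
        have e₁ : (j ▷ adamsPow J n ≫ (λ_ (adamsPow J n)).hom) ▷ x ≫
            (λ_ (adamsPow J n ⊗ x)).inv = (α_ J (adamsPow J n) x).hom ≫ j ▷ _ := by
          simp
        refine ⟨s₂.trivial, (hp.isHoPushout_iff_of_weakEquivalence ?_ s₂.isHoPushout.1
          (α_ J (adamsPow J n) x).hom (λ_ _).inv (𝟙 _) (𝟙 _) e₁ (Category.comp_id _)
          (Category.comp_id _) ((Category.comp_id _).trans (Category.id_comp _).symm)).2
          s₂.isHoPushout⟩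
        have := s₂.isHoPushout.1
        exact (Category.assoc _ _ _).symm.trans ((congrArg (· ≫ e ▷ _) e₁).trans
          ((Category.assoc _ _ _).trans ((congrArg _ this).trans (Category.assoc _ _ _).symm)))
      obtain ⟨i⟩ := s₁.nonempty_iso_of_eq hp s₃
      exact (IsNilObject.tensor (.base (E := E)) ‹_› (adamsPow J n ⊗ x) ‹_›).iso
        ((hoQ C).mapIso (β_ _ _) ≪≫ i.symm)
    obtain ⟨D, c, _, hD, _⟩ := exists_cofibration_isWeaklyTrivial
      (pushout g₁ (adamsStep j n ▷ x))
    have sq' := IsPushout.of_hasPushout c q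
    have hsq' := hp.isHoPushout_of_isPushout sq'
    have s' : IsCofiberSquare (adamsAug j n ▷ x ≫ (λ_ x).hom) (a ≫ c) (h' ≫ pushout.inr c q)
        (pushout.inl c q) :=
      ⟨hD, hp.isHoPushout_flip
        ((hp.isHoPushout_paste_iff (hp.isHoPushout_flip hr) sq'.w).2 hsq')⟩
    exact .cofiber₂ ⟨hD, hp.isHoPushout_flip hsq'⟩ hE (ih s')

theorem NullAt.isNilObject (hC : IsOperadicModelCategory C ι) (hp : IsProper C)
    (hz : HasZeroObject C) {E J P : C} [IsCofibrant E] [IsCofibrant J] {e : 𝟙_ C ⟶ E}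
    {j : J ⟶ 𝟙_ C} {g : J ⟶ P} {k : P ⟶ E} (H : IsCofiberSquare j g e k) {X : C} {n : ℕ}
    (hX : NullAt j n X) : IsNilObject E X := by
  obtain ⟨x, α, _, _, _⟩ := exists_cofibrant_resolution X
  have hx : NullAt j n x := hX.iso hC (asIso ((hoQ C).map α)).symm
  obtain ⟨D, c, _, hD, _⟩ := exists_cofibration_isWeaklyTrivial (adamsPow J n ⊗ x)
  have sq := IsPushout.of_hasPushout c (adamsAug j n ▷ x ≫ (λ_ x).hom)
  have s : IsCofiberSquare (adamsAug j n ▷ x ≫ (λ_ x).hom) c _ _ :=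
    ⟨hD, hp.isHoPushout_flip (hp.isHoPushout_of_isPushout sq)⟩
  obtain ⟨ψ, hψ⟩ := s.exists_factor hp (𝟙 _) (hx.postcomp _)
  exact ((isNilObject_of_isCofiberSquare hC hp hz H x n s).retract ⟨_, ψ, hψ⟩).of_weakEquivalence α

/-- Function objects into nilpotent objects are nilpotent. -/
theorem NullAt.ihom (hC : IsOperadicModelCategory C ι) (hz : HasZeroObject C) {J : C}
    [IsCofibrant J] {j : J ⟶ 𝟙_ C} {z : C} [IsFibrant z] {n : ℕ} (h : NullAt j n z) (K : C)
    [IsCofibrant K] : NullAt j n ((ihom K).obj z) := by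
  have := isCofibrant_adamsPow (J := J) hC n
  obtain ⟨A, α, _, _, _⟩ := exists_cofibrant_resolution ((CategoryTheory.ihom K).obj z)
  refine NullAt.iso hC (X := A) ?_ (asIso ((hoQ C).map α))
  have := hC.isCofibrant_tensor (adamsPow J n) A
  have := hC.isCofibrant_tensor K (adamsPow J n ⊗ A)
  obtain ⟨B, c, _, hB, _⟩ := exists_cofibration_isWeaklyTrivial (adamsPow J n ⊗ A)
  have := hC.cofibration_whiskerLeft c K
  let u : K ⊗ A ⟶ z := MonoidalClosed.uncurry α
  have hn : IsNull ((hoQ C).map (K ◁ (adamsTrans j n).app A ≫ u)) := by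
    have e := adamsTrans_tensor j n K A
    have e' := (adamsTrans j n).naturality u
    have h₁ := (h.precomp ((hoQ C).map ((tensorLeft (adamsPow J n)).map u))).precomp
      ((hoQ C).map ((α_ (adamsPow J n) K A).inv ≫ (β_ (adamsPow J n) K).hom ▷ A ≫
        (α_ K (adamsPow J n) A).hom |> inv))
    rw [← Functor.map_comp, ← Functor.map_comp, e', e] at h₁
    rw [Category.assoc, IsIso.inv_hom_id_assoc] at h₁
    exact h₁
  obtain ⟨χ, hχ⟩ := exists_extension_of_isNull (K ◁ c) (hB.tensorLeft hC hz K) hn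
  have e : c ≫ MonoidalClosed.curry χ = (adamsTrans j n).app A ≫ α := by
    rw [← MonoidalClosed.curry_natural_left, hχ, MonoidalClosed.curry_natural_left,
      MonoidalClosed.curry_uncurry]
  have hn' := (isNull_of_factor hB ((hoQ C).map c)
    ((hoQ C).map (MonoidalClosed.curry χ))).postcomp (inv ((hoQ C).map α))
  rw [← Functor.map_comp, e, Functor.map_comp, Category.assoc, IsIso.hom_inv_id] at hn'
  exact (congrArg IsNull (Category.comp_id _)).mp hn'

end

section

variable {C : Type u} [Category.{v} C] [MonoidalCategory C] [SymmetricCategory C]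
  [MonoidalClosed C] [ModelCategory C] [HasLimits C] [HasColimits C] {ι : SSet.{v} ⥤ C}
  [ι.Braided] [ι.IsLeftAdjoint]

/-! ### Pushout products -/

/-- The pushout-product map, from a chosen pushout. -/
theorem IsOperadicModelCategory.cofibration_pushoutProduct (hC : IsOperadicModelCategory C ι)
    {L M x w P : C} {i : L ⟶ M} {f : x ⟶ w} [Cofibration i] [Cofibration f] {l : M ⊗ x ⟶ P}
    {r : L ⊗ w ⟶ P} (s : IsPushout (i ▷ x) (L ◁ f) l r) {q : P ⟶ M ⊗ w} (hl : l ≫ q = M ◁ f)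
    (hr : r ≫ q = i ▷ w) : Cofibration q := by
  let sq : (curriedTensor C).PushoutObjObj i f :=
    { pt := P, inl := l, inr := r, isPushout := s }
  have : q = sq.ι := s.hom_ext (hl.trans sq.inl_ι.symm) (hr.trans sq.inr_ι.symm)
  rw [this]
  exact hC.pushout_product i f sq

theorem IsOperadicModelCategory.weakEquivalence_pushoutProduct (hC : IsOperadicModelCategory C ι)
    {L M x w P : C} {i : L ⟶ M} {f : x ⟶ w} [Cofibration i] [Cofibration f] {l : M ⊗ x ⟶ P}
    {r : L ⊗ w ⟶ P} (s : IsPushout (i ▷ x) (L ◁ f) l r) {q : P ⟶ M ⊗ w} (hl : l ≫ q = M ◁ f)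
    (hr : r ≫ q = i ▷ w) (h : WeakEquivalence i ∨ WeakEquivalence f) : WeakEquivalence q := by
  let sq : (curriedTensor C).PushoutObjObj i f :=
    { pt := P, inl := l, inr := r, isPushout := s }
  have : q = sq.ι := s.hom_ext (hl.trans sq.inl_ι.symm) (hr.trans sq.inr_ι.symm)
  rw [this]
  exact hC.pushout_product_acyclic i f sq h

section

variable {L M X y T w V P : C} {i : L ⟶ M} {f : X ⟶ y} {a : X ⟶ T} {η : y ⟶ w} {b : T ⟶ w}
  {l : M ⊗ X ⟶ V} {r : L ⊗ T ⟶ V} {l' : M ⊗ y ⟶ P} {r' : L ⊗ w ⟶ P}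

/-- The pushout-products of a cofibration with the two columns of a cofiber square form a cofiber
square. -/
theorem IsCofiberSquare.pushoutProduct (hC : IsOperadicModelCategory C ι) (hp : IsProper C)
    (hz : HasZeroObject C) (H : IsCofiberSquare f a η b) [IsCofibrant L] [IsCofibrant X]
    [IsCofibrant y] [Cofibration i] (s : IsPushout (i ▷ X) (L ◁ a) l r)
    (s' : IsPushout (i ▷ y) (L ◁ η) l' r') {v : V ⟶ P} (hv : l ≫ v = M ◁ f ≫ l')
    (hv' : r ≫ v = L ◁ b ≫ r') {u : V ⟶ M ⊗ T} (hu : l ≫ u = M ◁ a) (hu' : r ≫ u = i ▷ T)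
    {q : P ⟶ M ⊗ w} (hq : l' ≫ q = M ◁ η) (hq' : r' ≫ q = i ▷ w) :
    IsCofiberSquare v u q (M ◁ b) := by
  have : IsCofibrant M := isCofibrant_of_cofibration i
  have := hC.cofibration_whiskerRight i X
  have := hC.cofibration_whiskerRight i y
  have h₁ := hp.isHoPushout_of_isPushout s
  have h₂ := hp.isHoPushout_of_isPushout s'
  have hL := (H.tensorLeft hC hp hz L).isHoPushout
  have hM := (H.tensorLeft hC hp hz M).isHoPushout
  have h₃ : IsHoPushout (L ◁ f ≫ i ▷ y) (L ◁ a) l' (L ◁ b ≫ r') :=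
    (hp.isHoPushout_paste_iff hL h₂.1).2 h₂
  have h₄ : IsHoPushout (M ◁ f) l l' v := by
    refine (hp.isHoPushout_paste_iff h₁ hv.symm).1 ?_
    rw [← whisker_exchange, hv']
    exact h₃
  refine ⟨H.trivial.tensorLeft hC hz M, ?_⟩
  have w₁ : v ≫ q = u ≫ M ◁ b := by
    apply s.hom_ext
    · rw [← Category.assoc, hv, Category.assoc, hq, ← Category.assoc, hu,
        ← MonoidalCategory.whiskerLeft_comp, ← MonoidalCategory.whiskerLeft_comp, H.isHoPushout.1]
    · rw [← Category.assoc, hv', Category.assoc, hq', ← Category.assoc, hu', whisker_exchange]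
  refine hp.isHoPushout_flip
    ((hp.isHoPushout_paste_iff (hp.isHoPushout_flip h₄) w₁.symm).1 ?_)
  rw [hu, hq]
  exact hp.isHoPushout_flip hM

end

theorem isZero_tensorRight {O : C} (hO : IsZero O) (X : C) : IsZero (O ⊗ X) :=
  hO.of_iso ((IsInitial.isInitialObj (MonoidalCategory.tensorRight X) _
    hO.isInitial).uniqueUpToIso hO.isInitial)

/-- The pushout-product of a cofibration with a map to a weakly trivial object is equivalent to
the tensor product with the quotient. -/
theorem weakEquivalence_of_quotient (hC : IsOperadicModelCategory C ι) (hp : IsProper C)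
    (hz : HasZeroObject C) {L M X T V O K : C} {i : L ⟶ M} {a : X ⟶ T} {l : M ⊗ X ⟶ V}
    {r : L ⊗ T ⟶ V} [IsCofibrant L] [IsCofibrant X] [Cofibration i] (hT : IsWeaklyTrivial T)
    (s : IsPushout (i ▷ X) (L ◁ a) l r) (hO : IsZero O) {o : L ⟶ O} {k : M ⟶ K} {o' : O ⟶ K}
    (sK : IsPushout i o k o') {v : V ⟶ K ⊗ X} {δ : L ⊗ T ⟶ O ⊗ X} (hv : l ≫ v = k ▷ X)
    (hv' : r ≫ v = δ ≫ o' ▷ X) : WeakEquivalence v := by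
  have := hC.cofibration_whiskerRight i X
  have hOX : IsZero (O ⊗ X) := isZero_tensorRight hO X
  have := weakEquivalence_of_isWeaklyTrivial δ (hT.tensorLeft hC hz L)
    (isWeaklyTrivial_of_isInitial hz hOX.isInitial)
  exact hp.weakEquivalence_pushout_desc s (isPushout_whiskerRight sK X) (𝟙 _) (𝟙 _) δ v
    (by simp) (hOX.eq_of_tgt _ _) (by simpa using hv) hv'

section

variable {X y T w X' T' w' : C} {f : X ⟶ y} {a : X ⟶ T} {η : y ⟶ w} {b : T ⟶ w} {f' : X' ⟶ y}
  {a' : X' ⟶ T'} {η' : y ⟶ w'} {b' : T' ⟶ w'}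

/-- Extension of maps from one cofiber of a map to `y` to another one, along a map of cofiber
sequences that is null on the fibers. -/
theorem IsCofiberSquare.exists_extension (hC : IsOperadicModelCategory C ι) (hp : IsProper C)
    (hz : HasZeroObject C) (H : IsCofiberSquare f a η b) (H' : IsCofiberSquare f' a' η' b')
    (σ : X' ⟶ X) (τ : T' ⟶ T) (ω : w' ⟶ w) (hf : σ ≫ f = f') (ha : a' ≫ τ = σ ≫ a)
    (hη : η' ≫ ω = η) (hb : b' ≫ ω = τ ≫ b) [IsCofibrant X] [IsCofibrant X'] [IsCofibrant y]
    [Cofibration η] [Cofibration η'] {z : C} [IsFibrant z]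
    (hn : ∀ (K : C) [IsCofibrant K] (γ : (hoQ C).obj (K ⊗ X) ⟶ (hoQ C).obj z),
      IsNull ((hoQ C).map (K ◁ σ) ≫ γ))
    {L M : C} (i : L ⟶ M) [IsCofibrant L] [Cofibration i] (α : L ⊗ w ⟶ z) (β : M ⊗ y ⟶ z)
    (hαβ : L ◁ η ≫ α = i ▷ y ≫ β) :
    ∃ e : M ⊗ w' ⟶ z, i ▷ w' ≫ e = L ◁ ω ≫ α ∧ M ◁ η' ≫ e = β := by
  obtain ⟨O, hO⟩ := hz.zero
  have : IsCofibrant w := isCofibrant_of_cofibration η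
  have : IsCofibrant w' := isCofibrant_of_cofibration η'
  have : IsCofibrant M := isCofibrant_of_cofibration i
  have sK := IsPushout.of_hasPushout i (hO.isTerminal.from L)
  have : Cofibration (pushout.inr i (hO.isTerminal.from L)) := cofibration_of_isPushout sK
  have : IsCofibrant O := (isCofibrant_iff_of_isInitial (𝟙 O) hO.isInitial).2 inferInstance
  have : IsCofibrant (pushout i (hO.isTerminal.from L)) :=
    isCofibrant_of_cofibration (pushout.inr i (hO.isTerminal.from L))
  let K := pushout i (hO.isTerminal.from L)
  let k : M ⟶ K := pushout.inl _ _
  let o' : O ⟶ K := pushout.inr _ _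
  have ko : ∀ Y : C, i ▷ Y ≫ k ▷ Y = hO.isTerminal.from L ▷ Y ≫ o' ▷ Y := fun Y =>
    (isPushout_whiskerRight sK Y).w
  have hOX : ∀ Y : C, IsZero (O ⊗ Y) := fun Y => isZero_tensorRight hO Y
  have s := IsPushout.of_hasPushout (i ▷ X) (L ◁ a)
  have s' := IsPushout.of_hasPushout (i ▷ X') (L ◁ a')
  have p := IsPushout.of_hasPushout (i ▷ y) (L ◁ η)
  have p' := IsPushout.of_hasPushout (i ▷ y) (L ◁ η')
  -- the comparison maps with the quotient
  have ev : i ▷ X ≫ k ▷ X = L ◁ a ≫ (hOX X).isTerminal.from _ ≫ o' ▷ X := by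
    rw [ko, ← Category.assoc (L ◁ a)]
    exact congrArg (· ≫ o' ▷ X) ((hOX X).eq_of_tgt _ _)
  have ev' : i ▷ X' ≫ k ▷ X' = L ◁ a' ≫ (hOX X').isTerminal.from _ ≫ o' ▷ X' := by
    rw [ko, ← Category.assoc (L ◁ a')]
    exact congrArg (· ≫ o' ▷ X') ((hOX X').eq_of_tgt _ _)
  let v := s.desc _ _ ev
  let v' := s'.desc _ _ ev'
  have hv := s.inl_desc _ _ ev
  have hv₂ := s.inr_desc _ _ ev
  have hv' := s'.inl_desc _ _ ev'
  have hv₂' := s'.inr_desc _ _ ev'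
  have : WeakEquivalence v := weakEquivalence_of_quotient hC hp hz H.trivial s hO sK hv hv₂
  -- the map of fibers
  have eρ : i ▷ X' ≫ M ◁ σ ≫ pushout.inl (i ▷ X) (L ◁ a) =
      L ◁ a' ≫ L ◁ τ ≫ pushout.inr (i ▷ X) (L ◁ a) := by
    rw [← whisker_exchange_assoc, s.w, ← MonoidalCategory.whiskerLeft_comp_assoc,
      ← MonoidalCategory.whiskerLeft_comp_assoc, ha]
  let ρ := s'.desc _ _ eρ
  have hρ := s'.inl_desc _ _ eρ
  have hρ' := s'.inr_desc _ _ eρ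
  have hρv : ρ ≫ v = v' ≫ K ◁ σ := by
    apply s'.hom_ext
    · rw [reassoc_of% hρ, hv, reassoc_of% hv', whisker_exchange]
    · rw [reassoc_of% hρ', hv₂, reassoc_of% hv₂', ← whisker_exchange, ← Category.assoc,
        ← Category.assoc]
      exact congrArg (· ≫ o' ▷ X) ((hOX X).eq_of_tgt _ _)
  -- the cofiber square of pushout products
  have eg : i ▷ X ≫ M ◁ f ≫ pushout.inl (i ▷ y) (L ◁ η) =
      L ◁ a ≫ L ◁ b ≫ pushout.inr (i ▷ y) (L ◁ η) := by
    rw [← whisker_exchange_assoc, p.w, ← MonoidalCategory.whiskerLeft_comp_assoc,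
      ← MonoidalCategory.whiskerLeft_comp_assoc, H.isHoPushout.1]
  have eg' : i ▷ X' ≫ M ◁ f' ≫ pushout.inl (i ▷ y) (L ◁ η') =
      L ◁ a' ≫ L ◁ b' ≫ pushout.inr (i ▷ y) (L ◁ η') := by
    rw [← whisker_exchange_assoc, p'.w, ← MonoidalCategory.whiskerLeft_comp_assoc,
      ← MonoidalCategory.whiskerLeft_comp_assoc, H'.isHoPushout.1]
  have hg := s.inl_desc _ _ eg
  have hg₂ := s.inr_desc _ _ eg
  have hg' := s'.inl_desc _ _ eg'
  have hg₂' := s'.inr_desc _ _ eg'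
  have eu : i ▷ X' ≫ M ◁ a' = L ◁ a' ≫ i ▷ T' := (whisker_exchange i a').symm
  have eq : i ▷ y ≫ M ◁ η' = L ◁ η' ≫ i ▷ w' := (whisker_exchange i η').symm
  have hq := p'.inl_desc _ _ eq
  have hq₂ := p'.inr_desc _ _ eq
  have Hp := H'.pushoutProduct hC hp hz s' p' hg' hg₂' (s'.inl_desc _ _ eu) (s'.inr_desc _ _ eu)
    hq hq₂
  have := hC.cofibration_pushoutProduct p' hq hq₂
  have : IsCofibrant (pushout (i ▷ y) (L ◁ η')) := by
    have := hC.cofibration_whiskerRight i y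
    have := hC.isCofibrant_tensor L w'
    exact isCofibrant_of_cofibration (pushout.inr (i ▷ y) (L ◁ η'))
  have eφ : i ▷ y ≫ β = L ◁ η' ≫ L ◁ ω ≫ α := by
    rw [← MonoidalCategory.whiskerLeft_comp_assoc, hη, hαβ]
  let φ := p'.desc _ _ eφ
  let φ₀ := p.desc _ _ hαβ.symm
  have hφ : s'.desc _ _ eg' ≫ φ = ρ ≫ s.desc _ _ eg ≫ φ₀ := by
    apply s'.hom_ext
    · rw [reassoc_of% hg', p'.inl_desc, reassoc_of% hρ, reassoc_of% hg, p.inl_desc,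
        ← MonoidalCategory.whiskerLeft_comp_assoc, hf]
    · rw [reassoc_of% hg₂', p'.inr_desc, reassoc_of% hρ', reassoc_of% hg₂, p.inr_desc,
        ← MonoidalCategory.whiskerLeft_comp_assoc, ← MonoidalCategory.whiskerLeft_comp_assoc, hb]
  have hnull : IsNull ((hoQ C).map (s'.desc _ _ eg') ≫ (hoQ C).map φ) := by
    have := (hn K (inv ((hoQ C).map v) ≫ (hoQ C).map (s.desc _ _ eg ≫ φ₀))).precomp
      ((hoQ C).map v')
    rw [← Category.assoc, ← Functor.map_comp, ← hρv, Functor.map_comp, Category.assoc,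
      IsIso.hom_inv_id_assoc, ← Functor.map_comp] at this
    rw [← Functor.map_comp, hφ]
    exact this
  obtain ⟨ψ, hψ⟩ := Hp.exists_factor hp _ hnull
  obtain ⟨e, he, -⟩ := exists_extension_of_hoMap _ _ ψ hψ
  refine ⟨e, ?_, ?_⟩
  · rw [← hq₂, Category.assoc, he, p'.inr_desc]
  · rw [← hq, Category.assoc, he, p'.inl_desc]

end

end

section

variable {C : Type u} [Category.{v} C] [MonoidalCategory C] [SymmetricCategory C]
  [MonoidalClosed C] [ModelCategory C] [HasLimits C] [HasColimits C] {ι : SSet.{v} ⥤ C}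
  [ι.Braided] [ι.IsLeftAdjoint]

/-! ### Lifting problems at finite stages -/

section

variable {y : C} {w : ℕᵒᵖ ⥤ C} {η : (Functor.const ℕᵒᵖ).obj y ⟶ w}

theorem app_comp_map (η : (Functor.const ℕᵒᵖ).obj y ⟶ w) {s t : ℕ} (h : s ≤ t) :
    η.app (op t) ≫ w.map (homOfLE h).op = η.app (op s) :=
  (η.naturality (homOfLE h).op).symm.trans (Category.id_comp _)

theorem map_comp_map (w : ℕᵒᵖ ⥤ C) {s t r : ℕ} (h : s ≤ t) (h' : t ≤ r) :
    w.map (homOfLE h').op ≫ w.map (homOfLE h).op = w.map (homOfLE (h.trans h')).op := by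
  rw [← w.map_comp]; rfl

/-- Lifting problems for the pushout-products with `y ⟶ w_t` against `z ⟶ 0` can be solved at the
stage `t + n`. -/
def UniformLift (η : (Functor.const ℕᵒᵖ).obj y ⟶ w) (z : C) (n : ℕ) : Prop :=
  ∀ (t : ℕ) {L M : C} (i : L ⟶ M) [IsCofibrant L] [Cofibration i] (a : L ⊗ w.obj (op t) ⟶ z)
    (b : M ⊗ y ⟶ z), L ◁ η.app (op t) ≫ a = i ▷ y ≫ b →
    ∃ e : M ⊗ w.obj (op (t + n)) ⟶ z,
      i ▷ _ ≫ e = L ◁ w.map (homOfLE (t.le_add_right n)).op ≫ a ∧ M ◁ η.app (op (t + n)) ≫ e = b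

theorem UniformLift.stageLift {z : C} {n : ℕ} (h : UniformLift η z n) {L M : C} (i : L ⟶ M)
    [IsCofibrant L] [Cofibration i] : StageLift η i (terminal.from z) := by
  intro t a b d hab _ _
  obtain ⟨e, he, he'⟩ := h t i a b hab
  exact ⟨t + n, _, e, he, he', Subsingleton.elim _ _⟩

/-- Lifting against a fibration, from lifting for its source and target. -/
theorem StageLift.of_fibration (hC : IsOperadicModelCategory C ι) [IsCofibrant y]
    (hη : ∀ t, Cofibration (η.app (op t))) {Z Z' : C} (q : Z ⟶ Z') [Fibration q]
    (hZ : ∀ {L M : C} (i : L ⟶ M) [IsCofibrant L] [Cofibration i],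
      StageLift η i (terminal.from Z))
    (hZ' : ∀ {L M : C} (i : L ⟶ M) [IsCofibrant L] [Cofibration i],
      StageLift η i (terminal.from Z'))
    {L M : C} (i : L ⟶ M) [IsCofibrant L] [Cofibration i] : StageLift η i q := by
  intro t a b d hab haq hbq
  let ξ : ∀ t, y ⟶ w.obj (op t) := fun t => η.app (op t)
  have hξ : ∀ {s t : ℕ} (h : s ≤ t), ξ t ≫ w.map (homOfLE h).op = ξ s := app_comp_map η
  have : ∀ t, Cofibration (ξ t) := hη
  change M ⊗ y ⟶ Z at b
  change L ◁ ξ t ≫ a = i ▷ y ≫ b at hab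
  change b ≫ q = M ◁ ξ t ≫ d at hbq
  obtain ⟨t₁, h₁, e, he, he', -⟩ := hZ i t a b (terminal.from _) hab (Subsingleton.elim _ _)
    (Subsingleton.elim _ _)
  change M ◁ ξ t₁ ≫ e = b at he'
  have s := IsPushout.of_hasPushout i i
  let in₀ : M ⟶ pushout i i := pushout.inl i i
  let in₁ : M ⟶ pushout i i := pushout.inr i i
  have hin : i ≫ in₀ = i ≫ in₁ := s.w
  let fold : pushout i i ⟶ M := s.desc (𝟙 M) (𝟙 M) rfl
  have hf₀ : in₀ ≫ fold = 𝟙 M := s.inl_desc _ _ _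
  have hf₁ : in₁ ≫ fold = 𝟙 M := s.inr_desc _ _ _
  obtain ⟨Y, κ, π, _, _, _, hκ⟩ := exists_cofibration_trivialFibration fold
  have : IsCofibrant M := isCofibrant_of_cofibration i
  have : IsCofibrant (pushout i i) := isCofibrant_of_cofibration (pushout.inl i i)
  have s₁ := isPushout_whiskerRight s (w.obj (op t₁))
  have s₂ := isPushout_whiskerRight s y
  have ea : i ▷ w.obj (op t₁) ≫ e ≫ q =
      i ▷ w.obj (op t₁) ≫ M ◁ w.map (homOfLE h₁).op ≫ d := by
    rw [← Category.assoc, he, Category.assoc, haq, whisker_exchange_assoc]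
  let a' := s₁.desc _ _ ea
  have ha₀ : in₀ ▷ _ ≫ a' = e ≫ q := s₁.inl_desc _ _ ea
  have ha₁ : in₁ ▷ _ ≫ a' = M ◁ w.map (homOfLE h₁).op ≫ d := s₁.inr_desc _ _ ea
  have hπ₀ : in₀ ▷ y ≫ κ ▷ y ≫ π ▷ y = 𝟙 _ := by
    rw [← comp_whiskerRight, ← comp_whiskerRight, hκ, hf₀, id_whiskerRight]
  have hπ₁ : in₁ ▷ y ≫ κ ▷ y ≫ π ▷ y = 𝟙 _ := by
    rw [← comp_whiskerRight, ← comp_whiskerRight, hκ, hf₁, id_whiskerRight]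
  have hab' : pushout i i ◁ ξ t₁ ≫ a' = κ ▷ y ≫ π ▷ y ≫ b ≫ q := by
    apply s₂.hom_ext
    · change in₀ ▷ y ≫ _ = in₀ ▷ y ≫ _
      rw [← whisker_exchange_assoc, ha₀, reassoc_of% hπ₀, ← he', Category.assoc]
    · change in₁ ▷ y ≫ _ = in₁ ▷ y ≫ _
      rw [← whisker_exchange_assoc, ha₁, reassoc_of% hπ₁, hbq,
        ← MonoidalCategory.whiskerLeft_comp_assoc, hξ]
  obtain ⟨t₂, h₂, h, hh, hh', -⟩ := hZ' κ t₁ a' (π ▷ y ≫ b ≫ q) (terminal.from _) hab'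
    (Subsingleton.elim _ _) (Subsingleton.elim _ _)
  change Y ◁ ξ t₂ ≫ h = π ▷ y ≫ b ≫ q at hh'
  have : Cofibration (in₀ ≫ κ) := inferInstance
  have : WeakEquivalence (in₀ ≫ κ) :=
    weakEquivalence_of_postcomp_of_fac (g := π) (fg := 𝟙 M) (by rw [Category.assoc, hκ, hf₀])
  have p := IsPushout.of_hasPushout ((in₀ ≫ κ) ▷ y) (M ◁ ξ t₂)
  have eP : (in₀ ≫ κ) ▷ y ≫ Y ◁ ξ t₂ = M ◁ ξ t₂ ≫ (in₀ ≫ κ) ▷ w.obj (op t₂) :=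
    (whisker_exchange _ _).symm
  have := hC.cofibration_pushoutProduct p (p.inl_desc _ _ eP) (p.inr_desc _ _ eP)
  have hwe := hC.weakEquivalence_pushoutProduct p (p.inl_desc _ _ eP) (p.inr_desc _ _ eP)
    (Or.inl inferInstance)
  have eT : (in₀ ≫ κ) ▷ y ≫ π ▷ y ≫ b = M ◁ ξ t₂ ≫ M ◁ w.map (homOfLE h₂).op ≫ e := by
    rw [comp_whiskerRight, Category.assoc, reassoc_of% hπ₀,
      ← MonoidalCategory.whiskerLeft_comp_assoc, hξ, he']
  obtain ⟨H, hH, hHq⟩ := exists_lift (p.desc _ _ eP) q (Or.inl hwe) (p.desc _ _ eT) h (by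
    apply p.hom_ext
    · rw [← Category.assoc, p.inl_desc, ← Category.assoc, p.inl_desc, hh', Category.assoc]
    · rw [← Category.assoc, p.inr_desc, ← Category.assoc, p.inr_desc, comp_whiskerRight,
        Category.assoc, Category.assoc, hh, ← whisker_exchange_assoc, ha₀])
  have hH₁ : Y ◁ ξ t₂ ≫ H = π ▷ y ≫ b := by
    rw [← p.inl_desc _ _ eP, Category.assoc, hH, p.inl_desc]
  have hH₂ : (in₀ ≫ κ) ▷ w.obj (op t₂) ≫ H = M ◁ w.map (homOfLE h₂).op ≫ e := by
    rw [← p.inr_desc _ _ eP, Category.assoc, hH, p.inr_desc]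
  refine ⟨t₂, h₁.trans h₂, (in₁ ≫ κ) ▷ _ ≫ H, ?_, ?_, ?_⟩
  · rw [← comp_whiskerRight_assoc, ← Category.assoc, ← hin, Category.assoc, comp_whiskerRight,
      Category.assoc, hH₂, ← whisker_exchange_assoc, he,
      ← MonoidalCategory.whiskerLeft_comp_assoc, map_comp_map]
  · change M ◁ ξ t₂ ≫ _ = b
    rw [whisker_exchange_assoc, hH₁, comp_whiskerRight, Category.assoc, reassoc_of% hπ₁]
  · rw [Category.assoc, hHq, comp_whiskerRight, Category.assoc, hh, ← whisker_exchange_assoc, ha₁,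
      ← MonoidalCategory.whiskerLeft_comp_assoc, map_comp_map]

end

/-! ### Adams towers -/

section

variable {J : C} {j : J ⟶ 𝟙_ C}

theorem NullAt.isNull_whiskerLeft (hC : IsOperadicModelCategory C ι) [IsCofibrant J] {n : ℕ}
    {z : C} (h : NullAt j n z) (K X : C) [IsCofibrant K] (γ : (hoQ C).obj (K ⊗ X) ⟶ (hoQ C).obj z) :
    IsNull ((hoQ C).map (K ◁ (adamsTrans j n).app X) ≫ γ) := by
  have := isCofibrant_adamsPow (J := J) hC n
  obtain ⟨γ', hγ⟩ := exists_hoMap_comp_eq (tensorLeft (adamsPow J n))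
    (fun f _ => hC.tensor_weakEquivalence _ f) (adamsTrans j n) γ
  have h₁ := (h.precomp γ').precomp ((hoQ C).map (inv ((α_ (adamsPow J n) K X).inv ≫
    (β_ (adamsPow J n) K).hom ▷ X ≫ (α_ K (adamsPow J n) X).hom)))
  rw [← hγ, adamsTrans_tensor, ← Category.assoc] at h₁
  have h₂ := (hoQ C).map_comp (inv ((α_ (adamsPow J n) K X).inv ≫
    (β_ (adamsPow J n) K).hom ▷ X ≫ (α_ K (adamsPow J n) X).hom))
    (((α_ (adamsPow J n) K X).inv ≫ (β_ (adamsPow J n) K).hom ▷ X ≫ (α_ K (adamsPow J n) X).hom) ≫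
      K ◁ (adamsTrans j n).app X)
  rw [IsIso.inv_hom_id_assoc] at h₂
  rw [h₂]
  exact h₁

theorem adamsSteps_whiskerRight (t n : ℕ) (y : C) : adamsSteps j t n ▷ y =
    (adamsSplit J t n ▷ y ≫ (α_ _ _ _).hom) ≫ (adamsTrans j n).app (adamsPow J t ⊗ y) := by
  change (adamsSplit J t n ≫ adamsAug j n ▷ _ ≫ (λ_ _).hom) ▷ y =
    (adamsSplit J t n ▷ y ≫ (α_ _ _ _).hom) ≫ adamsAug j n ▷ _ ≫ (λ_ _).hom
  simp

variable {y : C} {w : ℕᵒᵖ ⥤ C} {η : (Functor.const ℕᵒᵖ).obj y ⟶ w}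

/-- Lifting problems for Adams towers against nilpotent objects have solutions at a finite
stage. -/
theorem IsAdamsTower.exists_uniformLift (hC : IsOperadicModelCategory C ι) (hp : IsProper C)
    (hs : IsStable C) {E : C} [IsCofibrant E] {e : 𝟙_ C ⟶ E} {m : E ⊗ E ⟶ E}
    (hE : IsMuRing E e m) [IsCofibrant y] (hη : IsFibrantTower η) (h : IsAdamsTower e η) (z : C)
    [IsFibrant z] (hz : IsNilObject E z) : ∃ n, UniformLift η z n := by
  obtain ⟨J, P, j, g, k, T, t, a, b, _, H, _, hat, hbt, hs'⟩ := h
  obtain ⟨n, hn⟩ := hz.exists_nullAt hC hp hs hE H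
  have htr : ∀ (s n : ℕ), ∃ τ : T (s + n) ⟶ T s, a (s + n) ≫ τ = adamsSteps j s n ▷ y ≫ a s ∧
      b (s + n) ≫ w.map (homOfLE (s.le_add_right n)).op = τ ≫ b s := by
    intro s n
    induction n with
    | zero =>
      refine ⟨𝟙 _, ?_, ?_⟩
      · rw [adamsSteps_zero, id_whiskerRight, Category.id_comp]; exact Category.comp_id _
      · rw [Category.id_comp]
        exact (congrArg (b s ≫ ·) (w.map_id _)).trans (Category.comp_id _)
    | succ n ih =>
      obtain ⟨τ, h₁, h₂⟩ := ih
      refine ⟨t (s + n) ≫ τ, ?_, ?_⟩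
      · rw [adamsSteps_succ, comp_whiskerRight, Category.assoc, ← h₁, ← Category.assoc]
        exact (congrArg (· ≫ τ) (hat (s + n))).trans (Category.assoc _ _ _)
      · rw [Category.assoc, ← h₂, ← Category.assoc, ← hbt, Category.assoc]
        exact congrArg (_ ≫ ·) (map_comp_map w _ _).symm
  refine ⟨n, fun s L M i _ _ α β hαβ => ?_⟩
  obtain ⟨τ, h₁, h₂⟩ := htr s n
  have := hη.cofibration
  have := isCofibrant_adamsPow (J := J) hC
  have : ∀ n, IsCofibrant (adamsPow J n ⊗ y) := fun n => hC.isCofibrant_tensor _ _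
  refine IsCofiberSquare.exists_extension hC hp hs.hasZeroObject (hs' s) (hs' (s + n))
    (adamsSteps j s n ▷ y) τ (w.map (homOfLE (s.le_add_right n)).op) ?_ h₁ ?_ h₂ ?_ i α β hαβ
  · rw [← Category.assoc, ← comp_whiskerRight, adamsSteps_aug]
  · exact app_comp_map η _
  · intro K _ γ
    rw [adamsSteps_whiskerRight, MonoidalCategory.whiskerLeft_comp, Functor.map_comp,
      Category.assoc]
    exact (hn.isNull_whiskerLeft hC K _ γ).precomp _

theorem IsAdamsTower.isNilObject (hC : IsOperadicModelCategory C ι) (hp : IsProper C)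
    (hz : HasZeroObject C) {E : C} [IsCofibrant E] {e : 𝟙_ C ⟶ E} [IsCofibrant y]
    (h : IsAdamsTower e η) (s : ℕ) : IsNilObject E (w.obj (op s)) := by
  obtain ⟨J, P, j, g, k, T, t, a, b, _, H, _, hat, hbt, hs'⟩ := h
  exact isNilObject_of_isCofiberSquare hC hp hz H y s (hs' s)

end

theorem IsFibrantTower.isFibrant_obj {y : C} {w : ℕᵒᵖ ⥤ C} {η : (Functor.const ℕᵒᵖ).obj y ⟶ w}
    (hη : IsFibrantTower η) (s : ℕ) : IsFibrant (w.obj (op s)) := by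
  induction s with
  | zero => exact hη.isFibrant
  | succ s ih =>
    have := hη.fibration s
    exact isFibrant_of_fibration (w.map (homOfLE s.le_succ).op)

theorem IsFibrantTower.isCofibrant_obj {y : C} {w : ℕᵒᵖ ⥤ C}
    {η : (Functor.const ℕᵒᵖ).obj y ⟶ w} (hη : IsFibrantTower η) [IsCofibrant y] (s : ℕ) :
    IsCofibrant (w.obj (op s)) := by
  have := hη.cofibration (op s)
  have : IsCofibrant (((Functor.const ℕᵒᵖ).obj y).obj (op s)) := ‹IsCofibrant y›
  exact isCofibrant_of_cofibration (η.app (op s))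

/-- Lifting against the stages of a tower implies that the space of lifts is contractible. -/
theorem IsFibrantTower.isContractibleKan_liftSpace (hC : IsOperadicModelCategory C ι) {y : C}
    {w : ℕᵒᵖ ⥤ C} {η : (Functor.const ℕᵒᵖ).obj y ⟶ w} (hη : IsFibrantTower η) [IsCofibrant y]
    {O : SOperad.{v}} (hO : O.IsCofibrant) (θ : OAlgebra ι O y)
    (h : ∀ (s : ℕ) {L M : C} (i : L ⟶ M) [IsCofibrant L] [Cofibration i],
      StageLift η i (terminal.from (w.obj (op s)))) :
    IsContractibleKan (liftSpace ι θ (towerProMap η)) :=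
  isContractibleKan_liftSpace_of_stageLift hC (fun n => by
      obtain ⟨n⟩ := n
      exact hη.isCofibrant_obj n) hO θ (fun i _ _ => h 0 i) fun i s _ _ => by
    have := hη.fibration s
    exact StageLift.of_fibration hC (fun t => hη.cofibration (op t)) _ (fun i => h (s + 1) i)
      (fun i => h s i) i

end

section

/-! ### Sequential colimits -/

section

variable {C : Type u} [Category.{v} C] [ModelCategory C]

/-- `ℕ`, as a category in any universe. -/
abbrev natEquivalence : ULift.{v} ℕ ≌ ℕ := 
  OrderIso.equivalence ⟨Equiv.ulift.{v} (α := ℕ), Iff.rfl⟩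

theorem isFiltered_ulift_nat : IsFiltered (ULift.{v} ℕ) :=
  IsFiltered.of_equivalence natEquivalence.symm

theorem HasGoodFilteredColimits.weakEquivalence_nat [HasColimits C]
    (h : HasGoodFilteredColimits C) : (weakEquivalences C).IsStableUnderColimitsOfShape ℕ := by
  have := isFiltered_ulift_nat.{v}
  rw [MorphismProperty.isStableUnderColimitsOfShape_iff_colimitsOfShape_le,
    ← MorphismProperty.colimitsOfShape_eq_of_equivalence _ natEquivalence.{v},
    ← MorphismProperty.isStableUnderColimitsOfShape_iff_colimitsOfShape_le]
  exact h.weakEquivalence (ULift.{v} ℕ)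

/-- If all lifting problems of cofibrations against the maps of a cocone can be solved one step
later, then the colimit is weakly equivalent to the vertex of the cocone. -/
theorem weakEquivalence_desc_of_lift_succ [HasColimits C] (hf : HasGoodFilteredColimits C)
    {F : ℕ ⥤ C} (c : Cocone F)
    (h : ∀ (t : ℕ) {L M : C} (i : L ⟶ M) [IsCofibrant L] [Cofibration i] (a : L ⟶ F.obj t)
      (b : M ⟶ c.pt), a ≫ c.ι.app t = i ≫ b →
      ∃ e : M ⟶ F.obj (t + 1), i ≫ e = a ≫ F.map (homOfLE t.le_succ) ∧ e ≫ c.ι.app (t + 1) = b) :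
    WeakEquivalence (colimit.desc F c) := by
  have := hf.weakEquivalence_nat
  choose L l hL hl hl' using fun t => exists_cofibrant_resolution (F.obj t)
  choose M i p hi hp hp' hip using fun t => exists_cofibration_trivialFibration (l t ≫ c.ι.app t)
  choose e he he' using fun t => h t (i t) (l t) (p t) (hip t).symm
  have hr : ∀ t, ∃ r : M t ⟶ L (t + 1), r ≫ l (t + 1) = e t := fun t => by
    have : IsCofibrant (M t) := isCofibrant_of_cofibration (i t)
    obtain ⟨r, -, hr⟩ := exists_lift (initial.to (M t)) (l (t + 1)) (Or.inr inferInstance)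
      (initial.to _) (e t) (Subsingleton.elim _ _)
    exact ⟨r, hr⟩
  choose r hr using hr
  let FL : ℕ ⥤ C := Functor.ofSequence fun t => i t ≫ r t
  let FM : ℕ ⥤ C := Functor.ofSequence fun t => r t ≫ i (t + 1)
  have hFL (t : ℕ) : FL.map (homOfLE t.le_succ) = i t ≫ r t :=
    Functor.ofSequence_map_homOfLE_succ _ _
  have hFM (t : ℕ) : FM.map (homOfLE t.le_succ) = r t ≫ i (t + 1) :=
    Functor.ofSequence_map_homOfLE_succ _ _
  have hL₁ (t : ℕ) : i t ≫ r t ≫ colimit.ι FL (t + 1) = colimit.ι FL t :=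
    (Category.assoc _ _ _).symm.trans
      ((congrArg (· ≫ colimit.ι FL (t + 1)) (hFL t).symm).trans (colimit.w FL _))
  have hM₁ (t : ℕ) : r t ≫ i (t + 1) ≫ colimit.ι FM (t + 1) = colimit.ι FM t :=
    (Category.assoc _ _ _).symm.trans
      ((congrArg (· ≫ colimit.ι FM (t + 1)) (hFM t).symm).trans (colimit.w FM _))
  have e₁ (t : ℕ) : (i t ≫ r t) ≫ l (t + 1) = l t ≫ F.map (homOfLE t.le_succ) := by
    rw [Category.assoc, hr, he]
  have e₂ (t : ℕ) : (r t ≫ i (t + 1)) ≫ p (t + 1) = p t := by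
    rw [Category.assoc, hip, reassoc_of% hr t, he']
  let fl : FL ⟶ F := NatTrans.ofSequence l fun t =>
    (congrArg (· ≫ l (t + 1)) (hFL t)).trans (e₁ t)
  let μ : FM ⟶ (Functor.const ℕ).obj c.pt := NatTrans.ofSequence p fun t =>
    (congrArg (· ≫ p (t + 1)) (hFM t)).trans ((e₂ t).trans (Category.comp_id _).symm)
  let ν : FL ⟶ FM := NatTrans.ofSequence i fun t =>
    (congrArg (· ≫ i (t + 1)) (hFL t)).trans
      ((Category.assoc _ _ _).trans (congrArg (i t ≫ ·) (hFM t).symm))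
  let ρ : FM ⟶ (Functor.const ℕ).obj (colimit FL) :=
    NatTrans.ofSequence (fun t => r t ≫ colimit.ι FL (t + 1)) fun t =>
      (congrArg (· ≫ r (t + 1) ≫ colimit.ι FL (t + 1 + 1)) (hFM t)).trans
        ((Category.assoc _ _ _).trans ((congrArg (r t ≫ ·) (hL₁ (t + 1))).trans
          (Category.comp_id _).symm))
  have hν : IsIso (colimMap ν) := by
    refine ⟨colimit.desc FM ⟨_, ρ⟩, colimit.hom_ext fun t => ?_, colimit.hom_ext fun t => ?_⟩
    · rw [ι_colimMap_assoc, colimit.ι_desc, Category.comp_id]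
      exact hL₁ t
    · rw [colimit.ι_desc_assoc, Category.comp_id]
      refine (Category.assoc _ _ _).trans (Eq.trans ?_ (hM₁ t))
      exact congrArg (r t ≫ ·) (ι_colimMap ν (t + 1))
  have hl₂ : WeakEquivalence (colimMap fl) := by
    rw [weakEquivalence_iff]
    exact MorphismProperty.colimMap _ fun t => (weakEquivalence_iff _).1 (hl' t)
  have hp₂ : WeakEquivalence (colimit.desc FM ⟨_, μ⟩) := by
    rw [weakEquivalence_iff]
    exact MorphismProperty.colimitsOfShape_le _ (MorphismProperty.colimitsOfShape.mk' _ _ _ _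
      (colimit.isColimit FM) (isColimitConstCocone ℕ c.pt) μ
      (fun t => (weakEquivalence_iff _).1 (hp' t)) _ fun t => by
        refine (colimit.ι_desc _ _).trans (Category.comp_id _).symm)
  have e₃ : colimMap fl ≫ colimit.desc F c = colimMap ν ≫ colimit.desc FM ⟨_, μ⟩ := by
    ext t
    rw [ι_colimMap_assoc, ι_colimMap_assoc, colimit.ι_desc, colimit.ι_desc]
    exact (hip t).symm
  have : WeakEquivalence (colimMap fl ≫ colimit.desc F c) := by
    rw [e₃]
    infer_instance
  exact weakEquivalence_of_precomp (colimMap fl) _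

/-- Multiplication by a positive number, as a functor. -/
abbrev mulFunctor (n : ℕ) : ℕ ⥤ ℕ :=
  Monotone.functor (f := fun k => k * n) fun _ _ h => Nat.mul_le_mul_right n h

theorem final_mulFunctor {n : ℕ} (hn : 0 < n) : (mulFunctor n).Final := by
  exact (Monotone.final_functor_iff _).2 fun k => ⟨k, Nat.le_mul_of_pos_right k hn⟩

theorem weakEquivalence_desc_of_lift_add [HasColimits C] (hf : HasGoodFilteredColimits C)
    {F : ℕ ⥤ C} (c : Cocone F) {n : ℕ} (hn : 0 < n)
    (h : ∀ (t : ℕ) {L M : C} (i : L ⟶ M) [IsCofibrant L] [Cofibration i] (a : L ⟶ F.obj t)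
      (b : M ⟶ c.pt), a ≫ c.ι.app t = i ≫ b →
      ∃ e : M ⟶ F.obj (t + n), i ≫ e = a ≫ F.map (homOfLE (t.le_add_right n)) ∧
        e ≫ c.ι.app (t + n) = b) :
    WeakEquivalence (colimit.desc F c) := by
  have := final_mulFunctor hn
  have h₁ : WeakEquivalence (colimit.desc (mulFunctor n ⋙ F) (c.whisker (mulFunctor n))) := by
    refine weakEquivalence_desc_of_lift_succ hf _ fun t L M i _ _ a b hab => ?_
    obtain ⟨e, he, he'⟩ := h (t * n) i a b hab
    have et : (t + 1) * n = t * n + n := Nat.succ_mul t n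
    refine ⟨e ≫ F.map (homOfLE et.ge), ?_, ?_⟩
    · exact (Category.assoc _ _ _).symm.trans ((congrArg (· ≫ _) he).trans
        ((Category.assoc _ _ _).trans (congrArg (a ≫ ·) (F.map_comp _ _).symm)))
    · exact (Category.assoc _ _ _).trans ((congrArg (e ≫ ·) (c.w (homOfLE et.ge))).trans he')
  have h₂ : colimit.pre F (mulFunctor n) ≫ colimit.desc F c =
      colimit.desc (mulFunctor n ⋙ F) (c.whisker (mulFunctor n)) := colimit.pre_desc _ _ _
  rw [← h₂] at h₁
  exact weakEquivalence_of_precomp (colimit.pre F (mulFunctor n)) _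

end

/-! ### Function objects -/

section

variable {C : Type u} [Category.{v} C] [MonoidalCategory C] [SymmetricCategory C]
  [MonoidalClosed C]

/-- The adjoint `L ⟶ F(A, z)` of a map `L ⊗ A ⟶ z`. -/
def toIhom {L A z : C} (f : L ⊗ A ⟶ z) : L ⟶ (ihom A).obj z :=
  MonoidalClosed.curry ((β_ A L).hom ≫ f)

theorem toIhom_surjective {L A z : C} (g : L ⟶ (ihom A).obj z) : ∃ f : L ⊗ A ⟶ z, toIhom f = g :=
  ⟨(β_ A L).inv ≫ MonoidalClosed.uncurry g, by simp [toIhom]⟩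

theorem toIhom_injective {L A z : C} {f g : L ⊗ A ⟶ z} (h : toIhom f = toIhom g) : f = g := by
  have := MonoidalClosed.curry_injective h
  exact (cancel_epi _).1 this

theorem comp_toIhom {L' L A z : C} (i : L' ⟶ L) (f : L ⊗ A ⟶ z) :
    i ≫ toIhom f = toIhom (i ▷ A ≫ f) := by
  rw [toIhom, ← MonoidalClosed.curry_natural_left, toIhom,
    BraidedCategory.braiding_naturality_right_assoc]

theorem toIhom_comp_pre {L A B z : C} (g : B ⟶ A) (f : L ⊗ A ⟶ z) :
    toIhom f ≫ (MonoidalClosed.pre g).app z = toIhom (L ◁ g ≫ f) := by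
  rw [toIhom, MonoidalClosed.curry_pre_app, toIhom,
    BraidedCategory.braiding_naturality_left_assoc]

theorem toIhom_comp_map {L A z z' : C} (g : z ⟶ z') (f : L ⊗ A ⟶ z) :
    toIhom f ≫ (ihom A).map g = toIhom (f ≫ g) := by
  rw [toIhom, ← MonoidalClosed.curry_natural_right, toIhom, Category.assoc]

variable [ModelCategory C] [HasLimits C] [HasColimits C] {y : C} {w : ℕᵒᵖ ⥤ C}
  {η : (Functor.const ℕᵒᵖ).obj y ⟶ w}

theorem UniformLift.succ {z : C} {n : ℕ} (h : UniformLift η z n) : UniformLift η z (n + 1) := by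
  intro t L M i _ _ a b hab
  obtain ⟨e, he, he'⟩ := h t i a b hab
  refine ⟨M ◁ w.map (homOfLE (t + n).le_succ).op ≫ e, ?_, ?_⟩
  · rw [← whisker_exchange_assoc, he, ← MonoidalCategory.whiskerLeft_comp_assoc, map_comp_map]
  · rw [← he', ← MonoidalCategory.whiskerLeft_comp_assoc]
    exact congrArg (fun f => M ◁ f ≫ e) (app_comp_map η (t + n).le_succ)

theorem UniformLift.weakEquivalence (hf : HasGoodFilteredColimits C) {z : C} {n : ℕ}
    (h : UniformLift η z n) : WeakEquivalence (colimit.desc _ (functionCocone η z)) := by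
  refine weakEquivalence_desc_of_lift_add hf _ n.succ_pos fun t L M i _ _ a b hab => ?_
  obtain ⟨a, rfl⟩ : ∃ a' : L ⊗ w.obj (op t) ⟶ z, toIhom a' = a := toIhom_surjective a
  obtain ⟨b, rfl⟩ : ∃ b' : M ⊗ y ⟶ z, toIhom b' = b := toIhom_surjective b
  have hab' : toIhom (L ◁ η.app (op t) ≫ a) = toIhom (i ▷ y ≫ b) :=
    (toIhom_comp_pre (η.app (op t)) a).symm.trans (hab.trans (comp_toIhom i b))
  obtain ⟨e, he, he'⟩ := h.succ t i a b (toIhom_injective hab')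
  refine ⟨toIhom e, ?_, ?_⟩
  · exact (comp_toIhom i e).trans ((congrArg toIhom he).trans (toIhom_comp_pre _ a).symm)
  · exact (toIhom_comp_pre _ e).trans (congrArg toIhom he')

theorem IsAdamsTower.isNilpotentResolution {ι : SSet.{v} ⥤ C} [ι.Braided] [ι.IsLeftAdjoint]
    (hC : IsOperadicModelCategory C ι) (hp : IsProper C) (hf : HasGoodFilteredColimits C)
    (hs : IsStable C) {E : C} [IsCofibrant E] {e : 𝟙_ C ⟶ E} {m : E ⊗ E ⟶ E}
    (hE : IsMuRing E e m) [IsCofibrant y] (hη : IsFibrantTower η) (h : IsAdamsTower e η) :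
    IsNilpotentResolution E η where
  nilpotent s := by
    obtain ⟨s⟩ := s
    exact h.isNilObject hC hp hs.hasZeroObject s
  weakEquivalence z _ hz := by
    obtain ⟨n, hn⟩ := h.exists_uniformLift hC hp hs hE hη z hz
    exact hn.weakEquivalence hf

end

end

section

/-! ### Existence of fibers -/

section

variable {C : Type u} [Category.{v} C] [ModelCategory C]

/-- The map `h` is the second map of a homotopy cofiber sequence. -/
def IsCofiberMap {Y Z : C} (h : Y ⟶ Z) : Prop :=
  ∃ (X P : C) (f : X ⟶ Y) (g : X ⟶ P) (k : P ⟶ Z), IsCofiberSquare f g h k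

theorem IsCofiberMap.of_weakEquivalence (hp : IsProper C) {Y Z Y' Z' : C} {h : Y ⟶ Z}
    (H : IsCofiberMap h) {h' : Y' ⟶ Z'} (p : Y ⟶ Y') (q : Z ⟶ Z') [WeakEquivalence p]
    [WeakEquivalence q] (w : h ≫ q = p ≫ h') : IsCofiberMap h' := by
  obtain ⟨X, P, f, g, k, H⟩ := H
  refine ⟨X, P, f ≫ p, g, k ≫ q, H.trivial, ?_⟩
  have w' := H.isHoPushout.1
  exact (hp.isHoPushout_iff_of_weakEquivalence w'
    (by rw [Category.assoc, ← w, reassoc_of% w']) (𝟙 X) p (𝟙 P) q (by simp) (by simp) w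
    (by simp)).1 H.isHoPushout

theorem IsCofiberMap.of_weakEquivalence' (hp : IsProper C) {Y Z Y' Z' : C} {h : Y ⟶ Z}
    {h' : Y' ⟶ Z'} (H : IsCofiberMap h') (p : Y ⟶ Y') (q : Z ⟶ Z') [WeakEquivalence p]
    [WeakEquivalence q] (w : h ≫ q = p ≫ h') : IsCofiberMap h := by
  obtain ⟨X, P, f, g, k, H⟩ := H
  have e := H.isHoPushout.1
  obtain ⟨X₁, i, f₁, _, _, _, hi⟩ := exists_trivialCofibration_fibration f
  obtain ⟨P₁, j, k₁, _, _, _, hj⟩ := exists_trivialCofibration_fibration k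
  obtain ⟨g₁, hg₁, hg₁'⟩ := exists_lift i k₁ (Or.inl ‹_›) (g ≫ j) (f₁ ≫ h')
    (by rw [Category.assoc, hj, reassoc_of% hi, e])
  have sX := IsPullback.of_hasPullback f₁ p
  have sP := IsPullback.of_hasPullback k₁ q
  have := hp.right sX
  have := hp.right sP
  have e₁ : (pullback.fst f₁ p ≫ g₁) ≫ k₁ = (pullback.snd f₁ p ≫ h) ≫ q := by
    rw [Category.assoc, Category.assoc, hg₁', w, sX.w_assoc]
  have e₂ : pullback.snd f₁ p ≫ h = sP.lift _ _ e₁ ≫ pullback.snd k₁ q := (sP.lift_snd _ _ _).symm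
  refine ⟨_, _, pullback.snd f₁ p, sP.lift _ _ e₁, pullback.snd k₁ q, ?_, ?_⟩
  · exact (isWeaklyTrivial_iff (pullback.fst k₁ q)).2 ((isWeaklyTrivial_iff j).1 H.trivial)
  · refine (hp.isHoPushout_iff_of_weakEquivalence e₂ hg₁'.symm (pullback.fst f₁ p) p
      (pullback.fst k₁ q) q sX.w.symm (sP.lift_fst _ _ _) w sP.w.symm).2 ?_
    exact (hp.isHoPushout_iff_of_weakEquivalence e hg₁'.symm i (𝟙 _) j (𝟙 _)
      (by rw [hi, Category.comp_id]) hg₁.symm (by simp) (by rw [hj, Category.comp_id])).1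
      H.isHoPushout

end

section

variable {C : Type u} [Category.{v} C] [MonoidalCategory C] [SymmetricCategory C]
  [MonoidalClosed C] [ModelCategory C] [HasLimits C] [HasColimits C] {ι : SSet.{v} ⥤ C} [ι.Braided]
  [ι.IsLeftAdjoint]

/-- The suspension of a map out of the unit is the second map of a homotopy cofiber sequence. -/
theorem isCofiberMap_suspension (hC : IsOperadicModelCategory C ι) (hp : IsProper C)
    (hz : HasZeroObject C) {D E : C} (c : 𝟙_ C ⟶ D) [Cofibration c] (hD : IsWeaklyTrivial D)
    [IsCofibrant D] (e : 𝟙_ C ⟶ E) [Cofibration e] [IsCofibrant E] :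
    IsCofiberMap ((ρ_ (pushout c c)).inv ≫ pushout c c ◁ e) := by
  have := hC.isCofibrant_unit
  have := hC.cofibration_whiskerRight c E
  let d : E ⟶ D ⊗ E := (λ_ E).inv ≫ c ▷ E
  have hd : Cofibration d := inferInstance
  let e' : D ⟶ D ⊗ E := (ρ_ D).inv ≫ D ◁ e
  have he' : WeakEquivalence e' := weakEquivalence_of_isWeaklyTrivial _ hD
    (hD.tensorRight hC hz E)
  have hde : e ≫ d = c ≫ e' := by
    simp only [d, e', rightUnitor_inv_naturality_assoc, leftUnitor_inv_naturality_assoc,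
      whisker_exchange, unitors_inv_equal]
  have s₁ := IsPushout.of_hasPushout e c
  have s₂ := IsPushout.of_hasPushout (pushout.inl e c) d
  have s₃ := isPushout_whiskerRight (IsPushout.of_hasPushout c c) E
  have s₃' : IsPushout d d (pushout.inl c c ▷ E) (pushout.inr c c ▷ E) :=
    s₃.of_iso (λ_ E) (Iso.refl _) (Iso.refl _) (Iso.refl _) (by simp [d]) (by simp [d]) (by simp)
      (by simp)
  obtain ⟨m, hm, hm'⟩ : ∃ m, pushout.inl e c ≫ m = d ∧ pushout.inr e c ≫ m = e' :=
    ⟨s₁.desc d e' hde, s₁.inl_desc _ _ _, s₁.inr_desc _ _ _⟩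
  generalize pushout.inl e c = l at *
  generalize pushout.inr e c = r at *
  generalize pushout.inl l d = x at *
  generalize pushout.inr l d = z at *
  obtain ⟨q, hq, hq'⟩ : ∃ q, x ≫ q = m ≫ pushout.inl c c ▷ E ∧ z ≫ q = pushout.inr c c ▷ E :=
    ⟨s₂.desc _ _ (by rw [reassoc_of% hm, s₃'.w]), s₂.inl_desc _ _ _, s₂.inr_desc _ _ _⟩
  have s₄ : IsPushout m x (pushout.inl c c ▷ E) q :=
    IsPushout.of_left (by rw [hm, hq']; exact s₃') hq.symm s₂
  have := cofibration_of_isPushout s₂.flip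
  have hq₁ : IsCofiberMap q := ⟨_, _, _, _, _, hD.tensorRight hC hz E,
    hp.isHoPushout_of_isPushout s₄.flip⟩
  obtain ⟨u, hu, hu'⟩ : ∃ u, pushout.inl c c ≫ u = r ≫ x ∧ pushout.inr c c ≫ u = e' ≫ z :=
    ⟨pushout.desc (r ≫ x) (e' ≫ z) (by rw [← reassoc_of% hde, ← s₂.w, s₁.w_assoc]),
      pushout.inl_desc _ _ _, pushout.inr_desc _ _ _⟩
  have : WeakEquivalence u := hp.weakEquivalence_pushout_desc_left e' hde.symm
    (IsPushout.of_hasPushout c c).flip (s₁.paste_horiz s₂.flip) u hu' hu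
  refine hq₁.of_weakEquivalence' hp u (𝟙 _) ?_
  rw [Category.comp_id]
  ext
  · rw [reassoc_of% hu, hq, reassoc_of% hm', rightUnitor_inv_naturality_assoc, ← whisker_exchange,
      Category.assoc]
  · rw [reassoc_of% hu', hq', rightUnitor_inv_naturality_assoc, ← whisker_exchange, Category.assoc]

theorem IsCofiberMap.tensorLeft (hC : IsOperadicModelCategory C ι) (hp : IsProper C)
    (hz : HasZeroObject C) {Y Z : C} {h : Y ⟶ Z} (H : IsCofiberMap h) (K : C) [IsCofibrant K] :
    IsCofiberMap (K ◁ h) := by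
  obtain ⟨X, P, f, g, k, H⟩ := H
  exact ⟨_, _, _, _, _, H.tensorLeft hC hp hz K⟩

/-- Every map out of the unit has a cofibrant homotopy fiber. -/
theorem exists_isCofiberSquare (hC : IsOperadicModelCategory C ι) (hp : IsProper C)
    (hs : IsStable C) {E : C} (e : 𝟙_ C ⟶ E) :
    ∃ (J P : C) (j : J ⟶ 𝟙_ C) (g : J ⟶ P) (k : P ⟶ E), IsCofibrant J ∧
      IsCofiberSquare j g e k := by
  have := hC.isCofibrant_unit
  obtain ⟨D, c, S, hS⟩ := exists_spheres hC hp hs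
  have := hS.cofibration
  have := hS.isCofibrant
  have := hS.isCofibrant_pushout
  have : IsCofibrant D := isCofibrant_of_cofibration c
  obtain ⟨E', e', p, _, _, _, rfl⟩ := exists_cofibration_trivialFibration e
  have : IsCofibrant E' := isCofibrant_of_cofibration e'
  obtain ⟨u, v, w, _, _⟩ := hS.exists_weakEquivalence
  let v' := (β_ S (pushout c c)).hom ≫ v
  have := hC.weakEquivalence_whiskerRight v' E'
  have := hC.weakEquivalence_whiskerRight w E'
  have h₁ := (isCofiberMap_suspension hC hp hs.hasZeroObject c hS.isWeaklyTrivial e').tensorLeft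
    hC hp hs.hasZeroObject S
  have h₂ : IsCofiberMap ((ρ_ u).inv ≫ u ◁ e') :=
    h₁.of_weakEquivalence hp v' ((α_ _ _ _).inv ≫ v' ▷ E') (by
      rw [rightUnitor_inv_naturality_assoc, ← whisker_exchange]
      simp)
  have h₃ : IsCofiberMap e' := h₂.of_weakEquivalence' hp w ((λ_ E').inv ≫ w ▷ E') (by
    rw [rightUnitor_inv_naturality_assoc, ← whisker_exchange, leftUnitor_inv_naturality_assoc,
      unitors_inv_equal])
  obtain ⟨X, P, f, g, k, H⟩ := h₃.of_weakEquivalence hp (𝟙 _) p (h' := e' ≫ p) (by simp)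
  obtain ⟨J, r, _, _, _⟩ := exists_cofibrant_resolution X
  have w := H.isHoPushout.1
  exact ⟨J, P, r ≫ f, r ≫ g, k, inferInstance, H.trivial,
    (hp.isHoPushout_iff_of_weakEquivalence (by simp [w]) w r (𝟙 _) (𝟙 _) (𝟙 _) (by simp) (by simp)
      (by simp) (by simp)).2 H.isHoPushout⟩

end

/-! ### Existence of Adams towers -/

section

variable {C : Type u} [Category.{v} C] [ModelCategory C]

/-- A tower is levelwise weakly equivalent to a tower of fibrations. -/
theorem exists_fibrant_tower (X : ℕ → C) (p : ∀ n, X (n + 1) ⟶ X n) :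
    ∃ (Y : ℕ → C) (q : ∀ n, Y (n + 1) ⟶ Y n) (r : ∀ n, X n ⟶ Y n), IsFibrant (Y 0) ∧
      (∀ n, Fibration (q n)) ∧ (∀ n, Cofibration (r n)) ∧ (∀ n, WeakEquivalence (r n)) ∧
      ∀ n, r (n + 1) ≫ q n = p n ≫ r n := by
  obtain ⟨Y₀, r₀, h₀, h₀', h₀''⟩ := exists_fibrant_resolution (X 0)
  choose M i f hi hi' hf hif using fun (n : ℕ) (Y : C) (r : X n ⟶ Y) =>
    exists_trivialCofibration_fibration (p n ≫ r)
  let Z : ∀ n, Σ Y, X n ⟶ Y :=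
    Nat.rec ⟨Y₀, r₀⟩ fun n Y => ⟨M n Y.1 Y.2, i n Y.1 Y.2⟩
  refine ⟨fun n => (Z n).1, fun n => f n _ (Z n).2, fun n => (Z n).2, h₀, fun n => hf _ _ _,
    fun n => ?_, fun n => ?_, fun n => hif _ _ _⟩
  · cases n with
    | zero => exact h₀'
    | succ n => exact hi n _ (Z n).2
  · cases n with
    | zero => exact h₀''
    | succ n => exact hi' n _ (Z n).2

end

section

variable {C : Type u} [Category.{v} C] [MonoidalCategory C] [SymmetricCategory C]
  [MonoidalClosed C] [ModelCategory C] [HasLimits C] [HasColimits C] {ι : SSet.{v} ⥤ C} [ι.Braided]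
  [ι.IsLeftAdjoint]

theorem exists_isAdamsTower (hC : IsOperadicModelCategory C ι) (hp : IsProper C)
    (hs : IsStable C) {E : C} (e : 𝟙_ C ⟶ E) (y : C) [IsCofibrant y] :
    ∃ (w : ℕᵒᵖ ⥤ C) (η : (Functor.const ℕᵒᵖ).obj y ⟶ w), IsFibrantTower η ∧ IsAdamsTower e η := by
  obtain ⟨J, P, j, g, k, _, H⟩ := exists_isCofiberSquare hC hp hs e
  have hJ (n) : IsCofibrant (adamsPow J n ⊗ y) := by
    have := isCofibrant_adamsPow (J := J) hC n
    exact hC.isCofibrant_tensor _ _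
  choose T a ha hT hT' using fun n => exists_cofibration_isWeaklyTrivial (adamsPow J n ⊗ y)
  choose t ht using fun n => exists_extension (a (n + 1)) (Or.inr (hT n))
    (adamsStep j n ▷ y ≫ a n)
  let f (n) : adamsPow J n ⊗ y ⟶ y := adamsAug j n ▷ y ≫ (λ_ y).hom
  have hf (n) : adamsStep j n ▷ y ≫ f n = f (n + 1) := by
    simp only [f, adamsAug, comp_whiskerRight, Category.assoc]
  have sq (n) := IsPushout.of_hasPushout (f n) (a n)
  let p (n) : pushout (f (n + 1)) (a (n + 1)) ⟶ pushout (f n) (a n) :=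
    pushout.desc (pushout.inl _ _) (t n ≫ pushout.inr _ _) (by
      rw [← hf, Category.assoc, pushout.condition, reassoc_of% ht n])
  obtain ⟨Y, q, r, h₀, hq, hr, hr', hrq⟩ := exists_fibrant_tower
    (fun n => pushout (f n) (a n)) p
  let w : ℕᵒᵖ ⥤ C := Functor.ofOpSequence q
  have hw (n : ℕ) : w.map (homOfLE n.le_succ).op = q n := Functor.ofOpSequence_map_homOfLE_succ q n
  have hη (n) : (pushout.inl (f (n + 1)) (a (n + 1)) ≫ r (n + 1)) ≫ q n =
      pushout.inl (f n) (a n) ≫ r n := by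
    rw [Category.assoc, hrq, pushout.inl_desc_assoc]
  let η : (Functor.const ℕᵒᵖ).obj y ⟶ w := NatTrans.ofOpSequence
    (fun n => pushout.inl (f n) (a n) ≫ r n) fun n =>
      (Category.id_comp _).trans ((hη n).symm.trans (congrArg (_ ≫ ·) (hw n).symm))
  refine ⟨w, η, ⟨fun ⟨n⟩ => ?_, h₀, fun n => ?_⟩, J, P, j, g, k, T, t, a,
    fun n => pushout.inr (f n) (a n) ≫ r n, inferInstance, H, fun n => ?_, ht, fun n => ?_,
    fun n => ⟨hT n, ?_⟩⟩
  · have := cofibration_of_isPushout (sq n).flip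
    exact inferInstanceAs (Cofibration (pushout.inl (f n) (a n) ≫ r n))
  · rw [hw]
    exact hq n
  · exact isCofibrant_of_cofibration (a n)
  · refine (congrArg (_ ≫ ·) (hw n)).trans ?_
    refine (Category.assoc _ _ _).trans ((congrArg (_ ≫ ·) (hrq n)).trans ?_)
    exact (pushout.inr_desc_assoc _ _ _ _).trans (Category.assoc _ _ _)
  · have h := hp.isHoPushout_flip (hp.isHoPushout_of_isPushout (sq n).flip)
    have h' : IsHoPushout (f n) (a n) (pushout.inl (f n) (a n) ≫ r n)
        (pushout.inr (f n) (a n) ≫ r n) :=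
      (hp.isHoPushout_iff_of_weakEquivalence h.1 (by rw [pushout.condition_assoc]) (𝟙 _) (𝟙 _)
        (𝟙 _) (r n) (by simp) (by simp) (by simp) (by simp)).1 h
    exact h'

end

end

section

/-! ### The interval -/

section

open Simplicial

theorem isIso_horn_ι : IsIso (SSet.horn.ι.{v} (n := 0) 0 1 (by decide)) := by
  have h := SSet.horn.ι_ι.{v} (n := 0) 0 1 (by decide)
  have : Mono (SSet.horn.ι.{v} (n := 0) 0 1 (by decide)) := by
    have : Mono (SSet.horn.ι.{v} (n := 0) 0 1 (by decide) ≫ Λ[1, 0].ι) := by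
      rw [h]; infer_instance
    exact mono_of_mono _ Λ[1, 0].ι
  have : Epi (SSet.horn.ι.{v} (n := 0) 0 1 (by decide)) := ⟨fun f g hfg => by
    refine SSet.horn.hom_ext f g fun j hj => ?_
    obtain rfl : j = 1 := by fin_cases j <;> simp_all
    rw [← SSet.horn.yonedaEquiv_ι, ← SSet.yonedaEquiv_comp, ← SSet.yonedaEquiv_comp, hfg]⟩
  exact isIso_of_mono_of_epi _

theorem ι₀_snd_eq : SSet.ι₀ ≫ SemiCartesianMonoidalCategory.snd Δ[0] Δ[1] =
    SSet.stdSimplex.δ.{v} (n := 0) 1 := by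
  apply SSet.yonedaEquiv.injective
  ext i
  fin_cases i
  rfl

theorem isIso_snd_interval : IsIso (SemiCartesianMonoidalCategory.snd (Δ[0] : SSet.{v}) Δ[1]) :=
  ⟨CartesianMonoidalCategory.lift (SSet.stdSimplex.isTerminalObj₀.from _) (𝟙 _),
    CartesianMonoidalCategory.hom_ext _ _ (SSet.stdSimplex.isTerminalObj₀.hom_ext _ _) (by simp),
    by simp⟩

variable {C : Type u} [Category.{v} C] [MonoidalCategory C] [SymmetricCategory C]
  [MonoidalClosed C] [ModelCategory C] {ι : SSet.{v} ⥤ C} [ι.Braided] [ι.IsLeftAdjoint]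

theorem IsOperadicModelCategory.map_ι₀ (hC : IsOperadicModelCategory C ι) :
    Cofibration (ι.map (SSet.ι₀ (X := Δ[0]))) ∧ WeakEquivalence (ι.map (SSet.ι₀ (X := Δ[0]))) := by
  obtain ⟨_, _⟩ := hC.acyclic_horn 0 0
  have := isIso_horn_ι.{v}
  have := isIso_snd_interval.{v}
  have e : (SSet.ι₀ (X := Δ[0])) = SSet.horn.ι.{v} (n := 0) 0 1 (by decide) ≫ Λ[1, 0].ι ≫
      inv (SemiCartesianMonoidalCategory.snd (Δ[0] : SSet.{v}) Δ[1]) := by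
    rw [← Category.assoc, SSet.horn.ι_ι, ← ι₀_snd_eq, Category.assoc, IsIso.hom_inv_id,
      Category.comp_id]
  rw [e, Functor.map_comp, Functor.map_comp]
  constructor <;> infer_instance

end

/-! ### Compactness of the unit -/

section

open Simplicial

variable {C : Type u} [Category.{v} C] [MonoidalCategory C] [SymmetricCategory C]
  [MonoidalClosed C] [ModelCategory C] [HasLimits C] [HasColimits C] {ι : SSet.{v} ⥤ C} [ι.Braided]
  [ι.IsLeftAdjoint]

/-- A map from the unit to a filtered colimit of fibrant objects is represented at some stage, up
to homotopy. -/
theorem IsUnitCompact.exists_homotopy (hI : IsUnitCompact ι) {J : Type v} [SmallCategory J]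
    [IsFiltered J] (F : J ⥤ C) (hF : ∀ j, IsFibrant (F.obj j)) (s : ι.obj Δ[0] ⟶ colimit F) :
    ∃ (j : J) (p : ι.obj Δ[0] ⟶ F.obj j) (h : ι.obj (Δ[0] ⊗ Δ[1]) ⟶ colimit F),
      ι.map SSet.ι₀ ≫ h = p ≫ colimit.ι F j ∧ ι.map SSet.ι₁ ≫ h = s := by
  let adj := Adjunction.ofIsLeftAdjoint ι
  have hu : Nonempty ((∂Δ[0] : SSet.{v}) ⟶ colimit (F ⋙ ι.rightAdjoint)) := by
    rw [SSet.boundary_zero]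
    exact ⟨SSet.Subcomplex.isInitialBot.to _⟩
  obtain ⟨u⟩ := hu
  obtain ⟨g, h, -, h₀, h₁, -⟩ := hI J F hF 0 u (adj.homEquiv _ _ s) SSet.boundary.hom_ext₀
  obtain ⟨j, p, hp⟩ := IsFinitelyPresentable.exists_hom_of_isColimit
    (colimit.isColimit (F ⋙ ι.rightAdjoint)) g
  refine ⟨j, (adj.homEquiv _ _).symm p, (adj.homEquiv _ _).symm h, ?_, ?_⟩
  · rw [← adj.homEquiv_naturality_left_symm, ← adj.homEquiv_naturality_right_symm, h₀, ← hp]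
    exact congrArg _ ((Category.assoc _ _ _).trans (congrArg (p ≫ ·) (colimit.ι_post _ _ _)))
  · rw [← adj.homEquiv_naturality_left_symm, h₁, Equiv.symm_apply_apply]

end

end

section

section

open Simplicial

variable {C : Type u} [Category.{v} C] [MonoidalCategory C] [SymmetricCategory C]
  [MonoidalClosed C] [ModelCategory C] [HasLimits C] [HasColimits C] {ι : SSet.{v} ⥤ C} [ι.Braided]
  [ι.IsLeftAdjoint]

theorem nonempty_iso_obj_stdSimplex (ι : SSet.{v} ⥤ C) [ι.Braided] :
    Nonempty (ι.obj Δ[0] ≅ 𝟙_ C) :=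
  ⟨ι.mapIso (SSet.stdSimplex.isTerminalObj₀.uniqueUpToIso
    CartesianMonoidalCategory.isTerminalTensorUnit) ≪≫ (Functor.Monoidal.εIso ι).symm⟩

theorem exists_lift_of_cocone (hC : IsOperadicModelCategory C ι)
    (hf : HasGoodFilteredColimits C) (hI : IsUnitCompact ι) {J : Type v} [SmallCategory J]
    [IsFiltered J] {G : J ⥤ C} {T : C} [IsFibrant T] (r : G ⟶ (Functor.const J).obj T)
    (hr : ∀ j, Fibration (r.app j)) [WeakEquivalence (colimMap r)] (f : 𝟙_ C ⟶ T) :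
    ∃ (k : J) (e : 𝟙_ C ⟶ G.obj k), e ≫ r.app k = f := by
  have := hC.isCofibrant_unit
  have hG (j) : IsFibrant (G.obj j) := by
    have : IsFibrant (((Functor.const J).obj T).obj j) := ‹IsFibrant T›
    have := hr j
    exact isFibrant_of_fibration (r.app j)
  obtain ⟨ψ⟩ := nonempty_iso_obj_stdSimplex ι
  have := hf.fibration J
  have : Fibration (colimMap r) := by
    rw [fibration_iff]
    exact MorphismProperty.colimMap _ fun j => (fibration_iff _).1 (hr j)
  let c : colimit ((Functor.const J).obj T) ⟶ T := colimit.desc _ ⟨T, 𝟙 _⟩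
  have hc (j) : colimit.ι ((Functor.const J).obj T) j ≫ c = 𝟙 T := colimit.ι_desc _ _
  obtain ⟨j₀⟩ := IsFiltered.nonempty (C := J)
  obtain ⟨s, -, hs⟩ := exists_lift (initial.to (𝟙_ C)) (colimMap r) (Or.inr ‹_›) (initial.to _)
    (f ≫ colimit.ι ((Functor.const J).obj T) j₀) (Subsingleton.elim _ _)
  obtain ⟨k, p, h, h₀, h₁⟩ := hI.exists_homotopy G hG (ψ.hom ≫ s)
  obtain ⟨_, _⟩ := hC.map_ι₀
  have := hr k
  have hp : p ≫ r.app k = ι.map SSet.ι₀ ≫ h ≫ colimMap r ≫ c := by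
    rw [reassoc_of% h₀, ι_colimMap_assoc]
    exact (congrArg (p ≫ ·) ((congrArg (r.app k ≫ ·) (hc k)).trans (Category.comp_id _))).symm
  obtain ⟨l, -, hl⟩ := exists_lift (ι.map SSet.ι₀) (r.app k) (Or.inl ‹_›) p (h ≫ colimMap r ≫ c) hp
  refine ⟨k, ψ.inv ≫ ι.map SSet.ι₁ ≫ l, ?_⟩
  rw [Category.assoc, Category.assoc, hl, reassoc_of% h₁, ψ.inv_hom_id_assoc, reassoc_of% hs]
  exact (congrArg (f ≫ ·) (hc j₀)).trans (Category.comp_id f)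

/-- A map from the unit to the base of a levelwise fibration that is a weak equivalence in the
colimit can be lifted at a later stage. -/
theorem exists_lift_of_isUnitCompact (hC : IsOperadicModelCategory C ι)
    (hf : HasGoodFilteredColimits C) (hI : IsUnitCompact ι) {J : Type v} [SmallCategory J]
    [IsFiltered J] {X P : J ⥤ C} (q : X ⟶ P) (hq : ∀ j, Fibration (q.app j))
    [WeakEquivalence (colimMap q)] (j : J) [IsFibrant (P.obj j)] (f : 𝟙_ C ⟶ P.obj j) :
    ∃ (k : J) (u : j ⟶ k) (e : 𝟙_ C ⟶ X.obj k), e ≫ q.app k = f ≫ P.map u := by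
  have := hC.isCofibrant_unit
  obtain ⟨T, i, _, _, _⟩ := exists_fibrant_resolution (𝟙_ C)
  obtain ⟨f', rfl⟩ := exists_extension i (Or.inl ‹_›) f
  let U := Under.forget j
  let φ : (Functor.const (Under j)).obj T ⟶ U ⋙ P :=
    { app := fun k => f' ≫ P.map k.hom
      naturality := fun k l g => by
        exact (Category.id_comp _).trans ((congrArg (fun u => f' ≫ P.map u) (Under.w g).symm).trans
          ((congrArg (f' ≫ ·) (P.map_comp _ _)).trans (Category.assoc _ _ _).symm)) }
  let q' : U ⋙ X ⟶ U ⋙ P := Functor.whiskerLeft U q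
  obtain ⟨G, g, r, sq⟩ : ∃ (G : Under j ⥤ C) (g : G ⟶ U ⋙ X)
      (r : G ⟶ (Functor.const (Under j)).obj T), IsPullback g r q' φ :=
    ⟨_, _, _, IsPullback.of_hasPullback q' φ⟩
  have hq' (k) : Fibration (q'.app k) := hq k.right
  have hr (k) : Fibration (r.app k) := by
    have : Fibration (((evaluation _ _).obj k).map q') := hq' k
    exact fibration_of_isPullback (sq.map ((evaluation _ _).obj k))
  have := hf.fibration (Under j)
  have := hf.exact (Under j)
  have := HasExactColimitsOfShape.preservesFiniteLimits (J := Under j) (C := C)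
  have : Fibration (colimMap q') := by
    rw [fibration_iff]
    exact MorphismProperty.colimMap _ fun j => (fibration_iff _).1 (hq' j)
  have e₁ : colimMap q' ≫ colimit.pre P U = colimit.pre X U ≫ colimMap q :=
    colimit.hom_ext fun k => by
      rw [ι_colimMap_assoc, colimit.ι_pre, colimit.ι_pre_assoc, ι_colimMap]
      rfl
  have : WeakEquivalence (colimMap q' ≫ colimit.pre P U) := by
    rw [e₁]
    infer_instance
  have : WeakEquivalence (colimMap q') := weakEquivalence_of_postcomp _ (colimit.pre P U)
  have : WeakEquivalence (colimMap r) :=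
    (weakEquivalence_iff _).2 (MorphismProperty.of_isPullback (sq.map colim)
      (mem_trivialFibrations (colimMap q'))).2
  obtain ⟨k, e, he⟩ := exists_lift_of_cocone hC hf hI r hr i
  refine ⟨k.right, k.hom, e ≫ g.app k, ?_⟩
  have e₂ : g.app k ≫ q.app k.right = r.app k ≫ f' ≫ P.map k.hom := NatTrans.congr_app sq.w k
  have e₃ : e ≫ r.app k ≫ f' ≫ P.map k.hom = (i ≫ f') ≫ P.map k.hom :=
    (Category.assoc _ _ _).symm.trans ((congrArg (· ≫ f' ≫ P.map k.hom) he).trans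
      (Category.assoc _ _ _).symm)
  exact (Category.assoc _ _ _).trans ((congrArg (e ≫ ·) e₂).trans e₃)

end

end

section

/-! ### Fibrations of function objects -/

theorem fibration_of_lift {C : Type u} [Category.{v} C] [ModelCategory C] {X Y : C} (p : X ⟶ Y)
    (h : ∀ {A B : C} (k : A ⟶ B) [Cofibration k] [WeakEquivalence k] (a : A ⟶ X) (b : B ⟶ Y),
      a ≫ p = k ≫ b → ∃ l, k ≫ l = a ∧ l ≫ p = b) : Fibration p := by
  rw [fibration_iff, ← trivialCofibrations_rlp]
  intro A B k hk
  obtain ⟨_, _⟩ := (mem_trivialCofibrations_iff k).1 hk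
  refine ⟨fun {a b} sq => ?_⟩
  obtain ⟨l, hl, hl'⟩ := h k a b sq.w
  exact ⟨⟨l, hl, hl'⟩⟩

section

variable {C : Type u} [Category.{v} C] [MonoidalCategory C] [SymmetricCategory C]
  [MonoidalClosed C] [ModelCategory C] [HasLimits C] [HasColimits C] {ι : SSet.{v} ⥤ C} [ι.Braided]
  [ι.IsLeftAdjoint]

theorem IsOperadicModelCategory.exists_lift_tensor (hC : IsOperadicModelCategory C ι)
    {A B y w Z Z' : C} (k : A ⟶ B) [Cofibration k] [WeakEquivalence k] (f : y ⟶ w) [Cofibration f]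
    (r : Z ⟶ Z') [Fibration r] (a : A ⊗ w ⟶ Z) (b : B ⊗ y ⟶ Z) (d : B ⊗ w ⟶ Z')
    (h : A ◁ f ≫ a = k ▷ y ≫ b) (ha : a ≫ r = k ▷ w ≫ d) (hb : b ≫ r = B ◁ f ≫ d) :
    ∃ l : B ⊗ w ⟶ Z, k ▷ w ≫ l = a ∧ B ◁ f ≫ l = b ∧ l ≫ r = d := by
  have s := IsPushout.of_hasPushout (k ▷ y) (A ◁ f)
  have e : k ▷ y ≫ B ◁ f = A ◁ f ≫ k ▷ w := (whisker_exchange _ _).symm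
  have := hC.cofibration_pushoutProduct s (s.inl_desc _ _ e) (s.inr_desc _ _ e)
  have hwe := hC.weakEquivalence_pushoutProduct s (s.inl_desc _ _ e) (s.inr_desc _ _ e)
    (Or.inl inferInstance)
  obtain ⟨l, hl, hl'⟩ := exists_lift (s.desc _ _ e) r (Or.inl hwe) (s.desc _ _ h.symm) d
    (s.hom_ext (by simp [hb]) (by simp [ha]))
  exact ⟨l, by rw [← s.inr_desc _ _ e, Category.assoc, hl, s.inr_desc],
    by rw [← s.inl_desc _ _ e, Category.assoc, hl, s.inl_desc], hl'⟩

theorem IsOperadicModelCategory.fibration_ihom_map (hC : IsOperadicModelCategory C ι) (K : C)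
    [IsCofibrant K] {Z Z' : C} (r : Z ⟶ Z') [Fibration r] : Fibration ((ihom K).map r) :=
  fibration_of_lift _ fun {A B} k _ _ a b h => by
    obtain ⟨a, rfl⟩ := toIhom_surjective a
    obtain ⟨b, rfl⟩ := toIhom_surjective b
    rw [toIhom_comp_map, comp_toIhom] at h
    have := hC.cofibration_whiskerRight k K
    have := hC.weakEquivalence_whiskerRight k K
    obtain ⟨l, hl, hl'⟩ := exists_lift (k ▷ K) r (Or.inl ‹_›) a b (toIhom_injective h)
    exact ⟨toIhom l, by rw [comp_toIhom, hl], by rw [toIhom_comp_map, hl']⟩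

theorem IsOperadicModelCategory.isFibrant_ihom (hC : IsOperadicModelCategory C ι) (K z : C)
    [IsCofibrant K] [IsFibrant z] : IsFibrant ((ihom K).obj z) := by
  have : Fibration (terminal.from z) :=
    (isFibrant_iff_of_isTerminal (terminal.from z) terminalIsTerminal).1 inferInstance
  exact (isFibrant_iff_of_isTerminal ((ihom K).map (terminal.from z))
    (IsTerminal.isTerminalObj (ihom K) _ terminalIsTerminal)).2 (hC.fibration_ihom_map K _)

theorem IsOperadicModelCategory.fibration_pre (hC : IsOperadicModelCategory C ι) {L M : C}
    (i : L ⟶ M) [Cofibration i] (z : C) [IsFibrant z] :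
    Fibration ((MonoidalClosed.pre i).app z) :=
  fibration_of_lift _ fun {A B} k _ _ a b h => by
    obtain ⟨a, rfl⟩ := toIhom_surjective a
    obtain ⟨b, rfl⟩ := toIhom_surjective b
    rw [toIhom_comp_pre, comp_toIhom] at h
    have : Fibration (terminal.from z) :=
      (isFibrant_iff_of_isTerminal (terminal.from z) terminalIsTerminal).1 inferInstance
    obtain ⟨l, hl, hl', -⟩ := hC.exists_lift_tensor k i (terminal.from z) a b (terminal.from _)
      (toIhom_injective h) (Subsingleton.elim _ _) (Subsingleton.elim _ _)
    exact ⟨toIhom l, by rw [comp_toIhom, hl], by rw [toIhom_comp_pre, hl']⟩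

theorem IsOperadicModelCategory.fibration_pullbackHom (hC : IsOperadicModelCategory C ι)
    {y w Z Z' P : C} (f : y ⟶ w) [Cofibration f] (r : Z ⟶ Z') [Fibration r]
    {p₁ : P ⟶ (ihom w).obj Z'} {p₂ : P ⟶ (ihom y).obj Z}
    (s : IsPullback p₁ p₂ ((MonoidalClosed.pre f).app Z') ((ihom y).map r))
    {q : (ihom w).obj Z ⟶ P} (h₁ : q ≫ p₁ = (ihom w).map r)
    (h₂ : q ≫ p₂ = (MonoidalClosed.pre f).app Z) : Fibration q :=
  fibration_of_lift _ fun {A B} k _ _ a b h => by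
    obtain ⟨a, rfl⟩ := toIhom_surjective a
    obtain ⟨β, hβ⟩ := toIhom_surjective (b ≫ p₂)
    obtain ⟨δ, hδ⟩ := toIhom_surjective (b ≫ p₁)
    obtain ⟨l, hl, hl', hl''⟩ := hC.exists_lift_tensor k f r a β δ
      (toIhom_injective (by rw [← comp_toIhom, hβ, ← toIhom_comp_pre, ← h₂, reassoc_of% h]))
      (toIhom_injective (by rw [← comp_toIhom, hδ, ← toIhom_comp_map, ← h₁, reassoc_of% h]))
      (toIhom_injective (by
        rw [← toIhom_comp_map, hβ, ← toIhom_comp_pre, hδ, Category.assoc, Category.assoc, s.w]))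
    refine ⟨toIhom l, by rw [comp_toIhom, hl], s.hom_ext ?_ ?_⟩
    · rw [Category.assoc, h₁, toIhom_comp_map, hl'', hδ]
    · rw [Category.assoc, h₂, toIhom_comp_pre, hl', hβ]

end

/-! ### Resolutions and a compact unit -/

section

variable {C : Type u} [Category.{v} C] [ModelCategory C]

theorem weakEquivalence_colimMap_whisker {J : Type*} [Category* J] {K : Type*} [Category* K]
    [HasColimitsOfShape J C] [HasColimitsOfShape K C] [IsConnected J] (N : J ⥤ K) [N.Final]
    {F : K ⥤ C} (c : Cocone F) [WeakEquivalence (colimit.desc F c)] :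
    WeakEquivalence (colimMap (c.whisker N).ι) := by
  let d : colimit ((Functor.const J).obj c.pt) ⟶ c.pt := colimit.desc _ ⟨c.pt, 𝟙 _⟩
  have hd (j) : colimit.ι ((Functor.const J).obj c.pt) j ≫ d = 𝟙 c.pt := colimit.ι_desc _ _
  have : IsIso d := ((colimit.isColimit _).coconePointUniqueUpToIso
    (isColimitConstCocone J c.pt)).isIso_hom
  have e : colimMap (c.whisker N).ι ≫ d = colimit.pre F N ≫ colimit.desc F c :=
    colimit.hom_ext fun j => by
      rw [ι_colimMap_assoc, colimit.ι_pre_assoc, colimit.ι_desc]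
      exact (congrArg (_ ≫ ·) (hd j)).trans (Category.comp_id _)
  have : WeakEquivalence (colimMap (c.whisker N).ι ≫ d) := by
    rw [e]
    infer_instance
  exact weakEquivalence_of_postcomp _ d

end

end

section

section

variable {C : Type u} [Category.{v} C] [MonoidalCategory C] [SymmetricCategory C]
  [MonoidalClosed C] [ModelCategory C] [HasLimits C] [HasColimits C] {ι : SSet.{v} ⥤ C} [ι.Braided]
  [ι.IsLeftAdjoint] {y : C} {w : ℕᵒᵖ ⥤ C} {η : (Functor.const ℕᵒᵖ).obj y ⟶ w}

/-- If the unit is compact, then maps from a tower to a fibration extend at a later stage, provided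
that the function objects out of the tower represent those out of `y`. -/
theorem exists_extension_of_isUnitCompact (hC : IsOperadicModelCategory C ι) (hp : IsProper C)
    (hf : HasGoodFilteredColimits C) (hI : IsUnitCompact ι) [IsCofibrant y]
    (hη : ∀ t, Cofibration (η.app t)) {Z Z' : C} (r : Z ⟶ Z') [Fibration r] [IsFibrant Z']
    [WeakEquivalence (colimit.desc _ (functionCocone η Z))]
    [WeakEquivalence (colimit.desc _ (functionCocone η Z'))] (t : ℕ) (a : w.obj (op t) ⟶ Z')
    (b : y ⟶ Z) (hab : η.app (op t) ≫ a = b ≫ r) :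
    ∃ (t' : ℕ) (h : t ≤ t') (e : w.obj (op t') ⟶ Z),
      e ≫ r = w.map (homOfLE h).op ≫ a ∧ η.app (op t') ≫ e = b := by
  have := isFiltered_ulift_nat.{v}
  have : IsCofibrant (w.obj (op t)) :=
    have : IsCofibrant (((Functor.const ℕᵒᵖ).obj y).obj (op t)) := ‹IsCofibrant y›
    have := hη (op t)
    isCofibrant_of_cofibration (η.app (op t))
  let N : ULift.{v} ℕ ⥤ ℕ := natEquivalence.functor
  let Φ := N ⋙ w.rightOp ⋙ MonoidalClosed.internalHom.flip.obj Z
  let Φ' := N ⋙ w.rightOp ⋙ MonoidalClosed.internalHom.flip.obj Z'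
  let ρ : Φ ⟶ Φ' :=
    Functor.whiskerLeft N (Functor.whiskerLeft w.rightOp (MonoidalClosed.internalHom.flip.map r))
  let α : Φ ⟶ (Functor.const _).obj ((ihom y).obj Z) := ((functionCocone η Z).whisker N).ι
  let α' : Φ' ⟶ (Functor.const _).obj ((ihom y).obj Z') := ((functionCocone η Z').whisker N).ι
  let β := (Functor.const (ULift.{v} ℕ)).map ((ihom y).map r)
  have hβ : Fibration ((ihom y).map r) := hC.fibration_ihom_map y r
  have e : ρ ≫ α' = α ≫ β := NatTrans.ext (funext fun s =>
    (MonoidalClosed.pre (η.app (op s.down))).naturality r)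
  obtain ⟨P, p₁, p₂, sq⟩ : ∃ (P : ULift.{v} ℕ ⥤ C) (p₁ : P ⟶ Φ')
      (p₂ : P ⟶ (Functor.const _).obj ((ihom y).obj Z)), IsPullback p₁ p₂ α' β :=
    ⟨_, _, _, IsPullback.of_hasPullback α' β⟩
  obtain ⟨q, hq₁, hq₂⟩ : ∃ q : Φ ⟶ P, q ≫ p₁ = ρ ∧ q ≫ p₂ = α :=
    ⟨sq.lift _ _ e, sq.lift_fst _ _ _, sq.lift_snd _ _ _⟩
  have sq' (s : ULift.{v} ℕ) : IsPullback (p₁.app s) (p₂.app s)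
      ((MonoidalClosed.pre (η.app (op s.down))).app Z') ((ihom y).map r) :=
    sq.map ((evaluation _ _).obj s)
  have hq (s) : Fibration (q.app s) := by
    have := hη (op s.down)
    exact hC.fibration_pullbackHom (η.app (op s.down)) r (sq' s) (NatTrans.congr_app hq₁ s)
      (NatTrans.congr_app hq₂ s)
  have hP : IsFibrant (P.obj ⟨t⟩) := by
    have := fibration_of_isPullback (sq' ⟨t⟩).flip
    have : IsFibrant (Φ'.obj ⟨t⟩) := hC.isFibrant_ihom (w.obj (op t)) Z'
    exact isFibrant_of_fibration (p₁.app ⟨t⟩)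
  have : WeakEquivalence (colimMap q) := by
    have : WeakEquivalence (colimMap α) := weakEquivalence_colimMap_whisker N (functionCocone η Z)
    have : WeakEquivalence (colimMap α') :=
      weakEquivalence_colimMap_whisker N (functionCocone η Z')
    have := hf.exact (ULift.{v} ℕ)
    have := HasExactColimitsOfShape.preservesFiniteLimits (J := ULift.{v} ℕ) (C := C)
    have : Fibration (colim.map β) := by
      have := hf.fibration (ULift.{v} ℕ)
      rw [fibration_iff]
      exact MorphismProperty.colimMap _ fun j => (fibration_iff _).1 hβ
    have : WeakEquivalence (colim.map α') := ‹WeakEquivalence (colimMap α')›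
    have : WeakEquivalence (colim.map p₂) := hp.right (sq.map colim).flip
    have e₂ : colimMap q ≫ colim.map p₂ = colimMap α :=
      (colim.map_comp q p₂).symm.trans (congrArg colimMap hq₂)
    exact weakEquivalence_of_postcomp_of_fac e₂
  have hab' : toIhom ((λ_ _).hom ≫ a) ≫ (MonoidalClosed.pre (η.app (op t))).app Z' =
      toIhom ((λ_ _).hom ≫ b) ≫ (ihom y).map r := by
    rw [toIhom_comp_pre, toIhom_comp_map, leftUnitor_naturality_assoc, hab, Category.assoc]
    rfl
  obtain ⟨f, hf₁, hf₂⟩ : ∃ f : 𝟙_ C ⟶ P.obj ⟨t⟩, f ≫ p₁.app ⟨t⟩ = toIhom ((λ_ _).hom ≫ a) ∧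
      f ≫ p₂.app ⟨t⟩ = toIhom ((λ_ _).hom ≫ b) :=
    ⟨(sq' ⟨t⟩).lift _ _ hab', (sq' ⟨t⟩).lift_fst _ _ _, (sq' ⟨t⟩).lift_snd _ _ _⟩
  obtain ⟨⟨k⟩, u, l, hl⟩ := exists_lift_of_isUnitCompact hC hf hI q hq ⟨t⟩ f
  obtain ⟨l, rfl⟩ : ∃ l' : 𝟙_ C ⊗ w.obj (op k) ⟶ Z, toIhom l' = l := toIhom_surjective l
  have htk : t ≤ k := by
    have := leOfHom u
    exact this
  refine ⟨k, htk, (λ_ _).inv ≫ l, ?_, ?_⟩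
  · have e₁ : toIhom (l ≫ r) = toIhom ((λ_ _).hom ≫ w.map (homOfLE htk).op ≫ a) := by
      rw [← toIhom_comp_map, ← leftUnitor_naturality_assoc, ← toIhom_comp_pre, ← hf₁]
      have e₂ := congrArg (· ≫ p₁.app ⟨k⟩) hl
      have e₃ : q.app ⟨k⟩ ≫ p₁.app ⟨k⟩ = (ihom (w.obj (op k))).map r := NatTrans.congr_app hq₁ ⟨k⟩
      have e₄ : P.map u ≫ p₁.app ⟨k⟩ =
        p₁.app ⟨t⟩ ≫ (MonoidalClosed.pre (w.map (homOfLE htk).op)).app Z' := p₁.naturality u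
      exact (congrArg (_ ≫ ·) e₃).symm.trans ((Category.assoc _ _ _).symm.trans (e₂.trans
        ((Category.assoc _ _ _).trans ((congrArg (f ≫ ·) e₄).trans (Category.assoc _ _ _).symm))))
    rw [Category.assoc, toIhom_injective e₁, (λ_ _).inv_hom_id_assoc]
  · have e₁ : toIhom (𝟙_ C ◁ η.app (op k) ≫ l) = toIhom ((λ_ y).hom ≫ b) := by
      rw [← hf₂]
      have e₂ := congrArg (· ≫ p₂.app ⟨k⟩) hl
      have e₃ : q.app ⟨k⟩ ≫ p₂.app ⟨k⟩ = (MonoidalClosed.pre (η.app (op k))).app Z :=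
        NatTrans.congr_app hq₂ ⟨k⟩
      have e₄ : P.map u ≫ p₂.app ⟨k⟩ = p₂.app ⟨t⟩ := (p₂.naturality u).trans (Category.comp_id _)
      exact (toIhom_comp_pre (η.app (op k)) l).symm.trans ((congrArg (_ ≫ ·) e₃).symm.trans
        ((Category.assoc _ _ _).symm.trans (e₂.trans
          ((Category.assoc _ _ _).trans (congrArg (f ≫ ·) e₄)))))
    have e₂ := leftUnitor_inv_naturality_assoc (η.app (op k)) l
    exact e₂.trans ((congrArg ((λ_ y).inv ≫ ·) (toIhom_injective e₁)).trans
      ((λ_ y).inv_hom_id_assoc b))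

theorem IsNilpotentResolution.stageLift (hC : IsOperadicModelCategory C ι) (hp : IsProper C)
    (hf : HasGoodFilteredColimits C) (hs : IsStable C) (hI : IsUnitCompact ι) {E : C}
    [IsCofibrant E] {e : 𝟙_ C ⟶ E} {m : E ⊗ E ⟶ E} (hE : IsMuRing E e m) [IsCofibrant y]
    (hη : ∀ t, Cofibration (η.app t)) (h : IsNilpotentResolution E η) {z : C} [IsFibrant z]
    (hz : IsNilObject E z) {L M : C} (i : L ⟶ M) [IsCofibrant L] [Cofibration i] :
    StageLift η i (terminal.from z) := by
  obtain ⟨J, P, j, g, k, _, H⟩ := exists_isCofiberSquare hC hp hs e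
  obtain ⟨n, hn⟩ := hz.exists_nullAt hC hp hs hE H
  have hF (K : C) [IsCofibrant K] :
      WeakEquivalence (colimit.desc _ (functionCocone η ((ihom K).obj z))) :=
    have := hC.isFibrant_ihom K z
    h.weakEquivalence _ ((hn.ihom hC hs.hasZeroObject K).isNilObject hC hp hs.hasZeroObject H)
  have : IsCofibrant M := isCofibrant_of_cofibration i
  have := hC.isFibrant_ihom L z
  have := hC.fibration_pre i z
  have := hF L
  have := hF M
  intro t a b d hab _ _
  obtain ⟨t', ht, l, hl, hl'⟩ := exists_extension_of_isUnitCompact hC hp hf hI hη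
    ((MonoidalClosed.pre i).app z) t (MonoidalClosed.curry a)
    (MonoidalClosed.curry (A := M) (Y := y) b) (by
      rw [MonoidalClosed.curry_pre_app, ← MonoidalClosed.curry_natural_left]
      exact congrArg MonoidalClosed.curry hab)
  refine ⟨t', ht, MonoidalClosed.uncurry l, ?_, ?_, Subsingleton.elim _ _⟩
  · apply MonoidalClosed.curry_injective
    rw [← MonoidalClosed.curry_pre_app, MonoidalClosed.curry_uncurry, hl,
      MonoidalClosed.curry_natural_left]
  · rw [← MonoidalClosed.uncurry_natural_left, hl', MonoidalClosed.uncurry_curry]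

end

end

end ProCompletion

theorem theorem7p6 {C : Type u} [Category.{v} C] [MonoidalCategory C] [SymmetricCategory C]
    [MonoidalClosed C] [ModelCategory C] [HasLimits C] [HasColimits C]
    (ι : SSet.{v} ⥤ C) [ι.Braided] [ι.IsLeftAdjoint]
    (hC : IsOperadicModelCategory C ι) (hproper : IsProper C)
    (hfiltered : HasGoodFilteredColimits C) (hstable : IsStable C)
    (E : C) [IsCofibrant E] [IsFibrant E] (e : 𝟙_ C ⟶ E) (m : E ⊗ E ⟶ E)
    (hE : IsMuRing E e m) (hdual : IsDualizable E)
    (O : SOperad.{v}) (hO : O.IsCofibrant)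
    (y : C) [IsCofibrant y] [IsFibrant y] (θ : OAlgebra ι O y) :
    (∃ (w : ℕᵒᵖ ⥤ C) (η : (Functor.const ℕᵒᵖ).obj y ⟶ w), IsFibrantTower η ∧ IsAdamsTower e η) ∧
    (∀ (w : ℕᵒᵖ ⥤ C) (η : (Functor.const ℕᵒᵖ).obj y ⟶ w), IsFibrantTower η → IsAdamsTower e η →
      IsNilpotentResolution E η ∧ IsContractibleKan (liftSpace ι θ (towerProMap η))) ∧
    (IsUnitCompact ι → ∀ (w : ℕᵒᵖ ⥤ C) (η : (Functor.const ℕᵒᵖ).obj y ⟶ w), IsFibrantTower η →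
      IsNilpotentResolution E η → IsContractibleKan (liftSpace ι θ (towerProMap η))) := by
  have := hC.isCofibrant_unit
  refine ⟨exists_isAdamsTower hC hproper hstable e y, fun w η hη h =>
    ⟨h.isNilpotentResolution hC hproper hfiltered hstable hE hη, ?_⟩, fun hI w η hη h => ?_⟩
  · refine hη.isContractibleKan_liftSpace hC hO θ fun s _ _ i _ _ => ?_
    have := hη.isFibrant_obj s
    obtain ⟨n, hn⟩ := h.exists_uniformLift hC hproper hstable hE hη (w.obj (op s))
      (h.isNilObject hC hproper hstable.hasZeroObject s)
    exact hn.stageLift i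
  · refine hη.isContractibleKan_liftSpace hC hO θ fun s _ _ i _ _ => ?_
    have := hη.isFibrant_obj s
    exact h.stageLift hC hproper hfiltered hstable hI hE hη.cofibration (h.nilpotent (op s)) i
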